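/- Let $k$ be an algebraically closed field of characteristic $0$, let $A$ be the henselization of the polynomial ring $k[x]$ at the maximal ideal $\langle x\rangle$, let $C=\operatorname{Spec}A$ with closed point $c_0$, and let $\mathbb P^1_C=\operatorname{Proj}A[Y,Z]$, with rational function $y=Y/Z$. A *nodal blowup* is a scheme $X$ with a morphism $X\to\mathbb P^1_C$ that is a composition of finitely many (possibly zero) blowups of closed points, each of which is a node of the scheme that is blown up. Here a *line* on $X$ is an irreducible component of the fibre $X_{c_0}$ over $c_0$; a *pseudo-line* is a line or the proper transform of $C\times\{[0:1]\}=\{Y=0\}$; and a *node* is a point of intersection of two different pseudo-lines. Rational functions on $\mathbb P^1_C$ are regarded as rational functions on $X$. For coprime integers $a\ge 0$ and $b\geq 1$, a line on $X$ is labelled $\ell_{a/b}$ if $x^a/y^b$ is a parameter on it, i.e. $x^a/y^b$ is regular at the generic point of the line and its restriction generates the function field of the line over $k$. For $r=a/b$ and a nodal blowup $X$ that has a line labelled $\ell_r$, let $$U_r := X\setminus\bigl(\operatorname{Supp}(\operatorname{div}(x^a/y^b))\cap X_{c_0}\bigr).$$ For an integral scheme $M$, separated and of finite type over $C$, and a rational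 function $f$ on $M$, i.e. a rational map from $M$ to $\mathbb P^1_C$ over $C$, let $M[f]\to M$ denote the universal $M$-scheme on which $f$ extends to a morphism: $M[f]$ is integral, separated and of finite type over $C$, the pullback of $f$ to $M[f]$ is defined and extends to a morphism $M[f]\to\mathbb P^1_C$, and every morphism $Y\to M$ such that $Y$ is integral, separated and of finite type over $C$ and the pullback of $f$ to $Y$ is defined and extends to a morphism $Y\to\mathbb P^1_C$ factors uniquely through $M[f]\to M$. **Theorem.** Let $r$ be a non-negative rational number, written in reduced form as $r=a/b$ with $b\ge1$. Let $\phi_b:C\to C$ be the morphism corresponding to the $k$-homomorphism $A\to A$ with $x\mapsto x^b$. Let $U_r$ be formed in any nodal blowup that has a line labelled $\ell_r$, and let $U_a$ be formed in any nodal blowup that has a line labelled $\ell_a$ (with $a=a/1$). Let $p_1:U_r\times_{C,\phi_b}C\to U_r$ and $p_2:U_r\times_{C,\phi_b}C\to C$ be the projections. View $U_r\times_{C,\phi_b}C$ as a $C$-scheme via $p_2$, and write $x$ for $p_2^*(x)$ and $y$ for $p_1^*(y)$ on it. Then the scheme $(U_r\times_{C,\phi_b}C)[x^a/y]$ exists,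 and there is an isomorphism of $C$-schemes $$U_a\;\xrightarrow{\ \sim\ }\;(U_r\times_{C,\phi_b}C)[x^a/y],$$ where the right-hand side is a $C$-scheme via $(U_r\times_{C,\phi_b}C)[x^a/y]\to U_r\times_{C,\phi_b}C\xrightarrow{\ p_2\ }C$. Moreover, the composition $$(U_r\times_{C,\phi_b}C)[x^a/y]\to U_r\times_{C,\phi_b}C\xrightarrow{\ p_1\ }U_r$$ is finite étale of constant degree $b$. -/

import Mathlib

open AlgebraicGeometry CategoryTheory CategoryTheory.Limits TopologicalSpace

universe u

noncomputable section

namespace NodalBlowup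

/-! ### Henselization -/

/-- `A` is a henselization of the ring `R` at the prime ideal `p`: it is a henselian local ring
whose maximal ideal contracts to `p` (equivalently, `R_p → A` is a local homomorphism), and it is
universal among such rings. Local homomorphisms `R_p → B` are the same as ring homomorphisms
`R → B` under which the maximal ideal of `B` contracts to `p`. -/
structure IsHenselizationAt (R : Type u) [CommRing R] (p : Ideal R)
    (A : Type u) [CommRing A] [IsLocalRing A] [Algebra R A] : Prop where
  henselian : HenselianLocalRing A
  comap_maximalIdeal : (IsLocalRing.maximalIdeal A).comap (algebraMap R A) = p
  existsUnique_lift : ∀ (B : Type u) [CommRing B] [HenselianLocalRing B] (f : R →+* B),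
    (IsLocalRing.maximalIdeal B).comap f = p →
      ∃! g : A →+* B, IsLocalHom g ∧ g.comp (algebraMap R A) = f

/-! ### The projective line over `C = Spec A` -/

section ProjectiveLine

variable (A : Type u) [CommRing A]

/-- The grading of `A[Y, Z]` by degree; `Y` is the variable `X 0` and `Z` is the variable `X 1`. -/
abbrev coordGrading : ℕ → Submodule A (MvPolynomial (Fin 2) A) :=
  MvPolynomial.homogeneousSubmodule (Fin 2) A

instance coordGradedAlgebra : GradedAlgebra (coordGrading A) := MvPolynomial.gradedAlgebra

/-- The projective line `Proj A[Y, Z]`. -/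
abbrev P1 : Scheme.{u} := Proj (coordGrading A)

/-- The structure morphism `Proj A[Y, Z] ⟶ Spec A`. -/
def P1.toBase : P1 A ⟶ Spec (CommRingCat.of A) :=
  Proj.toSpecZero (coordGrading A) ≫
    Spec.map (CommRingCat.ofHom (algebraMap A (coordGrading A 0)))

/-- The open subscheme `Y ≠ 0` of the projective line. -/
def opY : (P1 A).Opens := Proj.basicOpen (coordGrading A) (MvPolynomial.X 0)

/-- The closed subset `Y = 0`, i.e. `C × {[0 : 1]}`, the divisor of zeros of `y = Y / Z`. -/
def ellInfty : Set (P1 A) := (opY A : Set (P1 A))ᶜ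

variable {A}

/-- The function `x ^ a / y ^ b = x ^ a * Z ^ b / Y ^ b`, where `y = Y / Z`, on the open subscheme
`Y ≠ 0` of the projective line. -/
def monomialSection (x : A) (a b : ℕ) : Γ(P1 A, opY A) :=
  (Proj.awayToSection (coordGrading A) (MvPolynomial.X 0)).hom
    (HomogeneousLocalization.Away.mk (coordGrading A)
      (MvPolynomial.isHomogeneous_X A (0 : Fin 2)) b
      (MvPolynomial.C (x ^ a) * MvPolynomial.X 1 ^ b) (by
        have h := (MvPolynomial.isHomogeneous_C (Fin 2) (x ^ a)).mul
          ((MvPolynomial.isHomogeneous_X A (1 : Fin 2)).pow b)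
        simpa using h))

/-- The `A`-algebra structure on the global sections of a scheme over `Spec A`. -/
def sectionsMap {S : Scheme.{u}} (st : S ⟶ Spec (CommRingCat.of A)) : A →+* Γ(S, ⊤) :=
  ((Scheme.ΓSpecIso (CommRingCat.of A)).inv ≫ st.appTop).hom

/-- The morphism `[s : 1] : S ⟶ ℙ¹` over `Spec A` that is given by a function `s` on `S`. -/
def toP1 {S : Scheme.{u}} (st : S ⟶ Spec (CommRingCat.of A)) (s : Γ(S, ⊤)) : S ⟶ P1 A :=
  Proj.fromOfGlobalSections (coordGrading A)
    (MvPolynomial.eval₂Hom (sectionsMap st) ![s, 1]) (by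
      rw [Ideal.eq_top_iff_one]
      have h : (MvPolynomial.X 1 : MvPolynomial (Fin 2) A) ∈
          (HomogeneousIdeal.irrelevant (coordGrading A)).toIdeal := by
        have := HomogeneousIdeal.mem_irrelevant_of_mem (coordGrading A) Nat.one_pos
          (MvPolynomial.isHomogeneous_X A (1 : Fin 2))
        exact this
      simpa using Ideal.mem_map_of_mem
        (MvPolynomial.eval₂Hom (sectionsMap st) ![s, 1]) h)

end ProjectiveLine

/-! ### Blowups -/

section Blowup

/-- The inverse image ideal sheaf `f⁻¹ I · 𝒪_Y` is invertible: locally on `Y` it is generated by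
one nonzerodivisor. -/
def InvertibleInverseImage {X Y : Scheme.{u}} (I : X.IdealSheafData) (f : Y ⟶ X) : Prop :=
  ∀ y : Y, ∃ (U : X.affineOpens) (V : Y.affineOpens) (hVU : V.1 ≤ f ⁻¹ᵁ U.1), y ∈ V.1 ∧
    ∃ g ∈ nonZeroDivisors Γ(Y, V.1),
      (I.ideal U).map (f.appLE U.1 V.1 hVU).hom = Ideal.span {g}

/-- `β : X' ⟶ X` is the blowup of `X` along the ideal sheaf `I`. -/
structure IsBlowup {X X' : Scheme.{u}} (I : X.IdealSheafData) (β : X' ⟶ X) : Prop where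
  invertible : InvertibleInverseImage I β
  existsUnique_lift : ∀ {Y : Scheme.{u}} (f : Y ⟶ X), InvertibleInverseImage I f →
    ∃! g : Y ⟶ X', g ≫ β = f

/-- The ideal sheaf of the reduced closed subscheme supported at the (closed) point `q`. -/
def pointIdeal {X : Scheme.{u}} (q : X) : X.IdealSheafData :=
  Scheme.IdealSheafData.vanishingIdeal (Closeds.closure {q})

end Blowup

/-! ### Nodal blowups of the projective line over `C = Spec A`

Throughout, `π : X ⟶ P1 A` is the structure morphism, and `X` is a scheme over `C` via
`π ≫ P1.toBase A`. -/

section Nodal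

variable {A : Type u} [CommRing A] [IsLocalRing A] {X : Scheme.{u}} (π : X ⟶ P1 A)

/-- The fibre of `X` over the closed point `c₀` of `C`. -/
def specialFibre : Set X := (π ≫ P1.toBase A) ⁻¹' {IsLocalRing.closedPoint A}

/-- A line on `X` is an irreducible component of the fibre over `c₀`. -/
def IsLine (L : Set X) : Prop :=
  Maximal (fun s : Set X => IsIrreducible s ∧ s ⊆ specialFibre π) L

/-- The proper transform of `Y = 0`. For a nodal blowup `X`, the morphism `π` is an isomorphism
over the complement of the point `(c₀, [0 : 1])`, which is the only point of `Y = 0` over `c₀`. -/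
def properTransform : Set X := closure (π ⁻¹' ellInfty A \ specialFibre π)

/-- A pseudo-line is a line or the proper transform of `Y = 0`. -/
def IsPseudoLine (L : Set X) : Prop := IsLine π L ∨ L = properTransform π

/-- A node is a (closed) point of intersection of two different pseudo-lines. -/
def IsNode (q : X) : Prop :=
  IsClosed ({q} : Set X) ∧
    ∃ L₁ L₂ : Set X, IsPseudoLine π L₁ ∧ IsPseudoLine π L₂ ∧ L₁ ≠ L₂ ∧ q ∈ L₁ ∧ q ∈ L₂

/-- The schemes `X` with a morphism to the projective line over `C` that is a composition of
finitely many blowups at nodes. -/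
inductive IsNodalBlowup : ∀ {X : Scheme.{u}}, (X ⟶ P1 A) → Prop
  | base {X : Scheme.{u}} (π : X ⟶ P1 A) (hπ : IsIso π) : IsNodalBlowup π
  | step {X X' : Scheme.{u}} (π : X ⟶ P1 A) (hπ : IsNodalBlowup π) (q : X) (hq : IsNode π q)
      (β : X' ⟶ X) (hβ : IsBlowup (pointIdeal q) β) : IsNodalBlowup (β ≫ π)

variable (x : A) (a b : ℕ)

/-- The section `u` of `𝒪_X` over `V` equals `x ^ a / y ^ b` as a rational function on `X`, where
`y = Y / Z`. -/
def RepresentsMonomial (V : X.Opens) (u : Γ(X, V)) : Prop :=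
  X.presheaf.map (homOfLE (inf_le_left : V ⊓ π ⁻¹ᵁ opY A ≤ V)).op u =
    X.presheaf.map (homOfLE (inf_le_right : V ⊓ π ⁻¹ᵁ opY A ≤ π ⁻¹ᵁ opY A)).op
      (π.app (opY A) (monomialSection x a b))

/-- `X` has a line with parameter `x ^ a / y ^ b`: this rational function is regular at the generic
point `ξ` of the line, and its restriction to the line generates the function field `κ(ξ)` of the
line over `κ(c₀)`. -/
def HasLine : Prop :=
  ∃ (L : Set X) (ξ : X) (V : X.Opens) (hξ : ξ ∈ V) (u : Γ(X, V)),
    IsLine π L ∧ IsGenericPoint ξ L ∧ RepresentsMonomial π x a b V u ∧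
      Subfield.closure
        (Set.range ((π ≫ P1.toBase A).residueFieldMap ξ).hom ∪ {(X.evaluation V ξ hξ).hom u}) = ⊤

/-- The complement of the support of the divisor of the rational function `x ^ a / y ^ b`: the
points near which this rational function is an invertible regular function. -/
def unitLocus : X.Opens :=
  sSup {V : X.Opens | ∃ u : Γ(X, V), IsUnit u ∧ RepresentsMonomial π x a b V u}

/-- The complement of the special fibre. -/
def genericPart : X.Opens :=
  (π ≫ P1.toBase A) ⁻¹ᵁ
    ⟨{IsLocalRing.closedPoint A}ᶜ, (IsLocalRing.isClosed_singleton_closedPoint A).isOpen_compl⟩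

/-- The open subscheme `U_r`, `r = a / b`, of a nodal blowup `X` that has a line with parameter
`x ^ a / y ^ b`: the complement of `Supp (div (x ^ a / y ^ b)) ∩ X_{c₀}`. -/
def Uopen : X.Opens := unitLocus π x a b ⊔ genericPart π

/-- The structure morphism `U_r ⟶ C`. -/
def Uopen.toBase : (Uopen π x a b).toScheme ⟶ Spec (CommRingCat.of A) :=
  (Uopen π x a b).ι ≫ π ≫ P1.toBase A

/-- The fibre product `U_r ×_{C, Spec φ} C`. -/
abbrev UBase (φ : A →+* A) : Scheme.{u} :=
  pullback (Uopen.toBase π x a b) (Spec.map (CommRingCat.ofHom φ))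

variable (φ : A →+* A)

/-- The projection of `U_r ×_{C, Spec φ} C` to `U_r`. -/
abbrev UBase.p₁ : UBase π x a b φ ⟶ (Uopen π x a b).toScheme :=
  pullback.fst (Uopen.toBase π x a b) (Spec.map (CommRingCat.ofHom φ))

/-- The projection of `U_r ×_{C, Spec φ} C` to `C`, its structure morphism as a `C`-scheme. -/
abbrev UBase.p₂ : UBase π x a b φ ⟶ Spec (CommRingCat.of A) :=
  pullback.snd (Uopen.toBase π x a b) (Spec.map (CommRingCat.ofHom φ))

/-- The composition `U_r ×_{C, Spec φ} C ⟶ U_r ⟶ P1 A`; it pulls `y` back to `y`. -/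
def UBase.toP1 : UBase π x a b φ ⟶ P1 A := UBase.p₁ π x a b φ ≫ (Uopen π x a b).ι ≫ π

/-- The open subscheme of `U_r ×_{C, Spec φ} C` on which `Y ≠ 0`, i.e. on which `1 / y` is
regular. -/
def UBase.dom : (UBase π x a b φ).Opens := UBase.toP1 π x a b φ ⁻¹ᵁ opY A

/-- The function `p₂^*(x) ^ a / y` on the open subscheme `Y ≠ 0` of `U_r ×_{C, Spec φ} C`. -/
def UBase.function : Γ((UBase.dom π x a b φ).toScheme, ⊤) :=
  sectionsMap ((UBase.dom π x a b φ).ι ≫ UBase.p₂ π x a b φ) x ^ a *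
    (UBase.dom π x a b φ).topIso.inv ((UBase.toP1 π x a b φ).app (opY A) (monomialSection x 0 1))

/-- The rational function `p₂^*(x) ^ a / y` on `U_r ×_{C, Spec φ} C`, as a rational map to the
projective line over `C`. -/
def UBase.ratMap (hD : Dense (UBase.dom π x a b φ : Set (UBase π x a b φ))) :
    (UBase π x a b φ) ⤏ P1 A :=
  Scheme.PartialMap.toRationalMap
    { domain := UBase.dom π x a b φ
      dense_domain := hD
      hom := NodalBlowup.toP1 ((UBase.dom π x a b φ).ι ≫ UBase.p₂ π x a b φ)
        (UBase.function π x a b φ) }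

end Nodal

/-! ### The universal scheme on which a rational function extends to a morphism -/

section Extension

/-- The pullback `φ^*(f)` of the rational map `f : M ⤏ P` is defined, and it extends to a morphism
on all of `Y`. -/
def PullbackExtends {M P Y : Scheme.{u}} (f : M ⤏ P) (φ : Y ⟶ M) : Prop :=
  ∃ (h : M.PartialMap P) (g : Y ⟶ P), h.toRationalMap = f ∧
    Dense ((φ ⁻¹ᵁ h.domain : Y.Opens) : Set Y) ∧
    (φ ⁻¹ᵁ h.domain).ι ≫ g = φ ∣_ h.domain ≫ h.hom

/-- `Y` is an integral scheme, separated and of finite type over the base. -/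
structure IsVarietyOver {Y C : Scheme.{u}} (s : Y ⟶ C) : Prop where
  isIntegral : IsIntegral Y
  isSeparated : IsSeparated s
  locallyOfFiniteType : LocallyOfFiniteType s
  quasiCompact : QuasiCompact s

/-- `ρ : Z ⟶ M` is the scheme `M[f]`: it is universal among the integral schemes `Y ⟶ M`,
separated and of finite type over `C`, to which the rational map `f` pulls back and extends to a
morphism. Here `M` is a `C`-scheme via `s`. -/
structure IsUniversalExtension {M P C : Scheme.{u}} (s : M ⟶ C) (f : M ⤏ P)
    {Z : Scheme.{u}} (ρ : Z ⟶ M) : Prop where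
  isVariety : IsVarietyOver (ρ ≫ s)
  pullbackExtends : PullbackExtends f ρ
  existsUnique_lift : ∀ {Y : Scheme.{u}} (φ : Y ⟶ M), IsVarietyOver (φ ≫ s) →
    PullbackExtends f φ → ∃! ψ : Y ⟶ Z, ψ ≫ ρ = φ

end Extension

end NodalBlowup

end

open NodalBlowup

set_option linter.unusedSectionVars false

noncomputable section

namespace NodalBlowup

section

open Polynomial IsLocalRing

/-! ### Subrings of a henselization -/

/-! The theorem reduces to a computation in one monomial chart. Choose natural numbers with `b q' =
a q + 1`. Around its line, `U_r` is the spectrum of `R = A[s, v, v⁻¹] / (s ^ b v ^ q = x)` with `y =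
s ^ a v ^ q'`, so that `v = y ^ b / x ^ a` is the inverse of the parameter; away from the special
fibre `U_r` is the projective line. For the slope `a / 1` the chart is `R' = A[ω, ω⁻¹]` with `ω = y
/ x ^ a`. Substituting `x ^ b` for `x` turns `v` into `ω ^ b` and `s` into `x ω⁻q`. Hence `R' = R[ω]
/ (ω ^ b = v)`, which is finite étale of degree `b` because both `b` and `v` are invertible
(`IsRay.exists_isKummer`, `IsKummer.finite_etale`).

For the universal property, `x ^ a / y = ω⁻¹` is a morphism on `U_a`. Conversely, let `T` be an
integral scheme over the base change of `U_r` with a morphism to the projective line that extends `x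
^ a / y`, locally `[c₀ : c₁]`. Over the ray chart `c₁ ^ b = v c₀ ^ b`. Since `v` is invertible and
one coordinate is `1`, both coordinates are invertible, and `ω ↦ c₁ / c₀` defines the lift to `U_a`
(`exists_lift_of_injective`, `exists_extension`). Off the special fibre there is nothing to lift,
because `U_a` and the base change of `U_r` are both the projective line there.

The chart of `U_r` comes from toric charts of the blowup: `A[u, v] / (u ^ p v ^ q = x)` with `y = u
^ p' v ^ q'` and exponent determinant `±1`. The only possible node in such a chart is `u = v = 0`,
and blowing it up adds one column of exponents to the other, so charts of this kind, together with
one at `y = ∞` that contains no node, cover every nodal blowup (`IsNodalBlowup.exists_chart`). At a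
point of `u = 0`, invertibility of `x ^ a / y ^ b` forces `(p, p') = (b, a)` and `v` invertible,
which is the ray chart above.

The arithmetic input is that `A` is a Kummer extension of itself along `φ`, that is, free over
`φ(A)` on `1, x, …, x ^ (b - 1)` (`exists_sum_eq_and_unique`). The henselization is available only
through its universal property. That property shows that a subring containing the polynomials and
closed under inverses and Hensel roots is all of `A`; from this follow `A = k + x A`, injectivity of
the Taylor expansion into `k⟦X⟧`, and that `A` is a discrete valuation ring. The decomposition over
`φ(A)` is then the eigenspace decomposition under `x ↦ ζ x` for a primitive `b`-th root of unity
`ζ`, and a form of Newton's lemma identifies the invariants with `φ(A)`. -/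

theorem IsHenselizationAt.subring_eq_top {R : Type u} [CommRing R] {p : Ideal R} {A : Type u}
    [CommRing A] [IsLocalRing A] [Algebra R A] (hA : IsHenselizationAt R p A) (S : Subring A)
    (hS : ∀ r : R, algebraMap R A r ∈ S) (hinv : ∀ s ∈ S, ∀ t, s * t = 1 → t ∈ S)
    (hroot : ∀ (f : S[X]), f.Monic → ∀ (c : S) (z : A), aeval z f = 0 →
      z - c ∈ maximalIdeal A → (aeval (c : A) f) ∈ maximalIdeal A →
      IsUnit (aeval (c : A) (derivative f)) → z ∈ S) : S = ⊤ := by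
  have hunit : ∀ s : S, IsUnit (s : A) → IsUnit s := by
    rintro s hs
    obtain ⟨t, ht⟩ := hs.exists_right_inv
    exact IsUnit.of_mul_eq_one ⟨t, hinv s s.2 t ht⟩ (Subtype.ext ht)
  have hloc : IsLocalHom S.subtype := ⟨hunit⟩
  have : IsLocalRing S := S.subtype.domain_isLocalRing
  have hmax : ∀ s : S, s ∈ maximalIdeal S ↔ (s : A) ∈ maximalIdeal A := fun s ↦ by
    simp only [mem_maximalIdeal, mem_nonunits_iff, not_iff_not]
    exact ⟨fun h ↦ h.map S.subtype, hunit s⟩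
  have haeval : ∀ (f : S[X]) (c : S), aeval (c : A) f = (f.eval c : S) := fun f c ↦ by
    rw [aeval_def, eval₂_eq_eval_map, show (c : A) = algebraMap S A c from rfl, eval_map_apply]
    rfl
  have := hA.henselian
  have : HenselianLocalRing S :=
    { is_henselian := by
        intro f hf c hc hu
        obtain ⟨z, hz, hzc⟩ := HenselianLocalRing.is_henselian (f.map (algebraMap S A))
          (hf.map _) (c : A) (by
            rw [eval_map_algebraMap, haeval]
            exact (hmax _).1 hc) (by
            rw [derivative_map, eval_map_algebraMap, haeval]
            exact hu.map S.subtype)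
        rw [IsRoot.def, eval_map_algebraMap] at hz
        have hzS := hroot f hf c z hz hzc (by rw [haeval]; exact (hmax _).1 hc)
          (by rw [haeval]; exact hu.map S.subtype)
        refine ⟨⟨z, hzS⟩, ?_, (hmax _).2 hzc⟩
        have := haeval f ⟨z, hzS⟩
        rw [IsRoot.def]
        exact Subtype.ext (this.symm.trans hz) }
  -- `S` is now a henselian local ring, so the universal property yields `A → S`. Followed by the
  -- inclusion it is a local endomorphism of `A` over `R`, hence the identity, and so every element
  -- of `A` lies in `S`.
  obtain ⟨g, ⟨hg, hgf⟩, -⟩ := hA.existsUnique_lift S ((algebraMap R A).codRestrict S hS) (by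
    rw [← hA.comap_maximalIdeal]
    ext r
    simp only [Ideal.mem_comap, hmax]
    rfl)
  have hid : S.subtype.comp g = RingHom.id A := by
    refine (hA.existsUnique_lift A (algebraMap R A) hA.comap_maximalIdeal).unique
      ⟨RingHom.isLocalHom_comp _ _, ?_⟩ ⟨isLocalHom_id _, by simp⟩
    rw [RingHom.comp_assoc, hgf]
    rfl
  rw [eq_top_iff]
  intro z _
  rw [← RingHom.id_apply z, ← hid]
  exact (g z).2

/-! ### Residue field, maximal ideal and Taylor expansion of the henselization -/

section Line

variable {k : Type u} [Field k] {A : Type u} [CommRing A] [IsLocalRing A] [Algebra k[X] A]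
  [Algebra k A] [IsScalarTower k k[X] A]

theorem algebraMap_C_eq (c : k) : algebraMap k[X] A (C c) = algebraMap k A c := by
  rw [IsScalarTower.algebraMap_apply k k[X] A]; rfl

theorem isUnit_algebraMap_field {c : k} (hc : c ≠ 0) : IsUnit (algebraMap k A c) :=
  (IsUnit.mk0 c hc).map _

variable (hA : IsHenselizationAt k[X] (Ideal.span {X}) A)
include hA

theorem IsHenselizationAt.X_mem : algebraMap k[X] A X ∈ maximalIdeal A := by
  have : (X : k[X]) ∈ (maximalIdeal A).comap (algebraMap k[X] A) := by
    rw [hA.comap_maximalIdeal]; exact Ideal.mem_span_singleton_self _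
  exact this

/-- A subring with `S = k + x S` is local with residue field `k`. -/
theorem IsHenselizationAt.isUnit_of_add {c : k} (hc : c ≠ 0) (a : A) :
    IsUnit (algebraMap k A c + algebraMap k[X] A X * a) := by
  by_contra h
  have h1 : algebraMap k A c + algebraMap k[X] A X * a ∈ maximalIdeal A := h
  have h2 := Ideal.sub_mem _ h1 (Ideal.mul_mem_right a _ hA.X_mem)
  rw [add_sub_cancel_right] at h2
  exact h2 (isUnit_algebraMap_field hc)

/-- The elements of this form are a subring that contains the polynomials and is closed under
inverses and Hensel roots, so `subring_eq_top` applies. It follows that the residue field is `k` and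
that `x` generates the maximal ideal. -/
theorem IsHenselizationAt.exists_eq_add (z : A) :
    ∃ (c : k) (w : A), z = algebraMap k A c + algebraMap k[X] A X * w := by
  let x := algebraMap k[X] A X
  let S : Subring A :=
    { carrier := {z | ∃ (c : k) (w : A), z = algebraMap k A c + x * w}
      mul_mem' := by
        rintro _ _ ⟨c, w, rfl⟩ ⟨c', w', rfl⟩
        exact ⟨c * c', algebraMap k A c * w' + algebraMap k A c' * w + x * w * w',
          by rw [map_mul]; ring⟩
      one_mem' := ⟨1, 0, by simp⟩
      add_mem' := by
        rintro _ _ ⟨c, w, rfl⟩ ⟨c', w', rfl⟩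
        exact ⟨c + c', w + w', by rw [map_add]; ring⟩
      zero_mem' := ⟨0, 0, by simp⟩
      neg_mem' := by
        rintro _ ⟨c, w, rfl⟩
        exact ⟨-c, -w, by rw [map_neg]; ring⟩ }
  have hx : ∀ w, x * w ∈ S := fun w ↦ ⟨0, w, by simp⟩
  have hk : ∀ c, algebraMap k A c ∈ S := fun c ↦ ⟨c, 0, by simp⟩
  have hS : S = ⊤ := by
    refine hA.subring_eq_top S ?_ ?_ ?_
    · intro r
      refine ⟨r.coeff 0, algebraMap k[X] A r.divX, ?_⟩
      conv_lhs => rw [← X_mul_divX_add r]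
      rw [map_add, map_mul, algebraMap_C_eq, add_comm]
    · rintro _ ⟨c, w, rfl⟩ t ht
      have hc : c ≠ 0 := by
        rintro rfl
        rw [map_zero, zero_add, mul_assoc] at ht
        exact hA.X_mem (IsUnit.of_mul_eq_one _ ht)
      refine ⟨c⁻¹, -(algebraMap k A c⁻¹ * w * t), ?_⟩
      have hcc : algebraMap k A c⁻¹ * algebraMap k A c = 1 := by
        rw [← map_mul, inv_mul_cancel₀ hc, map_one]
      linear_combination (algebraMap k A c⁻¹) * ht - t * hcc
    -- Taylor's formula at `c` says that `z - c` times the unit `f'(c) + q (z - c)` equals `-f(c)`.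
    -- The value `f(c)` is in `S` and is not a unit, so it is a multiple of `x`, and then so is `z -
    -- c`.
    · intro f hf c z hz hzc hfc hu
      obtain ⟨q, hq⟩ := (f.map (algebraMap S A)).binomExpansion (c : A) (z - c)
      rw [add_sub_cancel, derivative_map, eval_map_algebraMap, eval_map_algebraMap,
        eval_map_algebraMap, hz] at hq
      have hfS : aeval (c : A) f = (f.eval c : S) := by
        rw [aeval_def, eval₂_eq_eval_map, show (c : A) = algebraMap S A c from rfl, eval_map_apply]
        rfl
      obtain ⟨d, w, hd⟩ := (f.eval c).2
      rw [← hfS] at hd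
      have hd0 : d = 0 := by
        by_contra h0
        rw [hd] at hfc
        exact hfc (hA.isUnit_of_add h0 w)
      subst hd0
      rw [map_zero, zero_add] at hd
      have hv : IsUnit (aeval (c : A) (derivative f) + q * (z - c)) := by
        by_contra h
        have h2 := Ideal.sub_mem _ (show _ ∈ maximalIdeal A from h)
          (Ideal.mul_mem_left _ q hzc)
        rw [add_sub_cancel_right] at h2
        exact h2 hu
      obtain ⟨v, hv⟩ := hv.exists_right_inv
      have hzc' : z = c + x * (-(w * v)) := by
        linear_combination (-(z - c)) * hv - v * hq - v * hd
      rw [hzc']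
      exact S.add_mem c.2 (hx _)
  have : z ∈ S := hS ▸ Subring.mem_top z
  exact this

theorem IsHenselizationAt.maximalIdeal_eq :
    maximalIdeal A = Ideal.span {algebraMap k[X] A X} := by
  refine le_antisymm (fun z hz ↦ ?_) ((Ideal.span_singleton_le_iff_mem _).2 hA.X_mem)
  obtain ⟨c, w, rfl⟩ := hA.exists_eq_add z
  have hc : c = 0 := by
    by_contra h
    exact hz (hA.isUnit_of_add h w)
  subst hc
  rw [map_zero, zero_add]
  exact Ideal.mul_mem_right _ _ (Ideal.mem_span_singleton_self _)

/-- The Taylor expansion. -/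
theorem IsHenselizationAt.exists_powerSeries :
    ∃ ψ : A →+* PowerSeries k, ψ (algebraMap k[X] A X) = PowerSeries.X ∧
      ∀ c : k, ψ (algebraMap k A c) = PowerSeries.C c := by
  have : IsAdicComplete (maximalIdeal (PowerSeries k)) (PowerSeries k) := by
    rw [PowerSeries.maximalIdeal_eq_span_X]; infer_instance
  have : HenselianLocalRing (PowerSeries k) :=
    { is_henselian := fun f hf a h1 h2 ↦
        HenselianRing.is_henselian (I := maximalIdeal (PowerSeries k)) f hf a h1 (h2.map _) }
  obtain ⟨g, ⟨-, hg⟩, -⟩ := hA.existsUnique_lift (PowerSeries k)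
    (Polynomial.coeToPowerSeries.ringHom) (by
      ext f
      rw [Ideal.mem_comap, PowerSeries.maximalIdeal_eq_span_X, Ideal.mem_span_singleton,
        Ideal.mem_span_singleton, PowerSeries.X_dvd_iff, Polynomial.X_dvd_iff]
      simp)
  refine ⟨g, ?_, fun c ↦ ?_⟩
  · have := RingHom.congr_fun hg X
    simpa using this
  · have := RingHom.congr_fun hg (C c)
    rw [RingHom.comp_apply, algebraMap_C_eq] at this
    simpa using this

theorem IsHenselizationAt.X_pow_ne_zero (n : ℕ) : algebraMap k[X] A X ^ n ≠ 0 := by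
  obtain ⟨ψ, hψ, -⟩ := hA.exists_powerSeries
  intro h
  have := congrArg ψ h
  rw [map_pow, hψ, map_zero] at this
  exact pow_ne_zero n PowerSeries.X_ne_zero this

end Line

end

/-! ### The henselization is a discrete valuation ring -/

section

open Polynomial IsLocalRing

/-- A ring embedded in `k⟦X⟧` in which every element is `c + x d` with `c` in `k`, and is a unit if
`c ≠ 0`, is a discrete valuation ring. -/
theorem exists_eq_pow_mul {k : Type u} [Field k] {D : Type u} [CommRing D] (x : D)
    (ψ : D →+* PowerSeries k) (hψ : Function.Injective ψ) (hx : ψ x = PowerSeries.X)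
    (h : ∀ d : D, IsUnit d ∨ ∃ d', d = x * d') (d : D) (hd : d ≠ 0) :
    ∃ (n : ℕ) (v : Dˣ), d = x ^ n * v := by
  -- Induction on a bound for the order of `ψ d`, which drops by one with every factor `x` that is
  -- split off.
  have key : ∀ (N : ℕ) (d : D), ¬ PowerSeries.X ^ N ∣ ψ d → ∃ (n : ℕ) (v : Dˣ), d = x ^ n * v := by
    intro N
    induction N with
    | zero => intro d hd; simp at hd
    | succ N ih =>
      intro d hd
      obtain ⟨v, hv⟩ | ⟨d', rfl⟩ := h d
      · exact ⟨0, v, by simp [hv]⟩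
      · rw [map_mul, hx, pow_succ'] at hd
        obtain ⟨n, v, rfl⟩ := ih d' (fun h ↦ hd (mul_dvd_mul_left _ h))
        exact ⟨n + 1, v, by ring⟩
  have hne : ψ d ≠ 0 := (map_ne_zero_iff ψ hψ).2 hd
  obtain ⟨m, hm⟩ : ∃ m, PowerSeries.coeff m (ψ d) ≠ 0 := by
    by_contra! h0
    exact hne (PowerSeries.ext (by simpa using h0))
  refine key (m + 1) d fun hdvd ↦ hm ?_
  exact (PowerSeries.X_pow_dvd_iff.1 hdvd) m (Nat.lt_succ_self m)

theorem isDiscreteValuationRing_of_powerSeries {k : Type u} [Field k] {D : Type u} [CommRing D]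
    (x : D) (ψ : D →+* PowerSeries k) (hψ : Function.Injective ψ) (hx : ψ x = PowerSeries.X)
    (h : ∀ d : D, IsUnit d ∨ ∃ d', d = x * d') :
    ∃ _ : IsDomain D, IsDiscreteValuationRing D ∧ Irreducible x := by
  have hdom : IsDomain D := hψ.isDomain ψ
  have hxu : ¬ IsUnit x := fun hu ↦ by
    have := hu.map ψ
    rw [hx] at this
    exact PowerSeries.X_prime.not_isUnit this
  have hirr : Irreducible x := by
    refine ⟨hxu, fun a b hab ↦ ?_⟩
    by_contra! hc
    obtain ⟨a', rfl⟩ := (h a).resolve_left hc.1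
    obtain ⟨b', rfl⟩ := (h b).resolve_left hc.2
    have hx0 : x ≠ 0 := fun h0 ↦ PowerSeries.X_ne_zero (hx.symm.trans (by rw [h0, map_zero]))
    refine hxu (IsUnit.of_mul_eq_one (a' * b') (mul_left_cancel₀ hx0 ?_))
    linear_combination -hab
  refine ⟨hdom, IsDiscreteValuationRing.ofHasUnitMulPowIrreducibleFactorization
    ⟨x, hirr, fun {d} hd ↦ ?_⟩, hirr⟩
  obtain ⟨n, v, rfl⟩ := exists_eq_pow_mul x ψ hψ hx h d hd
  exact ⟨n, v, rfl⟩

/-- The elements `e / u` of `A` with `e` and `u` in `E`, `u` a unit of `A`. -/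
def unitLocalization {A : Type u} [CommRing A] (E : Subring A) : Subring A where
  carrier := {a | ∃ e ∈ E, ∃ v ∈ E, IsUnit v ∧ a * v = e}
  mul_mem' := by
    rintro a b ⟨e, he, v, hv, hu, h⟩ ⟨e', he', v', hv', hu', h'⟩
    exact ⟨e * e', E.mul_mem he he', v * v', E.mul_mem hv hv', hu.mul hu', by
      linear_combination b * v' * h + e * h'⟩
  one_mem' := ⟨1, E.one_mem, 1, E.one_mem, isUnit_one, by simp⟩
  add_mem' := by
    rintro a b ⟨e, he, v, hv, hu, h⟩ ⟨e', he', v', hv', hu', h'⟩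
    exact ⟨e * v' + e' * v, E.add_mem (E.mul_mem he hv') (E.mul_mem he' hv), v * v',
      E.mul_mem hv hv', hu.mul hu', by linear_combination v' * h + v * h'⟩
  zero_mem' := ⟨0, E.zero_mem, 1, E.one_mem, isUnit_one, by simp⟩
  neg_mem' := by
    rintro a ⟨e, he, v, hv, hu, h⟩
    exact ⟨-e, E.neg_mem he, v, hv, hu, by linear_combination -h⟩

theorem le_unitLocalization {A : Type u} [CommRing A] (E : Subring A) : E ≤ unitLocalization E :=
  fun e he ↦ ⟨e, he, 1, E.one_mem, isUnit_one, by simp⟩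

theorem mem_unitLocalization_of_mul_eq_one {A : Type u} [CommRing A] (E : Subring A) {s t : A}
    (hs : s ∈ unitLocalization E) (h : s * t = 1) : t ∈ unitLocalization E := by
  obtain ⟨e, he, v, hv, hu, hsv⟩ := hs
  exact ⟨v, hv, e, he, hsv ▸ (IsUnit.of_mul_eq_one _ h).mul hu, by
    linear_combination -t * hsv + v * h⟩

section Line

variable {k : Type u} [Field k] {A : Type u} [CommRing A] [IsLocalRing A] [Algebra k[X] A]
  [Algebra k A] [IsScalarTower k k[X] A]

/-- A subring of `A` that is a discrete valuation ring with uniformizer `x`, embedded in `k⟦X⟧`. -/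
structure IsUniformized (ψ : A →+* PowerSeries k) (D : Subring A) : Prop where
  algebraMap_mem : ∀ r : k[X], algebraMap k[X] A r ∈ D
  inv_mem : ∀ s ∈ D, ∀ t, s * t = 1 → t ∈ D
  exists_eq_add : ∀ d ∈ D, ∃ (c : k), ∃ d' ∈ D, d = algebraMap k A c + algebraMap k[X] A X * d'
  eq_zero : ∀ d ∈ D, ψ d = 0 → d = 0

variable (hA : IsHenselizationAt k[X] (Ideal.span {X}) A)
include hA

/-- Only the elements of `E` have to be checked: if `e = c + x d` and `v = c' + x d'` with `c' ≠ 0`,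
then `e / v - c / c' = x (d - (c / c') d') / v`. -/
theorem IsHenselizationAt.isUniformized_unitLocalization {ψ : A →+* PowerSeries k} {E : Subring A}
    (h1 : ∀ r : k[X], algebraMap k[X] A r ∈ E)
    (h2 : ∀ d ∈ E, ∃ (c : k), ∃ d' ∈ unitLocalization E,
      d = algebraMap k A c + algebraMap k[X] A X * d')
    (h3 : ∀ d ∈ E, ψ d = 0 → d = 0) : IsUniformized ψ (unitLocalization E) where
  algebraMap_mem r := le_unitLocalization E (h1 r)
  inv_mem _ hs _ h := mem_unitLocalization_of_mul_eq_one E hs h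
  exists_eq_add := by
    rintro a ⟨e, he, v, hv, hu, h⟩
    obtain ⟨c, d, hd, rfl⟩ := h2 e he
    obtain ⟨c', d', hd', rfl⟩ := h2 v hv
    have hc' : c' ≠ 0 := by
      rintro rfl
      rw [map_zero, zero_add] at hu
      exact hA.X_mem (isUnit_of_mul_isUnit_left hu)
    obtain ⟨t, ht⟩ := hu.exists_right_inv
    have htm := mem_unitLocalization_of_mul_eq_one E (le_unitLocalization E hv) ht
    have hk : ∀ c : k, algebraMap k A c ∈ unitLocalization E := fun c ↦ by
      rw [← algebraMap_C_eq]; exact le_unitLocalization E (h1 _)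
    have hcc : algebraMap k A c'⁻¹ * algebraMap k A c' = 1 := by
      rw [← map_mul, inv_mul_cancel₀ hc', map_one]
    refine ⟨c * c'⁻¹, (d - algebraMap k A (c * c'⁻¹) * d') * t,
      Subring.mul_mem _ (Subring.sub_mem _ hd (Subring.mul_mem _ (hk _) hd')) htm, ?_⟩
    rw [map_mul]
    linear_combination t * h - a * ht + algebraMap k A c * t * (- hcc) +
      algebraMap k A c * algebraMap k A c'⁻¹ * ht
  eq_zero := by
    rintro a ⟨e, he, v, hv, hu, h⟩ h0
    have := h3 e he (by rw [← h, map_mul, h0, zero_mul])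
    rw [this] at h
    exact (hu.mul_left_eq_zero).1 h

/-- The new ring is `D[z]` with the units of `A` in it inverted. The delicate point is that `ψ`
stays injective. Since `D` is a discrete valuation ring, it is integrally closed, so the minimal
polynomial of `ψ z` divides both `f` and every `g` with `ψ (g(z)) = 0`. Because `z` is a simple root
of `f`, the minimal polynomial already vanishes at `z` itself, and therefore so does `g`. -/
theorem IsHenselizationAt.exists_isUniformized_root {ψ : A →+* PowerSeries k}
    (hψX : ψ (algebraMap k[X] A X) = PowerSeries.X) {D : Subring A}
    (hD : IsUniformized ψ D) (f : D[X]) (hf : f.Monic) (c : D) (z : A) (hz : aeval z f = 0)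
    (hzc : z - c ∈ maximalIdeal A) (hfc : (aeval (c : A) f) ∈ maximalIdeal A)
    (hu : IsUnit (aeval (c : A) (derivative f))) :
    ∃ D' : Subring A, IsUniformized ψ D' ∧ D ≤ D' ∧ z ∈ D' := by
  set x := algebraMap k[X] A X with hx
  have hxD : x ∈ D := hD.algebraMap_mem X
  let xD : D := ⟨x, hxD⟩
  have hψinj : Function.Injective (ψ.comp D.subtype) := by
    rw [injective_iff_map_eq_zero]
    intro d hd
    exact Subtype.ext (hD.eq_zero d d.2 hd)
  obtain ⟨hdom, hdvr, -⟩ := isDiscreteValuationRing_of_powerSeries xD (ψ.comp D.subtype) hψinj hψX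
    (by
      intro d
      obtain ⟨c, d', hd', h⟩ := hD.exists_eq_add d d.2
      by_cases hc : c = 0
      · right
        subst hc
        exact ⟨⟨d', hd'⟩, Subtype.ext (by rw [h]; simp [xD, hx])⟩
      · left
        have hu : IsUnit (d : A) := h ▸ hA.isUnit_of_add hc d'
        obtain ⟨t, ht⟩ := hu.exists_right_inv
        exact IsUnit.of_mul_eq_one ⟨t, hD.inv_mem d d.2 t ht⟩ (Subtype.ext ht))
  let E : Subring A := (aeval (R := D) z).range.toSubring
  have hE : ∀ g : D[X], aeval z g ∈ E := fun g ↦ ⟨g, rfl⟩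
  have hDE : D ≤ E := fun d hd ↦ by
    have := hE (C ⟨d, hd⟩)
    rwa [aeval_C] at this
  have hdiv : ∀ (g : D[X]), ∃ q : D[X], (∀ w : A, aeval w g = aeval (c : A) g +
      (w - c) * aeval w q) ∧ aeval (c : A) (derivative g) = aeval (c : A) q := by
    intro g
    obtain ⟨q, hq⟩ : X - C c ∣ g - C (g.eval c) := by
      rw [dvd_iff_isRoot]; simp
    refine ⟨q, fun w ↦ ?_, ?_⟩
    · have h1 := congrArg (aeval w) hq
      have h2 := congrArg (aeval (c : A)) hq
      simp only [map_sub, map_mul, aeval_C, aeval_X] at h1 h2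
      change _ - _ = (_ - (c : A)) * _ at h1
      change _ - _ = ((c : A) - (c : A)) * _ at h2
      linear_combination h1 - h2
    · have e1 : derivative g = q + (X - C c) * derivative q := by
        have := congrArg derivative hq
        simpa using this
      rw [e1]
      simp only [map_add, map_mul, map_sub, aeval_X, aeval_C]
      change _ + ((c : A) - (c : A)) * _ = _
      ring
  -- Write `f(z) - f(c) = (z - c) q(z)`. Here `q(c) = f'(c)` is a unit, hence so is `q(z)`, and
  -- `f(c)` is divisible by `x` in `D`.
  obtain ⟨w, hw, hzw⟩ : ∃ w ∈ unitLocalization E, z = c + x * w := by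
    obtain ⟨q, hq, hder⟩ := hdiv f
    have hqz : IsUnit (aeval z q) := by
      by_contra h
      obtain ⟨q', hq', -⟩ := hdiv q
      have h2 := Ideal.sub_mem _ (show _ ∈ maximalIdeal A from h)
        (Ideal.mul_mem_right (aeval z q') _ hzc)
      rw [hq' z, add_sub_cancel_right, ← hder] at h2
      exact h2 hu
    obtain ⟨c₁, d, hd, hcd⟩ := hD.exists_eq_add (aeval (c : A) f) (by
      rw [aeval_def, eval₂_eq_eval_map, show (c : A) = algebraMap D A c from rfl, eval_map_apply]
      exact (f.eval c).2)
    have hc₁ : c₁ = 0 := by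
      by_contra h0
      rw [hcd] at hfc
      exact hfc (hA.isUnit_of_add h0 d)
    subst hc₁
    obtain ⟨t, ht⟩ := hqz.exists_right_inv
    refine ⟨-d * t, ⟨-d, E.neg_mem (hDE hd), aeval z q, hE q, hqz, by
      linear_combination -d * ht⟩, ?_⟩
    have := hq z
    rw [hz, hcd, map_zero, zero_add] at this
    linear_combination (-(z - c)) * ht - t * this
  refine ⟨unitLocalization E, hA.isUniformized_unitLocalization ?_ ?_ ?_,
    hDE.trans (le_unitLocalization E), le_unitLocalization E (by simpa using hE X)⟩
  · exact fun r ↦ hDE (hD.algebraMap_mem r)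
  · rintro _ ⟨g, rfl⟩
    obtain ⟨q, hq, -⟩ := hdiv g
    obtain ⟨c₁, d, hd, hcd⟩ := hD.exists_eq_add (aeval (c : A) g) (by
      rw [aeval_def, eval₂_eq_eval_map, show (c : A) = algebraMap D A c from rfl, eval_map_apply]
      exact (g.eval c).2)
    refine ⟨c₁, d + w * aeval z q, Subring.add_mem _ (le_unitLocalization E (hDE hd))
      (Subring.mul_mem _ hw (le_unitLocalization E (hE q))), ?_⟩
    change aeval z g = _
    rw [hq z, hcd]
    linear_combination (aeval z q) * hzw
  · rintro _ ⟨g, rfl⟩ hg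
    let _ : Algebra D (PowerSeries k) := (ψ.comp D.subtype).toAlgebra
    have hcomp : ∀ h : D[X], ψ (aeval z h) = aeval (ψ z) h := fun h ↦ by
      rw [aeval_def, hom_eval₂]; rfl
    have : Module.IsTorsionFree D (PowerSeries k) :=
      Module.isTorsionFree_iff_algebraMap_injective.2 hψinj
    have hint : IsIntegral D (ψ z) := ⟨f, hf, by rw [← aeval_def, ← hcomp, hz, map_zero]⟩
    have hf0 : minpoly D (ψ z) ∣ f :=
      minpoly.isIntegrallyClosed_dvd hint (by rw [← hcomp, hz, map_zero])
    have hg0 : minpoly D (ψ z) ∣ g :=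
      minpoly.isIntegrallyClosed_dvd hint (by rw [← hcomp]; exact hg)
    -- With `f = m q`, the derivative `f'(z) = m'(z) q(z) + m(z) q'(z)` is a unit while `m(z)` is
    -- not. So `q(z)` is a unit, and `m(z) q(z) = 0` gives `m(z) = 0`.
    suffices hm : aeval z (minpoly D (ψ z)) = 0 by
      obtain ⟨q, rfl⟩ := hg0
      change aeval z _ = 0
      rw [map_mul, hm, zero_mul]
    set m := minpoly D (ψ z) with hmdef
    have hmψ : ψ (aeval z m) = 0 := by rw [hcomp]; exact minpoly.aeval _ _
    have hmm : aeval z m ∈ maximalIdeal A := by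
      intro hunit
      have := hunit.map ψ
      rw [hmψ] at this
      exact not_isUnit_zero this
    obtain ⟨q, hq⟩ := hf0
    have hder : aeval z (derivative f) = aeval z (derivative m) * aeval z q +
        aeval z m * aeval z (derivative q) := by
      rw [hq, derivative_mul]; simp
    have hfz : IsUnit (aeval z (derivative f)) := by
      by_contra h
      obtain ⟨q', hq', -⟩ := hdiv (derivative f)
      have h2 := Ideal.sub_mem _ (show _ ∈ maximalIdeal A from h)
        (Ideal.mul_mem_right (aeval z q') _ hzc)
      rw [hq' z, add_sub_cancel_right] at h2
      exact h2 hu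
    have hqz : IsUnit (aeval z q) := by
      by_contra h
      refine (show aeval z (derivative f) ∈ maximalIdeal A from ?_) hfz
      rw [hder]
      exact Ideal.add_mem _ (Ideal.mul_mem_left _ _ h) (Ideal.mul_mem_right _ _ hmm)
    rw [hq, map_mul] at hz
    exact (hqz.mul_left_eq_zero).1 hz

/-- By Zorn's lemma there is a maximal uniformized subring above the localization of the
polynomials. By maximality it contains all its Hensel roots, so it is `A`. In particular the Taylor
expansion is injective on `A`. -/
theorem IsHenselizationAt.isUniformized_top {ψ : A →+* PowerSeries k}
    (hψX : ψ (algebraMap k[X] A X) = PowerSeries.X)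
    (hψC : ∀ c : k, ψ (algebraMap k A c) = PowerSeries.C c) :
    IsUniformized ψ (⊤ : Subring A) := by
  have hbase : IsUniformized ψ (unitLocalization (algebraMap k[X] A).range) := by
    refine hA.isUniformized_unitLocalization (fun r ↦ ⟨r, rfl⟩) ?_ ?_
    · rintro _ ⟨r, rfl⟩
      refine ⟨r.coeff 0, algebraMap k[X] A r.divX, le_unitLocalization _ ⟨_, rfl⟩, ?_⟩
      conv_lhs => rw [← X_mul_divX_add r]
      rw [map_add, map_mul, algebraMap_C_eq, add_comm]
    · rintro _ ⟨r, rfl⟩ hr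
      have : ψ.comp (algebraMap k[X] A) = Polynomial.coeToPowerSeries.ringHom := by
        refine Polynomial.ringHom_ext (fun c ↦ ?_) ?_
        · simp [algebraMap_C_eq, hψC]
        · simpa using hψX
      have h1 := RingHom.congr_fun this r
      rw [RingHom.comp_apply, hr] at h1
      have : r = 0 := by simpa using h1.symm
      rw [this, map_zero]
  obtain ⟨D, -, hD⟩ := zorn_le_nonempty₀ {D : Subring A | IsUniformized ψ D} (by
    intro c hc hchain D₀ hD₀
    have hdir : DirectedOn (· ≤ ·) c := hchain.directedOn
    have hmem : ∀ {a}, a ∈ sSup c ↔ ∃ s ∈ c, a ∈ s :=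
      Subring.mem_sSup_of_directedOn ⟨D₀, hD₀⟩ hdir
    refine ⟨sSup c, ⟨?_, ?_, ?_, ?_⟩, fun D hD ↦ le_sSup hD⟩
    · exact fun r ↦ hmem.2 ⟨D₀, hD₀, (hc hD₀).algebraMap_mem r⟩
    · intro s hs t h
      obtain ⟨D, hD, hsD⟩ := hmem.1 hs
      exact hmem.2 ⟨D, hD, (hc hD).inv_mem s hsD t h⟩
    · intro s hs
      obtain ⟨D, hD, hsD⟩ := hmem.1 hs
      obtain ⟨a, d', hd', h⟩ := (hc hD).exists_eq_add s hsD
      exact ⟨a, d', hmem.2 ⟨D, hD, hd'⟩, h⟩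
    · intro s hs h
      obtain ⟨D, hD, hsD⟩ := hmem.1 hs
      exact (hc hD).eq_zero s hsD h) _ hbase
  have hDtop : D = ⊤ := by
    refine hA.subring_eq_top D hD.prop.algebraMap_mem hD.prop.inv_mem ?_
    intro f hf c z hz hzc hfc hu
    obtain ⟨D', hD', hle, hzD'⟩ :=
      hA.exists_isUniformized_root hψX hD.prop f hf c z hz hzc hfc hu
    exact hD.le_of_ge hD' hle hzD'
  exact hDtop ▸ hD.prop

theorem IsHenselizationAt.isDiscreteValuationRing :
    ∃ _ : IsDomain A, IsDiscreteValuationRing A ∧ Irreducible (algebraMap k[X] A X) := by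
  obtain ⟨ψ, hψX, hψC⟩ := hA.exists_powerSeries
  have h := hA.isUniformized_top hψX hψC
  refine isDiscreteValuationRing_of_powerSeries (algebraMap k[X] A X) ψ ?_ hψX fun d ↦ ?_
  · rw [injective_iff_map_eq_zero]
    exact fun d hd ↦ h.eq_zero d trivial hd
  · obtain ⟨c, w, rfl⟩ := hA.exists_eq_add d
    by_cases hc : c = 0
    · right; exact ⟨w, by simp [hc]⟩
    · left; exact hA.isUnit_of_add hc w

end Line

end

/-! ### Hensel's and Newton's lemmas -/

section

open Polynomial IsLocalRing

/-- Hensel's lemma for a polynomial `c + X + X ^ 2 h` that need not be monic. -/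
theorem exists_root_of_henselian {B : Type u} [CommRing B] [HenselianLocalRing B] {c : B}
    (hc : c ∈ maximalIdeal B) (h : B[X]) :
    ∃ s ∈ maximalIdeal B, c + s + s ^ 2 * h.eval s = 0 := by
  -- Substituting `s = c r` and dividing by `c` leaves `Q(r) = 1 + r + c r ^ 2 H(r)`. The reversal
  -- of `Q` is monic because `Q(0) = 1`, and modulo `c` it is `X ^ (n + 1) (X + 1)`, with simple
  -- root `-1`. Hensel's lemma lifts that root to a unit `w`, and `r = w⁻¹`.
  set H := h.comp (C c * X) with hH
  set n := H.natDegree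
  set R := reflect (n + 2) (X ^ 2 * H)
  set Q : B[X] := 1 + X + C c * (X ^ 2 * H) with hQ
  have hrefl : reflect (n + 2) Q = X ^ (n + 2) + X ^ (n + 1) + C c * R := by
    rw [hQ, reflect_add, reflect_add, reflect_C_mul]
    congr 2
    · rw [← C_1, reflect_C]; simp
    · conv_lhs => rw [← pow_one (X : B[X])]
      rw [reflect_monomial, revAt_le (by omega)]
      congr 1
  have hQdeg : Q.natDegree ≤ n + 2 := by
    rw [hQ]
    refine natDegree_add_le_of_degree_le (natDegree_add_le_of_degree_le (by simp) ?_) ?_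
    · exact natDegree_X_le.trans (by omega)
    · refine (natDegree_C_mul_le _ _).trans ((natDegree_mul_le).trans ?_)
      have := natDegree_X_pow_le (R := B) 2
      omega
  have hdeg : (reflect (n + 2) Q).natDegree ≤ n + 2 := by
    refine (natDegree_reflect_le).trans (by simp [hQdeg])
  have hmon : (reflect (n + 2) Q).Monic := by
    refine monic_of_natDegree_le_of_coeff_eq_one (n + 2) hdeg ?_
    rw [coeff_reflect, revAt_le le_rfl, Nat.sub_self, hQ]
    simp
  have hmem : ∀ b : B, c * b ∈ maximalIdeal B := fun b ↦ Ideal.mul_mem_right _ _ hc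
  obtain ⟨w, hw, hw1⟩ := HenselianLocalRing.is_henselian _ hmon (-1 : B) (by
      rw [hrefl]
      simp only [eval_add, eval_pow, eval_X, eval_mul, eval_C]
      rw [show (-1 : B) ^ (n + 2) + (-1) ^ (n + 1) = 0 by ring, zero_add]
      exact hmem _) (by
      rw [hrefl]
      simp only [derivative_add, derivative_X_pow, derivative_mul, derivative_C, eval_add,
        eval_mul, eval_pow, eval_X, eval_C, zero_mul, zero_add]
      by_contra hu
      have h2 := Ideal.sub_mem _ (show _ ∈ maximalIdeal B from hu)
        (hmem (eval (-1) (derivative R)))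
      rw [add_sub_cancel_right] at h2
      refine h2 ?_
      have : ((n + 2 : ℕ) : B) * (-1) ^ (n + 2 - 1) + ((n + 1 : ℕ) : B) * (-1) ^ (n + 1 - 1) =
        (-1) ^ (n + 1) := by
        rw [show n + 2 - 1 = n + 1 by omega, show n + 1 - 1 = n by omega]
        push_cast
        ring
      rw [this]
      exact (isUnit_one.neg).pow _)
  have hwu : IsUnit w := by
    by_contra hu
    have h2 := Ideal.sub_mem _ (show _ ∈ maximalIdeal B from hu) hw1
    rw [sub_sub_cancel] at h2
    exact h2 (isUnit_one.neg)
  obtain ⟨r, hr⟩ := hwu.exists_right_inv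
  let _ : Invertible r := ⟨w, hr, by rw [mul_comm]; exact hr⟩
  have key := eval₂_reflect_mul_pow (RingHom.id B) r (n + 2) Q hQdeg
  rw [show ⅟r = w from rfl, ← Polynomial.eval, hw.eq_zero,
    zero_mul, ← Polynomial.eval, hQ] at key
  simp only [eval_add, eval_one, eval_X, eval_mul, eval_C, eval_pow, hH, eval_comp] at key
  exact ⟨c * r, hmem r, by linear_combination -c * key⟩

/-- A form of Newton's lemma: an element that is algebraic over a henselian discrete valuation ring
and can be approximated by its elements belongs to it. -/
theorem mem_range_of_isAlgebraic {A B : Type u} [CommRing A] [IsDomain A] [CommRing B] [IsDomain B]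
    [CharZero B] [HenselianLocalRing B] (φ : B →+* A) (hφ : Function.Injective φ) (t : B) (x : A)
    (b : ℕ) (hb : 0 < b) (hx : ¬ IsUnit x) (hx0 : x ≠ 0) (ht : φ t = x ^ b)
    (htm : maximalIdeal B = Ideal.span {t})
    (hA : ∀ a : A, a ≠ 0 → ∃ (n : ℕ) (v : Aˣ), a = x ^ n * v)
    (hB : ∀ a : B, a ≠ 0 → ∃ (n : ℕ) (v : Bˣ), a = t ^ n * v)
    (β : A) (happ : ∀ N : ℕ, ∃ (c : B) (γ : A), β = φ c + (x ^ b) ^ N * γ)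
    (halg : ∃ f : B[X], f ≠ 0 ∧ f.eval₂ φ β = 0) : β ∈ φ.range := by
  classical
  have hord : ∀ {m n : ℕ} {u : A} (v : Aˣ), x ^ m * u = x ^ n * v → m ≤ n := by
    intro m n u v h
    by_contra! hlt
    obtain ⟨d, rfl⟩ := Nat.exists_eq_add_of_lt hlt
    refine hx (IsUnit.of_mul_eq_one (x ^ d * u * v⁻¹) (mul_left_cancel₀ (pow_ne_zero n hx0) ?_))
    have := v.mul_inv
    linear_combination (v⁻¹ : Aˣ).val * h + x ^ n * this
  -- Minimal degree together with characteristic zero ensures `f'(β) ≠ 0`.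
  obtain ⟨f, ⟨hf0, hf⟩, hmin⟩ : ∃ f : B[X], (f ≠ 0 ∧ f.eval₂ φ β = 0) ∧
      ∀ g : B[X], g ≠ 0 → g.eval₂ φ β = 0 → f.natDegree ≤ g.natDegree := by
    have hex : ∃ n, ∃ f : B[X], (f ≠ 0 ∧ f.eval₂ φ β = 0) ∧ f.natDegree = n := by
      obtain ⟨f, hf⟩ := halg
      exact ⟨_, f, hf, rfl⟩
    obtain ⟨f, hf, hn⟩ := Nat.find_spec hex
    exact ⟨f, hf, fun g hg hg' ↦ hn ▸ Nat.find_min' hex ⟨g, ⟨hg, hg'⟩, rfl⟩⟩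
  have hdeg : f.natDegree ≠ 0 := by
    intro h
    rw [eq_C_of_natDegree_eq_zero h, eval₂_C] at hf
    rw [eq_C_of_natDegree_eq_zero h, (map_eq_zero_iff φ hφ).1 hf, C_0] at hf0
    exact hf0 rfl
  have hder0 : derivative f ≠ 0 := fun h ↦ hdeg (derivative_eq_zero.1 h)
  have hder : (derivative f).eval₂ φ β ≠ 0 := fun h ↦ by
    have h1 := hmin _ hder0 h
    have h2 := natDegree_derivative_lt hdeg
    omega
  obtain ⟨e, v, hev⟩ := hA _ hder
  -- With `e` the order of `f'(β)` in `x`, this precision makes `f'(β₀)` have the same order `e`. If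
  -- its order in `t` is `n`, then `b n ≤ e`, whereas `f(β₀)` has order at least `2 e + 1 ≥ 2 n + 1`
  -- in `t`, as Newton's lemma requires.
  obtain ⟨β₀, γ, hβ⟩ := happ (2 * e + 1)
  have hevφ : ∀ (g : B[X]) (c : B), g.eval₂ φ (φ c) = φ (g.eval c) := fun g c ↦
    eval₂_at_apply φ c
  have hsub : ∀ (g : B[X]) (y z : A), ∃ q, g.eval₂ φ y = g.eval₂ φ z + (y - z) * q := by
    intro g y z
    obtain ⟨q, hq⟩ := sub_dvd_eval_sub y z (g.map φ)
    rw [Polynomial.eval_map, Polynomial.eval_map] at hq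
    exact ⟨q, by linear_combination hq⟩
  have hNe : e < b * (2 * e + 1) := by nlinarith
  obtain ⟨N', hN'⟩ := Nat.exists_eq_add_of_lt hNe
  set d := (derivative f).eval β₀ with hd
  have hxpow : (x ^ b) ^ (2 * e + 1) = x ^ e * x * x ^ N' := by
    rw [← pow_mul, hN']; ring
  obtain ⟨v', hv'⟩ : ∃ v' : Aˣ, φ d = x ^ e * v' := by
    obtain ⟨q, hq⟩ := hsub (derivative f) (φ β₀) β
    rw [hevφ] at hq
    obtain ⟨m, w, hw⟩ := hA (v - x * (x ^ N' * γ * q)) (fun h0 ↦ by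
      have hv : (v : A) = x * (x ^ N' * γ * q) := by linear_combination h0
      exact hx (isUnit_of_mul_isUnit_left (hv ▸ v.isUnit)))
    have hm : m = 0 := by
      by_contra hm
      obtain ⟨m', rfl⟩ := Nat.exists_eq_succ_of_ne_zero hm
      have hv : (v : A) = x * (x ^ N' * γ * q + x ^ m' * w) := by
        rw [pow_succ] at hw; linear_combination hw
      exact hx (isUnit_of_mul_isUnit_left (hv ▸ v.isUnit))
    subst hm
    refine ⟨w, ?_⟩
    rw [pow_zero, one_mul] at hw
    rw [hd, hq, hev, ← hw]
    have : φ β₀ - β = - (x ^ e * x * x ^ N' * γ) := by rw [← hxpow, hβ]; ring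
    rw [this]; ring
  have hd0 : d ≠ 0 := by
    rintro h
    rw [h, map_zero] at hv'
    exact (mul_ne_zero (pow_ne_zero e hx0) v'.ne_zero) hv'.symm
  obtain ⟨n, w, hw⟩ := hB d hd0
  have hbn : b * n ≤ e := by
    rw [hw, map_mul, map_pow, ht, ← pow_mul] at hv'
    exact hord v' hv'
  have hne : n ≤ e := (Nat.le_mul_of_pos_left n hb).trans hbn
  obtain ⟨c, hcm, hc⟩ : ∃ c ∈ maximalIdeal B, f.eval β₀ = d ^ 2 * c := by
    by_cases h0 : f.eval β₀ = 0
    · exact ⟨0, zero_mem _, by rw [h0, mul_zero]⟩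
    obtain ⟨m, w', hw'⟩ := hB _ h0
    have hm : 2 * n + 1 ≤ m := by
      obtain ⟨q, hq⟩ := hsub f (φ β₀) β
      rw [hf, zero_add, hevφ, hw', map_mul, map_pow, ht, ← pow_mul] at hq
      have h1 : x ^ (b * (2 * e + 1)) * (-γ * q) = x ^ (b * m) * (Units.map φ.toMonoidHom w' : A) := by
        have : φ β₀ - β = - ((x ^ b) ^ (2 * e + 1) * γ) := by rw [hβ]; ring
        rw [this, ← pow_mul] at hq
        simp only [Units.coe_map, RingHom.toMonoidHom_eq_coe, MonoidHom.coe_coe]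
        linear_combination -hq
      have h2 := hord _ h1
      have h3 := Nat.le_of_mul_le_mul_left h2 hb
      omega
    obtain ⟨m', rfl⟩ := Nat.exists_eq_add_of_le hm
    refine ⟨t * (t ^ m' * w' * (w⁻¹ : Bˣ) ^ 2), ?_, ?_⟩
    · rw [htm]; exact Ideal.mul_mem_right _ _ (Ideal.mem_span_singleton_self _)
    · rw [hw', hw]
      have h1 : ((w : B) * (w⁻¹ : Bˣ)) ^ 2 = 1 := by rw [w.mul_inv, one_pow]
      linear_combination (-(t ^ (2 * n + 1 + m') * w')) * h1
  -- Newton's substitution: in the Taylor expansion at `β₀` with step `d s`, where `d = f'(β₀)`, all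
  -- terms are divisible by `d ^ 2`.
  obtain ⟨g, hg⟩ : ∃ g : B[X], ∀ s : B, f.eval (β₀ + d * s) =
      d ^ 2 * (c + s + s ^ 2 * g.eval s) := by
    refine ⟨(divX (divX (taylor β₀ f))).comp (C d * X), fun s ↦ ?_⟩
    have h1 : f.eval (β₀ + d * s) = (taylor β₀ f).eval (d * s) := by
      rw [taylor_eval, add_comm]
    have h2 : taylor β₀ f = (divX (divX (taylor β₀ f)) * X + C d) * X + C (f.eval β₀) := by
      conv_lhs => rw [← divX_mul_X_add (taylor β₀ f), ← divX_mul_X_add (divX (taylor β₀ f))]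
      rw [coeff_divX, zero_add, taylor_coeff_one, taylor_coeff_zero]
    rw [h1, h2]
    simp only [eval_add, eval_mul, eval_X, eval_C, eval_comp]
    rw [← h2, hc]
    ring
  obtain ⟨s, hsm, hs⟩ := exists_root_of_henselian hcm g
  rw [htm, Ideal.mem_span_singleton] at hsm
  obtain ⟨s', rfl⟩ := hsm
  refine ⟨β₀ + d * (t * s'), ?_⟩
  -- If the root found in `B` differed from `β` by `δ ≠ 0`, expanding `f` at `β` would give `f'(β) =
  -- q δ`. But `f'(β)` has order `e` and `δ` is divisible by `x ^ (e + 1)`.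
  by_contra hne'
  have hroot := hg (t * s')
  rw [hs, mul_zero] at hroot
  set δ := β - φ (β₀ + d * (t * s')) with hδ
  have hδ0 : δ ≠ 0 := fun h ↦ hne' (by linear_combination -h)
  obtain ⟨q, hq⟩ := (f.map φ).binomExpansion β (-δ)
  rw [show β + -δ = φ (β₀ + d * (t * s')) by rw [hδ]; ring, derivative_map,
    Polynomial.eval_map, Polynomial.eval_map, Polynomial.eval_map, hf, hevφ, hroot, map_zero, hev] at hq
  have hδx : δ = x ^ e * x * (x ^ N' * γ - v' * x ^ (b - 1) * φ s') := by
    rw [hδ, hβ, hxpow, map_add, map_mul, map_mul, hv', ht]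
    obtain ⟨b', rfl⟩ := Nat.exists_eq_succ_of_ne_zero hb.ne'
    simp only [Nat.succ_sub_one, Nat.succ_eq_add_one, pow_succ]
    ring
  have h3 : x ^ e * v = q * δ := by
    refine mul_right_cancel₀ hδ0 ?_
    linear_combination hq
  rw [hδx] at h3
  have h4 : x ^ (e + 1) * (q * (x ^ N' * γ - v' * x ^ (b - 1) * φ s')) = x ^ e * v := by
    rw [h3]; ring
  have := hord v h4
  omega

end

/-! ### The henselization is free over its image under `x ↦ x ^ b` -/

section

open Polynomial IsLocalRing

section Line

variable {k : Type u} [Field k] {A : Type u} [CommRing A] [IsLocalRing A] [Algebra k[X] A]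
  [Algebra k A] [IsScalarTower k k[X] A]
variable (hA : IsHenselizationAt k[X] (Ideal.span {X}) A)

theorem IsHenselizationAt.eq_pow_mul (hA : IsHenselizationAt k[X] (Ideal.span {X}) A) (a : A)
    (ha : a ≠ 0) : ∃ (n : ℕ) (v : Aˣ), a = algebraMap k[X] A X ^ n * v := by
  obtain ⟨_, _, hirr⟩ := hA.isDiscreteValuationRing
  obtain ⟨n, h⟩ := IsDiscreteValuationRing.associated_pow_irreducible ha hirr
  obtain ⟨v, hv⟩ := h.symm
  exact ⟨n, v, hv.symm⟩

/-- If constants come from `B` and `x` is algebraic over `B`, then `A` is algebraic over `B`. -/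
theorem IsHenselizationAt.isAlgebraic (hA : IsHenselizationAt k[X] (Ideal.span {X}) A)
    [IsDomain A] {B : Type u} [CommRing B] [IsDomain B] [Algebra B A]
    (hinj : Function.Injective (algebraMap B A))
    (hk : ∀ c : k, algebraMap k A c ∈ (algebraMap B A).range)
    (hX : IsAlgebraic B (algebraMap k[X] A X)) (a : A) : IsAlgebraic B a := by
  have : FaithfulSMul B A := (faithfulSMul_iff_algebraMap_injective _ _).2 hinj
  let S := Subalgebra.algebraicClosure B A
  have hS : S.toSubring = ⊤ := by
    refine hA.subring_eq_top _ ?_ ?_ ?_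
    · intro r
      induction r using Polynomial.induction_on' with
      | add p q hp hq => rw [map_add]; exact Subring.add_mem _ hp hq
      | monomial n c =>
        rw [← C_mul_X_pow_eq_monomial, map_mul, map_pow, algebraMap_C_eq]
        refine Subring.mul_mem _ ?_ (Subring.pow_mem _ hX n)
        obtain ⟨d, hd⟩ := hk c
        rw [← hd]
        exact S.algebraMap_mem d
    · intro s hs t hst
      let _ : Invertible s := ⟨t, by rw [mul_comm]; exact hst, hst⟩
      exact IsAlgebraic.invOf (x := s) hs
    · intro f hf c z hz _ _ _
      have : Algebra.IsAlgebraic B S := inferInstance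
      have hzS : IsAlgebraic S z := ⟨f, hf.ne_zero, hz⟩
      exact hzS.restrictScalars B
  have : a ∈ S.toSubring := hS ▸ Subring.mem_top a
  exact this

variable [IsAlgClosed k] [CharZero k] (b : ℕ) (hb : 0 < b)
  (φ : A →ₐ[k] A) (hφ : φ (algebraMap k[X] A X) = algebraMap k[X] A X ^ b)

include hA

theorem IsHenselizationAt.ringHom_ext {B : Type u} [CommRing B] [HenselianLocalRing B]
    {f g : A →+* B} (hf : IsLocalHom f) (hg : IsLocalHom g)
    (h : f.comp (algebraMap k[X] A) = g.comp (algebraMap k[X] A)) : f = g := by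
  refine (hA.existsUnique_lift B (f.comp (algebraMap k[X] A)) ?_).unique ⟨hf, rfl⟩ ⟨hg, h.symm⟩
  have hm : (maximalIdeal B).comap f = maximalIdeal A := ((local_hom_TFAE f).out 0 4).1 hf
  rw [← Ideal.comap_comap, hm, hA.comap_maximalIdeal]

include hb hφ in
theorem IsHenselizationAt.isLocalHom_pow : IsLocalHom φ.toRingHom := by
  constructor
  intro a ha
  by_contra h
  have h1 : a ∈ maximalIdeal A := h
  rw [hA.maximalIdeal_eq, Ideal.mem_span_singleton] at h1
  obtain ⟨w, rfl⟩ := h1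
  have h2 : φ.toRingHom (algebraMap k[X] A X * w) = algebraMap k[X] A X ^ b * φ w := by
    rw [map_mul, ← hφ]; rfl
  rw [h2] at ha
  obtain ⟨b', rfl⟩ := Nat.exists_eq_succ_of_ne_zero hb.ne'
  rw [pow_succ', mul_assoc] at ha
  exact hA.X_mem (isUnit_of_mul_isUnit_left ha)

include hb hφ in
theorem IsHenselizationAt.injective_pow : Function.Injective φ := by
  rw [injective_iff_map_eq_zero]
  intro a ha
  by_contra h0
  obtain ⟨n, v, rfl⟩ := hA.eq_pow_mul a h0
  rw [map_mul, map_pow, hφ] at ha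
  refine hA.X_pow_ne_zero (b * n) ?_
  rw [pow_mul]
  exact ((v.isUnit.map φ).mul_left_eq_zero).1 ha

/-- The automorphism of `A` with `x ↦ ζ x`. -/
theorem IsHenselizationAt.exists_rotation (ζ : k) (_ : ζ ≠ 0) :
    ∃ σ : A →+* A, IsLocalHom σ ∧ σ (algebraMap k[X] A X) = algebraMap k A ζ * algebraMap k[X] A X ∧
      ∀ c, σ (algebraMap k A c) = algebraMap k A c := by
  have := hA.henselian
  obtain ⟨σ, ⟨h1, h2⟩, -⟩ := hA.existsUnique_lift A
    ((algebraMap k[X] A).comp (Polynomial.eval₂RingHom (C : k →+* k[X]) (C ζ * X))) (by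
      rw [← Ideal.comap_comap, hA.comap_maximalIdeal]
      ext f
      rw [Ideal.mem_comap, Ideal.mem_span_singleton, Ideal.mem_span_singleton, X_dvd_iff,
        X_dvd_iff, coeff_zero_eq_eval_zero, coeff_zero_eq_eval_zero]
      rw [coe_eval₂RingHom, ← Polynomial.comp, eval_comp]
      simp)
  refine ⟨σ, h1, ?_, fun c ↦ ?_⟩
  · have := RingHom.congr_fun h2 X
    simpa [algebraMap_C_eq] using this
  · have := RingHom.congr_fun h2 (C c)
    simpa [algebraMap_C_eq] using this

include hb hφ in
-- The rotation `σ : x ↦ ζ x` satisfies `σ ^ b = 1` and fixes `φ(A)`, so averaging splits every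
-- element into eigencomponents. A nonzero component with eigenvalue `ζ ^ i`, `i < b`, has order
-- congruent to `i` modulo `b`, hence equals `x ^ i` times an invariant. Invariants are algebraic
-- over `φ(A)` and can be approximated by `φ(A)`, so `mem_range_of_isAlgebraic` places them in
-- `φ(A)`.
theorem IsHenselizationAt.exists_sum_eq_and_unique :
    (∀ a : A, ∃ β : ℕ → A, a = ∑ i ∈ Finset.range b, φ (β i) * algebraMap k[X] A X ^ i) ∧
    ∀ β : ℕ → A, ∑ i ∈ Finset.range b, φ (β i) * algebraMap k[X] A X ^ i = 0 →
      ∀ i < b, β i = 0 := by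
  classical
  obtain ⟨_, _, hirr⟩ := hA.isDiscreteValuationRing
  have := hA.henselian
  set x := algebraMap k[X] A X with hx
  have hx0 : x ≠ 0 := hirr.ne_zero
  have : NeZero (b : k) := ⟨by exact_mod_cast hb.ne'⟩
  obtain ⟨ζ, hζ⟩ := HasEnoughRootsOfUnity.exists_primitiveRoot k b
  have hζ0 : ζ ≠ 0 := hζ.ne_zero hb.ne'
  obtain ⟨σ, hσl, hσx, hσc⟩ := hA.exists_rotation ζ hζ0
  set κ := algebraMap k A with hκ
  have hκinj : Function.Injective κ := κ.injective
  have hpx : ∀ j, (σ ^ j) x = κ ζ ^ j * x := by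
    intro j
    induction j with
    | zero => simp
    | succ j ih =>
      rw [pow_succ', RingHom.mul_def, RingHom.comp_apply, ih, map_mul, map_pow, hσx, hσc]; ring
  have hpc : ∀ j c, (σ ^ j) (κ c) = κ c := by
    intro j c
    induction j with
    | zero => simp
    | succ j ih => rw [pow_succ', RingHom.mul_def, RingHom.comp_apply, ih, hσc]
  have hpl : ∀ j, IsLocalHom (σ ^ j) := by
    intro j
    induction j with
    | zero => exact isLocalHom_id A
    | succ j ih => rw [pow_succ', RingHom.mul_def]; exact RingHom.isLocalHom_comp _ _
  have hφl := hA.isLocalHom_pow b hb φ hφ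
  have hσφ : ∀ j a, (σ ^ j) (φ a) = φ a := by
    intro j a
    have : (σ ^ j).comp φ.toRingHom = φ.toRingHom := by
      have := hpl j
      refine hA.ringHom_ext (RingHom.isLocalHom_comp _ _) hφl (Polynomial.ringHom_ext ?_ ?_)
      · intro c
        simp only [RingHom.comp_apply, algebraMap_C_eq]
        rw [show φ.toRingHom (algebraMap k A c) = κ c from φ.commutes c]
        exact hpc j c
      · simp only [RingHom.comp_apply]
        rw [show φ.toRingHom (algebraMap k[X] A X) = x ^ b from hφ, map_pow, hpx, mul_pow,
          ← pow_mul, mul_comm j b, pow_mul, ← map_pow, hζ.pow_eq_one, map_one, one_pow, one_mul]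
    exact RingHom.congr_fun this a
  have hσb : σ ^ b = RingHom.id A := by
    refine hA.ringHom_ext (hpl b) (isLocalHom_id A) (Polynomial.ringHom_ext ?_ ?_)
    · intro c
      simp only [RingHom.comp_apply, algebraMap_C_eq, RingHom.id_apply]
      exact hpc b c
    · simp only [RingHom.comp_apply, RingHom.id_apply]
      rw [← hx, hpx, ← map_pow, hζ.pow_eq_one, map_one, one_mul]
  have hgeom : ∀ i : ℤ, ∑ j ∈ Finset.range b, (ζ ^ i) ^ j = if (b : ℤ) ∣ i then (b : k) else 0 := by
    intro i
    split_ifs with h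
    · rw [(hζ.zpow_eq_one_iff_dvd i).2 h]; simp
    · have h1 : ζ ^ i ≠ 1 := fun h1 ↦ h ((hζ.zpow_eq_one_iff_dvd i).1 h1)
      rw [geom_sum_eq h1, ← zpow_natCast, ← zpow_mul, mul_comm, zpow_mul, zpow_natCast,
        hζ.pow_eq_one, one_zpow, sub_self, zero_div]
  -- the eigencomponents of `a`
  let comp : ℕ → A → A := fun i a ↦
    κ (b : k)⁻¹ * ∑ j ∈ Finset.range b, κ ((ζ ^ (-(i : ℤ))) ^ j) * (σ ^ j) a
  have hsum : ∀ a, a = ∑ i ∈ Finset.range b, comp i a := by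
    intro a
    simp only [comp]
    rw [← Finset.mul_sum, Finset.sum_comm]
    have h1 : ∀ j ∈ Finset.range b, ∑ i ∈ Finset.range b,
        κ ((ζ ^ (-(i : ℤ))) ^ j) * (σ ^ j) a = if j = 0 then κ (b : k) * a else 0 := by
      intro j hj
      rw [← Finset.sum_mul, ← map_sum]
      have : ∀ i ∈ Finset.range b, (ζ ^ (-(i : ℤ))) ^ j = (ζ ^ (-(j : ℤ))) ^ i := fun i _ ↦ by
        rw [← zpow_natCast, ← zpow_natCast, ← zpow_mul, ← zpow_mul]; congr 1; ring
      rw [Finset.sum_congr rfl this, hgeom]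
      by_cases hj0 : j = 0
      · subst hj0; simp
      · rw [if_neg hj0, if_neg, map_zero, zero_mul]
        rw [dvd_neg, Int.natCast_dvd_natCast]
        exact Nat.not_dvd_of_pos_of_lt (Nat.pos_of_ne_zero hj0) (Finset.mem_range.1 hj)
    rw [Finset.sum_congr rfl h1, Finset.sum_ite_eq', if_pos (Finset.mem_range.2 hb), ← mul_assoc,
      ← map_mul, inv_mul_cancel₀ (NeZero.ne _), map_one, one_mul]
  have hcomp : ∀ i a, σ (comp i a) = κ (ζ ^ i) * comp i a := by
    intro i a
    simp only [comp]
    rw [map_mul, hσc, map_sum, mul_left_comm]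
    congr 1
    rw [Finset.mul_sum]
    have h1 : ∀ j ∈ Finset.range b, σ (κ ((ζ ^ (-(i : ℤ))) ^ j) * (σ ^ j) a) =
        κ (ζ ^ i) * (κ ((ζ ^ (-(i : ℤ))) ^ (j + 1)) * (σ ^ (j + 1)) a) := by
      intro j _
      rw [map_mul, hσc, pow_succ' σ, RingHom.mul_def, RingHom.comp_apply, ← mul_assoc, ← map_mul]
      congr 2
      rw [pow_succ', zpow_neg, zpow_natCast, ← mul_assoc, mul_inv_cancel₀ (pow_ne_zero _ hζ0),
        one_mul]
    rw [Finset.sum_congr rfl h1]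
    have h2 := Finset.sum_range_succ (fun j ↦ κ (ζ ^ i) *
      (κ ((ζ ^ (-(i : ℤ))) ^ j) * (σ ^ j) a)) b
    rw [Finset.sum_range_succ'] at h2
    refine add_right_cancel (h2.trans ?_)
    congr 1
    have h3 : (ζ ^ (-(i : ℤ))) ^ b = 1 := by
      rw [← zpow_natCast, ← zpow_mul, mul_comm, zpow_mul, zpow_natCast, hζ.pow_eq_one, one_zpow]
    rw [hσb, h3, pow_zero, pow_zero]
    rfl
  -- Comparison of leading coefficients: `x ^ n (c + x w)` is sent to `ζ ^ n x ^ n (c + …)`, so `ζ ^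
  -- n = ζ ^ i`.
  have hvanish : ∀ (i : ℕ) (a : A), σ a = κ (ζ ^ i) * a → a ≠ 0 →
      ∃ (n : ℕ) (v : Aˣ), a = x ^ n * v ∧ (b : ℤ) ∣ n - i := by
    intro i a h ha
    obtain ⟨n, v, rfl⟩ := hA.eq_pow_mul a ha
    refine ⟨n, v, rfl, ?_⟩
    obtain ⟨c, w, hv⟩ := hA.exists_eq_add (v : A)
    have hc : c ≠ 0 := by
      rintro rfl
      rw [map_zero, zero_add] at hv
      exact hA.X_mem (isUnit_of_mul_isUnit_left (hv ▸ v.isUnit))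
    rw [map_mul, map_pow, hσx, mul_pow, mul_assoc, mul_left_comm, mul_left_comm (κ (ζ ^ i)),
      ← map_pow κ] at h
    have h1 := mul_left_cancel₀ (pow_ne_zero n hx0) h
    rw [hv, map_add, map_mul, hσc, hσx] at h1
    have h2 : κ ((ζ ^ n - ζ ^ i) * c) ∈ maximalIdeal A := by
      have : κ ((ζ ^ n - ζ ^ i) * c) = x * (κ (ζ ^ i) * w - κ (ζ ^ n) * κ ζ * σ w) := by
        rw [map_mul, map_sub]
        linear_combination h1
      rw [this]
      exact Ideal.mul_mem_right _ _ hA.X_mem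
    have h3 : (ζ ^ n - ζ ^ i) * c = 0 := by
      by_contra h3
      exact h2 (isUnit_algebraMap_field h3)
    have h4 : ζ ^ n = ζ ^ i := sub_eq_zero.1 ((mul_eq_zero.1 h3).resolve_right hc)
    rw [← hζ.zpow_eq_one_iff_dvd, zpow_sub₀ hζ0, zpow_natCast, zpow_natCast, h4,
      div_self (pow_ne_zero _ hζ0)]
  -- Subtracting its constant term from an invariant leaves an invariant of positive order divisible
  -- by `b`. Dividing that by `x ^ b = φ x` gives another invariant, to which the induction applies.
  have happ : ∀ (N : ℕ) (β : A), σ β = β → ∃ (c γ : A), β = φ c + (x ^ b) ^ N * γ ∧ σ γ = γ := by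
    intro N
    induction N with
    | zero => exact fun β hβ ↦ ⟨0, β, by simp, hβ⟩
    | succ N ih =>
      intro β hβ
      obtain ⟨c, w, hcw⟩ := hA.exists_eq_add β
      have hcφ : φ (κ c) = κ c := φ.commutes c
      by_cases h0 : β - κ c = 0
      · exact ⟨κ c, 0, by rw [hcφ]; linear_combination h0, map_zero _⟩
      obtain ⟨n, v, hv, hdvd⟩ := hvanish 0 (β - κ c) (by rw [map_sub, hβ, hσc]; simp) h0
      have hn : n ≠ 0 := by
        rintro rfl
        rw [pow_zero, one_mul] at hv
        have : (v : A) = x * w := by rw [← hv, hcw]; ring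
        exact hA.X_mem (isUnit_of_mul_isUnit_left (this ▸ v.isUnit))
      obtain ⟨m, hm⟩ : b ∣ n := by
        rwa [Nat.cast_zero, sub_zero, Int.natCast_dvd_natCast] at hdvd
      have hm0 : m ≠ 0 := by rintro rfl; exact hn (by simpa using hm)
      obtain ⟨m, rfl⟩ := Nat.exists_eq_succ_of_ne_zero hm0
      have hv' : β - κ c = x ^ b * (x ^ (b * m) * v) := by
        rw [hv, hm, Nat.succ_eq_add_one]; ring
      have hσxb : σ (x ^ b) = x ^ b := by
        rw [map_pow, hσx, mul_pow, ← map_pow, hζ.pow_eq_one, map_one, one_mul]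
      have hinv : σ (x ^ (b * m) * v) = x ^ (b * m) * v := by
        refine mul_left_cancel₀ (pow_ne_zero b hx0) ?_
        rw [← hv']
        conv_lhs => rw [← hσxb]
        rw [← map_mul, ← hv', map_sub, hβ, hσc]
      obtain ⟨c', γ, h, hγ⟩ := ih _ hinv
      refine ⟨κ c + algebraMap k[X] A X * c', γ, ?_, hγ⟩
      rw [map_add, map_mul, hcφ, hφ]
      rw [h] at hv'
      linear_combination hv'
  have hφinj := hA.injective_pow b hb φ hφ
  have : CharZero A := charZero_of_injective_algebraMap hκinj
  have hinv : ∀ β : A, σ β = β → β ∈ φ.toRingHom.range := by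
    intro β hβ
    refine mem_range_of_isAlgebraic φ.toRingHom hφinj x x b hb hA.X_mem hx0 hφ
      hA.maximalIdeal_eq (fun a ha ↦ hA.eq_pow_mul a ha) (fun a ha ↦ hA.eq_pow_mul a ha) β
      (fun N ↦ ?_) ?_
    · obtain ⟨c, γ, h, -⟩ := happ N β hβ
      exact ⟨c, γ, h⟩
    · have := @IsHenselizationAt.isAlgebraic k _ A _ _ _ _ _ hA _ A _ _ φ.toRingHom.toAlgebra
        hφinj (fun c ↦ ⟨κ c, φ.commutes c⟩)
        ⟨X ^ b - C x, X_pow_sub_C_ne_zero hb _, by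
          change Polynomial.eval₂ φ.toRingHom _ _ = 0
          simp only [eval₂_sub, eval₂_pow, eval₂_X, eval₂_C]
          exact sub_eq_zero.2 hφ.symm⟩ β
      obtain ⟨f, hf0, hf⟩ := this
      exact ⟨f, hf0, hf⟩
  constructor
  · intro a
    have hex : ∀ i, ∃ β, i < b → comp i a = φ β * x ^ i := by
      intro i
      by_cases h0 : comp i a = 0
      · exact ⟨0, fun _ ↦ by rw [h0]; simp⟩
      by_cases hi : i < b
      · obtain ⟨n, v, hv, hdvd⟩ := hvanish i _ (hcomp i a) h0
        obtain ⟨m, hm⟩ := hdvd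
        have hin : i ≤ n := by
          have : 0 ≤ m := by
            by_contra! hneg
            have : (b : ℤ) * m ≤ -b := by nlinarith
            omega
          have : 0 ≤ (b : ℤ) * m := by positivity
          omega
        obtain ⟨d, rfl⟩ := Nat.exists_eq_add_of_le hin
        have hv' : comp i a = x ^ i * (x ^ d * v) := by rw [hv]; ring
        obtain ⟨β, hβ⟩ := hinv (x ^ d * v) (by
          have h1 := hcomp i a
          rw [hv', map_mul, map_pow, hσx, mul_pow, ← map_pow, mul_assoc] at h1
          exact mul_left_cancel₀ (pow_ne_zero i hx0)
            (mul_left_cancel₀ ((map_ne_zero_iff κ hκinj).2 (pow_ne_zero i hζ0)) h1))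
        exact ⟨β, fun _ ↦ by rw [hv', ← hβ, mul_comm]; rfl⟩
      · exact ⟨0, fun h ↦ absurd h hi⟩
    choose β hβ using hex
    refine ⟨β, ?_⟩
    conv_lhs => rw [hsum a]
    exact Finset.sum_congr rfl fun i hi ↦ hβ i (Finset.mem_range.1 hi)
  · intro β hβ l hl
    -- Uniqueness is orthogonality of characters: applying all `σ ^ j` to the relation and averaging
    -- against `ζ ^ (-l j)` isolates its `l`-th term.
    have h1 : ∀ j, ∑ i ∈ Finset.range b, κ ((ζ ^ (i : ℤ)) ^ j) * (φ (β i) * x ^ i) = 0 := by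
      intro j
      have := congrArg (σ ^ j) hβ
      rw [map_zero, map_sum] at this
      rw [← this]
      refine Finset.sum_congr rfl fun i _ ↦ ?_
      rw [map_mul, hσφ, map_pow (σ ^ j), hpx, mul_pow, ← pow_mul, ← map_pow κ, zpow_natCast,
        ← pow_mul, mul_comm j i]
      ring
    have h2 : ∑ j ∈ Finset.range b, κ ((ζ ^ (-(l : ℤ))) ^ j) *
        ∑ i ∈ Finset.range b, κ ((ζ ^ (i : ℤ)) ^ j) * (φ (β i) * x ^ i) = 0 :=
      Finset.sum_eq_zero fun j _ ↦ by rw [h1, mul_zero]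
    simp only [Finset.mul_sum] at h2
    rw [Finset.sum_comm] at h2
    have h3 : ∀ i ∈ Finset.range b, ∑ j ∈ Finset.range b, κ ((ζ ^ (-(l : ℤ))) ^ j) *
        (κ ((ζ ^ (i : ℤ)) ^ j) * (φ (β i) * x ^ i)) =
        if i = l then κ (b : k) * (φ (β i) * x ^ i) else 0 := by
      intro i hi
      simp only [← mul_assoc]
      rw [← Finset.sum_mul, ← Finset.sum_mul]
      simp only [← map_mul, ← mul_pow]
      rw [← map_sum, ← zpow_add₀ hζ0, hgeom]
      have hil : (b : ℤ) ∣ -l + i ↔ i = l := by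
        constructor
        · intro h
          have h' := Int.eq_zero_of_abs_lt_dvd h (by
            rw [abs_lt]; have := Finset.mem_range.1 hi; omega)
          omega
        · rintro rfl; simp
      by_cases h : i = l
      · rw [if_pos h, if_pos (hil.2 h)]
      · rw [if_neg h, if_neg (fun h' ↦ h (hil.1 h')), map_zero, zero_mul, zero_mul]
    rw [Finset.sum_congr rfl h3, Finset.sum_ite_eq', if_pos (Finset.mem_range.2 hl)] at h2
    have h4 := (mul_eq_zero.1 h2).resolve_left ((map_ne_zero_iff κ hκinj).2 (NeZero.ne _))
    have h5 := (mul_eq_zero.1 h4).resolve_right (pow_ne_zero l hx0)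
    exact (map_eq_zero_iff φ hφinj).1 h5

end Line

end

/-! ### Morphisms to `Proj` given by global sections, and homogeneous coordinates -/

section

section Proj
open Proj

variable {σ : Type*} {B : Type u} [CommRing B] [SetLike σ B] [AddSubgroupClass σ B] (𝒜 : ℕ → σ)
  [GradedRing 𝒜] {X : Scheme.{u}} (f : B →+* Γ(X, ⊤))
  (hf : (HomogeneousIdeal.irrelevant 𝒜).toIdeal.map f = ⊤)

/-- The pullback of `num / t ^ N` is `f num / f t ^ N`, since the morphism is induced by the
localization `χ` of `f`. The denominator is cleared so that no inverse of `f t` has to be named. -/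
theorem toBasicOpenOfGlobalSections_appTop {t : B} {d : ℕ} (h0d : 0 < d) (hd : t ∈ 𝒜 d)
    (N : ℕ) (num : B) (hnum : num ∈ 𝒜 (N • d)) :
    (awayToSection 𝒜 t ≫ (basicOpen 𝒜 t).topIso.inv ≫
      (toBasicOpenOfGlobalSections 𝒜 f rfl h0d hd).appTop ≫
        (X.basicOpen (f t)).topIso.hom).hom (HomogeneousLocalization.Away.mk 𝒜 hd N num hnum) *
      X.presheaf.map (homOfLE le_top).op (f t) ^ N = X.presheaf.map (homOfLE le_top).op (f num) := by
  have h1 : awayToSection 𝒜 t ≫ (basicOpen 𝒜 t).topIso.inv =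
      (Scheme.ΓSpecIso _).inv ≫ (basicOpenToSpec 𝒜 t).appTop := by
    rw [Iso.eq_inv_comp]; exact (basicOpenToSpec_app_top 𝒜 t).symm
  let χ : HomogeneousLocalization.Away 𝒜 t →+* Localization.Away (f t) :=
    (IsLocalization.map (M := .powers t) (T := .powers (f t)) _ f (by
      rw [← Submonoid.map_le_iff_le_comap, Submonoid.map_powers])).comp
        (algebraMap _ (Localization.Away t))
  let θ : (X.basicOpen (f t)).toScheme ⟶ Spec (CommRingCat.of (Localization.Away (f t))) :=
    (X.isoOfEq (X.toSpecΓ_preimage_basicOpen (f t))).inv ≫ X.toSpecΓ ∣_ _ ≫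
      (basicOpenIsoSpecAway _).hom
  have hθ : θ ≫ Spec.map (CommRingCat.ofHom (algebraMap _ _)) =
      (X.basicOpen (f t)).ι ≫ X.toSpecΓ := by
    simp only [θ, Category.assoc]
    rw [basicOpenIsoSpecAway, IsOpenImmersion.isoOfRangeEq_hom_fac]
    refine (congrArg _ (morphismRestrict_ι X.toSpecΓ (PrimeSpectrum.basicOpen (f t)))).trans ?_
    rw [← Category.assoc]
    congr 1
    exact Scheme.isoOfEq_inv_ι _ _
  have h2 : toBasicOpenOfGlobalSections 𝒜 f rfl h0d hd ≫ basicOpenToSpec 𝒜 t =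
      θ ≫ Spec.map (CommRingCat.ofHom χ) := by
    rw [← basicOpenIsoSpec_hom 𝒜 t hd h0d, ← Iso.eq_comp_inv]
    simp only [toBasicOpenOfGlobalSections, θ, Category.assoc]
  have h3 : awayToSection 𝒜 t ≫ (basicOpen 𝒜 t).topIso.inv ≫
      (toBasicOpenOfGlobalSections 𝒜 f rfl h0d hd).appTop ≫ (X.basicOpen (f t)).topIso.hom =
      CommRingCat.ofHom χ ≫ (Scheme.ΓSpecIso _).inv ≫ θ.appTop ≫
        (X.basicOpen (f t)).topIso.hom := by
    rw [reassoc_of% h1, ← Scheme.Hom.comp_appTop_assoc, h2, Scheme.Hom.comp_appTop_assoc]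
    rw [← Scheme.ΓSpecIso_inv_naturality_assoc]
  have h4 : ∀ z : Γ(X, ⊤), ((Scheme.ΓSpecIso _).inv ≫ θ.appTop ≫
      (X.basicOpen (f t)).topIso.hom).hom (algebraMap _ (Localization.Away (f t)) z) =
      X.presheaf.map (homOfLE le_top).op z := by
    intro z
    have : CommRingCat.ofHom (algebraMap _ (Localization.Away (f t))) ≫
        (Scheme.ΓSpecIso _).inv ≫ θ.appTop ≫ (X.basicOpen (f t)).topIso.hom =
        X.presheaf.map (homOfLE le_top).op := by
      rw [Scheme.ΓSpecIso_inv_naturality_assoc, ← Scheme.Hom.comp_appTop_assoc, hθ,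
        Scheme.Hom.comp_appTop_assoc, Scheme.toSpecΓ_appTop, Iso.inv_hom_id_assoc]
      rw [Scheme.Opens.ι_appTop, Scheme.Opens.topIso_hom]
      exact (X.presheaf.map_comp _ _).symm
    exact congrArg (fun g ↦ g.hom z) this
  rw [h3]
  rw [← h4, ← h4, CommRingCat.comp_apply, ← map_pow, ← map_mul]
  congr 1
  simp only [χ, CommRingCat.hom_ofHom, RingHom.comp_apply,
    HomogeneousLocalization.algebraMap_apply, HomogeneousLocalization.Away.val_mk,
    Localization.mk_eq_mk', IsLocalization.map_mk']
  rw [← map_pow, ← map_pow]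
  exact IsLocalization.mk'_spec _ _ _


theorem topIso_inv_resLE_topIso_hom {X Y : Scheme.{u}} (f : X ⟶ Y) (U : Y.Opens) (V : X.Opens)
    (e : V ≤ f ⁻¹ᵁ U) :
    U.topIso.inv ≫ (f.resLE U V e).appTop ≫ V.topIso.hom = f.appLE U V e := by
  have aux {P P' Q Q' : CommRingCat.{u}} {p : P ⟶ P'} {q : P' ⟶ P} {L : P ⟶ Q} {c : Q ⟶ Q'}
      {d : Q' ⟶ Q} (h : p ≫ q = 𝟙 P) (h' : c ≫ d = 𝟙 Q) : p ≫ (q ≫ L ≫ c) ≫ d = L := by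
    simp [reassoc_of% h, h']
  have h1 : (f.resLE U V e).appTop = U.topIso.hom ≫ f.appLE U V e ≫ V.topIso.inv := by
    rw [Scheme.Hom.appTop, Scheme.Hom.resLE_app_top]
  rw [h1]
  exact aux U.topIso.inv_hom_id V.topIso.inv_hom_id

theorem fromOfGlobalSections_appLE {t : B} {d : ℕ} (h0d : 0 < d) (hd : t ∈ 𝒜 d)
    (N : ℕ) (num : B) (hnum : num ∈ 𝒜 (N • d)) (V : X.Opens)
    (hV : V ≤ fromOfGlobalSections 𝒜 f hf ⁻¹ᵁ basicOpen 𝒜 t) :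
    ((fromOfGlobalSections 𝒜 f hf).appLE (basicOpen 𝒜 t) V hV).hom
      ((awayToSection 𝒜 t).hom (HomogeneousLocalization.Away.mk 𝒜 hd N num hnum)) *
      (X.presheaf.map (homOfLE le_top).op (f t)) ^ N =
      X.presheaf.map (homOfLE le_top).op (f num) := by
  have key : ((fromOfGlobalSections 𝒜 f hf).appLE (basicOpen 𝒜 t) (X.basicOpen (f t))
      (fromOfGlobalSections_preimage_basicOpen 𝒜 f hf h0d hd).ge).hom
      ((awayToSection 𝒜 t).hom (HomogeneousLocalization.Away.mk 𝒜 hd N num hnum)) *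
      X.presheaf.map (homOfLE le_top).op (f t) ^ N =
      X.presheaf.map (homOfLE le_top).op (f num) := by
    rw [← toBasicOpenOfGlobalSections_appTop 𝒜 f h0d hd N num hnum,
      ← fromOfGlobalSections_resLE 𝒜 f hf h0d hd, ← CommRingCat.comp_apply]
    congr 3
    exact congrArg (awayToSection 𝒜 t ≫ ·) (topIso_inv_resLE_topIso_hom _ _ _ _).symm
  have hVb : V ≤ X.basicOpen (f t) :=
    hV.trans (fromOfGlobalSections_preimage_basicOpen 𝒜 f hf h0d hd).le
  have := congrArg (X.presheaf.map (homOfLE hVb).op) key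
  rw [map_mul, map_pow] at this
  simp only [← CommRingCat.comp_apply, ← Functor.map_comp, Scheme.Hom.appLE_map] at this
  exact this

end Proj

section ProjectiveLine

variable {A : Type u} [CommRing A]

theorem X_mem (A : Type u) [CommRing A] (i : Fin 2) :
    (MvPolynomial.X i : MvPolynomial (Fin 2) A) ∈ coordGrading A 1 :=
  MvPolynomial.isHomogeneous_X A i

/-- The open subscheme where the `i`-th homogeneous coordinate does not vanish. -/
def chartOpen (A : Type u) [CommRing A] (i : Fin 2) : (P1 A).Opens :=
  Proj.basicOpen (coordGrading A) (MvPolynomial.X i)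

/-- The function `X j / X i`. -/
def ratio (A : Type u) [CommRing A] (i j : Fin 2) : Γ(P1 A, chartOpen A i) :=
  (Proj.awayToSection (coordGrading A) (MvPolynomial.X i)).hom
    (HomogeneousLocalization.Away.mk (coordGrading A) (X_mem A i) 1
      (MvPolynomial.X j) (X_mem A j))

theorem map_irrelevant_eq_top {S : Scheme.{u}} (st : S ⟶ Spec (CommRingCat.of A))
    (c : Fin 2 → Γ(S, ⊤)) (i : Fin 2) (hi : c i = 1) :
    (HomogeneousIdeal.irrelevant (coordGrading A)).toIdeal.map
      (MvPolynomial.eval₂Hom (sectionsMap st) c) = ⊤ := by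
  rw [Ideal.eq_top_iff_one]
  have h : (MvPolynomial.X i : MvPolynomial (Fin 2) A) ∈
      (HomogeneousIdeal.irrelevant (coordGrading A)).toIdeal :=
    HomogeneousIdeal.mem_irrelevant_of_mem (coordGrading A) Nat.one_pos
      (X_mem A i)
  simpa [hi] using Ideal.mem_map_of_mem (MvPolynomial.eval₂Hom (sectionsMap st) c) h

/-- The morphism to the projective line with homogeneous coordinates `c`, one of which is `1`. -/
def homogP1 {S : Scheme.{u}} (st : S ⟶ Spec (CommRingCat.of A)) (c : Fin 2 → Γ(S, ⊤)) (i : Fin 2)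
    (hi : c i = 1) : S ⟶ P1 A :=
  Proj.fromOfGlobalSections (coordGrading A) (MvPolynomial.eval₂Hom (sectionsMap st) c)
    (map_irrelevant_eq_top st c i hi)

theorem toP1_eq {S : Scheme.{u}} (st : S ⟶ Spec (CommRingCat.of A)) (s : Γ(S, ⊤)) :
    toP1 st s = homogP1 st ![s, 1] 1 rfl := rfl

section
variable {S : Scheme.{u}} (st : S ⟶ Spec (CommRingCat.of A)) (c : Fin 2 → Γ(S, ⊤)) (i : Fin 2)
    (hi : c i = 1)

theorem homogP1_preimage (j : Fin 2) :
    homogP1 st c i hi ⁻¹ᵁ chartOpen A j = S.basicOpen (c j) := by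
  have := Proj.fromOfGlobalSections_preimage_basicOpen (coordGrading A)
    (MvPolynomial.eval₂Hom (sectionsMap st) c) (map_irrelevant_eq_top st c i hi)
    Nat.one_pos (X_mem A j)
  exact this.trans (congrArg S.basicOpen (MvPolynomial.eval₂_X _ _ _))

theorem homogP1_preimage_self : ⊤ ≤ homogP1 st c i hi ⁻¹ᵁ chartOpen A i := by
  rw [homogP1_preimage, hi, Scheme.basicOpen_of_isUnit _ isUnit_one]

theorem homogP1_ratio (j : Fin 2) :
    ((homogP1 st c i hi).appLE (chartOpen A i) ⊤ (homogP1_preimage_self st c i hi)).hom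
      (ratio A i j) = c j := by
  have h := fromOfGlobalSections_appLE (coordGrading A)
    (MvPolynomial.eval₂Hom (sectionsMap st) c) (map_irrelevant_eq_top st c i hi)
    Nat.one_pos (X_mem A i) 1 (MvPolynomial.X j)
    (X_mem A j) ⊤ (homogP1_preimage_self st c i hi)
  have e : ∀ l, MvPolynomial.eval₂Hom (sectionsMap st) c (MvPolynomial.X l) = c l :=
    fun l ↦ MvPolynomial.eval₂_X _ _ _
  rw [e, e, hi, map_one, one_pow, mul_one] at h
  refine h.trans ?_
  have : (homOfLE (le_top : (⊤ : S.Opens) ≤ ⊤)).op = 𝟙 _ := rfl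
  rw [this, S.presheaf.map_id]
  rfl

theorem homogP1_toBase : homogP1 st c i hi ≫ P1.toBase A = st := by
  rw [P1.toBase, homogP1, Proj.fromOfGlobalSections_toSpecZero_assoc, ← Spec.map_comp,
    ← CommRingCat.ofHom_comp]
  have : ((MvPolynomial.eval₂Hom (sectionsMap st) c).comp
      (algebraMap (coordGrading A 0) (MvPolynomial (Fin 2) A))).comp
        (algebraMap A (coordGrading A 0)) = sectionsMap st := by
    ext r
    exact MvPolynomial.eval₂_C _ _ _
  rw [this, sectionsMap]
  change S.toSpecΓ ≫ Spec.map ((Scheme.ΓSpecIso (CommRingCat.of A)).inv ≫ st.appTop) = st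
  rw [Spec.map_comp, ← Scheme.toSpecΓ_naturality_assoc, toSpecΓ_SpecMap_ΓSpecIso_inv, Category.comp_id]

end

end ProjectiveLine

end

/-! ### Functions on the charts of the projective line -/

section General

theorem resLE_top_comp {T P : Scheme.{u}} (g : T ⟶ P) {U : P.Opens} (e : ⊤ ≤ g ⁻¹ᵁ U)
    {R : CommRingCat.{u}} (α : R ⟶ Γ(P, U)) :
    (⊤ : T.Opens).ι ≫ T.toSpecΓ ≫ Spec.map (α ≫ g.appLE U ⊤ e) =
      g.resLE U ⊤ e ≫ U.toSpecΓ ≫ Spec.map α := by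
  rw [Spec.map_comp, ← Scheme.Opens.toSpecΓ_SpecMap_appLE_assoc, Scheme.Opens.toSpecΓ_top,
    Category.assoc]

theorem eq_toSpecΓ_appLE_fromSpec {T P : Scheme.{u}} (g : T ⟶ P) {U : P.Opens}
    (hU : IsAffineOpen U) (e : ⊤ ≤ g ⁻¹ᵁ U) :
    g = T.toSpecΓ ≫ Spec.map (g.appLE U ⊤ e) ≫ hU.fromSpec := by
  have h := resLE_top_comp g e (𝟙 _)
  rw [Category.id_comp, Spec.map_id, Category.comp_id] at h
  rw [← cancel_epi T.topIso.hom, Scheme.topIso_hom, reassoc_of% h, hU.toSpecΓ_fromSpec, Scheme.Hom.resLE_comp_ι]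

theorem comp_eq_toSpecΓ_of_ι_comp_eq {T P : Scheme.{u}} (g : T ⟶ P) {U : P.Opens}
    (e : ⊤ ≤ g ⁻¹ᵁ U) {R : CommRingCat.{u}} (α : R ⟶ Γ(P, U)) (b : P ⟶ Spec R)
    (hb : U.ι ≫ b = U.toSpecΓ ≫ Spec.map α) :
    g ≫ b = T.toSpecΓ ≫ Spec.map (α ≫ g.appLE U ⊤ e) := by
  rw [← cancel_epi T.topIso.hom, Scheme.topIso_hom, resLE_top_comp, ← hb, Scheme.Hom.resLE_comp_ι_assoc]

variable {A : Type u} [CommRing A]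

theorem sectionsMap_toSpecΓ {T : Scheme.{u}} (α : CommRingCat.of A ⟶ Γ(T, ⊤)) :
    sectionsMap (T.toSpecΓ ≫ Spec.map α) = α.hom := by
  rw [sectionsMap]
  congr 1
  rw [Scheme.Hom.comp_appTop, ← Scheme.ΓSpecIso_inv_naturality_assoc, Scheme.toSpecΓ_appTop,
    Iso.inv_hom_id, Category.comp_id]

theorem eq_toSpecΓ_sectionsMap {T : Scheme.{u}} (st : T ⟶ Spec (CommRingCat.of A)) :
    st = T.toSpecΓ ≫ Spec.map (CommRingCat.ofHom (sectionsMap st)) := by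
  change st = T.toSpecΓ ≫ Spec.map ((Scheme.ΓSpecIso (CommRingCat.of A)).inv ≫ st.appTop)
  rw [Spec.map_comp, ← Scheme.toSpecΓ_naturality_assoc, toSpecΓ_SpecMap_ΓSpecIso_inv,
    Category.comp_id]

theorem sectionsMap_comp {S T : Scheme.{u}} (f : S ⟶ T) (st : T ⟶ Spec (CommRingCat.of A)) :
    sectionsMap (f ≫ st) = f.appTop.hom.comp (sectionsMap st) := rfl

theorem sectionsMap_SpecMap {R : Type u} [CommRing R] (α : A →+* R) :
    sectionsMap (Spec.map (CommRingCat.ofHom α)) =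
      (Scheme.ΓSpecIso (CommRingCat.of R)).inv.hom.comp α := by
  rw [sectionsMap, ← Scheme.ΓSpecIso_inv_naturality]; rfl

end General

section Chart

variable {A : Type u} [CommRing A]

/-- The constants on a chart of the projective line. -/
def chartConst (A : Type u) [CommRing A] (i : Fin 2) :
    CommRingCat.of A ⟶ Γ(P1 A, chartOpen A i) :=
  CommRingCat.ofHom ((HomogeneousLocalization.fromZeroRingHom (coordGrading A) _).comp
    (algebraMap A (coordGrading A 0))) ≫
      Proj.awayToSection (coordGrading A) (MvPolynomial.X i)

theorem chartOpen_ι_toBase (i : Fin 2) : (chartOpen A i).ι ≫ P1.toBase A =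
    (chartOpen A i).toSpecΓ ≫ Spec.map (chartConst A i) := by
  have h : ((Proj.basicOpenIsoSpec (coordGrading A) (MvPolynomial.X i)
      (X_mem A i) Nat.one_pos).inv ≫ (Proj.basicOpen _ _).ι) ≫ _ = _ :=
    Proj.awayι_toSpecZero (coordGrading A) (MvPolynomial.X i)
      (X_mem A i) Nat.one_pos
  rw [Category.assoc, Iso.inv_comp_eq,
    Proj.basicOpenIsoSpec_hom, Proj.basicOpenToSpec] at h
  rw [P1.toBase]
  refine (congrArg (· ≫ Spec.map (CommRingCat.ofHom (algebraMap A (coordGrading A 0)))) h).trans ?_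
  simp only [Category.assoc, ← Spec.map_comp]
  rfl

theorem isAffineOpen_chartOpen (i : Fin 2) : IsAffineOpen (chartOpen A i) :=
  Proj.isAffineOpen_basicOpen (coordGrading A) (MvPolynomial.X i)
    (X_mem A i) Nat.one_pos

theorem appLE_chartConst {T : Scheme.{u}} (g : T ⟶ P1 A) (i : Fin 2)
    (e : ⊤ ≤ g ⁻¹ᵁ chartOpen A i) :
    (g.appLE _ ⊤ e).hom.comp (chartConst A i).hom = sectionsMap (g ≫ P1.toBase A) := by
  rw [comp_eq_toSpecΓ_of_ι_comp_eq g e _ _ (chartOpen_ι_toBase i), sectionsMap_toSpecΓ]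
  rfl

/-- Every monomial of a form of degree `n` has exponents with sum `n`, so division by the `n`-th
power of `X i` distributes one denominator to each variable. Consequently the functions on a chart
are polynomials in the ratios, and a morphism to a chart is known from the pullbacks of the ratios.
-/
theorem awayToSection_mk (i : Fin 2) (n : ℕ) (p : MvPolynomial (Fin 2) A)
    (hp : p ∈ coordGrading A (n • 1)) :
    (Proj.awayToSection (coordGrading A) (MvPolynomial.X i)).hom
      (HomogeneousLocalization.Away.mk (coordGrading A) (X_mem A i) n p hp) =
    MvPolynomial.eval₂ (chartConst A i).hom (ratio A i) p := by
  let γ : A →+* HomogeneousLocalization.Away (coordGrading A) (MvPolynomial.X i) :=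
    (HomogeneousLocalization.fromZeroRingHom (coordGrading A) _).comp
      (algebraMap A (coordGrading A 0))
  let c : Fin 2 → HomogeneousLocalization.Away (coordGrading A) (MvPolynomial.X i) := fun j ↦
    HomogeneousLocalization.Away.mk (coordGrading A) (X_mem A i) 1
      (MvPolynomial.X j) (X_mem A j)
  have h : HomogeneousLocalization.Away.mk (coordGrading A) (X_mem A i)
      n p hp = MvPolynomial.eval₂ γ c p := by
    apply HomogeneousLocalization.val_injective
    let L := Localization.Away (MvPolynomial.X i : MvPolynomial (Fin 2) A)
    let val : HomogeneousLocalization.Away (coordGrading A) (MvPolynomial.X i) →+* L :=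
      algebraMap _ _
    have hval : ∀ w, val w = w.val := fun w ↦ HomogeneousLocalization.algebraMap_apply w
    rw [HomogeneousLocalization.Away.val_mk, ← hval, MvPolynomial.eval₂, Finsupp.sum, map_sum]
    let t : L := algebraMap (MvPolynomial (Fin 2) A) L (MvPolynomial.X i)
    have ht : IsUnit t := IsLocalization.Away.algebraMap_isUnit _
    have hc : ∀ j, val (c j) * t = algebraMap (MvPolynomial (Fin 2) A) L (MvPolynomial.X j) := by
      intro j
      rw [hval, HomogeneousLocalization.Away.val_mk, Localization.mk_eq_mk']
      have := IsLocalization.mk'_spec L (MvPolynomial.X j : MvPolynomial (Fin 2) A)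
        (⟨MvPolynomial.X i ^ 1, 1, rfl⟩ : Submonoid.powers (MvPolynomial.X i))
      refine Eq.trans ?_ this
      exact congrArg (_ * ·) (congrArg (algebraMap (MvPolynomial (Fin 2) A) L) (pow_one _).symm)
    have hγ : ∀ r, val (γ r) = algebraMap (MvPolynomial (Fin 2) A) L (MvPolynomial.C r) := fun r ↦ by
      rw [hval]
      exact Localization.mk_one_eq_algebraMap _
    have hm : IsUnit (t ^ n) := ht.pow n
    rw [← hm.mul_left_inj, Localization.mk_eq_mk']
    have h1 := IsLocalization.mk'_spec L p
        (⟨MvPolynomial.X i ^ n, n, rfl⟩ : Submonoid.powers (MvPolynomial.X i))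
    rw [map_pow] at h1
    refine h1.trans ?_
    conv_lhs => rw [p.as_sum]
    rw [map_sum, Finset.sum_mul]
    refine Finset.sum_congr rfl fun m hm' ↦ ?_
    have hd : m 0 + m 1 = n := by
      have := hp (MvPolynomial.mem_support_iff.mp hm')
      simpa [Finsupp.weight_apply, Finsupp.sum_fintype] using this
    rw [MvPolynomial.monomial_eq, Finsupp.prod_fintype _ _ (by simp),
      Finsupp.prod_fintype _ _ (by simp)]
    simp only [Fin.prod_univ_two, map_mul, map_pow]
    rw [hγ, ← hc, ← hc, ← hd]
    change _ = algebraMap (MvPolynomial (Fin 2) A) L (MvPolynomial.C (MvPolynomial.coeff m p)) * _ * _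
    ring
  rw [h]
  change _ = MvPolynomial.eval₂ ((Proj.awayToSection (coordGrading A) (MvPolynomial.X i)).hom.comp γ)
    ((Proj.awayToSection (coordGrading A) (MvPolynomial.X i)).hom ∘ c) p
  exact MvPolynomial.eval₂_comp_left _ _ _ _

theorem exists_eq_eval₂ (i : Fin 2) (z : Γ(P1 A, chartOpen A i)) :
    ∃ p, z = MvPolynomial.eval₂ (chartConst A i).hom (ratio A i) p := by
  let e := Proj.basicOpenIsoAway (coordGrading A) (MvPolynomial.X i)
    (X_mem A i) Nat.one_pos
  obtain ⟨n, p, hp, hz⟩ := HomogeneousLocalization.Away.mk_surjective (coordGrading A)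
    (X_mem A i) (e.inv.hom z)
  refine ⟨p, ?_⟩
  rw [← awayToSection_mk i n p hp, hz]
  exact (ConcreteCategory.congr_hom e.inv_hom_id z).symm

/-- A morphism to a chart of the projective line is determined by the pulled back coordinates. -/
theorem hom_ext_chart {T : Scheme.{u}} {g g' : T ⟶ P1 A} (i : Fin 2)
    (e : ⊤ ≤ g ⁻¹ᵁ chartOpen A i) (e' : ⊤ ≤ g' ⁻¹ᵁ chartOpen A i)
    (hb : g ≫ P1.toBase A = g' ≫ P1.toBase A)
    (hr : ∀ j, (g.appLE _ ⊤ e).hom (ratio A i j) = (g'.appLE _ ⊤ e').hom (ratio A i j)) :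
    g = g' := by
  rw [eq_toSpecΓ_appLE_fromSpec g (isAffineOpen_chartOpen i) e,
    eq_toSpecΓ_appLE_fromSpec g' (isAffineOpen_chartOpen i) e']
  congr 3
  ext z
  obtain ⟨p, rfl⟩ := exists_eq_eval₂ i z
  rw [MvPolynomial.eval₂_comp_left, MvPolynomial.eval₂_comp_left, appLE_chartConst,
    appLE_chartConst, hb]
  congr 1
  ext j
  exact hr j

end Chart

/-! ### Gluing morphisms, and a criterion for open immersions -/

section Gluing

/-- Morphisms that exist locally and are unique can be glued. -/
theorem exists_glue {T X : Scheme.{u}} (Q : ∀ {O : Scheme.{u}}, (O ⟶ T) → (O ⟶ X) → Prop)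
    (restr : ∀ {O' O : Scheme.{u}} (k : O' ⟶ O) [IsOpenImmersion k] (i : O ⟶ T) (f : O ⟶ X),
      Q i f → Q (k ≫ i) (k ≫ f))
    (uniq : ∀ {O : Scheme.{u}} (i : O ⟶ T) [IsOpenImmersion i] (f f' : O ⟶ X),
      Q i f → Q i f' → f = f')
    (ex : ∀ t : T, ∃ (O : Scheme.{u}) (i : O ⟶ T) (_ : IsOpenImmersion i) (f : O ⟶ X),
      t ∈ Set.range i ∧ Q i f) :
    ∃ f : T ⟶ X, ∀ {O : Scheme.{u}} (i : O ⟶ T) [IsOpenImmersion i] (f' : O ⟶ X),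
      Q i f' → i ≫ f = f' := by
  choose O i hi f ht hQ using ex
  let 𝒰 : T.OpenCover := {
    I₀ := T, X := O, f := i,
    mem₀ := by
      rw [Scheme.presieve₀_mem_precoverage_iff]
      exact ⟨fun t ↦ ⟨t, ht t⟩, inferInstance⟩ }
  have hcomp : ∀ t t', pullback.fst (𝒰.f t) (𝒰.f t') ≫ f t = pullback.snd _ _ ≫ f t' := by
    intro t t'
    have : IsOpenImmersion (𝒰.f t) := hi t
    have : IsOpenImmersion (𝒰.f t') := hi t'
    refine uniq (pullback.fst (𝒰.f t) (𝒰.f t') ≫ 𝒰.f t) _ _ (restr _ _ _ (hQ t)) ?_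
    rw [pullback.condition]
    exact restr _ _ _ (hQ t')
  refine ⟨𝒰.glueMorphisms f hcomp, fun {O'} i' _ f' hf' ↦ ?_⟩
  refine Scheme.Cover.hom_ext (𝒰.pullback₁ i') _ _ fun t ↦ ?_
  have : IsOpenImmersion (𝒰.f t) := hi t
  change pullback.fst i' (𝒰.f t) ≫ _ = pullback.fst i' (𝒰.f t) ≫ _
  rw [pullback.condition_assoc]
  refine (congrArg (pullback.snd i' (𝒰.f t) ≫ ·)
    (Scheme.Cover.ι_glueMorphisms 𝒰 f hcomp t)).trans ?_
  refine uniq (pullback.snd i' (𝒰.f t) ≫ 𝒰.f t) _ _ (restr _ _ _ (hQ t)) ?_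
  rw [← pullback.condition]
  exact restr _ _ _ hf'

theorem isOpenImmersion_of_locally {S X : Scheme.{u}} (g : S ⟶ X)
    (H : ∀ s : S, ∃ U : S.Opens, s ∈ U ∧ IsOpenImmersion (U.ι ≫ g))
    (inj : Function.Injective g) : IsOpenImmersion g := by
  have hopen : IsOpenMap g := by
    rw [isOpenMap_iff_nhds_le]
    intro s
    obtain ⟨U, hs, hU⟩ := H s
    have h := (U.ι ≫ g).isOpenEmbedding.isOpenMap.nhds_le ⟨s, hs⟩
    have h2 : nhds s = Filter.map U.ι (nhds (⟨s, hs⟩ : U)) :=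
      (U.ι.isOpenEmbedding.map_nhds_eq (⟨s, hs⟩ : U)).symm
    rw [h2, Filter.map_map]
    exact h
  have hstalk : ∀ s, IsIso (g.stalkMap s) := by
    intro s
    obtain ⟨U, hs, hU⟩ := H s
    obtain ⟨u, rfl⟩ : ∃ u : U.toScheme, U.ι u = s := ⟨⟨s, hs⟩, rfl⟩
    have h1 : IsIso ((U.ι ≫ g).stalkMap u) := inferInstance
    rw [Scheme.Hom.stalkMap_comp] at h1
    have h2 : IsIso (U.ι.stalkMap u) := inferInstance
    exact @IsIso.of_isIso_comp_right _ _ _ _ _ (g.stalkMap (U.ι u)) (U.ι.stalkMap u) h2 h1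
  exact IsOpenImmersion.of_isIso_stalkMap g
    (.of_continuous_injective_isOpenMap g.continuous inj hopen)

/-- A morphism that has local inverses on the target is an open immersion. -/
theorem isOpenImmersion_of_local_inverse {S X : Scheme.{u}} (g : S ⟶ X)
    (H : ∀ s : S, ∃ V : X.Opens, g s ∈ V ∧ ∃ r : V.toScheme ⟶ S, r ≫ g = V.ι ∧
      ∀ k : (g ⁻¹ᵁ V).toScheme ⟶ S, k ≫ g = (g ⁻¹ᵁ V).ι ≫ g → k = (g ⁻¹ᵁ V).ι) :
    IsOpenImmersion g := by
  have key : ∀ s : S, ∃ V : X.Opens, g s ∈ V ∧ IsIso (g ∣_ V) := by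
    intro s
    obtain ⟨V, hs, r, hr, hk⟩ := H s
    refine ⟨V, hs, ?_⟩
    have hran : Set.range r ⊆ Set.range (g ⁻¹ᵁ V).ι := by
      rintro _ ⟨v, rfl⟩
      rw [Scheme.Opens.range_ι]
      change g (r v) ∈ V
      rw [← Scheme.Hom.comp_apply, hr]
      exact v.2
    -- The assumption on `k` is used for `g ∣_ V` followed by `r`: it makes `r` a two-sided inverse
    -- without requiring `g` to be a monomorphism.
    refine ⟨IsOpenImmersion.lift (g ⁻¹ᵁ V).ι r hran, ?_, ?_⟩
    · rw [← cancel_mono (g ⁻¹ᵁ V).ι, Category.assoc, IsOpenImmersion.lift_fac, Category.id_comp]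
      apply hk
      rw [Category.assoc, hr, morphismRestrict_ι]
    · rw [← cancel_mono V.ι, Category.assoc, morphismRestrict_ι, IsOpenImmersion.lift_fac_assoc,
        hr, Category.id_comp]
  refine isOpenImmersion_of_locally g (fun s ↦ ?_) fun s s' h ↦ ?_
  · obtain ⟨V, hs, hV⟩ := key s
    refine ⟨g ⁻¹ᵁ V, hs, ?_⟩
    rw [← morphismRestrict_ι]
    infer_instance
  · obtain ⟨V, hs, hV⟩ := key s
    obtain ⟨u, rfl⟩ : ∃ u : (g ⁻¹ᵁ V).toScheme, (g ⁻¹ᵁ V).ι u = s := ⟨⟨s, hs⟩, rfl⟩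
    obtain ⟨u', rfl⟩ : ∃ u : (g ⁻¹ᵁ V).toScheme, (g ⁻¹ᵁ V).ι u = s' :=
      ⟨⟨s', by change g s' ∈ V; rw [← h]; exact hs⟩, rfl⟩
    rw [← Scheme.Hom.comp_apply, ← Scheme.Hom.comp_apply, ← morphismRestrict_ι] at h
    rw [(g ∣_ V ≫ V.ι).isOpenEmbedding.injective h]

end Gluing

/-! ### Calculus of homogeneous coordinates -/

section Homog

variable {A : Type u} [CommRing A] {S : Scheme.{u}}

theorem homogP1_ratio_mul (st : S ⟶ Spec (CommRingCat.of A)) (c : Fin 2 → Γ(S, ⊤)) (i : Fin 2)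
    (hi : c i = 1) (l j : Fin 2) (V : S.Opens) (e : V ≤ homogP1 st c i hi ⁻¹ᵁ chartOpen A l) :
    ((homogP1 st c i hi).appLE (chartOpen A l) V e).hom (ratio A l j) *
      S.presheaf.map (homOfLE le_top).op (c l) = S.presheaf.map (homOfLE le_top).op (c j) := by
  have h := fromOfGlobalSections_appLE (coordGrading A)
    (MvPolynomial.eval₂Hom (sectionsMap st) c) (map_irrelevant_eq_top st c i hi)
    Nat.one_pos (X_mem A l) 1 (MvPolynomial.X j) (X_mem A j) V e
  have e : ∀ l, MvPolynomial.eval₂Hom (sectionsMap st) c (MvPolynomial.X l) = c l :=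
    fun l ↦ MvPolynomial.eval₂_X _ _ _
  rw [e, e, pow_one] at h
  exact h

theorem homogP1_monomialSection (st : S ⟶ Spec (CommRingCat.of A)) (c : Fin 2 → Γ(S, ⊤)) (i : Fin 2)
    (hi : c i = 1) (x : A) (a b : ℕ) (V : S.Opens)
    (e : V ≤ homogP1 st c i hi ⁻¹ᵁ opY A) :
    ((homogP1 st c i hi).appLE (opY A) V e).hom (monomialSection x a b) *
      S.presheaf.map (homOfLE le_top).op (c 0) ^ b =
      S.presheaf.map (homOfLE le_top).op (sectionsMap st x ^ a * c 1 ^ b) := by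
  have h := fromOfGlobalSections_appLE (coordGrading A)
    (MvPolynomial.eval₂Hom (sectionsMap st) c) (map_irrelevant_eq_top st c i hi)
    Nat.one_pos (X_mem A 0) b (MvPolynomial.C (x ^ a) * MvPolynomial.X 1 ^ b) (by
        have h := (MvPolynomial.isHomogeneous_C (Fin 2) (x ^ a)).mul
          ((MvPolynomial.isHomogeneous_X A (1 : Fin 2)).pow b)
        simpa using h) V e
  have e : ∀ l, MvPolynomial.eval₂Hom (sectionsMap st) c (MvPolynomial.X l) = c l :=
    fun l ↦ MvPolynomial.eval₂_X _ _ _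
  have e' : MvPolynomial.eval₂Hom (sectionsMap st) c (MvPolynomial.C (x ^ a)) =
    sectionsMap st x ^ a := (MvPolynomial.eval₂_C _ _ _).trans (map_pow _ _ _)
  have e2 : MvPolynomial.eval₂Hom (sectionsMap st) c
      (MvPolynomial.C (x ^ a) * MvPolynomial.X 1 ^ b) = sectionsMap st x ^ a * c 1 ^ b := by
    rw [map_mul, map_pow _ (MvPolynomial.X 1), e, e']
  rw [e, e2] at h
  exact h

theorem presheaf_map_top (c : Γ(S, ⊤)) :
    S.presheaf.map (homOfLE (le_top : (⊤ : S.Opens) ≤ ⊤)).op c = c := by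
  have : (homOfLE (le_top : (⊤ : S.Opens) ≤ ⊤)).op = 𝟙 _ := rfl
  rw [this, S.presheaf.map_id]
  rfl

theorem homogP1_congr {st st' : S ⟶ Spec (CommRingCat.of A)} {c c' : Fin 2 → Γ(S, ⊤)} {i : Fin 2}
    (hi : c i = 1) (hst : st = st') (hc : c = c') :
    homogP1 st c i hi = homogP1 st' c' i (hc ▸ hi) := by
  subst hst hc; rfl

theorem appLE_congr_hom {X Y : Scheme.{u}} {f f' : X ⟶ Y} (h : f = f') {U : Y.Opens} {V : X.Opens}
    (e : V ≤ f ⁻¹ᵁ U) (e' : V ≤ f' ⁻¹ᵁ U) (z : Γ(Y, U)) :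
    (f.appLE U V e).hom z = (f'.appLE U V e').hom z := by
  subst h; rfl

theorem homogP1_cross_of_eq {st : S ⟶ Spec (CommRingCat.of A)} {c c' : Fin 2 → Γ(S, ⊤)}
    {i i' : Fin 2} {hi : c i = 1} {hi' : c' i' = 1}
    (h : homogP1 st c i hi = homogP1 st c' i' hi') (j : Fin 2) : c j * c' i = c' j := by
  have e := homogP1_preimage_self st c i hi
  have e' : ⊤ ≤ homogP1 st c' i' hi' ⁻¹ᵁ chartOpen A i := h ▸ e
  have h2 := homogP1_ratio_mul st c' i' hi' i j ⊤ e'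
  rw [presheaf_map_top, presheaf_map_top, ← appLE_congr_hom h e e', homogP1_ratio] at h2
  exact h2

theorem homogP1_eq_of_cross {st : S ⟶ Spec (CommRingCat.of A)} {c c' : Fin 2 → Γ(S, ⊤)}
    {i i' : Fin 2} {hi : c i = 1} {hi' : c' i' = 1} (h : ∀ j l, c j * c' l = c l * c' j) :
    homogP1 st c i hi = homogP1 st c' i' hi' := by
  have hu : IsUnit (c i') := IsUnit.of_mul_eq_one (c' i) (by rw [h, hi, hi', one_mul])
  have e : ⊤ ≤ homogP1 st c i hi ⁻¹ᵁ chartOpen A i' := by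
    rw [homogP1_preimage, Scheme.basicOpen_of_isUnit _ hu]
  refine hom_ext_chart i' e (homogP1_preimage_self _ _ _ _) ?_ fun j ↦ ?_
  · rw [homogP1_toBase, homogP1_toBase]
  · rw [homogP1_ratio]
    have h3 := homogP1_ratio_mul st c i hi i' j ⊤ e
    rw [presheaf_map_top, presheaf_map_top] at h3
    rw [← hu.mul_left_inj, h3, ← mul_one (c j), ← hi', h, mul_comm]

/-- Each vector has an entry equal to `1`, so the vanishing of the single minor already makes the
vectors proportional by a unit. -/
theorem homogP1_eq_iff {st : S ⟶ Spec (CommRingCat.of A)} {c c' : Fin 2 → Γ(S, ⊤)} {i i' : Fin 2}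
    {hi : c i = 1} {hi' : c' i' = 1} :
    homogP1 st c i hi = homogP1 st c' i' hi' ↔ c 0 * c' 1 = c 1 * c' 0 := by
  constructor
  · intro h
    have h0 := homogP1_cross_of_eq h 0
    have h1 := homogP1_cross_of_eq h 1
    rw [← h0, ← h1]
    ring
  · intro h
    refine homogP1_eq_of_cross fun j l ↦ ?_
    fin_cases j <;> fin_cases l
    exacts [rfl, h, h.symm, rfl]

theorem comp_homogP1 {T : Scheme.{u}} (f : T ⟶ S) (st : S ⟶ Spec (CommRingCat.of A))
    (c : Fin 2 → Γ(S, ⊤)) (i : Fin 2) (hi : c i = 1) :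
    f ≫ homogP1 st c i hi =
      homogP1 (f ≫ st) (fun j ↦ f.appTop.hom (c j)) i (by rw [hi, map_one]) := by
  have e : ⊤ ≤ (f ≫ homogP1 st c i hi) ⁻¹ᵁ chartOpen A i := by
    have := homogP1_preimage_self st c i hi
    intro t _
    exact this (x := f t) trivial
  refine hom_ext_chart i e (homogP1_preimage_self _ _ _ _) ?_ fun j ↦ ?_
  · rw [Category.assoc, homogP1_toBase, homogP1_toBase]
  · rw [homogP1_ratio, ← homogP1_ratio st c i hi j,
      ← Scheme.Hom.appLE_comp_appLE f (homogP1 st c i hi) _ ⊤ ⊤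
        (homogP1_preimage_self st c i hi) le_rfl,
      show f.appLE ⊤ ⊤ le_rfl = f.appTop from Scheme.Hom.appLE_eq_app f]
    rfl

/-- The coordinates of a morphism to a chart of the projective line. -/
theorem eq_homogP1 (g : S ⟶ P1 A) (i : Fin 2) (e : ⊤ ≤ g ⁻¹ᵁ chartOpen A i) :
    ∃ (c : Fin 2 → Γ(S, ⊤)) (hi : c i = 1), g = homogP1 (g ≫ P1.toBase A) c i hi := by
  have h1 : ratio A i i = 1 := by
    have : HomogeneousLocalization.Away.mk (coordGrading A) (X_mem A i) 1
        (MvPolynomial.X i) (X_mem A i) = 1 := by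
      apply HomogeneousLocalization.val_injective
      rw [HomogeneousLocalization.Away.val_mk, HomogeneousLocalization.val_one]
      simp only [pow_one]
      exact Localization.mk_self (⟨MvPolynomial.X i, 1, pow_one _⟩ :
        Submonoid.powers (MvPolynomial.X i : MvPolynomial (Fin 2) A))
    rw [ratio]
    exact (congrArg _ this).trans (map_one _)
  refine ⟨fun j ↦ (g.appLE _ ⊤ e).hom (ratio A i j), (congrArg _ h1).trans (map_one _), ?_⟩
  refine hom_ext_chart i e (homogP1_preimage_self _ _ _ _) ?_ fun j ↦ ?_
  · rw [homogP1_toBase]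
  · rw [homogP1_ratio]

theorem exists_mem_chartOpen (t : P1 A) : ∃ i, t ∈ chartOpen A i := by
  have h : ⨆ i, chartOpen A i = ⊤ := by
    refine Proj.iSup_basicOpen_eq_top' (coordGrading A) (fun i : Fin 2 ↦ MvPolynomial.X i)
      (fun i ↦ ⟨1, X_mem A i⟩) ?_
    rw [eq_top_iff]
    intro p _
    induction p using MvPolynomial.induction_on with
    | C r =>
      exact (Algebra.adjoin (coordGrading A 0) (Set.range _)).algebraMap_mem
        (⟨MvPolynomial.C r, MvPolynomial.isHomogeneous_C _ _⟩ : coordGrading A 0)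
    | add p q hp hq => exact add_mem (hp trivial) (hq trivial)
    | mul_X p i hp => exact mul_mem (hp trivial) (Algebra.subset_adjoin ⟨i, rfl⟩)
  have : t ∈ ⨆ i, chartOpen A i := h ▸ trivial
  simpa using this

end Homog

/-! ### Points with affine source, the standard charts, and base change of the projective line -/

section Pt

variable {A : Type u} [CommRing A] {R S : Type u} [CommRing R] [CommRing S]

/-- The morphism `Spec R ⟶ ℙ¹` with homogeneous coordinates `c` over the base change `α`. -/
def pt (α : A →+* R) (c : Fin 2 → R) (i : Fin 2) (hi : c i = 1) :
    Spec (CommRingCat.of R) ⟶ P1 A :=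
  homogP1 (Spec.map (CommRingCat.ofHom α))
    (fun j ↦ (Scheme.ΓSpecIso (CommRingCat.of R)).inv.hom (c j)) i (by rw [hi, map_one])

theorem cons_one_apply_one (y : R) : (![y, 1] : Fin 2 → R) 1 = 1 := rfl

theorem one_cons_apply_zero (z : R) : (![1, z] : Fin 2 → R) 0 = 1 := rfl

/-- The morphism `[y : 1]`. -/
abbrev ptZ (α : A →+* R) (y : R) : Spec (CommRingCat.of R) ⟶ P1 A := pt α ![y, 1] 1 (cons_one_apply_one y)

/-- The morphism `[1 : z]`. -/
abbrev ptY (α : A →+* R) (z : R) : Spec (CommRingCat.of R) ⟶ P1 A := pt α ![1, z] 0 (one_cons_apply_zero z)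

theorem ΓSpecIso_inv_injective :
    Function.Injective (Scheme.ΓSpecIso (CommRingCat.of R)).inv.hom :=
  (ConcreteCategory.bijective_of_isIso (Scheme.ΓSpecIso (CommRingCat.of R)).inv).1

theorem pt_toBase (α : A →+* R) (c : Fin 2 → R) (i : Fin 2) (hi : c i = 1) :
    pt α c i hi ≫ P1.toBase A = Spec.map (CommRingCat.ofHom α) := homogP1_toBase _ _ _ _

theorem SpecMap_ofHom_injective {α β : A →+* R}
    (h : Spec.map (CommRingCat.ofHom α) = Spec.map (CommRingCat.ofHom β)) : α = β := by
  have := Spec.map_injective h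
  exact congrArg CommRingCat.Hom.hom this

theorem pt_eq_iff {α : A →+* R} {c c' : Fin 2 → R} {i i' : Fin 2} {hi : c i = 1}
    {hi' : c' i' = 1} : pt α c i hi = pt α c' i' hi' ↔ c 0 * c' 1 = c 1 * c' 0 := by
  rw [pt, pt, homogP1_eq_iff, ← map_mul, ← map_mul, ΓSpecIso_inv_injective.eq_iff]

theorem pt_eq_pt_iff {α β : A →+* R} {c c' : Fin 2 → R} {i i' : Fin 2} {hi : c i = 1}
    {hi' : c' i' = 1} :
    pt α c i hi = pt β c' i' hi' ↔ α = β ∧ c 0 * c' 1 = c 1 * c' 0 := by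
  constructor
  · intro h
    obtain rfl : α = β := SpecMap_ofHom_injective (by rw [← pt_toBase α c i hi, h, pt_toBase])
    exact ⟨rfl, pt_eq_iff.mp h⟩
  · rintro ⟨rfl, h⟩
    exact pt_eq_iff.mpr h

theorem SpecMap_pt (f : R →+* S) (α : A →+* R) (c : Fin 2 → R) (i : Fin 2) (hi : c i = 1) :
    Spec.map (CommRingCat.ofHom f) ≫ pt α c i hi =
      pt (f.comp α) (fun j ↦ f (c j)) i (by rw [hi, map_one]) := by
  rw [pt, comp_homogP1, pt]
  refine homogP1_congr _ ?_ ?_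
  · rw [← Spec.map_comp]; rfl
  · ext j
    have := Scheme.ΓSpecIso_inv_naturality (CommRingCat.ofHom f)
    exact (ConcreteCategory.congr_hom this (c j)).symm

theorem SpecMap_ptZ (f : R →+* S) (α : A →+* R) (y : R) :
    Spec.map (CommRingCat.ofHom f) ≫ ptZ α y = ptZ (f.comp α) (f y) := by
  rw [SpecMap_pt, pt_eq_iff]; simp

theorem SpecMap_ptY (f : R →+* S) (α : A →+* R) (y : R) :
    Spec.map (CommRingCat.ofHom f) ≫ ptY α y = ptY (f.comp α) (f y) := by
  rw [SpecMap_pt, pt_eq_iff]; simp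

theorem ptZ_eq_ptZ_iff {α β : A →+* R} {y y' : R} : ptZ α y = ptZ β y' ↔ α = β ∧ y = y' := by
  rw [pt_eq_pt_iff]; simp

theorem ptZ_eq_ptY_iff {α β : A →+* R} {y z : R} : ptZ α y = ptY β z ↔ α = β ∧ y * z = 1 := by
  rw [pt_eq_pt_iff]; simp

theorem pt_preimage (α : A →+* R) (c : Fin 2 → R) (i : Fin 2) (hi : c i = 1) (j : Fin 2) :
    pt α c i hi ⁻¹ᵁ chartOpen A j = PrimeSpectrum.basicOpen (c j) := by
  rw [pt, homogP1_preimage, basicOpen_eq_of_affine']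
  congr 1
  exact (ConcreteCategory.congr_hom (Scheme.ΓSpecIso (CommRingCat.of R)).inv_hom_id (c j))

theorem pt_mem_chartOpen (α : A →+* R) (c : Fin 2 → R) (i : Fin 2) (hi : c i = 1) (j : Fin 2)
    (p : PrimeSpectrum R) : pt α c i hi p ∈ chartOpen A j ↔ c j ∉ p.asIdeal := by
  have h : p ∈ (pt α c i hi ⁻¹ᵁ chartOpen A j) ↔ _ :=
    (pt_preimage α c i hi j ▸ Iff.rfl : _ ↔ p ∈ PrimeSpectrum.basicOpen (c j))
  exact h

theorem exists_ringHom {g : Spec (CommRingCat.of R) ⟶ Spec (CommRingCat.of A)} :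
    ∃ α : A →+* R, g = Spec.map (CommRingCat.ofHom α) :=
  ⟨(Spec.preimage g).hom, (Spec.map_preimage g).symm⟩

theorem eq_pt (g : Spec (CommRingCat.of R) ⟶ P1 A) (i : Fin 2) (e : ⊤ ≤ g ⁻¹ᵁ chartOpen A i) :
    ∃ (α : A →+* R) (c : Fin 2 → R) (hi : c i = 1), g = pt α c i hi := by
  obtain ⟨c, hi, hg⟩ := eq_homogP1 g i e
  obtain ⟨α, hα⟩ := exists_ringHom (g := g ≫ P1.toBase A)
  refine ⟨α, fun j ↦ (Scheme.ΓSpecIso (CommRingCat.of R)).hom.hom (c j),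
    (congrArg _ hi).trans (map_one _), ?_⟩
  conv_lhs => rw [hg]
  rw [pt]
  refine homogP1_congr _ hα ?_
  ext j
  exact (ConcreteCategory.congr_hom (Scheme.ΓSpecIso (CommRingCat.of R)).hom_inv_id (c j)).symm

theorem eq_ptZ (g : Spec (CommRingCat.of R) ⟶ P1 A) (e : ⊤ ≤ g ⁻¹ᵁ chartOpen A 1) :
    ∃ (α : A →+* R) (y : R), g = ptZ α y := by
  obtain ⟨α, c, hi, hg⟩ := eq_pt g 1 e
  exact ⟨α, c 0, by rw [hg, pt_eq_iff]; simp [hi]⟩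

theorem eq_ptY (g : Spec (CommRingCat.of R) ⟶ P1 A) (e : ⊤ ≤ g ⁻¹ᵁ chartOpen A 0) :
    ∃ (α : A →+* R) (z : R), g = ptY α z := by
  obtain ⟨α, c, hi, hg⟩ := eq_pt g 0 e
  exact ⟨α, c 1, by rw [hg, pt_eq_iff]; simp [hi]⟩

/-- A morphism from the spectrum of a local ring lands in one of the charts. -/
theorem eq_ptZ_or_ptY [IsLocalRing R] (g : Spec (CommRingCat.of R) ⟶ P1 A) :
    (∃ (α : A →+* R) (y : R), g = ptZ α y) ∨ ∃ (α : A →+* R) (z : R), g = ptY α z := by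
  obtain ⟨i, hi⟩ := exists_mem_chartOpen (g (IsLocalRing.closedPoint R))
  have e : ⊤ ≤ g ⁻¹ᵁ chartOpen A i := by
    have : IsLocalRing.closedPoint R ∈ g ⁻¹ᵁ chartOpen A i := hi
    exact ((IsLocalRing.closed_point_mem_iff (U := g ⁻¹ᵁ chartOpen A i)).mp this).ge
  have h2 : ∀ i : Fin 2, i = 0 ∨ i = 1 := by decide
  obtain rfl | rfl := h2 i
  · exact .inr (eq_ptY g e)
  · exact .inl (eq_ptZ g e)

/-- The morphism to an affine scheme that corresponds to a ring homomorphism. -/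
def toSpec {T : Scheme.{u}} (β : R →+* Γ(T, ⊤)) : T ⟶ Spec (CommRingCat.of R) :=
  T.toSpecΓ ≫ Spec.map (CommRingCat.ofHom β)

theorem sectionsMap_toSpec {T : Scheme.{u}} (β : R →+* Γ(T, ⊤)) : sectionsMap (toSpec β) = β :=
  sectionsMap_toSpecΓ _

theorem toSpec_sectionsMap {T : Scheme.{u}} (f : T ⟶ Spec (CommRingCat.of R)) :
    toSpec (sectionsMap f) = f := (eq_toSpecΓ_sectionsMap f).symm

theorem hom_ext_Spec {T : Scheme.{u}} {f g : T ⟶ Spec (CommRingCat.of R)}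
    (h : sectionsMap f = sectionsMap g) : f = g := by
  rw [← toSpec_sectionsMap f, ← toSpec_sectionsMap g, h]

theorem sectionsMap_comp_SpecMap {T : Scheme.{u}} (f : T ⟶ Spec (CommRingCat.of S))
    (α : R →+* S) :
    sectionsMap (f ≫ Spec.map (CommRingCat.ofHom α)) = (sectionsMap f).comp α := by
  rw [sectionsMap_comp, sectionsMap_SpecMap]
  rfl

theorem comp_pt {T : Scheme.{u}} (f : T ⟶ Spec (CommRingCat.of R)) (α : A →+* R) (c : Fin 2 → R)
    (i : Fin 2) (hi : c i = 1) :
    f ≫ pt α c i hi = homogP1 (f ≫ Spec.map (CommRingCat.ofHom α))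
      (fun j ↦ sectionsMap f (c j)) i (by rw [hi, map_one]) := comp_homogP1 _ _ _ _ _

theorem comp_pt_cross {T : Scheme.{u}} {f f' : T ⟶ Spec (CommRingCat.of R)} {α : A →+* R}
    {c : Fin 2 → R} {i : Fin 2} {hi : c i = 1} (h : f ≫ pt α c i hi = f' ≫ pt α c i hi) :
    (sectionsMap f).comp α = (sectionsMap f').comp α ∧
      ∀ j, sectionsMap f (c j) = sectionsMap f' (c j) := by
  have hb := congrArg (· ≫ P1.toBase A) h
  simp only [Category.assoc, pt_toBase] at hb
  refine ⟨by rw [← sectionsMap_comp_SpecMap, ← sectionsMap_comp_SpecMap, hb], fun j ↦ ?_⟩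
  rw [comp_pt, comp_pt] at h
  rw [homogP1_congr (hst := hb) (hc := rfl)] at h
  · have h2 := homogP1_cross_of_eq h j
    rwa [hi, map_one, mul_one] at h2

theorem exists_comp_pt_eq {T : Scheme.{u}} (g : T ⟶ P1 A) (i l : Fin 2)
    (hil : ∀ j, j = i ∨ j = l) (c : Fin 2 → Polynomial A) (hi : c i = 1)
    (hl : c l = Polynomial.X) (hg : ⊤ ≤ g ⁻¹ᵁ chartOpen A i) :
    ∃ r : T ⟶ Spec (CommRingCat.of (Polynomial A)), r ≫ pt Polynomial.C c i hi = g := by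
  obtain ⟨c', hi', hV⟩ := eq_homogP1 g i hg
  refine ⟨toSpec (Polynomial.eval₂RingHom (sectionsMap (g ≫ P1.toBase A)) (c' l)), ?_⟩
  rw [comp_pt]
  conv_rhs => rw [hV]
  refine homogP1_congr _ ?_ ?_
  · apply hom_ext_Spec
    rw [sectionsMap_comp_SpecMap, sectionsMap_toSpec]
    ext a
    exact Polynomial.eval₂_C _ _
  · ext j
    rw [sectionsMap_toSpec]
    obtain rfl | rfl := hil j
    · rw [hi, map_one, hi']
    · rw [hl]; exact Polynomial.eval₂_X _ _

/-- The standard charts of the projective line. -/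
theorem isOpenImmersion_pt (i l : Fin 2) (hil : ∀ j, j = i ∨ j = l) (c : Fin 2 → Polynomial A)
    (hi : c i = 1) (hl : c l = Polynomial.X) :
    IsOpenImmersion (pt Polynomial.C c i hi) ∧
      ∀ t, t ∈ Set.range (pt Polynomial.C c i hi) ↔ t ∈ chartOpen A i := by
  have hg : ∀ s, pt Polynomial.C c i hi s ∈ chartOpen A i := fun s ↦ by
    refine (pt_mem_chartOpen _ c i hi i s).mpr ?_
    rw [hi]
    exact s.asIdeal.ne_top_iff_one.mp s.2.ne_top
  obtain ⟨r, hr⟩ := exists_comp_pt_eq (chartOpen A i).ι i l hil c hi hl (fun v _ ↦ v.2)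
  refine ⟨isOpenImmersion_of_local_inverse _ fun s ↦ ⟨chartOpen A i, hg s, r, hr, fun k hk ↦ ?_⟩,
    fun t ↦ ⟨?_, fun ht ↦ ?_⟩⟩
  · obtain ⟨h1, h2⟩ := comp_pt_cross hk
    apply hom_ext_Spec
    refine Polynomial.ringHom_ext (fun a ↦ congrArg (fun f ↦ f a) h1) ?_
    have := h2 l
    rwa [hl] at this
  · rintro ⟨s, rfl⟩; exact hg s
  · obtain ⟨v, rfl⟩ : ∃ v : (chartOpen A i).toScheme, (chartOpen A i).ι v = t := ⟨⟨t, ht⟩, rfl⟩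
    rw [← hr, Scheme.Hom.comp_apply]
    exact ⟨_, rfl⟩

/-- The morphism keeps the coordinates and composes the structure morphism with `Spec φ`. It is
characterized on all morphisms that have global coordinates, not just on the charts. Off such
morphisms nothing is lost, because every morphism to the projective line has coordinates locally. -/
theorem exists_baseChange (φ : A →+* A) : ∃ Φ : P1 A ⟶ P1 A,
    ∀ {T : Scheme.{u}} (st : T ⟶ Spec (CommRingCat.of A)) (c : Fin 2 → Γ(T, ⊤)) (i : Fin 2)
      (hi : c i = 1), homogP1 st c i hi ≫ Φ =
        homogP1 (st ≫ Spec.map (CommRingCat.ofHom φ)) c i hi := by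
  -- Quantifying over all `k : T ⟶ O` makes the condition stable under restriction, as gluing
  -- requires.
  let Q : ∀ {O : Scheme.{u}}, (O ⟶ P1 A) → (O ⟶ P1 A) → Prop := fun {O} i f ↦
    ∀ {T : Scheme.{u}} (k : T ⟶ O) (st : T ⟶ Spec (CommRingCat.of A)) (c : Fin 2 → Γ(T, ⊤))
      (j : Fin 2) (hj : c j = 1), k ≫ i = homogP1 st c j hj →
        k ≫ f = homogP1 (st ≫ Spec.map (CommRingCat.ofHom φ)) c j hj
  have ex : ∀ i, ∃ f, Q (chartOpen A i).ι f := by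
    intro i
    obtain ⟨c', hi', hV⟩ := eq_homogP1 (chartOpen A i).ι i (fun v _ ↦ v.2)
    refine ⟨homogP1 (((chartOpen A i).ι ≫ P1.toBase A) ≫ Spec.map (CommRingCat.ofHom φ)) c' i hi',
      fun {T} k st c j hj hk ↦ ?_⟩
    have hst : k ≫ (chartOpen A i).ι ≫ P1.toBase A = st := by
      rw [← Category.assoc, hk, homogP1_toBase]
    rw [hV, comp_homogP1, homogP1_congr (hst := hst) (hc := rfl), homogP1_eq_iff] at hk
    rw [comp_homogP1, homogP1_congr (hst := (Category.assoc _ _ _).symm.trans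
      (congrArg (· ≫ Spec.map (CommRingCat.ofHom φ)) hst)) (hc := rfl), homogP1_eq_iff]
    exact hk
  obtain ⟨Φ, hΦ⟩ := exists_glue Q (by
      intro O' O k _ i f h T k' st c j hj hk
      rw [← Category.assoc]
      exact h (k' ≫ k) st c j hj (by rw [Category.assoc, hk]))
    (by
      intro O i _ f f' h h'
      refine Scheme.hom_ext_of_forall _ _ fun o ↦ ?_
      obtain ⟨j, hj⟩ := exists_mem_chartOpen (i o)
      refine ⟨i ⁻¹ᵁ chartOpen A j, hj, ?_⟩
      obtain ⟨c, hc, hg⟩ := eq_homogP1 ((i ⁻¹ᵁ chartOpen A j).ι ≫ i) j (fun v _ ↦ v.2)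
      rw [h _ _ c j hc hg, h' _ _ c j hc hg])
    (fun t ↦ by
      obtain ⟨j, hj⟩ := exists_mem_chartOpen t
      obtain ⟨f, hf⟩ := ex j
      exact ⟨_, (chartOpen A j).ι, inferInstance, f, ⟨⟨t, hj⟩, rfl⟩, hf⟩)
  refine ⟨Φ, fun {T} st c i hi ↦ ?_⟩
  obtain ⟨f, hf⟩ := ex i
  have hran : Set.range (homogP1 st c i hi) ⊆ Set.range (chartOpen A i).ι := by
    rw [Scheme.Opens.range_ι]
    rintro _ ⟨t, rfl⟩
    exact homogP1_preimage_self st c i hi (x := t) trivial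
  have hk := IsOpenImmersion.lift_fac (chartOpen A i).ι (homogP1 st c i hi) hran
  conv_lhs => rw [← hk]
  rw [Category.assoc, hΦ _ f hf]
  exact hf _ st c i hi hk

/-- The morphism `ℙ¹ ⟶ ℙ¹` over `Spec φ`. -/
def baseChange (φ : A →+* A) : P1 A ⟶ P1 A := (exists_baseChange φ).choose

theorem homogP1_baseChange (φ : A →+* A) {T : Scheme.{u}} (st : T ⟶ Spec (CommRingCat.of A))
    (c : Fin 2 → Γ(T, ⊤)) (i : Fin 2) (hi : c i = 1) : homogP1 st c i hi ≫ baseChange φ =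
        homogP1 (st ≫ Spec.map (CommRingCat.ofHom φ)) c i hi :=
  (exists_baseChange φ).choose_spec st c i hi

theorem pt_baseChange (φ : A →+* A) (α : A →+* R) (c : Fin 2 → R) (i : Fin 2) (hi : c i = 1) :
    pt α c i hi ≫ baseChange φ = pt (α.comp φ) c i hi := by
  rw [pt, homogP1_baseChange, pt]
  exact homogP1_congr _ (by rw [← Spec.map_comp]; rfl) rfl

theorem baseChange_toBase (φ : A →+* A) :
    baseChange φ ≫ P1.toBase A = P1.toBase A ≫ Spec.map (CommRingCat.ofHom φ) := by
  refine Scheme.hom_ext_of_forall _ _ fun t ↦ ?_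
  obtain ⟨j, hj⟩ := exists_mem_chartOpen t
  refine ⟨chartOpen A j, hj, ?_⟩
  obtain ⟨c, hc, hg⟩ := eq_homogP1 (chartOpen A j).ι j (fun v _ ↦ v.2)
  rw [hg, ← Category.assoc, ← Category.assoc, homogP1_baseChange, homogP1_toBase, homogP1_toBase]

instance : Scheme.IsSeparated (P1 A) := inferInstanceAs (Proj (coordGrading A)).IsSeparated

instance : IsSeparated (P1.toBase A) := inferInstance

end Pt

/-! ### The rings `A[u, v] / (u ^ p v ^ q = x)` -/

section Toric

/-- `R` is the `A`-algebra generated by `u` and `v` subject to the relation `u ^ p * v ^ q = x`. -/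
structure IsToric {A R : Type u} [CommRing A] [CommRing R] (α : A →+* R) (x : A) (u v : R)
    (p q : ℕ) : Prop where
  rel : α x = u ^ p * v ^ q
  existsUnique_lift : ∀ {S : Type u} [CommRing S] (γ : A →+* S) (u' v' : S),
    γ x = u' ^ p * v' ^ q → ∃! g : R →+* S, g.comp α = γ ∧ g u = u' ∧ g v = v'

variable {A R : Type u} [CommRing A] [CommRing R] {α : A →+* R} {x : A} {u v : R} {p q : ℕ}

theorem IsToric.swap (h : IsToric α x u v p q) : IsToric α x v u q p where
  rel := by rw [h.rel, mul_comm]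
  existsUnique_lift γ u' v' hr := by
    obtain ⟨g, ⟨h1, h2, h3⟩, hu⟩ := h.existsUnique_lift γ v' u' (by rw [hr, mul_comm])
    exact ⟨g, ⟨h1, h3, h2⟩, fun g' ⟨h1', h2', h3'⟩ ↦ hu g' ⟨h1', h3', h2'⟩⟩

theorem IsToric.hom_ext (h : IsToric α x u v p q) {S : Type u} [CommRing S] {g g' : R →+* S}
    (hα : g.comp α = g'.comp α) (hu : g u = g' u) (hv : g v = g' v) : g = g' :=
  (h.existsUnique_lift (g'.comp α) (g' u) (g' v) (by
    rw [RingHom.comp_apply, h.rel, map_mul, map_pow, map_pow])).unique ⟨hα, hu, hv⟩ ⟨rfl, rfl, rfl⟩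

theorem IsToric.exists_lift (h : IsToric α x u v p q) {S : Type u} [CommRing S] (γ : A →+* S)
    (u' v' : S) (hr : γ x = u' ^ p * v' ^ q) :
    ∃ g : R →+* S, g.comp α = γ ∧ g u = u' ∧ g v = v' :=
  (h.existsUnique_lift γ u' v' hr).exists

theorem IsToric.exists_ringEquiv (h : IsToric α x u v p q) {R' : Type u} [CommRing R']
    {α' : A →+* R'} {u' v' : R'} (h' : IsToric α' x u' v' p q) :
    ∃ e : R ≃+* R', (e : R →+* R').comp α = α' ∧ e u = u' ∧ e v = v' := by
  obtain ⟨f, hf, hfu, hfv⟩ := h.exists_lift α' u' v' h'.rel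
  obtain ⟨g, hg, hgu, hgv⟩ := h'.exists_lift α u v h.rel
  refine ⟨RingEquiv.ofRingHom f g (h'.hom_ext ?_ ?_ ?_) (h.hom_ext ?_ ?_ ?_), hf, hfu, hfv⟩
  · rw [RingHom.comp_assoc, hg, hf]; rfl
  · simp [hgu, hfu]
  · simp [hgv, hfv]
  · rw [RingHom.comp_assoc, hf, hg]; rfl
  · simp [hgu, hfu]
  · simp [hgv, hfv]

/-- A model of the `A`-algebra generated by `u` and `v` subject to `u ^ p * v ^ q = x`. -/
abbrev ToricRing (x : A) (p q : ℕ) : Type u :=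
  AdjoinRoot (Polynomial.C (Polynomial.X ^ q) * Polynomial.X ^ p -
    Polynomial.C (Polynomial.C x) : Polynomial (Polynomial A))

theorem isToric_toricRing (x : A) (p q : ℕ) :
    IsToric (R := ToricRing x p q) ((AdjoinRoot.of _).comp Polynomial.C) x (AdjoinRoot.root _)
      (AdjoinRoot.of _ Polynomial.X) p q where
  rel := by
    have h := AdjoinRoot.eval₂_root (Polynomial.C (Polynomial.X ^ q) * Polynomial.X ^ p -
      Polynomial.C (Polynomial.C x) : Polynomial (Polynomial A))
    rw [Polynomial.eval₂_sub, Polynomial.eval₂_mul, Polynomial.eval₂_C, Polynomial.eval₂_C,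
      Polynomial.eval₂_pow, Polynomial.eval₂_X, sub_eq_zero] at h
    rw [RingHom.comp_apply, ← h, mul_comm]
    exact congrArg (_ * ·) (map_pow _ _ _)
  existsUnique_lift {S} _ γ u' v' hr := by
    refine ⟨AdjoinRoot.lift (Polynomial.eval₂RingHom γ v') u' ?_, ⟨?_, ?_, ?_⟩, ?_⟩
    · rw [Polynomial.eval₂_sub, Polynomial.eval₂_mul, Polynomial.eval₂_C, Polynomial.eval₂_C,
        Polynomial.eval₂_pow, Polynomial.eval₂_X, map_pow]
      simp [hr, mul_comm]
    · ext a; simp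
    · simp
    · simp
    · rintro g ⟨h1, h2, h3⟩
      apply AdjoinRoot.ringHom_ext
      · refine Polynomial.ringHom_ext (fun a ↦ ?_) ?_
        · simpa using congrArg (fun f ↦ f a) h1
        · simpa using h3
      · simpa using h2

theorem IsToric.closure_eq_top (h : IsToric α x u v p q) :
    Subring.closure (Set.range α ∪ {u, v}) = ⊤ := by
  set S := Subring.closure (Set.range α ∪ {u, v})
  have hα : ∀ a, α a ∈ S := fun a ↦ Subring.subset_closure (.inl ⟨a, rfl⟩)
  have hu : u ∈ S := Subring.subset_closure (.inr (by simp))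
  have hv : v ∈ S := Subring.subset_closure (.inr (by simp))
  obtain ⟨g, h1, h2, h3⟩ := h.exists_lift (α.codRestrict S hα) ⟨u, hu⟩ ⟨v, hv⟩
    (Subtype.ext h.rel)
  have hid : S.subtype.comp g = RingHom.id R := by
    refine h.hom_ext ?_ ?_ ?_
    · rw [RingHom.comp_assoc, h1]; rfl
    · simp [h2]
    · simp [h3]
  rw [eq_top_iff]
  intro r _
  have := congrArg (fun f ↦ f r) hid
  rw [← show S.subtype (g r) = r from this]
  exact (g r).2

theorem IsToric.exists_eq_add (h : IsToric α x u v p q) (r : R) :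
    ∃ (P : Polynomial A) (r' : R), r = Polynomial.eval₂ α v P + u * r' := by
  have hr : r ∈ Subring.closure (Set.range α ∪ {u, v}) := h.closure_eq_top ▸ trivial
  induction hr using Subring.closure_induction with
  | mem r hr =>
    obtain ⟨a, rfl⟩ | rfl | rfl := hr
    · exact ⟨Polynomial.C a, 0, by simp⟩
    · exact ⟨0, 1, by simp⟩
    · exact ⟨Polynomial.X, 0, by simp⟩
  | zero => exact ⟨0, 0, by simp⟩
  | one => exact ⟨1, 0, by simp⟩
  | add r s _ _ hr hs =>
    obtain ⟨P, r', rfl⟩ := hr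
    obtain ⟨Q, s', rfl⟩ := hs
    exact ⟨P + Q, r' + s', by rw [Polynomial.eval₂_add]; ring⟩
  | neg r _ hr =>
    obtain ⟨P, r', rfl⟩ := hr
    exact ⟨-P, -r', by rw [Polynomial.eval₂_neg]; ring⟩
  | mul r s _ _ hr hs =>
    obtain ⟨P, r', rfl⟩ := hr
    obtain ⟨Q, s', rfl⟩ := hs
    exact ⟨P * Q, Polynomial.eval₂ α v P * s' + Polynomial.eval₂ α v Q * r' + u * r' * s', by
      rw [Polynomial.eval₂_mul]; ring⟩

theorem IsToric.exists_eq_add_add (h : IsToric α x u v p q) (r : R) :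
    ∃ (a : A) (r' s' : R), r = α a + u * r' + v * s' := by
  obtain ⟨P, r', rfl⟩ := h.exists_eq_add r
  refine ⟨P.coeff 0, r', Polynomial.eval₂ α v P.divX, ?_⟩
  conv_lhs => rw [← P.divX_mul_X_add]
  rw [Polynomial.eval₂_add, Polynomial.eval₂_mul, Polynomial.eval₂_X, Polynomial.eval₂_C]
  ring

variable [IsDomain A] [IsDiscreteValuationRing A]

/-- Eisenstein's criterion for the prime `(x)` of `A[v]`, with `u` as the variable: the leading
coefficient `v ^ q` is not divisible by `x`, and the constant term `-x` is divisible exactly once.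
The polynomial is primitive because a common divisor of `v ^ q` and `x` is a constant dividing `1`.
-/
theorem irreducible_toric (hx : Irreducible x) (hp : p ≠ 0) :
    Irreducible (Polynomial.C (Polynomial.X ^ q) * Polynomial.X ^ p -
      Polynomial.C (Polynomial.C x) : Polynomial (Polynomial A)) := by
  set f := (Polynomial.C (Polynomial.X ^ q) * Polynomial.X ^ p -
      Polynomial.C (Polynomial.C x) : Polynomial (Polynomial A)) with hf
  have hcoeff : ∀ n, f.coeff n = (if n = p then Polynomial.X ^ q else 0) -
      (if n = 0 then Polynomial.C x else 0) := fun n ↦ by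
    rw [hf, Polynomial.coeff_sub, Polynomial.coeff_C_mul_X_pow, Polynomial.coeff_C]
  have hXq : (Polynomial.X ^ q : Polynomial A) ≠ 0 := pow_ne_zero _ Polynomial.X_ne_zero
  have hdeg : f.natDegree = p := by
    rw [hf, Polynomial.natDegree_sub_C, Polynomial.natDegree_C_mul_X_pow _ _ hXq]
  have hlead : f.leadingCoeff = Polynomial.X ^ q := by
    rw [Polynomial.leadingCoeff, hdeg, hcoeff, if_pos rfl, if_neg hp, sub_zero]
  have hxp : Prime (Polynomial.C x : Polynomial A) := Polynomial.prime_C_iff.mpr hx.prime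
  have hP : (Ideal.span {(Polynomial.C x : Polynomial A)}).IsPrime :=
    (Ideal.span_singleton_prime hxp.ne_zero).mpr hxp
  have hnd : ¬ Polynomial.C x ∣ (Polynomial.X ^ q : Polynomial A) := fun h ↦ by
    have := Polynomial.C_dvd_iff_dvd_coeff _ _ |>.mp h q
    rw [Polynomial.coeff_X_pow_self] at this
    exact hx.not_isUnit (isUnit_of_dvd_one this)
  refine Polynomial.irreducible_of_eisenstein_criterion (f := f) hP ?_ ?_ ?_ ?_ ?_
  · rw [hlead, Ideal.mem_span_singleton]; exact hnd
  · intro n hn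
    have hn' : n < p := by
      have := Polynomial.natDegree_lt_natDegree_iff (p := f) (q := f)
      rw [Polynomial.degree_eq_natDegree (fun h ↦ by
        rw [h, Polynomial.leadingCoeff_zero] at hlead; exact hXq hlead.symm), hdeg] at hn
      exact_mod_cast hn
    rw [hcoeff, if_neg hn'.ne, zero_sub, Ideal.neg_mem_iff, Ideal.mem_span_singleton]
    split_ifs
    · exact dvd_rfl
    · exact dvd_zero _
  · rw [← Polynomial.natDegree_pos_iff_degree_pos, hdeg]; exact Nat.pos_of_ne_zero hp
  · rw [hcoeff, if_neg (Ne.symm hp), if_pos rfl, zero_sub, Ideal.neg_mem_iff,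
      Ideal.span_singleton_pow, Ideal.mem_span_singleton]
    intro h
    obtain ⟨c, hc⟩ := h
    have h1 : Polynomial.C x * 1 = Polynomial.C x * (Polynomial.C x * c) := by
      rw [mul_one, ← mul_assoc, ← sq]; exact hc
    exact hxp.not_isUnit (IsUnit.of_mul_eq_one _ (mul_left_cancel₀ hxp.ne_zero h1).symm)
  · intro r hr
    have hr' := Polynomial.C_dvd_iff_dvd_coeff _ _ |>.mp hr
    have h1 := hr' p
    have h2 := hr' 0
    rw [hcoeff, if_pos rfl, if_neg hp, sub_zero] at h1
    rw [hcoeff, if_neg (Ne.symm hp), if_pos rfl, zero_sub, dvd_neg] at h2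
    obtain ⟨c, hc⟩ := h2
    have hd := congrArg Polynomial.natDegree hc
    have hne : r * c ≠ 0 := hc ▸ hxp.ne_zero
    rw [Polynomial.natDegree_C, Polynomial.natDegree_mul (left_ne_zero_of_mul hne)
      (right_ne_zero_of_mul hne)] at hd
    rw [Polynomial.eq_C_of_natDegree_eq_zero (p := r) (by omega)] at h1 ⊢
    have := Polynomial.C_dvd_iff_dvd_coeff _ _ |>.mp h1 q
    rw [Polynomial.coeff_X_pow_self] at this
    exact (isUnit_of_dvd_one this).map Polynomial.C

theorem IsToric.isDomain (h : IsToric α x u v p q) (hx : Irreducible x) (hpq : p ≠ 0 ∨ q ≠ 0) :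
    IsDomain R := by
  wlog hp : p ≠ 0 generalizing u v p q
  · exact this h.swap hpq.symm (by tauto)
  have := Fact.mk (irreducible_toric (q := q) hx hp)
  have hd : IsDomain (ToricRing x p q) := AdjoinRoot.isDomain_of_prime
    (irreducible_toric (q := q) hx hp).prime
  obtain ⟨e, -⟩ := h.exists_ringEquiv (isToric_toricRing x p q)
  exact e.toMulEquiv.isDomain _

theorem IsToric.injective (h : IsToric α x u v p q) (hpq : p ≠ 0 ∨ q ≠ 0) :
    Function.Injective α := by
  wlog hp : p ≠ 0 generalizing u v p q
  · exact this h.swap hpq.symm (by tauto)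
  -- The embedding of `A` in `L` factors through `α`: send `u` to a `p`-th root of `x` and `v` to
  -- `1`.
  let L := AlgebraicClosure (FractionRing A)
  obtain ⟨z, hz⟩ := IsAlgClosed.exists_pow_nat_eq (algebraMap A L x) (Nat.pos_of_ne_zero hp)
  obtain ⟨g, hg, -⟩ := h.exists_lift (algebraMap A L) z 1 (by rw [hz, one_pow, mul_one])
  have hinj : Function.Injective (algebraMap A L) := by
    rw [IsScalarTower.algebraMap_eq A (FractionRing A) L]
    exact (algebraMap (FractionRing A) L).injective.comp (IsFractionRing.injective A _)
  rw [← hg] at hinj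
  exact Function.Injective.of_comp hinj

/-- Reduction of a toric ring along the divisor `u = 0`. -/
theorem IsToric.exists_residue (h : IsToric α x u v p q) (hx : Irreducible x) (hp : p ≠ 0) :
    ∃ g : R →+* Polynomial (IsLocalRing.ResidueField A),
      (∀ a, g (α a) = Polynomial.C (IsLocalRing.residue A a)) ∧ g u = 0 ∧ g v = Polynomial.X ∧
      ∀ r, g r = 0 ↔ u ∣ r := by
  have hm := hx.maximalIdeal_eq
  have hxm : IsLocalRing.residue A x = 0 := by
    rw [IsLocalRing.residue_eq_zero_iff, hm]; exact Ideal.mem_span_singleton_self x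
  obtain ⟨g, h1, h2, h3⟩ := h.exists_lift (S := Polynomial (IsLocalRing.ResidueField A))
    (Polynomial.C.comp (IsLocalRing.residue A)) 0 Polynomial.X (by simp [hxm, hp])
  have h1' : ∀ a, g (α a) = Polynomial.C (IsLocalRing.residue A a) :=
    fun a ↦ congrArg (fun f ↦ f a) h1
  refine ⟨g, h1', h2, h3, fun r ↦ ⟨fun hr ↦ ?_, ?_⟩⟩
  · obtain ⟨P, r', rfl⟩ := h.exists_eq_add r
    rw [map_add, map_mul, h2, zero_mul, add_zero, Polynomial.hom_eval₂, h1, h3] at hr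
    have hP : P.map (IsLocalRing.residue A) = 0 := by
      rw [← hr]; rfl
    have hC : Polynomial.C x ∣ P := by
      rw [Polynomial.C_dvd_iff_dvd_coeff]
      intro i
      have := congrArg (fun Q ↦ Polynomial.coeff Q i) hP
      simp only [Polynomial.coeff_map, Polynomial.coeff_zero] at this
      rw [IsLocalRing.residue_eq_zero_iff, hm, Ideal.mem_span_singleton] at this
      exact this
    obtain ⟨Q, rfl⟩ := hC
    rw [Polynomial.eval₂_mul, Polynomial.eval₂_C, h.rel]
    obtain ⟨n, rfl⟩ := Nat.exists_eq_succ_of_ne_zero hp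
    exact ⟨u ^ n * v ^ q * Polynomial.eval₂ α v Q + r', by rw [pow_succ]; ring⟩
  · rintro ⟨s, rfl⟩
    rw [map_mul, h2, zero_mul]

theorem IsToric.ne_zero (h : IsToric α x u v p q) (hx : Irreducible x) (hp : p ≠ 0) : u ≠ 0 := by
  rintro rfl
  have h1 := h.rel
  rw [zero_pow hp, zero_mul, map_eq_zero_iff _ (h.injective (.inl hp))] at h1
  exact hx.ne_zero h1

theorem IsToric.prime (h : IsToric α x u v p q) (hx : Irreducible x) (hp : p ≠ 0) : Prime u := by
  obtain ⟨g, h1, h2, h3, hg⟩ := h.exists_residue hx hp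
  refine ⟨h.ne_zero hx hp, fun hu ↦ ?_, fun a b hab ↦ ?_⟩
  · have := hu.map g
    rw [h2] at this
    exact not_isUnit_zero this
  · rw [← hg, map_mul, mul_eq_zero, hg, hg] at hab
    exact hab

theorem IsToric.not_dvd (h : IsToric α x u v p q) (hx : Irreducible x) (hp : p ≠ 0) : ¬ u ∣ v := by
  obtain ⟨g, h1, h2, h3, hg⟩ := h.exists_residue hx hp
  rw [← hg, h3]
  exact Polynomial.X_ne_zero

/-- Modulo `u` and `v` every element is a constant, and a nonunit constant is a multiple of `x`,
which is in `(u, v)` already. Thus `u = v = 0` is a single point whose ideal is `(u, v)`; this is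
the centre of a nodal blowup. -/
theorem IsToric.eq_span (h : IsToric α x u v p q) (hx : Irreducible x) (hpq : p ≠ 0 ∨ q ≠ 0)
    (P : Ideal R) (hP : P ≠ ⊤) (hu : u ∈ P) (hv : v ∈ P) : P = Ideal.span {u, v} := by
  refine le_antisymm (fun r hr ↦ ?_) (Ideal.span_le.mpr (by rintro _ (rfl | rfl) <;> assumption))
  obtain ⟨a, r', s', rfl⟩ := h.exists_eq_add_add r
  have hu' : u ∈ Ideal.span {u, v} := Ideal.subset_span (by simp)
  have hv' : v ∈ Ideal.span {u, v} := Ideal.subset_span (by simp)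
  refine add_mem (add_mem ?_ (Ideal.mul_mem_right _ _ hu')) (Ideal.mul_mem_right _ _ hv')
  have ha : α a ∈ P := by
    have := sub_mem (sub_mem hr (Ideal.mul_mem_right r' _ hu)) (Ideal.mul_mem_right s' _ hv)
    convert this using 1
    ring
  have hna : ¬ IsUnit a := fun h ↦ hP (Ideal.eq_top_of_isUnit_mem _ ha (h.map α))
  have : a ∈ IsLocalRing.maximalIdeal A := hna
  rw [hx.maximalIdeal_eq, Ideal.mem_span_singleton] at this
  obtain ⟨c, rfl⟩ := this
  rw [map_mul, h.rel]
  refine Ideal.mul_mem_right _ _ ?_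
  rcases hpq with hp | hq
  · exact Ideal.mul_mem_right _ _ (Ideal.pow_mem_of_mem _ hu' _ (Nat.pos_of_ne_zero hp))
  · exact Ideal.mul_mem_left _ _ (Ideal.pow_mem_of_mem _ hv' _ (Nat.pos_of_ne_zero hq))

end Toric

/-! ### Ideal sheaves with invertible inverse image -/

section Invertible

variable {X Y : Scheme.{u}}

theorem appLE_eq_sectionsMap {T : Scheme.{u}} {W : X.Opens} (hW : IsAffineOpen W)
    (m : T ⟶ Spec (CommRingCat.of Γ(X, W))) (e : ⊤ ≤ (m ≫ hW.fromSpec) ⁻¹ᵁ W) :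
    ((m ≫ hW.fromSpec).appLE W ⊤ e).hom = sectionsMap m := by
  have h := eq_toSpecΓ_appLE_fromSpec (m ≫ hW.fromSpec) hW e
  rw [← Category.assoc, cancel_mono] at h
  conv_rhs => rw [h]
  exact (sectionsMap_toSpecΓ _).symm

theorem fromSpec_preimage {T : Scheme.{u}} {W : X.Opens} (hW : IsAffineOpen W)
    (m : T ⟶ Spec (CommRingCat.of Γ(X, W))) : ⊤ ≤ (m ≫ hW.fromSpec) ⁻¹ᵁ W := by
  intro t _
  have : hW.fromSpec (m t) ∈ Set.range hW.fromSpec := ⟨_, rfl⟩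
  rw [hW.range_fromSpec] at this
  exact this

theorem invertible_SpecMap {I : X.IdealSheafData} (W : X.affineOpens) {B : Type u} [CommRing B]
    (f : Γ(X, W.1) →+* B) (g : B) (hg : g ∈ nonZeroDivisors B)
    (hI : (I.ideal W).map f = Ideal.span {g}) :
    InvertibleInverseImage I (Spec.map (CommRingCat.ofHom f) ≫ W.2.fromSpec) := by
  intro y
  refine ⟨W, ⟨⊤, isAffineOpen_top _⟩, fromSpec_preimage W.2 _, trivial,
    (Scheme.ΓSpecIso (CommRingCat.of B)).inv.hom g, ?_, ?_⟩
  · refine mem_nonZeroDivisors_of_injective (f := (Scheme.ΓSpecIso (CommRingCat.of B)).hom.hom)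
      (Scheme.ΓSpecIso (CommRingCat.of B)).commRingCatIsoToRingEquiv.injective ?_
    have h : (Scheme.ΓSpecIso (CommRingCat.of B)).hom.hom
        ((Scheme.ΓSpecIso (CommRingCat.of B)).inv.hom g) = g :=
      (Scheme.ΓSpecIso (CommRingCat.of B)).commRingCatIsoToRingEquiv.apply_symm_apply g
    rw [h]
    exact hg
  · have e := (appLE_eq_sectionsMap W.2 (Spec.map (CommRingCat.ofHom f))
      (fromSpec_preimage W.2 _)).trans (sectionsMap_SpecMap f)
    refine (congrArg (Ideal.map · (I.ideal W)) e).trans ?_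
    refine (Ideal.map_map _ _).symm.trans ?_
    rw [hI, Ideal.map_span, Set.image_singleton]

theorem map_ideal_appLE (I : X.IdealSheafData) (f : Y ⟶ X) {O U : X.affineOpens} (h : O ≤ U)
    {V : Y.Opens} (hO : V ≤ f ⁻¹ᵁ O.1) (hU : V ≤ f ⁻¹ᵁ U.1) :
    (I.ideal U).map (f.appLE U.1 V hU).hom = (I.ideal O).map (f.appLE O.1 V hO).hom := by
  rw [← I.map_ideal h, Ideal.map_map, ← CommRingCat.hom_comp]
  exact congrArg (fun g ↦ (I.ideal U).map (CommRingCat.Hom.hom g))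
    (Scheme.Hom.map_appLE f hO (homOfLE h).op).symm

/-- The inverse image of an ideal sheaf is locally generated by one nonzerodivisor with respect to
any affine open subset of the target. -/
theorem InvertibleInverseImage.exists_affine {I : X.IdealSheafData} {f : Y ⟶ X}
    (hf : InvertibleInverseImage I f) (W : X.affineOpens) (y : Y) (hy : f y ∈ W.1) :
    ∃ (V : Y.affineOpens) (hV : V.1 ≤ f ⁻¹ᵁ W.1), y ∈ V.1 ∧
      ∃ g ∈ nonZeroDivisors Γ(Y, V.1),
        (I.ideal W).map (f.appLE W.1 V.1 hV).hom = Ideal.span {g} := by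
  obtain ⟨U, V, hVU, hyV, g, hg, hI⟩ := hf y
  obtain ⟨_, ⟨O, hO, rfl⟩, hyO, hOUW⟩ := X.isBasis_affineOpens.exists_subset_of_mem_open
    (show f y ∈ ((U.1 ⊓ W.1 : X.Opens) : Set X) from ⟨hVU hyV, hy⟩) (U.1 ⊓ W.1).isOpen
  have hOU : O ≤ U.1 := fun _ h ↦ (hOUW h).1
  have hOW : O ≤ W.1 := fun _ h ↦ (hOUW h).2
  obtain ⟨h, hh, hyh⟩ := V.2.exists_basicOpen_le (V := f ⁻¹ᵁ O) ⟨y, hyO⟩ hyV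
  refine ⟨Y.affineBasicOpen h, hh.trans fun z hz ↦ hOW hz, hyh,
    (Y.presheaf.map (homOfLE (Y.basicOpen_le h)).op).hom g, ?_, ?_⟩
  · let := (Y.presheaf.map (homOfLE (Y.basicOpen_le h)).op).hom.toAlgebra
    have : IsLocalization.Away h Γ(Y, Y.basicOpen h) := V.2.isLocalization_of_eq_basicOpen _ _ rfl
    exact IsLocalization.map_nonZeroDivisors_le (Submonoid.powers h) Γ(Y, Y.basicOpen h)
      (Submonoid.mem_map_of_mem _ hg)
  · refine (map_ideal_appLE I f (O := ⟨O, hO⟩) (U := W) hOW hh _).trans ?_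
    refine (map_ideal_appLE I f (O := ⟨O, hO⟩) (U := U) hOU hh
      ((Y.basicOpen_le h).trans hVU)).symm.trans ?_
    have e2 := Scheme.Hom.appLE_map f hVU (homOfLE (Y.basicOpen_le h)).op
    refine (congrArg (fun g ↦ (I.ideal U).map (CommRingCat.Hom.hom g)) e2.symm).trans ?_
    rw [CommRingCat.hom_comp]
    refine (Ideal.map_map _ _).symm.trans ?_
    rw [hI, Ideal.map_span, Set.image_singleton]
    rfl

theorem pointIdeal_mem {q : X} (hq : IsClosed {q}) (W : X.affineOpens) (r : Γ(X, W.1)) :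
    r ∈ (pointIdeal q).ideal W ↔
      ∀ p : PrimeSpectrum Γ(X, W.1), W.2.fromSpec p = q → r ∈ p.asIdeal := by
  rw [pointIdeal, Scheme.IdealSheafData.vanishingIdeal_ideal, PrimeSpectrum.mem_vanishingIdeal]
  refine forall_congr' fun p ↦ ?_
  have : (W.2.fromSpec p ∈ (Closeds.closure {q} : Closeds X)) ↔ W.2.fromSpec p = q := by
    rw [← SetLike.mem_coe, Closeds.coe_closure, hq.closure_eq, Set.mem_singleton_iff]
  exact imp_congr_left this

theorem invertible_pointIdeal {q : X} (hq : IsClosed {q}) (f : Y ⟶ X) (hf : ∀ y, f y ≠ q) :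
    InvertibleInverseImage (pointIdeal q) f := by
  intro y
  obtain ⟨_, ⟨U, (hU : IsAffineOpen U), rfl⟩, hyU, hUq⟩ := X.isBasis_affineOpens.exists_subset_of_mem_open
    (show f y ∈ ({q}ᶜ : Set X) from hf y) hq.isOpen_compl
  obtain ⟨_, ⟨V, hV, rfl⟩, hyV, hVU⟩ := Y.isBasis_affineOpens.exists_subset_of_mem_open
    (show y ∈ ((f ⁻¹ᵁ U : Y.Opens) : Set Y) from hyU) (f ⁻¹ᵁ U).isOpen
  refine ⟨⟨U, hU⟩, ⟨V, hV⟩, hVU, hyV, 1, one_mem _, ?_⟩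
  have : (pointIdeal q).ideal ⟨U, hU⟩ = ⊤ := by
    rw [Ideal.eq_top_iff_one, pointIdeal_mem hq]
    intro p hp
    have h1 : IsAffineOpen.fromSpec hU p ∈ Set.range (IsAffineOpen.fromSpec hU) := ⟨_, rfl⟩
    rw [IsAffineOpen.range_fromSpec] at h1
    exact absurd hp (hUq h1)
  rw [this, Ideal.map_top, Ideal.span_singleton_one]

/-- A function that vanishes at the centre makes inverse images on integral schemes invertible. -/
theorem InvertibleInverseImage.comp_of_isIntegral {I : X.IdealSheafData} {β : Y ⟶ X}
    (hβ : InvertibleInverseImage I β) {Z : Scheme.{u}} [IsIntegral Z] (f : Z ⟶ Y)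
    (hI : ∀ (U : X.affineOpens) (V : Z.Opens) (hV : V ≤ (f ≫ β) ⁻¹ᵁ U.1), V.1.Nonempty →
      ∃ r ∈ I.ideal U, ((f ≫ β).appLE U.1 V hV).hom r ≠ 0) :
    InvertibleInverseImage I (f ≫ β) := by
  intro z
  obtain ⟨U, V, hVU, hzV, g, hg, hI'⟩ := hβ (f z)
  obtain ⟨_, ⟨O, hO, rfl⟩, hzO, hOV⟩ := Z.isBasis_affineOpens.exists_subset_of_mem_open
    (show z ∈ ((f ⁻¹ᵁ V.1 : Z.Opens) : Set Z) from hzV) (f ⁻¹ᵁ V.1).isOpen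
  replace hOV : O ≤ f ⁻¹ᵁ V.1 := hOV
  have hOU : O ≤ (f ≫ β) ⁻¹ᵁ U.1 := fun o ho ↦ hVU (hOV ho)
  have : Nonempty O := ⟨⟨z, hzO⟩⟩
  have e : (f ≫ β).appLE U.1 O hOU = β.appLE U.1 V.1 hVU ≫ f.appLE V.1 O hOV := by
    rw [Scheme.Hom.appLE_comp_appLE]
  have hmap : (I.ideal U).map ((f ≫ β).appLE U.1 O hOU).hom =
      Ideal.span {(f.appLE V.1 O hOV).hom g} := by
    rw [e, CommRingCat.hom_comp, ← Ideal.map_map, hI', Ideal.map_span, Set.image_singleton]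
  refine ⟨U, ⟨O, hO⟩, hOU, hzO, _, ?_, hmap⟩
  rw [mem_nonZeroDivisors_iff_ne_zero]
  intro h0
  obtain ⟨r, hr, hr0⟩ := hI U O hOU ⟨z, hzO⟩
  have := Ideal.mem_map_of_mem ((f ≫ β).appLE U.1 O hOU).hom hr
  rw [hmap, h0, Ideal.mem_span_singleton, zero_dvd_iff] at this
  exact hr0 this

end Invertible

/-! ### Charts of a blowup whose centre is generated by two functions -/

section BlowupChart

variable {X X' : Scheme.{u}}

/-- Near `z`, the pullback of `u` is a nonzerodivisor that divides the pullback of `v`. -/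
def IsChartPoint (β : X' ⟶ X) (W : X.Opens) (u v : Γ(X, W)) (z : X') : Prop :=
  ∃ (V : X'.affineOpens) (hV : V.1 ≤ β ⁻¹ᵁ W), z ∈ V.1 ∧
    (β.appLE W V.1 hV).hom u ∈ nonZeroDivisors Γ(X', V.1) ∧
    ∃ t, (β.appLE W V.1 hV).hom v = (β.appLE W V.1 hV).hom u * t

theorem IsChartPoint.of_basicOpen {β : X' ⟶ X} {W : X.Opens} {u v : Γ(X, W)} {z : X'}
    (V : X'.affineOpens) (hV : V.1 ≤ β ⁻¹ᵁ W) {g c d : Γ(X', V.1)} (hg : g ∈ nonZeroDivisors _)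
    (hu : (β.appLE W V.1 hV).hom u = g * c) (hv : (β.appLE W V.1 hV).hom v = g * d)
    (hz : z ∈ X'.basicOpen c) : IsChartPoint β W u v z := by
  let ρ := (X'.presheaf.map (homOfLE (X'.basicOpen_le c)).op).hom
  have hρ : (β.appLE W (X'.basicOpen c) ((X'.basicOpen_le c).trans hV)).hom =
      ρ.comp (β.appLE W V.1 hV).hom :=
    congrArg CommRingCat.Hom.hom (Scheme.Hom.appLE_map β hV (homOfLE (X'.basicOpen_le c)).op).symm
  let := ρ.toAlgebra
  have : IsLocalization.Away c Γ(X', X'.basicOpen c) := V.2.isLocalization_of_eq_basicOpen _ _ rfl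
  have hc : IsUnit (ρ c) := IsLocalization.Away.algebraMap_isUnit c
  obtain ⟨c', hc'⟩ := hc.exists_right_inv
  refine ⟨X'.affineBasicOpen c, (X'.basicOpen_le c).trans hV, hz, ?_, c' * ρ d, ?_⟩
  · have h1 : ρ g ∈ nonZeroDivisors _ :=
      IsLocalization.map_nonZeroDivisors_le (Submonoid.powers c) Γ(X', X'.basicOpen c)
        (Submonoid.mem_map_of_mem _ hg)
    have h2 := mul_mem h1 hc.mem_nonZeroDivisors
    rw [← map_mul, ← hu] at h2
    refine Eq.mp ?_ h2
    exact congrArg (· ∈ nonZeroDivisors _) (congrArg (fun f ↦ f u) hρ).symm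
  · refine (congrArg (fun f ↦ f v) hρ).trans (Eq.trans ?_ (congrArg (· * (c' * ρ d))
      (congrArg (fun f ↦ f u) hρ).symm))
    change ρ _ = ρ _ * _
    rw [hu, hv, map_mul, map_mul]
    linear_combination (-ρ g * ρ d) * hc'

/-- Write the pullbacks as `u = g c`, `v = g d` and `g = m u + n v`. Cancelling the nonzerodivisor
`g` gives `m c + n d = 1`, so `c` or `d` is invertible at `z`, and the corresponding function
generates the ideal there. -/
theorem isChartPoint_or_isChartPoint {I : X.IdealSheafData} {β : X' ⟶ X}
    (hβ : InvertibleInverseImage I β) (W : X.affineOpens) (u v : Γ(X, W.1))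
    (hI : I.ideal W = Ideal.span {u, v}) (z : X') (hz : β z ∈ W.1) :
    IsChartPoint β W.1 u v z ∨ IsChartPoint β W.1 v u z := by
  obtain ⟨V, hV, hzV, g, hg, h⟩ := hβ.exists_affine W z hz
  rw [hI, Ideal.map_span, Set.image_pair] at h
  obtain ⟨c, hc⟩ := Ideal.mem_span_singleton.mp
    (h ▸ Ideal.subset_span (by simp) : (β.appLE W.1 V.1 hV).hom u ∈ Ideal.span {g})
  obtain ⟨d, hd⟩ := Ideal.mem_span_singleton.mp
    (h ▸ Ideal.subset_span (by simp) : (β.appLE W.1 V.1 hV).hom v ∈ Ideal.span {g})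
  obtain ⟨m, n, hmn⟩ := Ideal.mem_span_pair.mp (h ▸ Ideal.mem_span_singleton_self g)
  have h1 : m * c + n * d = 1 := by
    rw [← sub_eq_zero]
    refine (mem_nonZeroDivisors_iff.mp hg).1 _ ?_
    rw [hc, hd] at hmn
    linear_combination hmn
  by_cases hzc : z ∈ X'.basicOpen c
  · exact .inl (.of_basicOpen V hV hg hc hd hzc)
  · by_cases hzd : z ∈ X'.basicOpen d
    · exact .inr (.of_basicOpen V hV hg hd hc hzd)
    · rw [Scheme.mem_basicOpen _ _ _ hzV] at hzc hzd
      have h2 := congrArg (X'.presheaf.germ V.1 z hzV) h1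
      rw [map_add, map_mul, map_mul, map_one] at h2
      exfalso
      have := IsLocalRing.isUnit_or_isUnit_of_add_one h2
      rcases this with h | h
      · exact hzc (isUnit_of_mul_isUnit_right h)
      · exact hzd (isUnit_of_mul_isUnit_right h)

theorem sectionsMap_ι_injective {R : Type u} [CommRing R] [IsDomain R]
    (O : (Spec (CommRingCat.of R)).Opens) [Nonempty O] :
    Function.Injective (sectionsMap O.ι) := by
  have : O.ι = O.ι ≫ 𝟙 _ := (Category.comp_id _).symm
  have h : sectionsMap O.ι = (O.ι.appTop).hom.comp (sectionsMap (𝟙 (Spec (CommRingCat.of R)))) := by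
    conv_lhs => rw [this]
    exact sectionsMap_comp _ _
  have h1 : sectionsMap (𝟙 (Spec (CommRingCat.of R))) =
      (Scheme.ΓSpecIso (CommRingCat.of R)).inv.hom := by
    rw [← Spec.map_id]
    exact (sectionsMap_SpecMap (RingHom.id R)).trans (RingHom.comp_id _)
  rw [h, h1, Scheme.Opens.ι_appTop]
  refine Function.Injective.comp (g := (CategoryTheory.ConcreteCategory.hom
    ((Spec (CommRingCat.of R)).presheaf.map (homOfLE (le_top : O.ι ''ᵁ ⊤ ≤ ⊤)).op))) ?_
    ΓSpecIso_inv_injective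
  have : Nonempty (O.ι ''ᵁ ⊤ : (Spec (CommRingCat.of R)).Opens) := by
    obtain ⟨o⟩ := ‹Nonempty O›
    exact ⟨⟨O.ι o, o, trivial, rfl⟩⟩
  exact map_injective_of_isIntegral _ _

variable {R : Type u} [CommRing R] [IsDomain R]

/-- The ring `R` represents the ring maps under which `v` becomes a multiple of `u` with a chosen
quotient `t`. The universal property of the blowup produces `j`, and that of `R` produces inverses
of `j` near chart points. Since `R` is a domain and `u` is nonzero in it, the quotient is unique on
open subschemes of `Spec R`. -/
theorem IsBlowup.chart {I : X.IdealSheafData} {β : X' ⟶ X} (hβ : IsBlowup I β) (W : X.affineOpens)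
    (u v : Γ(X, W.1)) (hI : I.ideal W = Ideal.span {u, v}) (f : Γ(X, W.1) →+* R) (t : R)
    (hu : f u ≠ 0) (hv : f v = f u * t)
    (hf : ∀ {S : Type u} [CommRing S] (g : Γ(X, W.1) →+* S) (t' : S), g v = g u * t' →
      ∃! h : R →+* S, h.comp f = g ∧ h t = t') :
    ∃ j : Spec (CommRingCat.of R) ⟶ X', IsOpenImmersion j ∧
      j ≫ β = Spec.map (CommRingCat.ofHom f) ≫ W.2.fromSpec ∧
      ∀ z, IsChartPoint β W.1 u v z → z ∈ Set.range j := by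
  have hspan : ∀ {S : Type u} [CommRing S] (g : Γ(X, W.1) →+* S) (t' : S), g v = g u * t' →
      (I.ideal W).map g = Ideal.span {g u} := by
    intro S _ g t' h
    rw [hI, Ideal.map_span, Set.image_pair, h]
    refine le_antisymm (Ideal.span_le.mpr ?_) (Ideal.span_mono (by simp))
    rintro _ (rfl | rfl)
    · exact Ideal.mem_span_singleton_self _
    · exact Ideal.mem_span_singleton.mpr (dvd_mul_right _ _)
  obtain ⟨j, hj, -⟩ := hβ.existsUnique_lift _ (invertible_SpecMap W f (f u)
    (mem_nonZeroDivisors_of_ne_zero hu) (hspan f t hv))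
  -- Where `u` generates the inverse image ideal, the quotient `v / u` defines a morphism back to
  -- `Spec R`. It is a section of `j`, because two lifts to the blowup of the same morphism
  -- coincide.
  have key : ∀ (V : X'.affineOpens) (hV : V.1 ≤ β ⁻¹ᵁ W.1),
      (β.appLE W.1 V.1 hV).hom u ∈ nonZeroDivisors Γ(X', V.1) →
      (∃ t, (β.appLE W.1 V.1 hV).hom v = (β.appLE W.1 V.1 hV).hom u * t) →
      ∃ r : Spec (CommRingCat.of Γ(X', V.1)) ⟶ Spec (CommRingCat.of R), r ≫ j = V.2.fromSpec := by
    rintro V hV hu' ⟨t', ht'⟩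
    obtain ⟨h, ⟨hh, -⟩, -⟩ := hf (β.appLE W.1 V.1 hV).hom t' ht'
    have h1 : Spec.map (CommRingCat.ofHom (β.appLE W.1 V.1 hV).hom) ≫ W.2.fromSpec =
      V.2.fromSpec ≫ β := IsAffineOpen.SpecMap_appLE_fromSpec β W.2 V.2 hV
    refine ⟨Spec.map (CommRingCat.ofHom h),
      (hβ.existsUnique_lift _ (invertible_SpecMap W _ _ hu' (hspan _ t' ht'))).unique ?_ h1.symm⟩
    rw [Category.assoc, hj, ← Category.assoc, ← Spec.map_comp, ← CommRingCat.ofHom_comp, hh]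
  refine ⟨j, isOpenImmersion_of_local_inverse j fun s ↦ ?_, hj, ?_⟩
  · have hs : β (j s) ∈ W.1 := by
      have : (j ≫ β) s ∈ W.1 := by
        rw [hj]
        exact fromSpec_preimage W.2 (Spec.map (CommRingCat.ofHom f)) (trivial : s ∈ ⊤)
      exact this
    have hpull : ∀ (V : X'.affineOpens) (hV : V.1 ≤ β ⁻¹ᵁ W.1)
        (e : ⊤ ≤ ((j ⁻¹ᵁ V.1).ι ≫ j) ⁻¹ᵁ V.1) (w : Γ(X, W.1)),
        (((j ⁻¹ᵁ V.1).ι ≫ j).appLE V.1 ⊤ e).hom ((β.appLE W.1 V.1 hV).hom w) =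
          sectionsMap (j ⁻¹ᵁ V.1).ι (f w) := by
      intro V hV e w
      have h1 : (((j ⁻¹ᵁ V.1).ι ≫ j) ≫ β) =
          ((j ⁻¹ᵁ V.1).ι ≫ Spec.map (CommRingCat.ofHom f)) ≫ W.2.fromSpec := by
        rw [Category.assoc, hj, Category.assoc]
      have h2 := Scheme.Hom.appLE_comp_appLE ((j ⁻¹ᵁ V.1).ι ≫ j) β W.1 V.1 ⊤ hV e
      have h3 := appLE_eq_sectionsMap W.2 ((j ⁻¹ᵁ V.1).ι ≫ Spec.map (CommRingCat.ofHom f))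
        (fromSpec_preimage W.2 _)
      have e' : ⊤ ≤ (((j ⁻¹ᵁ V.1).ι ≫ j) ≫ β) ⁻¹ᵁ W.1 := by
        rw [h1]; exact fromSpec_preimage W.2 _
      have h4 := appLE_congr_hom h1 e' (fromSpec_preimage W.2 _) w
      have h5 := h3.trans (sectionsMap_comp_SpecMap _ f)
      exact (congrArg (fun g ↦ (CommRingCat.Hom.hom g) w) h2).trans
        (h4.trans (congrArg (fun g ↦ g w) h5))
    have hle : ∀ V : X'.Opens, ⊤ ≤ ((j ⁻¹ᵁ V).ι ≫ j) ⁻¹ᵁ V := fun V o _ ↦ o.2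
    -- If instead `v` generates and `u = v t'`, pulling back to `Spec R` gives `u = u t t'`. Hence
    -- `t'` is invertible at `j s`, and `u` generates there as well.
    have hC : IsChartPoint β W.1 u v (j s) := by
      refine (isChartPoint_or_isChartPoint hβ.invertible W u v hI (j s) hs).elim id ?_
      rintro ⟨V, hV, hzV, hv', t', ht'⟩
      refine .of_basicOpen V hV hv' ht' (mul_one _).symm ?_
      have : Nonempty (j ⁻¹ᵁ V.1) := ⟨⟨s, hzV⟩⟩
      have h1 := hpull V hV (hle V.1) u
      rw [ht', map_mul, hpull V hV (hle V.1) v, hv, map_mul, mul_assoc] at h1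
      have hu0 : sectionsMap (j ⁻¹ᵁ V.1).ι (f u) ≠ 0 := fun h0 ↦ hu
        ((map_eq_zero_iff _ (sectionsMap_ι_injective (j ⁻¹ᵁ V.1))).mp h0)
      have hint : IsDomain Γ((j ⁻¹ᵁ V.1).toScheme, ⊤) := inferInstance
      have h2 := mul_left_cancel₀ hu0 (h1.trans (mul_one _).symm)
      have h3 : IsUnit ((((j ⁻¹ᵁ V.1).ι ≫ j).appLE V.1 ⊤ (hle V.1)).hom t') :=
        IsUnit.of_mul_eq_one_right _ h2
      have h4 := Scheme.basicOpen_of_isUnit _ h3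
      have h5 := Scheme.basicOpen_appLE ((j ⁻¹ᵁ V.1).ι ≫ j) ⊤ V.1 (hle V.1) t'
      have h6 : (⟨s, hzV⟩ : j ⁻¹ᵁ V.1) ∈ ((j ⁻¹ᵁ V.1).toScheme.basicOpen
        ((((j ⁻¹ᵁ V.1).ι ≫ j).appLE V.1 ⊤ (hle V.1)).hom t')) := by rw [h4]; trivial
      have h7 := h5 ▸ h6
      exact h7.2
    obtain ⟨V, hV, hzV, hu', ht'⟩ := hC
    obtain ⟨r, hr⟩ := key V hV hu' ht'
    refine ⟨V.1, hzV, V.2.isoSpec.hom ≫ r, ?_, fun k hk ↦ ?_⟩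
    · have haV : IsAffineOpen V.1 := V.2
      exact (Category.assoc _ _ _).trans ((congrArg (haV.isoSpec.hom ≫ ·) hr).trans
        haV.isoSpec_hom_fromSpec)
    · have : Nonempty (j ⁻¹ᵁ V.1) := ⟨⟨s, hzV⟩⟩
      have h1 : k ≫ Spec.map (CommRingCat.ofHom f) =
          (j ⁻¹ᵁ V.1).ι ≫ Spec.map (CommRingCat.ofHom f) := by
        have haW : IsAffineOpen W.1 := W.2
        refine (cancel_mono haW.fromSpec).mp ?_
        rw [Category.assoc, Category.assoc]
        refine (congrArg (k ≫ ·) hj).symm.trans (Eq.trans ?_ (congrArg ((j ⁻¹ᵁ V.1).ι ≫ ·) hj))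
        rw [← Category.assoc, hk, Category.assoc]
      have h2 : (sectionsMap k).comp f = (sectionsMap (j ⁻¹ᵁ V.1).ι).comp f := by
        rw [← sectionsMap_comp_SpecMap, h1, sectionsMap_comp_SpecMap]
      have hw : ∀ w, sectionsMap k (f w) = sectionsMap (j ⁻¹ᵁ V.1).ι (f w) :=
        fun w ↦ congrArg (fun g ↦ g w) h2
      have hu0 : sectionsMap (j ⁻¹ᵁ V.1).ι (f u) ≠ 0 := fun h0 ↦ hu
        ((map_eq_zero_iff _ (sectionsMap_ι_injective (j ⁻¹ᵁ V.1))).mp h0)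
      have hint : IsDomain Γ((j ⁻¹ᵁ V.1).toScheme, ⊤) := inferInstance
      have ht : sectionsMap k t = sectionsMap (j ⁻¹ᵁ V.1).ι t := by
        refine mul_left_cancel₀ hu0 ?_
        rw [← map_mul, ← hv, ← hw, ← hw, hv, map_mul]
      refine hom_ext_Spec ((hf ((sectionsMap k).comp f) (sectionsMap k t) ?_).unique
        ⟨rfl, rfl⟩ ⟨h2.symm, ht.symm⟩)
      rw [RingHom.comp_apply, hv, map_mul, RingHom.comp_apply]
  · rintro z ⟨V, hV, hzV, hu', ht'⟩
    obtain ⟨r, hr⟩ := key V hV hu' ht'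
    have haV : IsAffineOpen V.1 := V.2
    have : z ∈ Set.range haV.fromSpec := by rw [IsAffineOpen.range_fromSpec]; exact hzV
    obtain ⟨s, rfl⟩ := this
    exact ⟨r s, congrArg (fun g : _ ⟶ X' ↦ g s) hr⟩

end BlowupChart

/-! ### The special fibre, and lifting morphisms to nodal blowups -/

section Fibre

theorem basicOpen_sectionsMap {A : Type u} [CommRing A] {S : Scheme.{u}}
    (st : S ⟶ Spec (CommRingCat.of A)) (a : A) (s : S) :
    s ∈ S.basicOpen (sectionsMap st a) ↔ a ∉ (st s).asIdeal := by
  have h : S.toSpecΓ ⁻¹ᵁ PrimeSpectrum.basicOpen (sectionsMap st a) =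
    S.basicOpen (sectionsMap st a) := Scheme.toSpecΓ_preimage_basicOpen S (sectionsMap st a)
  rw [← h]
  conv_rhs => rw [eq_toSpecΓ_sectionsMap st]
  exact Iff.rfl

variable {A : Type u} [CommRing A] [IsDomain A] [IsDiscreteValuationRing A] {x : A}

theorem eq_closedPoint_iff (hx : Irreducible x) (p : PrimeSpectrum A) :
    p = IsLocalRing.closedPoint A ↔ x ∈ p.asIdeal := by
  constructor
  · rintro rfl
    change x ∈ IsLocalRing.maximalIdeal A
    rw [hx.maximalIdeal_eq]
    exact Ideal.mem_span_singleton_self x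
  · intro h
    refine PrimeSpectrum.ext ?_
    change p.asIdeal = IsLocalRing.maximalIdeal A
    refine le_antisymm (IsLocalRing.le_maximalIdeal p.2.ne_top) ?_
    rw [hx.maximalIdeal_eq, Ideal.span_singleton_le_iff_mem]
    exact h

theorem SpecMap_eq_closedPoint_iff (hx : Irreducible x) {R : Type u} [CommRing R] (α : A →+* R)
    (s : Spec (CommRingCat.of R)) :
    Spec.map (CommRingCat.ofHom α) s = IsLocalRing.closedPoint A ↔ α x ∈ s.asIdeal :=
  eq_closedPoint_iff hx _

theorem mem_basicOpen_sectionsMap_iff (hx : Irreducible x) {S : Scheme.{u}}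
    (st : S ⟶ Spec (CommRingCat.of A)) (s : S) :
    s ∈ S.basicOpen (sectionsMap st x) ↔ st s ≠ IsLocalRing.closedPoint A := by
  exact (basicOpen_sectionsMap st x s).trans (eq_closedPoint_iff hx (st s)).not.symm

theorem mem_genericPart {X : Scheme.{u}} {π : X ⟶ P1 A} {z : X} :
    z ∈ genericPart π ↔ (π ≫ P1.toBase A) z ≠ IsLocalRing.closedPoint A := Iff.rfl

theorem mem_specialFibre {X : Scheme.{u}} {π : X ⟶ P1 A} {z : X} :
    z ∈ specialFibre π ↔ (π ≫ P1.toBase A) z = IsLocalRing.closedPoint A := Iff.rfl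

theorem IsNode.mem_specialFibre {X : Scheme.{u}} {π : X ⟶ P1 A} {q : X} (hq : IsNode π q) :
    q ∈ specialFibre π := by
  obtain ⟨-, L₁, L₂, h₁, h₂, hne, hq₁, hq₂⟩ := hq
  rcases h₁ with h₁ | rfl
  · exact h₁.1.2 hq₁
  · rcases h₂ with h₂ | rfl
    · exact h₂.1.2 hq₂
    · exact absurd rfl hne

end Fibre

section Lift

/-- An open immersion that avoids the centre of a blowup lifts to the blowup. -/
theorem IsBlowup.exists_lift_of_notMem {X X' S : Scheme.{u}} {q : X} (hq : IsClosed {q})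
    {β : X' ⟶ X} (hβ : IsBlowup (pointIdeal q) β) (j : S ⟶ X) [IsOpenImmersion j]
    (hj : q ∉ Set.range j) :
    ∃ j' : S ⟶ X', IsOpenImmersion j' ∧ j' ≫ β = j ∧ ∀ z, β z ∈ Set.range j → z ∈ Set.range j' := by
  obtain ⟨j', hj', -⟩ := hβ.existsUnique_lift j
    (invertible_pointIdeal hq j fun s h ↦ hj ⟨s, h⟩)
  set V : X'.Opens := β ⁻¹ᵁ j.opensRange with hV
  have hle : Set.range (V.ι ≫ β) ⊆ Set.range j := by
    rintro _ ⟨o, rfl⟩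
    exact o.2
  set r := IsOpenImmersion.lift j (V.ι ≫ β) hle
  have hr : r ≫ j' = V.ι := by
    refine (hβ.existsUnique_lift (V.ι ≫ β) (invertible_pointIdeal hq _ fun o h ↦
      hj (h ▸ hle ⟨o, rfl⟩))).unique ?_ rfl
    rw [Category.assoc, hj', IsOpenImmersion.lift_fac]
  refine ⟨j', isOpenImmersion_of_local_inverse j' fun s ↦ ⟨V, ?_, r, hr, fun k hk ↦ ?_⟩, hj', ?_⟩
  · exact ⟨s, congrArg (fun g : S ⟶ X ↦ g s) hj'.symm⟩
  · rw [← cancel_mono j, ← hj', ← Category.assoc, hk, Category.assoc]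
  · intro z hz
    exact ⟨r ⟨z, hz⟩, congrArg (fun g : V.toScheme ⟶ X' ↦ g ⟨z, hz⟩) hr⟩

variable {A : Type u} [CommRing A] [IsDomain A] [IsDiscreteValuationRing A]

/-- A nodal blowup is an isomorphism over the complement of the special fibre. -/
theorem IsNodalBlowup.existsUnique_lift {X : Scheme.{u}} {π : X ⟶ P1 A} (hπ : IsNodalBlowup π)
    {Y : Scheme.{u}} (f : Y ⟶ P1 A)
    (hf : ∀ y, (f ≫ P1.toBase A) y ≠ IsLocalRing.closedPoint A) : ∃! g : Y ⟶ X, g ≫ π = f := by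
  induction hπ with
  | base π hπ => exact ⟨f ≫ inv π, by simp, fun g hg ↦ by simp [← hg]⟩
  | @step X X' π hπ q hq β hβ ih =>
    obtain ⟨g, hg, hu⟩ := ih
    have hgq : ∀ y, g y ≠ q := fun y h ↦ by
      have := hq.mem_specialFibre
      rw [NodalBlowup.mem_specialFibre, ← h] at this
      apply hf y
      rw [← hg, Category.assoc]
      exact this
    obtain ⟨g', hg', hu'⟩ := hβ.existsUnique_lift g (invertible_pointIdeal hq.1 g hgq)
    refine ⟨g', by dsimp only; rw [← Category.assoc, hg', hg], fun g'' hg'' ↦ hu' g'' (hu _ ?_)⟩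
    dsimp only at hg'' ⊢
    rw [Category.assoc, hg'']

/-- The witness is `x`: it vanishes at `q`, which lies over the closed point, and its pullback does
not vanish at `z`. So on an integral scheme that leaves the special fibre, the centre of a blowup
never pulls back to zero. -/
theorem hom_pointIdeal_ne_zero {x : A} (hx : Irreducible x) {X : Scheme.{u}}
    (st : X ⟶ Spec (CommRingCat.of A)) {q : X} (hq : IsClosed {q})
    (hqF : st q = IsLocalRing.closedPoint A) {Z : Scheme.{u}} (f : Z ⟶ X) (U : X.affineOpens)
    (V : Z.Opens) (hV : V ≤ f ⁻¹ᵁ U.1) (z : Z) (hz : z ∈ V)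
    (hzF : (f ≫ st) z ≠ IsLocalRing.closedPoint A) :
    ∃ r ∈ (pointIdeal q).ideal U, (f.appLE U.1 V hV).hom r ≠ 0 := by
  have hU : IsAffineOpen U.1 := U.2
  refine ⟨(X.presheaf.map (homOfLE (le_top : U.1 ≤ ⊤)).op).hom (sectionsMap st x), ?_, ?_⟩
  · rw [pointIdeal_mem hq]
    rintro p hp
    by_contra hc
    have h1 : p ∈ hU.fromSpec ⁻¹ᵁ X.basicOpen
        ((X.presheaf.map (homOfLE (le_top : U.1 ≤ ⊤)).op).hom (sectionsMap st x)) := by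
      rw [hU.fromSpec_preimage_basicOpen]
      exact hc
    have h2 := X.basicOpen_res (sectionsMap st x) (homOfLE (le_top : U.1 ≤ ⊤)).op
    have h3 : hU.fromSpec p ∈ X.basicOpen (sectionsMap st x) := (h2.le h1).2
    rw [mem_basicOpen_sectionsMap_iff hx] at h3
    exact h3 (hp ▸ hqF)
  · intro h0
    have h1 := Scheme.Hom.map_appLE f hV (homOfLE (le_top : U.1 ≤ ⊤)).op
    have h2 : (f.appLE ⊤ V le_top).hom (sectionsMap st x) = 0 :=
      (congrArg (fun g ↦ (CommRingCat.Hom.hom g) (sectionsMap st x)) h1).symm.trans h0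
    have h3 := Scheme.basicOpen_appLE f V ⊤ le_top (sectionsMap st x)
    have h4 : z ∈ V ⊓ f ⁻¹ᵁ X.basicOpen (sectionsMap st x) := by
      refine ⟨hz, ?_⟩
      change f z ∈ X.basicOpen (sectionsMap st x)
      rw [mem_basicOpen_sectionsMap_iff hx]
      exact hzF
    rw [← h3] at h4
    have h5 : Z.basicOpen ((f.appLE ⊤ V le_top).hom (sectionsMap st x)) = ⊥ := by
      rw [h2]; exact Z.basicOpen_zero V
    exact (h5.le h4).elim

/-- Two morphisms to a nodal blowup from an integral scheme that is not contained in the special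
fibre agree if they agree on the projective line. -/
theorem IsNodalBlowup.hom_ext {x : A} (hx : Irreducible x) {X : Scheme.{u}} {π : X ⟶ P1 A}
    (hπ : IsNodalBlowup π) {Y : Scheme.{u}} [IsIntegral Y] {f g : Y ⟶ X} (h : f ≫ π = g ≫ π)
    (y : Y) (hy : (f ≫ π ≫ P1.toBase A) y ≠ IsLocalRing.closedPoint A) : f = g := by
  induction hπ with
  | base π hπ => exact (cancel_mono π).mp h
  | @step X X' π hπ q hq β hβ ih =>
    have h1 : f ≫ β = g ≫ β := ih (by simpa only [Category.assoc] using h)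
      (by simpa only [Category.assoc] using hy)
    refine (hβ.existsUnique_lift (f ≫ β) ?_).unique rfl h1.symm
    refine hβ.invertible.comp_of_isIntegral f fun U V hV hne ↦ ?_
    have ho : IsOpen (((f ≫ β) ≫ π ≫ P1.toBase A) ⁻¹ᵁ
      ⟨{IsLocalRing.closedPoint A}ᶜ, (IsLocalRing.isClosed_singleton_closedPoint A).isOpen_compl⟩ :
        Y.Opens).1 := Opens.isOpen _
    obtain ⟨z, hzV, hz⟩ := nonempty_preirreducible_inter V.2 ho hne
      ⟨y, by
        change ((f ≫ β) ≫ π ≫ P1.toBase A) y ≠ IsLocalRing.closedPoint A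
        simpa only [Category.assoc] using hy⟩
    exact hom_pointIdeal_ne_zero hx (π ≫ P1.toBase A) hq.1 hq.mem_specialFibre (f ≫ β) U V hV z
      hzV hz

end Lift

/-! ### Toric charts of nodal blowups -/

section NodeChart

theorem _root_.IsPreirreducible.inter_isOpen {Z : Type*} [TopologicalSpace Z] {S U : Set Z}
    (hS : IsPreirreducible S) (hU : IsOpen U) : IsPreirreducible (S ∩ U) := by
  rintro V W hV hW ⟨a, ⟨haS, haU⟩, haV⟩ ⟨b, ⟨hbS, hbU⟩, hbW⟩
  obtain ⟨c, hcS, ⟨hcU, hcV⟩, -, hcW⟩ := hS (U ∩ V) (U ∩ W) (hU.inter hV) (hU.inter hW)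
    ⟨a, haS, haU, haV⟩ ⟨b, hbS, hbU, hbW⟩
  exact ⟨c, ⟨hcS, hcU⟩, hcV, hcW⟩

/-- An open immersion of a spectrum identifies the ring with the functions on its range. -/
theorem exists_ringEquiv_fromSpec {X : Scheme.{u}} {R : Type u} [CommRing R]
    (j : Spec (CommRingCat.of R) ⟶ X) [IsOpenImmersion j] :
    ∃ (W : X.Opens) (hW : IsAffineOpen W) (ε : Γ(X, W) ≃+* R), W = j.opensRange ∧
      Spec.map (CommRingCat.ofHom (ε : Γ(X, W) →+* R)) ≫ hW.fromSpec = j := by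
  have hW : IsAffineOpen j.opensRange := isAffineOpen_opensRange j
  have hr : Set.range j = Set.range hW.fromSpec := by rw [hW.range_fromSpec]; rfl
  let e := IsOpenImmersion.isoOfRangeEq j hW.fromSpec hr
  have he : e.hom ≫ hW.fromSpec = j := IsOpenImmersion.isoOfRangeEq_hom_fac _ _ _
  obtain ⟨f, hf⟩ := Spec.map_surjective e.hom
  obtain ⟨g, hg⟩ := Spec.map_surjective e.inv
  have hfg : f ≫ g = 𝟙 _ := Spec.map_injective (by rw [Spec.map_comp, hf, hg]; simp)
  have hgf : g ≫ f = 𝟙 _ := Spec.map_injective (by rw [Spec.map_comp, hf, hg]; simp)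
  refine ⟨j.opensRange, hW, RingEquiv.ofRingHom f.hom g.hom ?_ ?_, rfl, ?_⟩
  · rw [← CommRingCat.hom_comp, hgf]; rfl
  · rw [← CommRingCat.hom_comp, hfg]; rfl
  · conv_rhs => rw [← he, ← hf]
    rfl

variable {A : Type u} [CommRing A]

/-- A chart of a nodal blowup with coordinates `u` and `v`, in which `x = u ^ p * v ^ q` and
`y = u ^ p' * v ^ q'`. -/
structure IsNodeChart {X : Scheme.{u}} (π : X ⟶ P1 A) (x : A) {R : Type u} [CommRing R]
    (j : Spec (CommRingCat.of R) ⟶ X) (α : A →+* R) (u v : R) (p q p' q' : ℕ) : Prop where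
  isOpenImmersion : IsOpenImmersion j
  isToric : IsToric α x u v p q
  det : p * q' + 1 = p' * q ∨ p' * q + 1 = p * q'
  comp : j ≫ π = ptZ α (u ^ p' * v ^ q')

variable {X : Scheme.{u}} {π : X ⟶ P1 A} {x : A} {R : Type u} [CommRing R]
    {j : Spec (CommRingCat.of R) ⟶ X} {α : A →+* R} {u v : R} {p q p' q' : ℕ}

theorem IsNodeChart.swap (h : IsNodeChart π x j α u v p q p' q') :
    IsNodeChart π x j α v u q p q' p' where
  isOpenImmersion := h.isOpenImmersion
  isToric := h.isToric.swap
  det := by have := h.det; rw [mul_comm q, mul_comm q']; tauto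
  comp := by rw [h.comp]; congr 1; rw [mul_comm]

theorem IsNodeChart.ne_zero (h : IsNodeChart π x j α u v p q p' q') : p ≠ 0 ∨ q ≠ 0 := by
  by_contra! hc
  obtain ⟨rfl, rfl⟩ := hc
  have := h.det
  simp at this

theorem IsNodeChart.comp_toBase (h : IsNodeChart π x j α u v p q p' q') :
    j ≫ π ≫ P1.toBase A = Spec.map (CommRingCat.ofHom α) := by
  rw [← Category.assoc, h.comp, pt_toBase]

variable [IsDomain A] [IsDiscreteValuationRing A]

theorem apply_mem_specialFibre_iff (hx : Irreducible x)
    (h : j ≫ π ≫ P1.toBase A = Spec.map (CommRingCat.ofHom α)) (s : Spec (CommRingCat.of R)) :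
    j s ∈ specialFibre π ↔ α x ∈ s.asIdeal := by
  rw [mem_specialFibre, ← SpecMap_eq_closedPoint_iff hx, ← h]
  exact Iff.rfl

/-- Every pseudo-line through `q` would be the closure of `O ∩ specialFibre π`: a line by its
maximality, while the proper transform of `Y = 0` cannot reach `q`, since it has no points in `O`
outside the special fibre. Two different ones therefore do not meet at `q`. -/
theorem not_isNode_of_isPreirreducible {O : Set X} (hO : IsOpen O) {q : X} (hq : q ∈ O)
    (hirr : IsPreirreducible (O ∩ specialFibre π))
    (hPT : ∀ z ∈ O, π z ∈ ellInfty A → z ∈ specialFibre π) : ¬ IsNode π q := by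
  rintro ⟨-, L₁, L₂, h₁, h₂, hne, hq₁, hq₂⟩
  have hF : IsClosed (specialFibre π) :=
    (IsLocalRing.isClosed_singleton_closedPoint A).preimage (π ≫ P1.toBase A).continuous
  have key : ∀ L, IsPseudoLine π L → q ∈ L → L = closure (O ∩ specialFibre π) := by
    rintro L (hL | rfl) hqL
    · have hsub : L ⊆ closure (O ∩ specialFibre π) :=
        (subset_closure_inter_of_isPreirreducible_of_isOpen hL.1.1.2 hO ⟨q, hqL, hq⟩).trans
          (closure_mono fun z hz ↦ ⟨hz.2, hL.1.2 hz.1⟩)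
      refine subset_antisymm hsub (hL.2 ⟨⟨⟨q, hsub hqL⟩, hirr.closure⟩, ?_⟩ hsub)
      exact closure_minimal Set.inter_subset_right hF
    · obtain ⟨z, hzO, hz⟩ := mem_closure_iff.mp hqL O hO hq
      exact absurd (hPT z hzO hz.1) hz.2
  exact hne ((key _ h₁ hq₁).trans (key _ h₂ hq₂).symm)

theorem mem_zeroLocus_singleton {r : R} {t : PrimeSpectrum R} :
    t ∈ PrimeSpectrum.zeroLocus {r} ↔ r ∈ t.asIdeal := by
  rw [PrimeSpectrum.mem_zeroLocus, Set.singleton_subset_iff, SetLike.mem_coe]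

theorem isPreirreducible_zeroLocus {r : R} (hr : Prime r) :
    IsPreirreducible (PrimeSpectrum.zeroLocus {r}) := by
  rw [← PrimeSpectrum.zeroLocus_span]
  have hp := (Ideal.span_singleton_prime hr.ne_zero).mpr hr
  exact ((PrimeSpectrum.isIrreducible_zeroLocus_iff_of_radical _ hp.isRadical).mpr hp).2

/-- Where `v` is invertible, the special fibre is the irreducible divisor `u = 0`, and `y = u ^ p' v
^ q'` vanishes only on it, so there is no node. With `swap` this leaves `u = v = 0` as the only
possible node of the chart. -/
theorem IsNodeChart.mem_of_isNode (h : IsNodeChart π x j α u v p q p' q') (hx : Irreducible x)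
    {s : Spec (CommRingCat.of R)} (hs : IsNode π (j s)) : v ∈ s.asIdeal := by
  by_contra hv
  have := h.isOpenImmersion
  have hxs := (apply_mem_specialFibre_iff hx h.comp_toBase s).mp hs.mem_specialFibre
  rw [h.isToric.rel] at hxs
  have hus := (s.2.mem_or_mem hxs).resolve_right (fun hc ↦ hv (s.2.mem_of_pow_mem _ hc))
  have hp : p ≠ 0 := by
    rintro rfl
    exact s.2.ne_top ((Ideal.eq_top_iff_one _).mpr (by simpa using hus))
  have hD : IsOpen (PrimeSpectrum.basicOpen v : Set (PrimeSpectrum R)) :=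
    PrimeSpectrum.isOpen_basicOpen
  have hO := j.isOpenEmbedding.isOpenMap _ hD
  refine not_isNode_of_isPreirreducible hO (q := j s) ⟨s, hv, rfl⟩ ?_ ?_ hs
  · have h1 := ((isPreirreducible_zeroLocus (h.isToric.prime hx hp)).inter_isOpen hD).image j
      j.continuous.continuousOn
    convert h1 using 1
    ext z
    constructor
    · rintro ⟨⟨t, ht, rfl⟩, hz⟩
      refine ⟨t, ⟨mem_zeroLocus_singleton.mpr ?_, ht⟩, rfl⟩
      rw [apply_mem_specialFibre_iff hx h.comp_toBase, h.isToric.rel] at hz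
      exact t.2.mem_of_pow_mem _
        ((t.2.mem_or_mem hz).resolve_right (fun hc ↦ ht (t.2.mem_of_pow_mem _ hc)))
    · rintro ⟨t, ⟨hut, ht⟩, rfl⟩
      refine ⟨⟨t, ht, rfl⟩, ?_⟩
      refine (apply_mem_specialFibre_iff hx h.comp_toBase _).mpr ?_
      rw [h.isToric.rel]
      replace hut := mem_zeroLocus_singleton.mp hut
      exact Ideal.mul_mem_right _ _ (Ideal.pow_mem_of_mem _ hut _ (Nat.pos_of_ne_zero hp))
  · rintro _ ⟨t, ht, rfl⟩ hz
    have hz' : u ^ p' * v ^ q' ∈ t.asIdeal := by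
      by_contra hc
      refine hz ?_
      have := (pt_mem_chartOpen α ![u ^ p' * v ^ q', 1] 1 (cons_one_apply_one _) 0 t).mpr hc
      change (j ≫ π) t ∈ chartOpen A 0
      rw [h.comp]
      exact this
    have hu' := (t.2.mem_or_mem hz').resolve_right (fun hc ↦ ht (t.2.mem_of_pow_mem _ hc))
    rw [apply_mem_specialFibre_iff hx h.comp_toBase, h.isToric.rel]
    exact Ideal.mul_mem_right _ _ (Ideal.pow_mem_of_mem _ (t.2.mem_of_pow_mem _ hu') _
      (Nat.pos_of_ne_zero hp))

/-- In the chart around `y = ∞` the special fibre is an irreducible affine line and `Y` does not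
vanish. Blowups at nodes thus leave this chart unchanged. -/
theorem not_isNode_of_comp_eq_ptY (hx : Irreducible x)
    (j : Spec (CommRingCat.of (Polynomial A)) ⟶ X) [IsOpenImmersion j]
    (hj : j ≫ π = ptY Polynomial.C Polynomial.X) (s : Spec (CommRingCat.of (Polynomial A))) :
    ¬ IsNode π (j s) := by
  have hb : j ≫ π ≫ P1.toBase A = Spec.map (CommRingCat.ofHom Polynomial.C) := by
    rw [← Category.assoc, hj, pt_toBase]
  refine not_isNode_of_isPreirreducible j.isOpenEmbedding.isOpen_range ⟨s, rfl⟩ ?_ ?_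
  · have h1 := (isPreirreducible_zeroLocus (Polynomial.prime_C_iff.mpr hx.prime)).image j
      j.continuous.continuousOn
    convert h1 using 1
    ext z
    constructor
    · rintro ⟨⟨t, rfl⟩, hz⟩
      exact ⟨t, mem_zeroLocus_singleton.mpr ((apply_mem_specialFibre_iff hx hb t).mp hz), rfl⟩
    · rintro ⟨t, ht, rfl⟩
      exact ⟨⟨t, rfl⟩, (apply_mem_specialFibre_iff hx hb t).mpr (mem_zeroLocus_singleton.mp ht)⟩
  · rintro _ ⟨t, rfl⟩ hz
    refine absurd ?_ hz
    have := (pt_mem_chartOpen Polynomial.C ![1, Polynomial.X] 0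
      (one_cons_apply_zero (Polynomial.X : Polynomial A)) 0 t).mpr
      (fun hc ↦ t.2.ne_top ((Ideal.eq_top_iff_one _).mpr hc))
    change (j ≫ π) t ∈ chartOpen A 0
    rw [hj]
    exact this

/-- The chart of the blowup is given by `u = u₁`, `v = u₁ v₁`. Then `u ^ p v ^ q = u₁ ^ (p + q) v₁ ^
q`, and likewise for `y`, so one column of exponents is added to the other and the determinant is
unchanged. The second chart is obtained by `swap`. -/
theorem IsNodeChart.exists_blowup_chart (h : IsNodeChart π x j α u v p q p' q')
    (hx : Irreducible x) {s : Spec (CommRingCat.of R)} (hs : IsNode π (j s)) {X' : Scheme.{u}}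
    {β : X' ⟶ X} (hβ : IsBlowup (pointIdeal (j s)) β) {W : X.Opens} (hW : IsAffineOpen W)
    (ε : Γ(X, W) ≃+* R)
    (hε : Spec.map (CommRingCat.ofHom (ε : Γ(X, W) →+* R)) ≫ hW.fromSpec = j) :
    (pointIdeal (j s)).ideal ⟨W, hW⟩ = Ideal.span {ε.symm u, ε.symm v} ∧
    ∃ (R' : Type u) (_ : CommRing R') (j' : Spec (CommRingCat.of R') ⟶ X') (α' : A →+* R')
      (u' v' : R'), IsNodeChart (β ≫ π) x j' α' u' v' (p + q) q (p' + q') q' ∧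
        ∀ z, IsChartPoint β W (ε.symm u) (ε.symm v) z → z ∈ Set.range j' := by
  have hspan : (pointIdeal (j s)).ideal ⟨W, hW⟩ = Ideal.span {ε.symm u, ε.symm v} := by
    have hsp := h.isToric.eq_span hx h.ne_zero s.asIdeal s.2.ne_top (h.swap.mem_of_isNode hx hs)
      (h.mem_of_isNode hx hs)
    have h1 : (pointIdeal (j s)).ideal ⟨W, hW⟩ = s.asIdeal.comap (ε : Γ(X, W) →+* R) := by
      ext r
      rw [pointIdeal_mem hs.1]
      have hps : hW.fromSpec (PrimeSpectrum.comap (ε : Γ(X, W) →+* R) s) = j s :=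
        congrArg (fun g : _ ⟶ X ↦ g s) hε
      constructor
      · intro hr
        exact hr (PrimeSpectrum.comap (ε : Γ(X, W) →+* R) s) hps
      · rintro hr t ht
        have : t = PrimeSpectrum.comap (ε : Γ(X, W) →+* R) s :=
          hW.fromSpec.isOpenEmbedding.injective (ht.trans hps.symm)
        rw [this]
        exact hr
    rw [h1, hsp]
    have h2 := Ideal.map_symm (I := Ideal.span {u, v}) ε
    have h3 := Ideal.map_span (ε.symm : R →+* Γ(X, W)) {u, v}
    rw [Set.image_pair] at h3
    exact h2.symm.trans h3
  refine ⟨hspan, ?_⟩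
  have hpq := h.ne_zero
  have hpq' : p + q ≠ 0 := by omega
  obtain ⟨R₁, _, α₁, u₁, v₁, ht⟩ : ∃ (R₁ : Type u) (_ : CommRing R₁) (α₁ : A →+* R₁) (u₁ v₁ : R₁),
    IsToric α₁ x u₁ v₁ (p + q) q := ⟨_, _, _, _, _, isToric_toricRing x (p + q) q⟩
  have hdom := ht.isDomain hx (.inl hpq')
  obtain ⟨f, hf, hfu, hfv⟩ := h.isToric.exists_lift α₁ u₁ (u₁ * v₁) (by rw [ht.rel]; ring)
  obtain ⟨j', hj', hj'β, hz⟩ := hβ.chart ⟨W, hW⟩ (ε.symm u) (ε.symm v) hspan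
    (f.comp (ε : Γ(X, W) →+* R)) v₁ (by simpa [hfu] using ht.ne_zero hx hpq') (by simp [hfu, hfv]) (by
      intro S _ g t' hgt
      obtain ⟨k, ⟨hk, hku, hkv⟩, hkuniq⟩ := ht.existsUnique_lift
        ((g.comp (ε.symm : R →+* Γ(X, W))).comp α) (g (ε.symm u)) t' (by
          change g (ε.symm (α x)) = _
          rw [h.isToric.rel, map_mul, map_pow, map_pow, map_mul, map_pow, map_pow, hgt]
          ring)
      have hkf : k.comp f = g.comp (ε.symm : R →+* Γ(X, W)) := by
        refine h.isToric.hom_ext ?_ ?_ ?_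
        · rw [RingHom.comp_assoc, hf, hk]
        · simp [hfu, hku]
        · simp [hfv, hku, hkv, hgt]
      refine ⟨k, ⟨?_, hkv⟩, fun k' ⟨hk', hkt'⟩ ↦ hkuniq k' ⟨?_, ?_, hkt'⟩⟩
      · rw [← RingHom.comp_assoc, hkf]
        ext r
        simp
      · rw [← hf, ← hk']
        ext r
        simp
      · rw [← hk']
        simp [hfu])
  refine ⟨_, inferInstance, j', α₁, u₁, v₁, ⟨hj', ht, ?_, ?_⟩, hz⟩
  · have := h.det
    rw [add_mul, add_mul, mul_comm q' q]
    omega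
  · have h1 : Spec.map (CommRingCat.ofHom (f.comp (ε : Γ(X, W) →+* R))) ≫ hW.fromSpec =
        Spec.map (CommRingCat.ofHom f) ≫ j := by
      rw [← hε, CommRingCat.ofHom_comp, Spec.map_comp, Category.assoc]
    rw [← Category.assoc, hj'β]
    refine (congrArg (· ≫ π) h1).trans ?_
    rw [Category.assoc, h.comp, SpecMap_ptZ, hf]
    congr 1
    rw [map_mul, map_pow, map_pow, hfu, hfv]
    ring

theorem IsNodeChart.exists_blowup (h : IsNodeChart π x j α u v p q p' q')
    (hx : Irreducible x) {s : Spec (CommRingCat.of R)} (hs : IsNode π (j s)) {X' : Scheme.{u}}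
    {β : X' ⟶ X} (hβ : IsBlowup (pointIdeal (j s)) β) (z : X') (hz : β z ∈ Set.range j) :
    ∃ (R' : Type u) (_ : CommRing R') (j' : Spec (CommRingCat.of R') ⟶ X') (α' : A →+* R')
      (u' v' : R') (p₁ q₁ p₁' q₁' : ℕ), IsNodeChart (β ≫ π) x j' α' u' v' p₁ q₁ p₁' q₁' ∧
        z ∈ Set.range j' := by
  have := h.isOpenImmersion
  obtain ⟨W, hW, ε, hWj, hε⟩ := exists_ringEquiv_fromSpec j
  obtain ⟨hI, R₁, i₁, j₁, α₁, u₁, v₁, h₁, hz₁⟩ := h.exists_blowup_chart hx hs hβ hW ε hε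
  obtain ⟨-, R₂, i₂, j₂, α₂, u₂, v₂, h₂, hz₂⟩ := h.swap.exists_blowup_chart hx hs hβ hW ε hε
  have hzW : β z ∈ W := by rw [hWj]; exact hz
  rcases isChartPoint_or_isChartPoint hβ.invertible ⟨W, hW⟩ _ _ hI z hzW with hc | hc
  · exact ⟨R₁, i₁, j₁, α₁, u₁, v₁, _, _, _, _, h₁, hz₁ z hc⟩
  · exact ⟨R₂, i₂, j₂, α₂, u₂, v₂, _, _, _, _, h₂, hz₂ z hc⟩

theorem isToric_polynomial (x : A) :
    IsToric Polynomial.C x (Polynomial.C x) Polynomial.X 1 0 where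
  rel := by simp
  existsUnique_lift γ u' v' h := by
    refine ⟨Polynomial.eval₂RingHom γ v', ⟨?_, ?_, ?_⟩, ?_⟩
    · ext a; simp
    · simpa using h
    · simp
    · rintro g ⟨h1, -, h3⟩
      refine Polynomial.ringHom_ext (fun a ↦ ?_) ?_
      · simpa using congrArg (fun f ↦ f a) h1
      · simpa using h3

/-- Every point of a nodal blowup has a toric chart, except for the points with `y = ∞`. -/
theorem IsNodalBlowup.exists_chart (hπ : IsNodalBlowup π) (hx : Irreducible x) (z : X) :
    (∃ (R : Type u) (_ : CommRing R) (j : Spec (CommRingCat.of R) ⟶ X) (α : A →+* R)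
      (u v : R) (p q p' q' : ℕ), IsNodeChart π x j α u v p q p' q' ∧ z ∈ Set.range j) ∨
    ∃ j : Spec (CommRingCat.of (Polynomial A)) ⟶ X, IsOpenImmersion j ∧
      j ≫ π = ptY Polynomial.C Polynomial.X ∧
      ∃ s : Spec (CommRingCat.of (Polynomial A)), j s = z ∧ Polynomial.X ∈ s.asIdeal := by
  induction hπ with
  | @base X π hπ =>
    have h1 := isOpenImmersion_pt (A := A) 1 0 (fun j ↦ by fin_cases j <;> simp)
      ![Polynomial.X, 1] rfl rfl
    have h0 := isOpenImmersion_pt (A := A) 0 1 (fun j ↦ by fin_cases j <;> simp)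
      ![1, Polynomial.X] rfl rfl
    have hcomp : ∀ (g : Spec (CommRingCat.of (Polynomial A)) ⟶ P1 A)
        (s : Spec (CommRingCat.of (Polynomial A))), g s = π z → (g ≫ inv π) s = z := by
      intro g s hs
      have : inv π (π z) = z := by
        change (π ≫ inv π) z = z
        rw [IsIso.hom_inv_id]
        rfl
      rw [← this, ← hs]
      rfl
    by_cases hz : π z ∈ chartOpen A 1
    · obtain ⟨s, hs⟩ := (h1.2 _).mpr hz
      have := h1.1
      -- The chart to start from is `A[y]` with `u = x` and `v = y`, whose exponent matrix is the
      -- identity.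
      exact .inl ⟨_, inferInstance, ptZ Polynomial.C Polynomial.X ≫ inv π, Polynomial.C,
        Polynomial.C x, Polynomial.X, 1, 0, 0, 1, ⟨inferInstance, isToric_polynomial x, by simp,
          by simp⟩, s, hcomp _ s hs⟩
    · obtain ⟨i, hi⟩ := exists_mem_chartOpen (π z)
      have hi0 : i = 0 := by
        fin_cases i
        · rfl
        · exact absurd hi hz
      subst hi0
      obtain ⟨s, hs⟩ := (h0.2 _).mpr hi
      have := h0.1
      refine .inr ⟨ptY Polynomial.C Polynomial.X ≫ inv π, inferInstance, by simp, s,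
        hcomp _ s hs, ?_⟩
      by_contra hc
      refine hz ?_
      rw [← hs]
      exact (pt_mem_chartOpen _ _ _ _ 1 s).mpr hc
  | @step X X' π hπ n hn β hβ ih =>
    rcases ih (β z) with ⟨R, i, j, α, u, v, p, q, p', q', h, hz⟩ | ⟨j, hj, hjπ, s, hs, hXs⟩
    · by_cases hnj : n ∈ Set.range j
      · obtain ⟨s, rfl⟩ := hnj
        exact .inl (h.exists_blowup hx hn hβ z hz)
      · have := h.isOpenImmersion
        obtain ⟨j', hj', hj'β, hz'⟩ := hβ.exists_lift_of_notMem hn.1 j hnj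
        exact .inl ⟨R, i, j', α, u, v, p, q, p', q', ⟨hj', h.isToric, h.det, by
          rw [← Category.assoc, hj'β, h.comp]⟩, hz' z hz⟩
    · have hnj : n ∉ Set.range j := by
        rintro ⟨t, rfl⟩
        exact not_isNode_of_comp_eq_ptY hx j hjπ t hn
      obtain ⟨j', hj', hj'β, hz'⟩ := hβ.exists_lift_of_notMem hn.1 j hnj
      obtain ⟨t, rfl⟩ := hz' z ⟨s, hs⟩
      refine .inr ⟨j', hj', by rw [← Category.assoc, hj'β, hjπ], t, rfl, ?_⟩
      have : j t = j s := by
        rw [hs, ← hj'β]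
        rfl
      rw [j.isOpenEmbedding.injective this]
      exact hXs

end NodeChart

/-! ### The rings `A[s, v, v⁻¹] / (s ^ b v ^ q = x)` -/

section Ray

/-- `R` is the `A`-algebra generated by `s` and an invertible element `v` subject to the relation
`s ^ b * v ^ q = x`. -/
structure IsRay {A R : Type u} [CommRing A] [CommRing R] (α : A →+* R) (x : A) (s v : R)
    (b q : ℕ) : Prop where
  isUnit : IsUnit v
  rel : α x = s ^ b * v ^ q
  existsUnique_lift : ∀ {S : Type u} [CommRing S] (γ : A →+* S) (s' v' : S), IsUnit v' →
    γ x = s' ^ b * v' ^ q → ∃! g : R →+* S, g.comp α = γ ∧ g s = s' ∧ g v = v'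

variable {A R : Type u} [CommRing A] [CommRing R] {α : A →+* R} {x : A} {s v : R} {a b q q' : ℕ}

theorem IsRay.hom_ext (h : IsRay α x s v b q) {S : Type u} [CommRing S] {g g' : R →+* S}
    (hα : g.comp α = g'.comp α) (hs : g s = g' s) (hv : g v = g' v) : g = g' :=
  (h.existsUnique_lift (g'.comp α) (g' s) (g' v) (h.isUnit.map g') (by
    rw [RingHom.comp_apply, h.rel, map_mul, map_pow, map_pow])).unique ⟨hα, hs, hv⟩ ⟨rfl, rfl, rfl⟩

theorem IsRay.exists_lift (h : IsRay α x s v b q) {S : Type u} [CommRing S] (γ : A →+* S)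
    (s' v' : S) (hv : IsUnit v') (hr : γ x = s' ^ b * v' ^ q) :
    ∃ g : R →+* S, g.comp α = γ ∧ g s = s' ∧ g v = v' :=
  (h.existsUnique_lift γ s' v' hv hr).exists

theorem IsRay.exists_ringEquiv (h : IsRay α x s v b q) {R' : Type u} [CommRing R']
    {α' : A →+* R'} {s' v' : R'} (h' : IsRay α' x s' v' b q) :
    ∃ e : R ≃+* R', (e : R →+* R').comp α = α' ∧ e s = s' ∧ e v = v' := by
  obtain ⟨f, hf, hfs, hfv⟩ := h.exists_lift α' s' v' h'.isUnit h'.rel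
  obtain ⟨g, hg, hgs, hgv⟩ := h'.exists_lift α s v h.isUnit h.rel
  refine ⟨RingEquiv.ofRingHom f g (h'.hom_ext ?_ ?_ ?_) (h.hom_ext ?_ ?_ ?_), hf, hfs, hfv⟩
  · rw [RingHom.comp_assoc, hg, hf]; rfl
  · simp [hgs, hfs]
  · simp [hgv, hfv]
  · rw [RingHom.comp_assoc, hf, hg]; rfl
  · simp [hgs, hfs]
  · simp [hgv, hfv]

theorem IsToric.isRay (h : IsToric α x s v b q) (R' : Type u) [CommRing R'] [Algebra R R']
    [IsLocalization.Away v R'] :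
    IsRay ((algebraMap R R').comp α) x (algebraMap R R' s) (algebraMap R R' v) b q where
  isUnit := IsLocalization.Away.algebraMap_isUnit v
  rel := by rw [RingHom.comp_apply, h.rel, map_mul, map_pow, map_pow]
  existsUnique_lift γ s' v' hv hr := by
    obtain ⟨g, hg, hgs, hgv⟩ := h.exists_lift γ s' v' hr
    refine ⟨IsLocalization.Away.lift v (g := g) (hgv ▸ hv), ⟨?_, ?_, ?_⟩, ?_⟩
    · rw [← RingHom.comp_assoc, IsLocalization.Away.lift_comp, hg]
    · rw [IsLocalization.Away.lift_eq, hgs]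
    · rw [IsLocalization.Away.lift_eq, hgv]
    · rintro f ⟨hf, hfs, hfv⟩
      refine IsLocalization.ringHom_ext (Submonoid.powers v) ?_
      rw [IsLocalization.Away.lift_comp]
      refine h.hom_ext ?_ ?_ ?_
      · rw [RingHom.comp_assoc, hf, hg]
      · rw [RingHom.comp_apply, hfs, hgs]
      · rw [RingHom.comp_apply, hfv, hgv]

/-- Change of the coordinates of a ray chart. -/
theorem IsRay.exists_normalize {p p' : ℕ} (h : IsRay α x s v b p) (hb : 0 < b) (hab : a.Coprime b)
    (hq : b * q' = a * q + 1) (hp : b * p' = a * p + 1 ∨ a * p = b * p' + 1) :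
    ∃ t w : R, IsRay α x t w b q ∧ t ^ a * w ^ q' = s ^ a * v ^ p' := by
  -- With `ε = b p' - a p = ±1`, coprimality yields an integer `k` with `p - ε q = b k` and `p' - ε
  -- q' = a k`. The new coordinates are `t = s v ^ k` and `w = v ^ ε`; the exponents may be negative
  -- because `v` is a unit.
  obtain ⟨ε, hε, hε1⟩ : ∃ ε : ℤ, ε * ε = 1 ∧ (b * p' - a * p : ℤ) = ε := by
    rcases hp with hp | hp
    · exact ⟨1, by norm_num, by zify at hp; linarith⟩
    · exact ⟨-1, by norm_num, by zify at hp; linarith⟩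
  zify at hq
  have h1 : (b * (p' - ε * q') : ℤ) = a * (p - ε * q) := by linear_combination hε1 - ε * hq
  obtain ⟨k, hk⟩ : (b : ℤ) ∣ (p - ε * q) := by
    have : IsCoprime (b : ℤ) a := Nat.isCoprime_iff_coprime.mpr hab.symm
    exact this.dvd_of_dvd_mul_left ⟨_, h1.symm⟩
  have hk' : (p' - ε * q' : ℤ) = a * k := by
    rw [hk] at h1
    refine mul_left_cancel₀ (a := (b : ℤ)) (by exact_mod_cast hb.ne') ?_
    linear_combination h1
  obtain ⟨V, rfl⟩ := h.isUnit
  have key : ∀ {S : Type u} [CommRing S] (T : S) (U : Sˣ) (c : ℕ) (m n e : ℤ), m + c * n = e →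
      (T * ((U ^ n : Sˣ) : S)) ^ c * ((U ^ m : Sˣ) : S) = T ^ c * ((U ^ e : Sˣ) : S) := by
    intro S _ T U c m n e he
    rw [mul_pow, mul_assoc, ← Units.val_pow_eq_pow_val, ← Units.val_mul, ← zpow_natCast,
      ← zpow_mul, ← zpow_add, ← he, show n * c + m = m + c * n by ring]
  have hnat : ∀ {S : Type u} [CommRing S] (U : Sˣ) (m : ℤ) (n : ℕ),
      ((U ^ m : Sˣ) : S) ^ n = ((U ^ (m * n) : Sˣ) : S) := by
    intro S _ U m n
    rw [← Units.val_pow_eq_pow_val, ← zpow_natCast, ← zpow_mul]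
  have hnat1 : ∀ {S : Type u} [CommRing S] (U : Sˣ) (n : ℕ),
      (U : S) ^ n = ((U ^ (n : ℤ) : Sˣ) : S) := by
    intro S _ U n
    rw [← Units.val_pow_eq_pow_val, ← zpow_natCast]
  refine ⟨s * ((V ^ k : Rˣ) : R), ((V ^ ε : Rˣ) : R), ⟨Units.isUnit _, ?_, ?_⟩, ?_⟩
  · rw [h.rel, hnat, hnat1, key s V b _ _ (p : ℤ) (by linear_combination -hk)]
  · intro S _ γ t' w' hw' hr
    obtain ⟨U, rfl⟩ := hw'
    have hmap : ∀ (f : R →+* S) (W : Sˣ), f V = W → ∀ m : ℤ, f ((V ^ m : Rˣ) : R) = ((W ^ m : Sˣ) : S) := by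
      intro f W hf m
      have : Units.map (f : R →* S) V = W := Units.ext hf
      rw [← this, ← map_zpow]
      rfl
    obtain ⟨g, ⟨hg, hgs, hgv⟩, hgu⟩ := h.existsUnique_lift γ (t' * ((U ^ (-(ε * k)) : Sˣ) : S))
      ((U ^ ε : Sˣ) : S) (Units.isUnit _) (by
        rw [hr, hnat, key t' U b _ _ (q : ℤ) (by linear_combination ε * hk + q * hε), hnat1])
    refine ⟨g, ⟨hg, ?_, ?_⟩, ?_⟩
    · rw [map_mul, hgs, hmap g _ hgv, mul_assoc, ← Units.val_mul, ← zpow_mul, ← zpow_add]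
      simp
    · rw [hmap g _ hgv, ← zpow_mul, hε, zpow_one]
    · rintro f ⟨hf, hfs, hfv⟩
      have hfV : f V = ((U ^ ε : Sˣ) : S) := by
        have h2 := Units.map (f : R →* S) V
        have h3 : Units.map (f : R →* S) V ^ ε = U := by
          refine Units.ext ?_
          rw [← map_zpow]
          exact hfv
        rw [← h3, ← zpow_mul, hε, zpow_one]
        rfl
      refine hgu f ⟨hf, ?_, hfV⟩
      rw [map_mul, hmap f _ hfV] at hfs
      rw [← hfs, mul_assoc, ← Units.val_mul, ← zpow_mul, ← zpow_add]
      simp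
  · rw [hnat, key s V a _ _ (p' : ℤ) (by linear_combination -hk'), hnat1]

end Ray

/-! ### Pulling back the function `x ^ a / y ^ b` -/

section Pullback

variable {A B : Type u} [CommRing A] [CommRing B] {X : Scheme.{u}} {π : X ⟶ P1 A}

theorem ι_appLE_eq {S : Scheme.{u}} (m : S ⟶ X) {V : X.Opens} (hV : ⊤ ≤ m ⁻¹ᵁ V) {O : S.Opens}
    (hO : O ≤ m ⁻¹ᵁ V) (r : Γ(X, V)) :
    (S.presheaf.map (homOfLE (le_top : O ≤ ⊤)).op).hom ((m.appLE V ⊤ hV).hom r) =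
      (m.appLE V O hO).hom r :=
  congrArg (fun g ↦ (CommRingCat.Hom.hom g) r)
    (Scheme.Hom.appLE_map m hV (homOfLE (le_top : O ≤ ⊤)).op)

theorem RepresentsMonomial.appLE_eq {x : A} {a b : ℕ} {V : X.Opens} {r : Γ(X, V)} [IsLocalRing A]
    (h : RepresentsMonomial π x a b V r) {S : Scheme.{u}} (m : S ⟶ X) {O : S.Opens}
    (hO : O ≤ m ⁻¹ᵁ V) (hO' : O ≤ (m ≫ π) ⁻¹ᵁ opY A) :
    (m.appLE V O hO).hom r = ((m ≫ π).appLE (opY A) O hO').hom (monomialSection x a b) := by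
  have hO'' : O ≤ m ⁻¹ᵁ (π ⁻¹ᵁ opY A) := hO'
  have hi : O ≤ m ⁻¹ᵁ (V ⊓ π ⁻¹ᵁ opY A) := fun o ho ↦ ⟨hO ho, hO' ho⟩
  have h1 := congrArg (fun g ↦ (CommRingCat.Hom.hom g) r)
    (Scheme.Hom.map_appLE m hi (homOfLE (inf_le_left : V ⊓ π ⁻¹ᵁ opY A ≤ V)).op)
  have h2 := congrArg (fun g ↦ (CommRingCat.Hom.hom g) ((π.app (opY A)).hom (monomialSection x a b)))
    (Scheme.Hom.map_appLE m hi (homOfLE (inf_le_right : V ⊓ π ⁻¹ᵁ opY A ≤ π ⁻¹ᵁ opY A)).op)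
  have h3 : (π.app (opY A) ≫ m.appLE (π ⁻¹ᵁ opY A) O hO'') = (m ≫ π).appLE (opY A) O hO' := by
    rw [← Scheme.Hom.appLE_comp_appLE m π (opY A) (π ⁻¹ᵁ opY A) O le_rfl hO'',
      Scheme.Hom.appLE_eq_app]
  have h4 := congrArg (fun g ↦ (CommRingCat.Hom.hom g) (monomialSection x a b)) h3
  refine h1.symm.trans ((congrArg (m.appLE (V ⊓ π ⁻¹ᵁ opY A) O hi).hom h).trans (h2.trans h4))

/-- The identity holds on the open subset `c 0 ≠ 0`, where `x ^ a / y ^ b` is defined by its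
formula. That subset is nonempty and `B` is a domain, so the identity holds everywhere. -/
theorem RepresentsMonomial.exists_pullback {x : A} {a b : ℕ} {V : X.Opens} {r : Γ(X, V)}
    [IsLocalRing A] [IsDomain B] (h : RepresentsMonomial π x a b V r)
    (m : Spec (CommRingCat.of B) ⟶ X) (hV : ⊤ ≤ m ⁻¹ᵁ V) {α : A →+* B} {c : Fin 2 → B} {i : Fin 2}
    {hi : c i = 1} (hm : m ≫ π = pt α c i hi) (hc : c 0 ≠ 0) :
    ∃ w : B, (IsUnit r → IsUnit w) ∧ w * c 0 ^ b = α x ^ a * c 1 ^ b := by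
  let e := Scheme.ΓSpecIso (CommRingCat.of B)
  refine ⟨e.hom.hom ((m.appLE V ⊤ hV).hom r), fun hr ↦ (hr.map _).map _, ?_⟩
  have hinv : ∀ z, e.inv.hom (e.hom.hom z) = z :=
    fun z ↦ e.commRingCatIsoToRingEquiv.symm_apply_apply z
  refine ΓSpecIso_inv_injective ?_
  rw [map_mul, map_pow, map_mul, map_pow, map_pow]
  refine (congrArg (· * _) (hinv _)).trans ?_
  set O : (Spec (CommRingCat.of B)).Opens := (pt α c i hi) ⁻¹ᵁ opY A
  have hO : O = PrimeSpectrum.basicOpen (c 0) := pt_preimage α c i hi 0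
  have hne : Nonempty O := by
    refine ⟨⟨⟨⊥, Ideal.isPrime_bot⟩, ?_⟩⟩
    rw [hO]
    exact hc
  refine map_injective_of_isIntegral _ (homOfLE (le_top : O ≤ ⊤)) ?_
  have h1 := homogP1_monomialSection (Spec.map (CommRingCat.ofHom α))
    (fun j ↦ (Scheme.ΓSpecIso (CommRingCat.of B)).inv.hom (c j)) i (by rw [hi, map_one]) x a b O le_rfl
  have hO' : O ≤ (m ≫ π) ⁻¹ᵁ opY A := by rw [hm]
  have h2 := h.appLE_eq m (le_top.trans hV) hO'
  have h3 := h2.trans (appLE_congr_hom hm hO' le_rfl (monomialSection x a b))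
  have h4 := ι_appLE_eq m hV (le_top.trans hV : O ≤ _) r
  rw [map_mul, map_pow]
  refine (congrArg (· * _) (h4.trans h3)).trans (h1.trans ?_)
  rw [sectionsMap_SpecMap]
  rfl

end Pullback

/-! ### The locus where `x ^ a / y ^ b` is invertible -/

section RayChart

variable {A : Type u} [CommRing A]

/-- A chart of a nodal blowup with coordinates `s` and `v`, where `v` is invertible, in which
`x = s ^ b * v ^ q` and `y = s ^ a * v ^ q'`. -/
structure IsRayChart {X : Scheme.{u}} (π : X ⟶ P1 A) (x : A) {R : Type u} [CommRing R]
    (j : Spec (CommRingCat.of R) ⟶ X) (α : A →+* R) (s v : R) (a b q q' : ℕ) : Prop where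
  isOpenImmersion : IsOpenImmersion j
  isRay : IsRay α x s v b q
  isDomain : IsDomain R
  ne_zero : α x ≠ 0
  comp : j ≫ π = ptZ α (s ^ a * v ^ q')

theorem pow_eq_of_prime {R : Type*} [CommRing R] [IsDomain R] {u v N M : R} (hu : Prime u)
    (huv : ¬ u ∣ v) (hN : ¬ u ∣ N) (hM : ¬ u ∣ M) {i k l m : ℕ}
    (h : N * (u ^ i * v ^ k) = M * (u ^ l * v ^ m)) : i = l ∧ N * v ^ k = M * v ^ m := by
  have key : ∀ {N M : R} {i k l m : ℕ}, ¬ u ∣ N → N * (u ^ i * v ^ k) = M * (u ^ l * v ^ m) →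
      ¬ i < l := by
    intro N M i k l m hN h hil
    obtain ⟨d, rfl⟩ := Nat.exists_eq_add_of_lt hil
    have h1 : N * v ^ k = u * (M * u ^ d * v ^ m) := by
      refine mul_left_cancel₀ (pow_ne_zero i hu.ne_zero) ?_
      linear_combination h
    rcases hu.dvd_or_dvd (Dvd.intro _ h1.symm) with hd | hd
    · exact hN hd
    · exact huv (hu.dvd_of_dvd_pow hd)
  have hil : i = l := le_antisymm (not_lt.mp (key hM h.symm)) (not_lt.mp (key hN h))
  subst hil
  refine ⟨rfl, mul_left_cancel₀ (pow_ne_zero i hu.ne_zero) ?_⟩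
  linear_combination h

/-- The determinant condition makes `p` and `p'` coprime, so `p' / p` and `a / b` are equal
fractions in lowest terms. -/
theorem eq_of_mul_eq_mul {a b p p' q q' : ℕ} (hb : 0 < b) (hab : a.Coprime b)
    (hdet : p * q' + 1 = p' * q ∨ p' * q + 1 = p * q') (h : p' * b = p * a) : p = b ∧ p' = a := by
  have hc : p.Coprime p' := by
    rw [← Nat.isCoprime_iff_coprime]
    rcases hdet with h | h
    · exact ⟨-q', q, by zify at h; linear_combination -h⟩
    · exact ⟨q', -q, by zify at h; linear_combination -h⟩
  have h1 : p ∣ b := hc.dvd_of_dvd_mul_left ⟨a, h⟩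
  have h2 : b ∣ p := hab.symm.dvd_of_dvd_mul_right ⟨p', by rw [← h, mul_comm]⟩
  obtain rfl := Nat.dvd_antisymm h1 h2
  exact ⟨rfl, Nat.eq_of_mul_eq_mul_left hb (by rw [mul_comm, h])⟩

theorem mem_unitLocus [IsLocalRing A] {X : Scheme.{u}} {π : X ⟶ P1 A} {x : A} {a b : ℕ} {z : X} :
    z ∈ unitLocus π x a b ↔
      ∃ (V : X.Opens) (r : Γ(X, V)), IsUnit r ∧ RepresentsMonomial π x a b V r ∧ z ∈ V := by
  rw [unitLocus, Opens.mem_sSup]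
  constructor
  · rintro ⟨V, ⟨r, hr, hr'⟩, hz⟩
    exact ⟨V, r, hr, hr', hz⟩
  · rintro ⟨V, r, hr, hr', hz⟩
    exact ⟨V, ⟨r, hr, hr'⟩, hz⟩

variable {X : Scheme.{u}} {π : X ⟶ P1 A} {x : A} {a b : ℕ} {R : Type u} [CommRing R]

/-- The order of vanishing of `x ^ a / y ^ b` at a point of the unit locus, in terms of a chart. -/
theorem exists_mul_eq_of_mem_unitLocus [IsLocalRing A] [IsDomain R]
    (j : Spec (CommRingCat.of R) ⟶ X) {α : A →+* R} {c : Fin 2 → R} {i : Fin 2}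
    {hi : c i = 1} (hj : j ≫ π = pt α c i hi) (hc : c 0 ≠ 0) {s : Spec (CommRingCat.of R)}
    (hs : j s ∈ unitLocus π x a b) :
    ∃ N M : R, N ∉ s.asIdeal ∧ M ∉ s.asIdeal ∧ N * c 0 ^ b = M * (α x ^ a * c 1 ^ b) := by
  obtain ⟨V, r, hr, hrep, hsV⟩ := mem_unitLocus.mp hs
  let P : Ideal R := s.asIdeal
  have hP : P.IsPrime := s.2
  let B := Localization.AtPrime P
  have hinj : Function.Injective (algebraMap R B) :=
    IsLocalization.injective B P.primeCompl_le_nonZeroDivisors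
  have : IsDomain B := IsLocalization.isDomain_of_le_nonZeroDivisors B P.primeCompl_le_nonZeroDivisors
  let m : Spec (CommRingCat.of B) ⟶ X := Spec.map (CommRingCat.ofHom (algebraMap R B)) ≫ j
  have hV : ⊤ ≤ m ⁻¹ᵁ V := by
    intro t _
    have h1 : (Spec.map (CommRingCat.ofHom (algebraMap R B))) t ⤳ s := by
      refine (PrimeSpectrum.le_iff_specializes (PrimeSpectrum.comap (algebraMap R B) t) s).mp ?_
      intro z hz
      by_contra hzs
      exact t.2.ne_top (Ideal.eq_top_of_isUnit_mem _ hz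
        (IsLocalization.map_units B (⟨z, hzs⟩ : P.primeCompl)))
    exact (h1.map j.continuous).mem_open V.2 hsV
  have hm : m ≫ π = pt ((algebraMap R B).comp α) (fun i ↦ algebraMap R B (c i)) i
      (by rw [hi, map_one]) := by
    rw [Category.assoc, hj, SpecMap_pt]
  obtain ⟨w, hw, hw'⟩ := hrep.exists_pullback m hV hm
    (by rwa [ne_eq, map_eq_zero_iff _ hinj])
  obtain ⟨N, M, rfl⟩ := IsLocalization.exists_mk'_eq P.primeCompl w
  have hN := (IsLocalization.AtPrime.isUnit_mk'_iff B P N M).mp (hw hr)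
  refine ⟨N, M, hN, M.2, hinj ?_⟩
  have h2 : IsLocalization.mk' B N M * algebraMap R B M = algebraMap R B N :=
    IsLocalization.mk'_spec _ _ _
  simp only [map_mul, map_pow] at hw' ⊢
  rw [← h2, mul_right_comm, hw', RingHom.comp_apply, mul_comm]

variable [IsDomain A] [IsDiscreteValuationRing A] {q q' : ℕ}

/-- In the chart, `x ^ a / y ^ b = u ^ (p a - p' b) v ^ (r a - r' b)`. Since it is invertible at a
point of `u = 0`, the exponent of `u` is zero, which forces `(p, p') = (b, a)`. The exponent of `v`
is then `±1`, so `v` is invertible at the point and may be inverted; the exponents of `v` are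
afterwards normalized to `q` and `q'`. -/
theorem IsNodeChart.exists_rayChart {j : Spec (CommRingCat.of R) ⟶ X} {α : A →+* R} {u v : R}
    {p r p' r' : ℕ} (h : IsNodeChart π x j α u v p r p' r') (hx : Irreducible x) (hb : 0 < b)
    (hab : a.Coprime b) (hq : b * q' = a * q + 1) {s : Spec (CommRingCat.of R)}
    (hs : j s ∈ unitLocus π x a b) (hu : u ∈ s.asIdeal) (hp : p ≠ 0) :
    ∃ (R' : Type u) (_ : CommRing R') (j' : Spec (CommRingCat.of R') ⟶ X) (α' : A →+* R')
      (t w : R'), IsRayChart π x j' α' t w a b q q' ∧ j s ∈ Set.range j' := by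
  have hdom := h.isToric.isDomain hx h.ne_zero
  have hup := h.isToric.prime hx hp
  have huv := h.isToric.not_dvd hx hp
  have hv0 : v ≠ 0 := fun h0 ↦ huv (h0 ▸ dvd_zero u)
  have hj := h.isOpenImmersion
  obtain ⟨N, M, hN, hM, hNM⟩ := exists_mul_eq_of_mem_unitLocus j h.comp
    (mul_ne_zero (pow_ne_zero p' hup.ne_zero) (pow_ne_zero r' hv0)) hs
  have hdvd : ∀ z, z ∉ s.asIdeal → ¬ u ∣ z := fun z hz hd ↦ hz (Ideal.mem_of_dvd _ hd hu)
  have hNM' : N * (u ^ (p' * b) * v ^ (r' * b)) = M * (u ^ (p * a) * v ^ (r * a)) := by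
    have h1 : N * (u ^ p' * v ^ r') ^ b = M * ((α x) ^ a * 1 ^ b) := hNM
    rw [h.isToric.rel, one_pow, mul_one, mul_pow, mul_pow, ← pow_mul, ← pow_mul, ← pow_mul,
      ← pow_mul] at h1
    exact h1
  obtain ⟨h1, h2⟩ := pow_eq_of_prime hup huv (hdvd N hN) (hdvd M hM) hNM'
  obtain ⟨rfl, rfl⟩ := eq_of_mul_eq_mul hb hab h.det h1
  have hdet := h.det
  have hv : v ∉ s.asIdeal := by
    intro hv
    rcases hdet with hd | hd
    · rw [mul_comm r p', mul_comm r' p, ← hd, pow_succ] at h2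
      have h3 : N = M * v := mul_right_cancel₀ (pow_ne_zero _ hv0) (h2.trans (by ring))
      exact hN (h3 ▸ Ideal.mul_mem_left _ _ hv)
    · rw [mul_comm r p', mul_comm r' p, ← hd, pow_succ] at h2
      have h3 : N * v = M := mul_right_cancel₀ (pow_ne_zero (p' * r) hv0) (Eq.trans (by ring) h2)
      exact hM (h3 ▸ Ideal.mul_mem_left _ _ hv)
  let R' := Localization.Away v
  have hinj : Function.Injective (algebraMap R R') := IsLocalization.injective R'
    (powers_le_nonZeroDivisors_of_noZeroDivisors hv0)
  have hray := h.isToric.isRay R'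
  obtain ⟨t, w, htw, hy⟩ := hray.exists_normalize hb hab hq (p' := r') (by omega)
  have hopen : IsOpenImmersion (Spec.map (CommRingCat.ofHom (algebraMap R R'))) :=
    IsOpenImmersion.of_isLocalization v
  refine ⟨R', inferInstance, Spec.map (CommRingCat.ofHom (algebraMap R R')) ≫ j, _, t, w,
    ⟨inferInstance, htw, IsLocalization.isDomain_of_le_nonZeroDivisors R'
      (powers_le_nonZeroDivisors_of_noZeroDivisors hv0), ?_, ?_⟩, ?_⟩
  · rw [RingHom.comp_apply, ne_eq, map_eq_zero_iff _ hinj,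
      map_eq_zero_iff _ (h.isToric.injective h.ne_zero)]
    exact hx.ne_zero
  · rw [Category.assoc, h.comp, SpecMap_ptZ, hy, map_mul, map_pow, map_pow]
  · have h3 : s ∈ Set.range (PrimeSpectrum.comap (algebraMap R R')) := by
      rw [PrimeSpectrum.localization_away_comap_range R' v]
      exact hv
    obtain ⟨t, rfl⟩ := h3
    exact ⟨t, rfl⟩

theorem IsNodalBlowup.exists_rayChart (hπ : IsNodalBlowup π) (hx : Irreducible x) (hb : 0 < b)
    (hab : a.Coprime b) (hq : b * q' = a * q + 1) {z : X} (hz : z ∈ unitLocus π x a b)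
    (hzF : z ∈ specialFibre π) :
    ∃ (R : Type u) (_ : CommRing R) (j : Spec (CommRingCat.of R) ⟶ X) (α : A →+* R)
      (s v : R), IsRayChart π x j α s v a b q q' ∧ z ∈ Set.range j := by
  rcases hπ.exists_chart hx z with ⟨R, _, j, α, u, v, p, r, p', r', h, s, rfl⟩ |
    ⟨j, hj, hjπ, s, rfl, hs⟩
  · have hxs := (apply_mem_specialFibre_iff hx h.comp_toBase s).mp hzF
    rw [h.isToric.rel] at hxs
    have key : ∀ {w : R} {m : ℕ}, w ^ m ∈ s.asIdeal → w ∈ s.asIdeal ∧ m ≠ 0 := by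
      intro w m hw
      refine ⟨s.2.mem_of_pow_mem _ hw, ?_⟩
      rintro rfl
      exact s.2.ne_top ((Ideal.eq_top_iff_one _).mpr (by simpa using hw))
    rcases s.2.mem_or_mem hxs with hu | hv
    · exact h.exists_rayChart hx hb hab hq hz (key hu).1 (key hu).2
    · exact h.swap.exists_rayChart hx hb hab hq hz (key hv).1 (key hv).2
  -- At a point with `y = ∞` the function is `x ^ a (1 / y) ^ b`, which vanishes because `b > 0`.
  · obtain ⟨N, M, hN, hM, hNM⟩ := exists_mul_eq_of_mem_unitLocus j hjπ
      (one_ne_zero : (1 : Polynomial A) ≠ 0) hz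
    have hNM' : N * 1 ^ b = M * (Polynomial.C x ^ a * Polynomial.X ^ b) := hNM
    rw [one_pow, mul_one] at hNM'
    exact absurd (hNM' ▸ Ideal.mul_mem_left _ _ (Ideal.mul_mem_left _ _
      (Ideal.pow_mem_of_mem _ hs _ hb))) hN

/-- The coordinate rings are isomorphic over `A` compatibly with `y`, and morphisms to a nodal
blowup from an integral scheme not contained in the special fibre are determined on the projective
line. So a single ray chart accounts for the whole special fibre of `U_r`. -/
theorem IsRayChart.range_eq {R' : Type u} [CommRing R'] {j : Spec (CommRingCat.of R) ⟶ X}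
    {α : A →+* R} {s v : R} {j' : Spec (CommRingCat.of R') ⟶ X} {α' : A →+* R'} {s' v' : R'}
    (h : IsRayChart π x j α s v a b q q') (h' : IsRayChart π x j' α' s' v' a b q q')
    (hπ : IsNodalBlowup π) (hx : Irreducible x) : Set.range j = Set.range j' := by
  have key : ∀ {R R' : Type u} [CommRing R] [CommRing R'] {j : Spec (CommRingCat.of R) ⟶ X}
      {α : A →+* R} {s v : R} {j' : Spec (CommRingCat.of R') ⟶ X} {α' : A →+* R'} {s' v' : R'}
      (h : IsRayChart π x j α s v a b q q') (h' : IsRayChart π x j' α' s' v' a b q q'),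
      Set.range j ⊆ Set.range j' := by
    intro R R' _ _ j α s v j' α' s' v' h h'
    obtain ⟨e, he, hes, hev⟩ := h'.isRay.exists_ringEquiv h.isRay
    have := h.isDomain
    have h1 : Spec.map (CommRingCat.ofHom (e : R' →+* R)) ≫ j' = j := by
      refine hπ.hom_ext hx ?_ ⟨⊥, Ideal.isPrime_bot⟩ ?_
      · rw [Category.assoc, h'.comp, h.comp, SpecMap_ptZ, he]
        congr 1
        simp [hes, hev]
      · have h2 : (Spec.map (CommRingCat.ofHom (e : R' →+* R)) ≫ j') ≫ π ≫ P1.toBase A =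
            Spec.map (CommRingCat.ofHom α) := by
          rw [Category.assoc, ← Category.assoc j', h'.comp, pt_toBase, ← Spec.map_comp,
            ← CommRingCat.ofHom_comp, he]
        rw [h2]
        exact fun hc ↦ h.ne_zero ((SpecMap_eq_closedPoint_iff hx α _).mp hc)
    rw [← h1]
    rintro _ ⟨t, rfl⟩
    exact ⟨_, rfl⟩
  exact subset_antisymm (key h h') (key h' h)

end RayChart

section Structure

variable {A : Type u} [CommRing A] [IsDomain A] [IsDiscreteValuationRing A] {X : Scheme.{u}}
  {π : X ⟶ P1 A} {x : A} {a b q q' : ℕ} {R : Type u} [CommRing R]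

theorem IsRayChart.comp_toBase {j : Spec (CommRingCat.of R) ⟶ X} {α : A →+* R} {s v : R}
    (h : IsRayChart π x j α s v a b q q') :
    j ≫ π ≫ P1.toBase A = Spec.map (CommRingCat.ofHom α) := by
  rw [← Category.assoc, h.comp, pt_toBase]

/-- On a ray chart, `x ^ a / y ^ b` is an invertible function. -/
theorem IsRayChart.mem_unitLocus {j : Spec (CommRingCat.of R) ⟶ X} {α : A →+* R} {s v : R}
    (h : IsRayChart π x j α s v a b q q') (hq : b * q' = a * q + 1) (t : Spec (CommRingCat.of R)) :
    j t ∈ unitLocus π x a b := by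
  have hj := h.isOpenImmersion
  obtain ⟨W, hW, ε, hWj, hε⟩ := exists_ringEquiv_fromSpec j
  obtain ⟨w, hw⟩ := h.isRay.isUnit.exists_right_inv
  have hWt : ⊤ ≤ j ⁻¹ᵁ W := by
    rw [hWj]
    rintro t -
    exact ⟨t, rfl⟩
  -- The section is `w = v⁻¹`, because `x ^ a / y ^ b = v ^ (a q - b q') = v⁻¹`.
  refine NodalBlowup.mem_unitLocus.mpr ⟨W, ε.symm w, (IsUnit.of_mul_eq_one_right _ hw).map ε.symm,
    ?_, hWt (trivial : t ∈ ⊤)⟩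
  set c : Fin 2 → R := ![s ^ a * v ^ q', 1]
  set c₀ := (Scheme.ΓSpecIso (CommRingCat.of R)).inv.hom (c 0)
  set O : (Spec (CommRingCat.of R)).Opens := (Spec (CommRingCat.of R)).basicOpen c₀
  have hjO : j ⁻¹ᵁ (W ⊓ π ⁻¹ᵁ opY A) = O := by
    have h1 : (j ≫ π) ⁻¹ᵁ opY A = O := by
      rw [h.comp]
      exact homogP1_preimage _ _ _ _ 0
    rw [← h1]
    ext z
    exact ⟨fun hz ↦ hz.2, fun hz ↦ ⟨hWt (trivial : z ∈ ⊤), hz⟩⟩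
  have hiso := j.isIso_app (W ⊓ π ⁻¹ᵁ opY A) (hWj ▸ inf_le_left)
  have hinj : Function.Injective (j.app (W ⊓ π ⁻¹ᵁ opY A)).hom :=
    (ConcreteCategory.bijective_of_isIso (j.app (W ⊓ π ⁻¹ᵁ opY A))).1
  have hinj' : Function.Injective (j.appLE (W ⊓ π ⁻¹ᵁ opY A) O hjO.ge).hom := by
    have : ∀ (O' : (Spec (CommRingCat.of R)).Opens) (e : j ⁻¹ᵁ (W ⊓ π ⁻¹ᵁ opY A) = O'),
        Function.Injective (j.appLE (W ⊓ π ⁻¹ᵁ opY A) O' e.ge).hom := by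
      rintro _ rfl
      rw [Scheme.Hom.appLE_eq_app]
      exact hinj
    exact this O hjO
  refine hinj' ?_
  have h1 := congrArg (fun g ↦ (CommRingCat.Hom.hom g) (ε.symm w))
    (Scheme.Hom.map_appLE j hjO.ge (homOfLE (inf_le_left : W ⊓ π ⁻¹ᵁ opY A ≤ W)).op)
  have h2 := congrArg (fun g ↦ (CommRingCat.Hom.hom g) ((π.app (opY A)).hom (monomialSection x a b)))
    (Scheme.Hom.map_appLE j hjO.ge (homOfLE (inf_le_right : W ⊓ π ⁻¹ᵁ opY A ≤ π ⁻¹ᵁ opY A)).op)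
  have hO'' : O ≤ j ⁻¹ᵁ (π ⁻¹ᵁ opY A) := hjO.ge.trans fun z hz ↦ hz.2
  have h3 : (π.app (opY A) ≫ j.appLE (π ⁻¹ᵁ opY A) O hO'') = (j ≫ π).appLE (opY A) O hO'' := by
    rw [← Scheme.Hom.appLE_comp_appLE j π (opY A) (π ⁻¹ᵁ opY A) O le_rfl hO'',
      Scheme.Hom.appLE_eq_app]
  have h4 := congrArg (fun g ↦ (CommRingCat.Hom.hom g) (monomialSection x a b)) h3
  refine h1.trans (Eq.trans ?_ (h2.trans h4).symm)
  have hO3 : O ≤ ptZ α (s ^ a * v ^ q') ⁻¹ᵁ opY A := by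
    have : ptZ α (s ^ a * v ^ q') ⁻¹ᵁ opY A = O := homogP1_preimage _ _ _ _ 0
    exact this.ge
  have h5 := appLE_congr_hom h.comp hO'' hO3 (monomialSection x a b)
  refine Eq.trans ?_ h5.symm
  have h6 := homogP1_monomialSection (Spec.map (CommRingCat.ofHom α))
    (fun j ↦ (Scheme.ΓSpecIso (CommRingCat.of R)).inv.hom (c j)) 1 (map_one _) x a b O hO3
  have hu : IsUnit (((Spec (CommRingCat.of R)).presheaf.map (homOfLE (le_top : O ≤ ⊤)).op).hom c₀) :=
    RingedSpace.isUnit_res_basicOpen _ c₀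
  refine (hu.pow b).mul_right_cancel (Eq.trans ?_ h6.symm)
  have e : ⊤ ≤ (Spec.map (CommRingCat.ofHom (ε : Γ(X, W) →+* R)) ≫ hW.fromSpec) ⁻¹ᵁ W :=
    fromSpec_preimage hW _
  have h7 : (j.appLE W ⊤ hWt).hom (ε.symm w) =
      (Scheme.ΓSpecIso (CommRingCat.of R)).inv.hom w := by
    refine (appLE_congr_hom hε.symm hWt e (ε.symm w)).trans ?_
    refine (congrArg (fun g ↦ g (ε.symm w)) ((appLE_eq_sectionsMap hW _ e).trans
      (sectionsMap_SpecMap (ε : Γ(X, W) →+* R)))).trans ?_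
    exact congrArg (Scheme.ΓSpecIso (CommRingCat.of R)).inv.hom (ε.apply_symm_apply w)
  have h8 := ι_appLE_eq j hWt (O := O) (le_top.trans hWt) (ε.symm w)
  refine (congrArg (· * _) (h8.symm.trans (congrArg _ h7))).trans ?_
  have h9 : w * c 0 ^ b = α x ^ a * c 1 ^ b := by
    change w * (s ^ a * v ^ q') ^ b = α x ^ a * 1 ^ b
    have h10 : v ^ (b * q') = v ^ (a * q + 1) := by rw [hq]
    rw [h.isRay.rel]
    rw [pow_succ] at h10
    calc w * (s ^ a * v ^ q') ^ b = w * s ^ (a * b) * v ^ (b * q') := by ring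
      _ = (s ^ b * v ^ q) ^ a * (v * w) := by rw [h10]; ring
      _ = _ := by rw [hw]; ring
  rw [sectionsMap_SpecMap]
  have h11 := congrArg (fun z ↦ ((Spec (CommRingCat.of R)).presheaf.map (homOfLE (le_top : O ≤ ⊤)).op).hom
    ((Scheme.ΓSpecIso (CommRingCat.of R)).inv.hom z)) h9
  simp only [map_mul, map_pow] at h11 ⊢
  exact h11

end Structure

/-! ### The line `ℓ_r` and the structure of `U_r` -/

section HasLine

variable {A : Type u} [CommRing A] [IsDomain A] [IsDiscreteValuationRing A] {X : Scheme.{u}}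
  {π : X ⟶ P1 A} {x : A} {a b q q' : ℕ} {R : Type u} [CommRing R]

/-- The function field of a line is not generated by constants. -/
theorem IsToric.exists_forall_sub_notMem {α : A →+* R} {u v : R} {p r : ℕ}
    (h : IsToric α x u v p r) (hx : Irreducible x) (j : Spec (CommRingCat.of R) ⟶ X)
    [IsOpenImmersion j] (hj : j ≫ π ≫ P1.toBase A = Spec.map (CommRingCat.ofHom α))
    {s : Spec (CommRingCat.of R)} {L : Set X} (hL : IsLine π L) (hs : IsGenericPoint (j s) L) :
    ∃ w : R, ∀ c : A, w - α c ∉ s.asIdeal := by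
  have hsF : j s ∈ specialFibre π := hL.1.2 hs.mem
  have hxs := (apply_mem_specialFibre_iff hx hj s).mp hsF
  rw [h.rel] at hxs
  have key : ∀ {w : R} {m : ℕ}, w ^ m ∈ s.asIdeal → w ∈ s.asIdeal ∧ m ≠ 0 := by
    intro w m hw
    refine ⟨s.2.mem_of_pow_mem _ hw, ?_⟩
    rintro rfl
    exact s.2.ne_top ((Ideal.eq_top_iff_one _).mpr (by simpa using hw))
  have main : ∀ {u v : R} {p r : ℕ}, IsToric α x u v p r → u ∈ s.asIdeal → p ≠ 0 →
      ∃ w : R, ∀ c : A, w - α c ∉ s.asIdeal := by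
    intro u v p r h hu hp
    have hprime := (Ideal.span_singleton_prime (h.ne_zero hx hp)).mpr (h.prime hx hp)
    -- The closure of `η` is irreducible in the special fibre and contains `L`, so it is `L` by
    -- maximality, and `s` and `η` specialize to each other. Modulo `u` the ring embeds in
    -- polynomials over the residue field with `v` as the variable, so `v` is not congruent to a
    -- constant.
    let η : PrimeSpectrum R := ⟨Ideal.span {u}, hprime⟩
    have hηs : j η ⤳ j s := ((PrimeSpectrum.le_iff_specializes η s).mp
      ((Ideal.span_singleton_le_iff_mem (I := s.asIdeal)).mpr hu)).map j.continuous
    have hF : IsClosed (specialFibre π) :=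
      (IsLocalRing.isClosed_singleton_closedPoint A).preimage (π ≫ P1.toBase A).continuous
    have hηF : j η ∈ specialFibre π := by
      refine (apply_mem_specialFibre_iff hx hj η).mpr ?_
      rw [h.rel]
      exact Ideal.mul_mem_right _ _ (Ideal.pow_mem_of_mem _ (Ideal.mem_span_singleton_self u) _
        (Nat.pos_of_ne_zero hp))
    have hLη : L ⊆ closure {j η} := by
      rw [← hs.def]
      exact closure_minimal (Set.singleton_subset_iff.mpr (specializes_iff_mem_closure.mp hηs))
        isClosed_closure
    have hηL : closure {j η} ⊆ L := hL.2 ⟨isIrreducible_singleton.closure,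
      closure_minimal (Set.singleton_subset_iff.mpr hηF) hF⟩ hLη
    have hsη : j s ⤳ j η := by
      rw [specializes_iff_mem_closure, hs.def]
      exact hηL (subset_closure rfl)
    have hle : s.asIdeal ≤ Ideal.span {u} := (PrimeSpectrum.le_iff_specializes s η).mpr
      (j.isOpenEmbedding.toIsInducing.specializes_iff.mp hsη)
    obtain ⟨g, hg, -, hgv, hg0⟩ := h.exists_residue hx hp
    refine ⟨v, fun c hc ↦ ?_⟩
    have h1 := (hg0 _).mpr (Ideal.mem_span_singleton.mp (hle hc))
    rw [map_sub, hgv, hg] at h1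
    exact Polynomial.X_sub_C_ne_zero _ h1
  rcases s.2.mem_or_mem hxs with hu | hv
  · exact main h (key hu).1 (key hu).2
  · exact main h.swap (key hv).1 (key hv).2

theorem IsNodalBlowup.exists_toric_chart (hπ : IsNodalBlowup π) (hx : Irreducible x) (z : X) :
    ∃ (R : Type u) (_ : CommRing R) (j : Spec (CommRingCat.of R) ⟶ X) (_ : IsOpenImmersion j)
      (α : A →+* R) (u v : R) (p r : ℕ), IsToric α x u v p r ∧
        j ≫ π ≫ P1.toBase A = Spec.map (CommRingCat.ofHom α) ∧ z ∈ Set.range j := by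
  rcases hπ.exists_chart hx z with ⟨R, _, j, α, u, v, p, r, p', r', h, hz⟩ |
    ⟨j, hj, hjπ, s, rfl, hs⟩
  · exact ⟨R, _, j, h.isOpenImmersion, α, u, v, p, r, h.isToric, h.comp_toBase, hz⟩
  · exact ⟨_, _, j, hj, Polynomial.C, _, _, _, _, isToric_polynomial x,
      by rw [← Category.assoc, hjπ, pt_toBase], s, rfl⟩

theorem mem_unitLocus_of_ne_zero {ξ : X} {V : X.Opens} (hξ : ξ ∈ V) {u : Γ(X, V)}
    (hrep : RepresentsMonomial π x a b V u) (hu : (X.evaluation V ξ hξ).hom u ≠ 0) :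
    ξ ∈ unitLocus π x a b := by
  have hmem : ξ ∈ X.basicOpen u := (X.evaluation_ne_zero_iff_mem_basicOpen ξ hξ u).mp hu
  refine mem_unitLocus.mpr ⟨X.basicOpen u, (X.presheaf.map (homOfLE (X.basicOpen_le u)).op).hom u,
    RingedSpace.isUnit_res_basicOpen _ u, ?_, hmem⟩
  have h1 := congrArg (X.presheaf.map (homOfLE
    (inf_le_inf_right _ (X.basicOpen_le u) : X.basicOpen u ⊓ π ⁻¹ᵁ opY A ≤ V ⊓ π ⁻¹ᵁ opY A)).op).hom hrep
  have h2 : ∀ {U₁ U₂ U₃ : X.Opens} (i₁ : U₁ ≤ U₂) (i₂ : U₂ ≤ U₃) (z : Γ(X, U₃)),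
      (X.presheaf.map (homOfLE i₁).op).hom ((X.presheaf.map (homOfLE i₂).op).hom z) =
        (X.presheaf.map (homOfLE (i₁.trans i₂)).op).hom z := by
    intro U₁ U₂ U₃ i₁ i₂ z
    have := X.presheaf.map_comp (homOfLE i₂).op (homOfLE i₁).op
    exact (congrArg (fun g ↦ (CommRingCat.Hom.hom g) z) this).symm
  exact (h2 _ _ u).trans ((h2 _ _ u).symm.trans (h1.trans (h2 _ _ _)))

/-- The generic point `ξ` of the line works as soon as the parameter does not vanish there. If it
vanished, it would contribute nothing to the function field, which would then equal the residue
field of `A`; but that field contains a nonconstant function by `exists_forall_sub_notMem`. -/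
theorem IsNodalBlowup.exists_mem_unitLocus (hπ : IsNodalBlowup π) (hx : Irreducible x)
    (hL : HasLine π x a b) : ∃ z ∈ unitLocus π x a b, z ∈ specialFibre π := by
  obtain ⟨L, ξ, V, hξ, u, hL, hgen, hrep, hcl⟩ := hL
  have hξF : ξ ∈ specialFibre π := hL.1.2 hgen.mem
  by_cases hu : (X.evaluation V ξ hξ).hom u = 0
  swap
  · exact ⟨ξ, mem_unitLocus_of_ne_zero hξ hrep hu, hξF⟩
  exfalso
  obtain ⟨R, _, j, hj, α, u', v', p, r, htor, hjst, s, hs⟩ := hπ.exists_toric_chart hx ξ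
  obtain ⟨w, hw⟩ := htor.exists_forall_sub_notMem hx j hjst hL (hs.symm ▸ hgen)
  set st := π ≫ P1.toBase A with hst
  have hle : Set.range (X.fromSpecResidueField ξ) ⊆ Set.range j := by
    rw [Scheme.range_fromSpecResidueField]
    rintro _ rfl
    exact ⟨s, hs⟩
  obtain ⟨f, hf⟩ := Spec.map_surjective (IsOpenImmersion.lift j (X.fromSpecResidueField ξ) hle)
  have hfj : Spec.map f ≫ j = X.fromSpecResidueField ξ := by
    rw [hf, IsOpenImmersion.lift_fac]
  have hker : ∀ z : R, f.hom z = 0 → z ∈ s.asIdeal := by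
    intro z hz
    let o : PrimeSpectrum (X.residueField ξ) := ⟨⊥, Ideal.isPrime_bot⟩
    have h1 : Spec.map f o = s := by
      refine j.isOpenEmbedding.injective (Eq.trans ?_ hs.symm)
      exact (congrArg (fun g : Spec (X.residueField ξ) ⟶ X ↦ g o) hfj).trans
        (Scheme.fromSpecResidueField_apply ξ o)
    rw [← h1]
    exact hz
  have hsurj : ∀ y : X.residueField ξ, ∃ k, (st.residueFieldMap ξ).hom k = y := by
    intro y
    rw [hu] at hcl
    have h1 : y ∈ (st.residueFieldMap ξ).hom.fieldRange := by
      have h2 : Subfield.closure (Set.range (st.residueFieldMap ξ).hom ∪ {0}) ≤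
          (st.residueFieldMap ξ).hom.fieldRange := by
        rw [Subfield.closure_le]
        rintro _ (⟨k, rfl⟩ | rfl)
        · exact ⟨k, rfl⟩
        · exact zero_mem _
      exact h2 (hcl.symm ▸ trivial)
    exact h1
  obtain ⟨k, hk⟩ := hsurj (f.hom w)
  have hmax : (st ξ).asIdeal.IsMaximal := by
    have : st ξ = IsLocalRing.closedPoint A := hξF
    rw [this]
    exact IsLocalRing.maximalIdeal.isMaximal A
  obtain ⟨c, hc⟩ := Ideal.algebraMap_residueField_surjective (st ξ).asIdeal
    ((Scheme.Spec.residueFieldIso (CommRingCat.of A) (st ξ)).hom.hom k)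
  have h1 : CommRingCat.ofHom α ≫ f = CommRingCat.ofHom (algebraMap A (st ξ).asIdeal.ResidueField) ≫
      (Scheme.Spec.residueFieldIso (CommRingCat.of A) (st ξ)).inv ≫ st.residueFieldMap ξ := by
    refine Spec.map_injective ?_
    rw [Spec.map_comp, Spec.map_comp, Spec.map_comp, Category.assoc]
    have h2 := Scheme.Spec.map_residueFieldIso_inv_eq_fromSpecResidueField (CommRingCat.of A) (st ξ)
    refine Eq.trans ?_ (congrArg (Spec.map (st.residueFieldMap ξ) ≫ ·) h2).symm
    dsimp only
    rw [Scheme.Hom.SpecMap_residueFieldMap_fromSpecResidueField, ← hfj, Category.assoc, hjst]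
  have h3 : f.hom (α c) = f.hom w := by
    have h4 := congrArg (fun g ↦ (CommRingCat.Hom.hom g) c) h1
    refine h4.trans ?_
    refine Eq.trans ?_ hk
    have h5 : (Scheme.Spec.residueFieldIso (CommRingCat.of A) (st ξ)).inv.hom
        (algebraMap A (st ξ).asIdeal.ResidueField c) = k := by
      refine (congrArg (Scheme.Spec.residueFieldIso (CommRingCat.of A) (st ξ)).inv.hom hc).trans ?_
      exact (Scheme.Spec.residueFieldIso (CommRingCat.of A) (st ξ)).commRingCatIsoToRingEquiv.symm_apply_apply k
    exact congrArg (st.residueFieldMap ξ).hom h5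
  exact hw c (hker _ (by rw [map_sub, h3, sub_self]))

/-- The structure of `U_r`: the union of a ray chart and the complement of the special fibre. -/
theorem IsNodalBlowup.exists_rayChart_Uopen (hπ : IsNodalBlowup π) (hx : Irreducible x)
    (hL : HasLine π x a b) (hb : 0 < b) (hab : a.Coprime b) (hq : b * q' = a * q + 1) :
    ∃ (R : Type u) (_ : CommRing R) (j : Spec (CommRingCat.of R) ⟶ X) (α : A →+* R)
      (s v : R), IsRayChart π x j α s v a b q q' ∧
      ∀ z, z ∈ Uopen π x a b ↔ z ∈ Set.range j ∨ z ∈ genericPart π := by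
  obtain ⟨z₀, hz₀, hz₀F⟩ := hπ.exists_mem_unitLocus hx hL
  obtain ⟨R, _, j, α, s, v, h, -⟩ := hπ.exists_rayChart hx hb hab hq hz₀ hz₀F
  refine ⟨R, _, j, α, s, v, h, fun z ↦ ⟨fun hz ↦ ?_, ?_⟩⟩
  · by_cases hzF : z ∈ specialFibre π
    · rcases hz with hz | hz
      · obtain ⟨R', _, j', α', s', v', h', hz'⟩ := hπ.exists_rayChart hx hb hab hq hz hzF
        exact .inl (h.range_eq h' hπ hx ▸ hz')
      · exact .inr hz
    · exact .inr hzF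
  · rintro (⟨t, rfl⟩ | hz)
    · exact .inl (h.mem_unitLocus hq t)
    · exact .inr hz

end HasLine

/-! ### Kummer extensions of rings -/

section Kummer

/-- `S` is the `R`-algebra generated by a root `τ` of `T ^ b = w`. -/
structure IsKummer {R S : Type u} [CommRing R] [CommRing S] (f : R →+* S) (w : R) (τ : S)
    (b : ℕ) : Prop where
  rel : τ ^ b = f w
  existsUnique_lift : ∀ {S' : Type u} [CommRing S'] (g : R →+* S') (t : S'), t ^ b = g w →
    ∃! h : S →+* S', h.comp f = g ∧ h τ = t

variable {R S : Type u} [CommRing R] [CommRing S] {f : R →+* S} {w : R} {τ : S} {b : ℕ}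

theorem IsKummer.exists_lift (h : IsKummer f w τ b) {S' : Type u} [CommRing S'] (g : R →+* S')
    (t : S') (ht : t ^ b = g w) : ∃ k : S →+* S', k.comp f = g ∧ k τ = t :=
  (h.existsUnique_lift g t ht).exists

theorem IsKummer.hom_ext (h : IsKummer f w τ b) {S' : Type u} [CommRing S'] {g g' : S →+* S'}
    (hf : g.comp f = g'.comp f) (hτ : g τ = g' τ) : g = g' :=
  (h.existsUnique_lift (g'.comp f) (g' τ) (by rw [← map_pow, h.rel]; rfl)).unique ⟨hf, hτ⟩
    ⟨rfl, rfl⟩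

theorem IsKummer.exists_ringEquiv (h : IsKummer f w τ b) {S' : Type u} [CommRing S']
    {f' : R →+* S'} {τ' : S'} (h' : IsKummer f' w τ' b) :
    ∃ e : S ≃+* S', (e : S →+* S').comp f = f' ∧ e τ = τ' := by
  obtain ⟨g, hg, hgτ⟩ := h.exists_lift f' τ' h'.rel
  obtain ⟨g', hg', hgτ'⟩ := h'.exists_lift f τ h.rel
  refine ⟨RingEquiv.ofRingHom g g' (h'.hom_ext ?_ ?_) (h.hom_ext ?_ ?_), hg, hgτ⟩
  · rw [RingHom.comp_assoc, hg', hg]; rfl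
  · simp [hgτ, hgτ']
  · rw [RingHom.comp_assoc, hg, hg']; rfl
  · simp [hgτ, hgτ']

theorem isKummer_adjoinRoot (w : R) (b : ℕ) :
    IsKummer (AdjoinRoot.of (Polynomial.X ^ b - Polynomial.C w)) w (AdjoinRoot.root _) b where
  rel := by
    have h := AdjoinRoot.eval₂_root (Polynomial.X ^ b - Polynomial.C w)
    rw [Polynomial.eval₂_sub, Polynomial.eval₂_pow, Polynomial.eval₂_X, Polynomial.eval₂_C,
      sub_eq_zero] at h
    exact h
  existsUnique_lift g t ht := by
    refine ⟨AdjoinRoot.lift g t (by simp [ht]), ⟨?_, by simp⟩, fun k ⟨hk, hkt⟩ ↦ ?_⟩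
    · ext r; simp
    · apply AdjoinRoot.ringHom_ext
      · rw [hk]; ext r; simp
      · simpa using hkt

/-- Existence and uniqueness of the expansions are surjectivity and injectivity of `R[T] / (T ^ b -
x) → R`, where `R` acts on the target through `φ`. -/
theorem isKummer_of_exists_sum [Nontrivial R] {φ : R →+* R} {x : R} (hb : 0 < b) (hφ : φ x = x ^ b)
    (h : (∀ a, ∃ β : ℕ → R, a = ∑ i ∈ Finset.range b, φ (β i) * x ^ i) ∧
      ∀ β : ℕ → R, ∑ i ∈ Finset.range b, φ (β i) * x ^ i = 0 → ∀ i < b, β i = 0) :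
    IsKummer φ x x b := by
  obtain ⟨k, hk, hkx⟩ := (isKummer_adjoinRoot x b).exists_lift φ x hφ.symm
  have hmonic : (Polynomial.X ^ b - Polynomial.C x).Monic :=
    Polynomial.monic_X_pow_sub_C x hb.ne'
  have hkφ : ∀ r, k (AdjoinRoot.of _ r) = φ r := fun r ↦ congrArg (fun g ↦ g r) hk
  have hbij : Function.Bijective k := by
    constructor
    · rw [injective_iff_map_eq_zero]
      intro z hz
      obtain ⟨p, rfl⟩ := AdjoinRoot.mk_surjective z
      have h1 : AdjoinRoot.mk (Polynomial.X ^ b - Polynomial.C x) p =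
          AdjoinRoot.mk _ (p %ₘ (Polynomial.X ^ b - Polynomial.C x)) := by
        conv_lhs => rw [← Polynomial.modByMonic_add_div p (Polynomial.X ^ b - Polynomial.C x)]
        rw [map_add, map_mul, AdjoinRoot.mk_self, zero_mul, add_zero]
      rw [h1] at hz ⊢
      set r := p %ₘ (Polynomial.X ^ b - Polynomial.C x)
      have hdeg : r.natDegree < b := by
        have h2 := Polynomial.natDegree_modByMonic_lt p hmonic (by
          intro h3
          have h4 := congrArg Polynomial.natDegree h3
          rw [Polynomial.natDegree_X_pow_sub_C, Polynomial.natDegree_one] at h4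
          exact hb.ne' h4)
        rwa [Polynomial.natDegree_X_pow_sub_C] at h2
      have h5 : k (AdjoinRoot.mk _ r) = ∑ i ∈ Finset.range b, φ (r.coeff i) * x ^ i := by
        conv_lhs => rw [Polynomial.as_sum_range' r b hdeg]
        rw [map_sum, map_sum]
        refine Finset.sum_congr rfl fun i _ ↦ ?_
        rw [← Polynomial.C_mul_X_pow_eq_monomial, map_mul, map_pow, AdjoinRoot.mk_X, map_mul,
          map_pow, hkx, ← hkφ]
        rfl
      have h6 := h.2 _ (h5.symm.trans hz)
      have h7 : r = 0 := by
        ext i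
        by_cases hi : i < b
        · rw [h6 i hi, Polynomial.coeff_zero]
        · rw [Polynomial.coeff_eq_zero_of_natDegree_lt (by omega), Polynomial.coeff_zero]
      rw [h7, map_zero]
    · intro a
      obtain ⟨β, rfl⟩ := h.1 a
      refine ⟨∑ i ∈ Finset.range b, AdjoinRoot.of _ (β i) * AdjoinRoot.root _ ^ i, ?_⟩
      rw [map_sum]
      refine Finset.sum_congr rfl fun i _ ↦ ?_
      rw [map_mul, map_pow, hkφ, hkx]
  let e := RingEquiv.ofBijective k hbij
  refine ⟨hφ.symm, fun g t ht ↦ ?_⟩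
  obtain ⟨l, ⟨hl, hlt⟩, hlu⟩ := (isKummer_adjoinRoot x b).existsUnique_lift g t ht
  have hek : ∀ z, e.symm (k z) = z := e.symm_apply_apply
  refine ⟨l.comp (e.symm : R →+* _), ⟨?_, ?_⟩, fun m ⟨hm, hmt⟩ ↦ ?_⟩
  · rw [← hl, ← hk]
    ext r
    exact congrArg l (hek _)
  · rw [← hlt]
    exact congrArg l ((congrArg e.symm hkx).symm.trans (hek _))
  · have h1 : m.comp k = l := hlu _ ⟨by rw [RingHom.comp_assoc, hk, hm], by
      rw [RingHom.comp_apply, hkx, hmt]⟩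
    ext r
    rw [← h1]
    exact congrArg m (e.apply_symm_apply r).symm

/-- The powers of `τ` below `b` are a basis. The extension is étale since `T` times the derivative
of `T ^ b - w` is `b w` modulo `T ^ b - w`, a unit. -/
theorem IsKummer.finite_etale [Nontrivial R] (h : IsKummer f w τ b) (hb : IsUnit (b : R))
    (hw : IsUnit w) :
    IsFinite (Spec.map (CommRingCat.ofHom f)) ∧ Etale (Spec.map (CommRingCat.ofHom f)) ∧
      ∀ p, (Spec.map (CommRingCat.ofHom f)).finrank p = b := by
  have hb0 : b ≠ 0 := by
    rintro rfl
    simp at hb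
  obtain ⟨e, he, heτ⟩ := h.exists_ringEquiv (isKummer_adjoinRoot w b)
  algebraize [f]
  have hmonic : (Polynomial.X ^ b - Polynomial.C w).Monic := Polynomial.monic_X_pow_sub_C w hb0
  let e' : S ≃ₐ[R] AdjoinRoot (Polynomial.X ^ b - Polynomial.C w) :=
    AlgEquiv.ofRingEquiv (f := e) fun r ↦ congrArg (fun g ↦ g r) he
  let pb := (AdjoinRoot.powerBasis' hmonic).map e'.symm
  have hfin : Module.Finite R S := pb.finite
  have hfree : Module.Free R S := .of_basis pb.basis
  have hrank : Module.finrank R S = b := by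
    rw [pb.finrank]
    exact Polynomial.natDegree_X_pow_sub_C
  obtain ⟨c, hc⟩ := (hb.mul hw).exists_right_inv
  let P : StandardEtalePair R :=
    { f := Polynomial.X ^ b - Polynomial.C w
      monic_f := hmonic
      g := 1
      cond := by
        -- With `c = (b w)⁻¹` these coefficients express `1` through the polynomial and its
        -- derivative: `c T (b T ^ (b - 1)) - c b (T ^ b - w) = c b w = 1`.
        refine ⟨Polynomial.C c * Polynomial.X, -(Polynomial.C c * Polynomial.C (b : R)), 1, ?_⟩
        obtain ⟨n, rfl⟩ := Nat.exists_eq_succ_of_ne_zero hb0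
        have h1 : Polynomial.C ((n + 1 : ℕ) : R) * Polynomial.C w * Polynomial.C c = 1 := by
          rw [← Polynomial.C_mul, ← Polynomial.C_mul, hc, Polynomial.C_1]
        rw [Polynomial.derivative_sub, Polynomial.derivative_C, Polynomial.derivative_X_pow]
        simp only [Nat.succ_eq_add_one, Nat.add_sub_cancel, sub_zero, pow_succ]
        linear_combination h1 }
  have hP : IsKummer (algebraMap R P.Ring) w P.X b := by
    refine ⟨?_, fun g t ht ↦ ?_⟩
    · have h1 := P.hasMap_X.1
      simp only [P, map_sub, map_pow, Polynomial.aeval_X, Polynomial.aeval_C, sub_eq_zero] at h1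
      exact h1
    · let := g.toAlgebra
      have hm : P.HasMap t := by
        refine ⟨?_, by simp [P]⟩
        simp only [P, map_sub, map_pow, Polynomial.aeval_X, Polynomial.aeval_C, ht, sub_eq_zero]
        rfl
      refine ⟨(P.lift t hm : P.Ring →+* _), ⟨(P.lift t hm).comp_algebraMap, P.lift_X t hm⟩, ?_⟩
      rintro k ⟨hk, hkt⟩
      let k' : P.Ring →ₐ[R] _ := ⟨k, fun r ↦ congrArg (fun g ↦ g r) hk⟩
      have : k' = P.lift t hm := P.hom_ext (by rw [P.lift_X]; exact hkt)
      exact congrArg AlgHom.toRingHom this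
  obtain ⟨d, hd, -⟩ := hP.exists_ringEquiv h
  have hetale : Algebra.Etale R S :=
    Algebra.Etale.of_equiv (AlgEquiv.ofRingEquiv (f := d) fun r ↦ congrArg (fun g ↦ g r) hd)
  refine ⟨?_, ?_, fun p ↦ ?_⟩
  · rw [IsFinite.SpecMap_iff]
    exact RingHom.finite_algebraMap.mpr hfin
  · rw [HasRingHomProperty.Spec_iff (P := @Etale)]
    exact RingHom.etale_algebraMap.mpr hetale
  · have h1 := Scheme.Hom.finrank_SpecMap_algebraMap R S p
    refine h1.trans ?_
    rw [Module.rankAtStalk_eq_finrank_of_free, hrank]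
    rfl

variable {A R' : Type u} [CommRing A] [CommRing R'] {φ : A →+* A} {x : A} {α : A →+* R} {s v : R}
  {q q' a : ℕ} {α' : A →+* R'} {s' ω : R'}

/-- The normalization of the base change of a ray chart is a Kummer covering. -/
theorem IsRay.exists_isKummer (h : IsRay α x s v b q) (h' : IsRay α' x s' ω 1 0)
    (hφ : IsKummer φ x x b)
    (hb : 0 < b) :
    ∃ f : R →+* R', f.comp α = α'.comp φ ∧ f s * ω ^ q = α' x ∧ f v = ω ^ b ∧
      IsKummer f v ω b := by
  obtain ⟨ω', hω'⟩ := h'.isUnit.exists_right_inv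
  -- The images are `s ↦ x ω⁻q` and `v ↦ ω ^ b`; then `s ^ b v ^ q` goes to `x ^ b`, which is the
  -- image of `x` under `φ`.
  obtain ⟨f, hf, hfs, hfv⟩ := h.exists_lift (α'.comp φ) (α' x * ω' ^ q) (ω ^ b) (h'.isUnit.pow b) (by
    have h1 : (ω * ω') ^ (q * b) = 1 := by rw [hω', one_pow]
    rw [RingHom.comp_apply, ← hφ.rel, map_pow, mul_pow]
    rw [mul_pow] at h1
    linear_combination (-(α' x) ^ b) * h1)
  have hfs' : f s * ω ^ q = α' x := by
    rw [hfs]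
    have h1 : (ω * ω') ^ q = 1 := by rw [hω', one_pow]
    rw [mul_pow] at h1
    linear_combination (α' x) * h1
  refine ⟨f, hf, hfs', hfv, hfv.symm, fun {S'} _ g t ht ↦ ?_⟩
  -- A map out of `R'` needs a map on its own copy of `A`, not just on `φ(A)`. As `A` is Kummer over
  -- `φ(A)`, it suffices to give a `b`-th root of the image of `x`, and `x = s ω ^ q` dictates `g s
  -- * t ^ q`.
  obtain ⟨c, hc, hcx⟩ := hφ.exists_lift (g.comp α) (g s * t ^ q) (by
    rw [RingHom.comp_apply, h.rel, map_mul, map_pow, map_pow, ← ht]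
    ring)
  have htu : IsUnit t := by
    refine isUnit_of_dvd_unit (dvd_pow_self t hb.ne') ?_
    rw [ht]
    exact h.isUnit.map g
  obtain ⟨k, hk, hks, hkω⟩ := h'.exists_lift c (c x) t htu (by simp)
  have hcφ : ∀ z, c (φ z) = g (α z) := fun z ↦ congrArg (fun g ↦ g z) hc
  have hkα : ∀ z, k (α' z) = c z := fun z ↦ congrArg (fun g ↦ g z) hk
  refine ⟨k, ⟨h.hom_ext ?_ ?_ ?_, hkω⟩, fun m ⟨hm, hmω⟩ ↦ ?_⟩
  · rw [RingHom.comp_assoc, hf, ← RingHom.comp_assoc, hk, hc]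
  · refine (htu.pow q).mul_right_cancel ?_
    calc k (f s) * t ^ q = k (f s * ω ^ q) := by rw [map_mul, map_pow, hkω]
      _ = g s * t ^ q := by rw [hfs', hkα, hcx]
  · rw [RingHom.comp_apply, hfv, map_pow, hkω, ht]
  · have hmα : m.comp α' = c := by
      refine hφ.hom_ext ?_ ?_
      · rw [hc, RingHom.comp_assoc, ← hf, ← RingHom.comp_assoc, hm]
      · rw [RingHom.comp_apply, ← hfs', map_mul, map_pow, hmω, hcx, ← hm]
        rfl
    have hs' : α' x = s' := by simpa using h'.rel
    refine h'.hom_ext (hmα.trans hk.symm) ?_ (hmω.trans hkω.symm)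
    rw [← hs', hkα, ← hmα]
    rfl

end Kummer

/-! ### A criterion for integrality -/

section Integral

theorem germ_eq_zero_of_comp {M N O : Scheme.{u}} (σ : N ⟶ M) (j : O ⟶ M) [IsOpenImmersion j]
   (l : O ⟶ N) (h : l ≫ σ = j) (V : M.Opens) (s : Γ(M, V)) (hs : (σ.app V).hom s = 0) (t : O)
   (ht : j t ∈ V) : (M.presheaf.germ V (j t) ht).hom s = 0 := by
  subst h
  have h1 : ((l ≫ σ).app V).hom s = 0 := by
    rw [Scheme.Hom.comp_app]
    exact (congrArg (l.app _).hom hs).trans (map_zero _)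
  have h2 := Scheme.Hom.germ_stalkMap_apply (l ≫ σ) V t ht s
  rw [h1, map_zero] at h2
  have h3 : Function.Injective ((l ≫ σ).stalkMap t).hom :=
    (ConcreteCategory.bijective_of_isIso ((l ≫ σ).stalkMap t)).1
  exact h3 (h2.trans (map_zero _).symm)


theorem injective_of_isLocalization_away {B S T : Type*} [CommRing B] [CommRing S] [CommRing T]
    [Algebra B S] [Algebra B T] (f d : B) [IsLocalization.Away f S] [IsLocalization.Away (f * d) T]
    (hd : d ∈ nonZeroDivisors B) (ρ : S →+* T) (hρ : ρ.comp (algebraMap B S) = algebraMap B T) :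
    Function.Injective ρ := by
  rw [injective_iff_map_eq_zero]
  intro z hz
  obtain ⟨⟨r, ⟨m, hm⟩⟩, hr⟩ := IsLocalization.surj (Submonoid.powers f) z
  have h1 : algebraMap B T r = 0 := by
    rw [← hρ, RingHom.comp_apply]
    dsimp only at hr
    rw [← hr, map_mul, hz, zero_mul]
  rw [IsLocalization.map_eq_zero_iff (Submonoid.powers (f * d))] at h1
  obtain ⟨⟨_, n, rfl⟩, hn⟩ := h1
  have h2 : f ^ n * r = 0 := by
    have h3 : f ^ n * r * d ^ n = 0 := by
      rw [← hn]; dsimp only; ring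
    exact (mem_nonZeroDivisors_iff.mp (pow_mem hd n)).2 _ h3
  have h4 : algebraMap B S r = 0 := by
    rw [IsLocalization.map_eq_zero_iff (Submonoid.powers f)]
    exact ⟨⟨_, n, rfl⟩, h2⟩
  have h5 := IsLocalization.map_units S (⟨m, hm⟩ : Submonoid.powers f)
  dsimp only at hr
  rw [h4] at hr
  exact (h5.mul_left_eq_zero).mp hr

theorem isLocalization_away_basicOpen {R : CommRingCat.{u}} (f : R) (W : (Spec R).Opens)
    (h : W = PrimeSpectrum.basicOpen f) : IsLocalization.Away f Γ(Spec R, W) := by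
  subst h
  infer_instance

/-- Locally the section lives in a localization `B_f`, which embeds in `B_(f d)` because `d` is a
nonzerodivisor. -/
theorem eq_zero_of_germ_eq_zero_basicOpen {B : CommRingCat.{u}} (O : (Spec B).Opens) (s : Γ(Spec B, O))
    (d : B) (hd : d ∈ nonZeroDivisors B) 
    (h : ∀ t (ht : t ∈ O), t ∈ PrimeSpectrum.basicOpen d → ((Spec B).presheaf.germ O t ht).hom s = 0) : s = 0 := by
  refine TopCat.Presheaf.section_ext (Spec B).sheaf O s 0 fun t ht ↦ ?_
  obtain ⟨_, ⟨_, ⟨f, rfl⟩, rfl⟩, htf, hf⟩ := PrimeSpectrum.isBasis_basic_opens.exists_subset_of_mem_open ht O.2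
  have hf : PrimeSpectrum.basicOpen f ≤ O := hf
  let W : (Spec B).Opens := PrimeSpectrum.basicOpen f
  let W' : (Spec B).Opens := PrimeSpectrum.basicOpen (f * d)
  have hW : W' ≤ W := PrimeSpectrum.basicOpen_mul_le_left f d
  have hres : (Spec B).presheaf.map (homOfLE (hW.trans hf)).op s = 0 := by
    refine TopCat.Presheaf.section_ext (Spec B).sheaf W' _ 0 fun y hy ↦ ?_
    have h2 := h y (hf (hW hy)) (PrimeSpectrum.basicOpen_mul_le_right f d hy)
    exact (TopCat.Presheaf.germ_res_apply _ (homOfLE (hW.trans hf)) y hy s).trans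
      (h2.trans (map_zero _).symm)
  have hloc := isLocalization_away_basicOpen f W rfl
  have hloc' := isLocalization_away_basicOpen (f * d) W' rfl
  have hinj := injective_of_isLocalization_away (B := B) (S := Γ(Spec B, W))
    (T := Γ(Spec B, W')) f d hd
    ((Spec B).presheaf.map (homOfLE hW).op).hom rfl
  have h0 : (Spec B).presheaf.map (homOfLE hf).op s = 0 := by
    refine hinj (Eq.trans ?_ (map_zero _).symm)
    exact (congrArg (fun g ↦ g.hom s)
      ((Spec B).presheaf.map_comp (homOfLE hf).op (homOfLE hW).op)).symm.trans hres
  have := TopCat.Presheaf.germ_res_apply (Spec B).presheaf (homOfLE hf) t htf s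
  refine this.symm.trans ?_
  refine (congrArg _ h0).trans ((map_zero _).trans (map_zero _).symm)

/-- A scheme with a morphism from an integral scheme through which charts factor after inverting
a nonzerodivisor is integral. -/
theorem isIntegral_of_charts {M N : Scheme.{u}} [IsIntegral N] (σ : N ⟶ M)
    (H : ∀ z : M, ∃ (B : Type u) (_ : CommRing B) (j : Spec (.of B) ⟶ M) (_ : IsOpenImmersion j)
      (d : B) (l : Spec (.of (Localization.Away d)) ⟶ N), d ∈ nonZeroDivisors B ∧ z ∈ Set.range j ∧
      l ≫ σ = Spec.map (CommRingCat.ofHom (algebraMap B (Localization.Away d))) ≫ j) :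
    IsIntegral M := by
  -- Pullback along `σ` is injective on sections over every open subset, so these rings inherit the
  -- absence of zero divisors from `N`.
  have key : ∀ (V : M.Opens) (s : Γ(M, V)), (σ.app V).hom s = 0 → s = 0 := by
    intro V s hs
    refine TopCat.Presheaf.section_ext M.sheaf V s 0 fun z hz ↦ ?_
    refine Eq.trans ?_ (map_zero _).symm
    obtain ⟨B, _, j, _, d, l, hd, ⟨t, rfl⟩, hl⟩ := H z
    have h1 : (j.app V).hom s = 0 := by
      refine eq_zero_of_germ_eq_zero_basicOpen (B := .of B) _ _ d hd fun y hy hyd ↦ ?_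
      have hm : y ∈ Set.range (Spec.map (CommRingCat.ofHom
          (algebraMap B (Localization.Away d)))) := by
        exact (PrimeSpectrum.localization_away_comap_range (Localization.Away d) d).ge hyd
      obtain ⟨w, rfl⟩ := hm
      have h2 := germ_eq_zero_of_comp σ _ l hl V s hs w hy
      have h3 := Scheme.Hom.germ_stalkMap_apply j V _ hy s
      exact h3.symm.trans ((congrArg _ h2).trans (map_zero _))
    have h2 := Scheme.Hom.germ_stalkMap_apply j V t hz s
    have h3 : Function.Injective (j.stalkMap t).hom :=
      (ConcreteCategory.bijective_of_isIso (j.stalkMap t)).1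
    refine h3 (h2.trans ?_)
    exact (congrArg _ h1).trans ((map_zero _).trans (map_zero _).symm)
  have : Nonempty M := Nonempty.map σ inferInstance
  refine ⟨this, fun V hV ↦ ?_⟩
  have hinj : Function.Injective (σ.app V).hom := (injective_iff_map_eq_zero _).mpr (key V)
  have hne : Nonempty (σ ⁻¹ᵁ V) := by
    by_contra h
    have h1 : σ ⁻¹ᵁ V = ⊥ := by
      ext z
      exact ⟨fun hz ↦ (h ⟨⟨z, hz⟩⟩).elim, fun hz ↦ hz.elim⟩
    have h2 : Subsingleton Γ(N, σ ⁻¹ᵁ V) := by rw [h1]; infer_instance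
    have h3 : Subsingleton Γ(M, V) := hinj.subsingleton
    exact not_subsingleton _ h3
  exact hinj.isDomain _

variable {A : Type u} [CommRing A] [IsDomain A]

instance : IsIntegral (P1 A) := by
  refine isIntegral_of_charts (ptZ (Polynomial.C : A →+* _) Polynomial.X) fun z ↦ ?_
  obtain ⟨i, hi⟩ := exists_mem_chartOpen z
  have h0 : IsOpenImmersion (ptY (Polynomial.C : A →+* _) Polynomial.X) ∧
    ∀ t, t ∈ Set.range (ptY (Polynomial.C : A →+* _) Polynomial.X) ↔ t ∈ chartOpen A 0 :=
      isOpenImmersion_pt (A := A) 0 1 (by decide) ![1, Polynomial.X] rfl rfl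
  have h1 : IsOpenImmersion (ptZ (Polynomial.C : A →+* _) Polynomial.X) ∧
    ∀ t, t ∈ Set.range (ptZ (Polynomial.C : A →+* _) Polynomial.X) ↔ t ∈ chartOpen A 1 :=
      isOpenImmersion_pt (A := A) 1 0 (by decide) ![Polynomial.X, 1] rfl rfl
  fin_cases i
  · have hu : IsUnit (algebraMap (Polynomial A) (Localization.Away (Polynomial.X : Polynomial A))
        Polynomial.X) := IsLocalization.Away.algebraMap_isUnit _
    obtain ⟨c, hc⟩ := hu.exists_right_inv
    refine ⟨_, _, _, h0.1, Polynomial.X, Spec.map (CommRingCat.ofHom (Polynomial.eval₂RingHom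
      ((algebraMap (Polynomial A) (Localization.Away (Polynomial.X : Polynomial A))).comp
        Polynomial.C) c)), mem_nonZeroDivisors_of_ne_zero Polynomial.X_ne_zero,
      (h0.2 z).mpr hi, ?_⟩
    refine (SpecMap_ptZ _ _ _).trans (Eq.trans ?_ (SpecMap_ptY _ _ _).symm)
    refine ptZ_eq_ptY_iff.mpr ⟨?_, ?_⟩
    · ext r
      simp
    · simpa [mul_comm] using hc
  · exact ⟨_, _, _, h1.1, 1, Spec.map (CommRingCat.ofHom (algebraMap _ _)),
      one_mem _, (h1.2 z).mpr hi, rfl⟩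

end Integral

/-! ### Ray schemes: the properties of `U_r` that the remaining argument uses -/

section RayScheme

variable {A : Type u} [CommRing A] [IsDomain A] [IsDiscreteValuationRing A]

/-- A scheme over `ℙ¹` which is an isomorphism over the generic point of `C`, and which is covered
by the generic fibre and a ray chart. -/
structure IsRayScheme {V : Scheme.{u}} (p : V ⟶ P1 A) (x : A) {R : Type u} [CommRing R]
    (j : Spec (CommRingCat.of R) ⟶ V) (α : A →+* R) (s v : R) (a b q q' : ℕ) : Prop where
  chart : IsRayChart p x j α s v a b q q'
  existsUnique_lift : ∀ {Y : Scheme.{u}} (f : Y ⟶ P1 A),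
    (∀ y : Y, (f ≫ P1.toBase A) y ≠ IsLocalRing.closedPoint A) → ∃! g : Y ⟶ V, g ≫ p = f
  hom_ext : ∀ {Y : Scheme.{u}} [IsIntegral Y] {f g : Y ⟶ V}, f ≫ p = g ≫ p →
    ∀ y : Y, (f ≫ p ≫ P1.toBase A) y ≠ IsLocalRing.closedPoint A → f = g
  mem_range : ∀ z : V, (p ≫ P1.toBase A) z = IsLocalRing.closedPoint A → z ∈ Set.range j

/-- This is where the blowups are left behind: from here on `U_r` enters only through its ray chart
and its behaviour off the special fibre, both inherited from the nodal blowup. -/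
theorem IsNodalBlowup.exists_isRayScheme {X : Scheme.{u}} {π : X ⟶ P1 A} {x : A} {a b q q' : ℕ}
    (hπ : IsNodalBlowup π) (hx : Irreducible x) (hL : HasLine π x a b) (hb : 0 < b)
    (hab : a.Coprime b) (hq : b * q' = a * q + 1) :
    ∃ (R : Type u) (_ : CommRing R) (j : Spec (.of R) ⟶ (Uopen π x a b).toScheme) (α : A →+* R)
      (s v : R), IsRayScheme ((Uopen π x a b).ι ≫ π) x j α s v a b q q' := by
  obtain ⟨R, _, j, α, s, v, h, hU⟩ := hπ.exists_rayChart_Uopen hx hL hb hab hq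
  have := h.isOpenImmersion
  have hj : Set.range j ⊆ Set.range (Uopen π x a b).ι := by
    rw [Scheme.Opens.range_ι]
    exact fun z hz ↦ (hU z).mpr (.inl hz)
  let j' := IsOpenImmersion.lift (Uopen π x a b).ι j hj
  have hj' : j' ≫ (Uopen π x a b).ι = j := IsOpenImmersion.lift_fac _ _ _
  have hj'' : IsOpenImmersion (j' ≫ (Uopen π x a b).ι) := hj' ▸ this
  refine ⟨R, _, j', α, s, v, ⟨IsOpenImmersion.of_comp _ (Uopen π x a b).ι, h.isRay, h.isDomain,
    h.ne_zero, ?_⟩, fun {Y} f hf ↦ ?_, fun {Y} _ f g hfg y hy ↦ ?_, fun z hz ↦ ?_⟩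
  · rw [← Category.assoc, hj', h.comp]
  · obtain ⟨g, hg, hgu⟩ := hπ.existsUnique_lift f hf
    have hg' : Set.range g ⊆ Set.range (Uopen π x a b).ι := by
      rw [Scheme.Opens.range_ι]
      rintro _ ⟨y, rfl⟩
      refine (hU _).mpr (.inr (mem_genericPart.mpr ?_))
      intro h1
      apply hf y
      rw [← hg]
      exact h1
    refine ⟨IsOpenImmersion.lift (Uopen π x a b).ι g hg', ?_, fun k hk ↦ ?_⟩
    · dsimp only
      rw [← Category.assoc, IsOpenImmersion.lift_fac, hg]
    · rw [← cancel_mono (Uopen π x a b).ι, IsOpenImmersion.lift_fac]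
      exact hgu _ (by dsimp only; rw [Category.assoc, hk])
  · rw [← cancel_mono (Uopen π x a b).ι]
    exact hπ.hom_ext hx (by simpa using hfg) y (by simpa using hy)
  · have h1 : (Uopen π x a b).ι z ∈ Set.range j := by
      refine ((hU _).mp z.2).resolve_right fun h1 ↦ mem_genericPart.mp h1 ?_
      exact hz
    obtain ⟨t, ht⟩ := h1
    refine ⟨t, (Uopen π x a b).ι.isOpenEmbedding.injective ?_⟩
    rw [← ht, ← hj']
    rfl

variable {V : Scheme.{u}} {p : V ⟶ P1 A} {x : A} {R : Type u} [CommRing R]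
    {j : Spec (CommRingCat.of R) ⟶ V} {α : A →+* R} {s v : R} {a b q q' : ℕ}

theorem apply_ne_closedPoint_of_isUnit (hx : Irreducible x) (α : A →+* R) (hα : IsUnit (α x))
    (t : Spec (CommRingCat.of R)) :
    (Spec.map (CommRingCat.ofHom α)) t ≠ IsLocalRing.closedPoint A := by
  exact fun h ↦ t.2.ne_top
    (Ideal.eq_top_of_isUnit_mem _ ((SpecMap_eq_closedPoint_iff hx α t).mp h) hα)

variable (A) in
/-- The generic fibre of the projective line over `C`. -/
abbrev genericP1 : Scheme.{u} := (genericPart (𝟙 (P1 A))).toScheme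

theorem genericP1_ne_closedPoint (y : genericP1 A) :
    ((genericPart (𝟙 (P1 A))).ι ≫ P1.toBase A) y ≠ IsLocalRing.closedPoint A := by
  have h := mem_genericPart.mp y.2
  rwa [Category.id_comp] at h

theorem ι_ne_closedPoint (p : V ⟶ P1 A) (y : (genericPart p).toScheme) :
    ((genericPart p).ι ≫ p ≫ P1.toBase A) y ≠ IsLocalRing.closedPoint A := by
  rw [Scheme.Hom.comp_apply]
  exact mem_genericPart.mp y.2

theorem exists_comp_genericP1_ι {Y : Scheme.{u}} (f : Y ⟶ P1 A)
    (hf : ∀ y : Y, (f ≫ P1.toBase A) y ≠ IsLocalRing.closedPoint A) :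
    ∃ g : Y ⟶ genericP1 A, g ≫ (genericPart (𝟙 (P1 A))).ι = f := by
  have h : Set.range f ⊆ Set.range (genericPart (𝟙 (P1 A))).ι := by
    rw [Scheme.Opens.range_ι]
    rintro _ ⟨y, rfl⟩
    refine mem_genericPart.mpr ?_
    rw [Category.id_comp]
    exact hf y
  exact ⟨IsOpenImmersion.lift _ f h, IsOpenImmersion.lift_fac _ _ _⟩

theorem genericP1_nonempty (hx : Irreducible x) : Nonempty (genericP1 A) := by
  let K := FractionRing A
  let f : Spec (.of K) ⟶ P1 A := ptZ (algebraMap A K) 0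
  obtain ⟨g, -⟩ := exists_comp_genericP1_ι f (fun y ↦ by
    rw [pt_toBase]
    refine apply_ne_closedPoint_of_isUnit hx _ (IsUnit.mk0 _ fun h0 ↦ hx.ne_zero ?_) y
    exact (FaithfulSMul.algebraMap_eq_zero_iff A K).mp h0)
  have : Nonempty (Spec (.of K)) := inferInstance
  exact this.map g

/-- The generic fibre of the projective line is the generic fibre of a ray scheme. -/
theorem IsRayScheme.exists_genericP1_hom (h : IsRayScheme p x j α s v a b q q') :
    ∃ σ : genericP1 A ⟶ V, IsOpenImmersion σ ∧ σ ≫ p = (genericPart (𝟙 (P1 A))).ι ∧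
      ∀ {Y : Scheme.{u}} (f : Y ⟶ V),
        (∀ y : Y, (f ≫ p ≫ P1.toBase A) y ≠ IsLocalRing.closedPoint A) →
          ∃ g : Y ⟶ genericP1 A, g ≫ σ = f := by
  obtain ⟨σ, hσ, -⟩ := h.existsUnique_lift (genericPart (𝟙 (P1 A))).ι genericP1_ne_closedPoint
  have hf : ∀ {Y : Scheme.{u}} (f : Y ⟶ V),
      (∀ y : Y, (f ≫ p ≫ P1.toBase A) y ≠ IsLocalRing.closedPoint A) →
        ∃ g : Y ⟶ genericP1 A, g ≫ σ = f := by
    intro Y f hf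
    obtain ⟨g, hg⟩ := exists_comp_genericP1_ι (f ≫ p) (by simpa using hf)
    refine ⟨g, (h.existsUnique_lift (f ≫ p) (by simpa using hf)).unique ?_ rfl⟩
    rw [Category.assoc, hσ, hg]
  have hmono : Mono σ := by
    have : Mono (σ ≫ p) := hσ ▸ inferInstance
    exact mono_of_mono σ p
  refine ⟨σ, isOpenImmersion_of_local_inverse σ fun z ↦ ?_, hσ, hf⟩
  refine ⟨genericPart p, ?_, ?_⟩
  · rw [mem_genericPart]
    have h1 := genericP1_ne_closedPoint z
    rw [← hσ] at h1
    simpa using h1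
  · obtain ⟨r, hr⟩ := hf (genericPart p).ι (ι_ne_closedPoint p)
    exact ⟨r, hr, fun k hk ↦ (cancel_mono σ).mp hk⟩

/-- The generic fibre is open in the integral scheme `P1 A`, and the ray chart maps into it after
inverting the nonzerodivisor `x`, so `isIntegral_of_charts` applies. -/
theorem IsRayScheme.isIntegral (h : IsRayScheme p x j α s v a b q q') (hx : Irreducible x) :
    IsIntegral V := by
  obtain ⟨σ, hσ, hσp, hσu⟩ := h.exists_genericP1_hom
  have : Nonempty (genericP1 A) := genericP1_nonempty hx
  have : IsIntegral (genericP1 A) := inferInstance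
  have := h.chart.isDomain
  have := h.chart.isOpenImmersion
  refine isIntegral_of_charts σ fun z ↦ ?_
  by_cases hz : (p ≫ P1.toBase A) z = IsLocalRing.closedPoint A
  · let β := algebraMap R (Localization.Away (α x))
    have h1 : (Spec.map (CommRingCat.ofHom β) ≫ j) ≫ p ≫ P1.toBase A =
        Spec.map (CommRingCat.ofHom (β.comp α)) := by
      rw [Category.assoc, h.chart.comp_toBase, ← Spec.map_comp, ← CommRingCat.ofHom_comp]
    have h2 : IsUnit (β (α x)) := IsLocalization.Away.algebraMap_isUnit _
    have h3 : ∀ y, ((Spec.map (CommRingCat.ofHom β) ≫ j) ≫ p ≫ P1.toBase A) y ≠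
        IsLocalRing.closedPoint A := by
      rw [h1]
      exact apply_ne_closedPoint_of_isUnit hx (β.comp α) h2
    obtain ⟨g, hg⟩ := hσu _ h3
    exact ⟨R, _, j, inferInstance, α x, g, mem_nonZeroDivisors_of_ne_zero h.chart.ne_zero,
      h.mem_range z hz, hg⟩
  · obtain ⟨_, ⟨W, (hW : IsAffineOpen W), rfl⟩, h1, h2⟩ :=
      V.isBasis_affineOpens.exists_subset_of_mem_open (mem_genericPart.mpr hz) (genericPart p).2
    have h2 : W ≤ genericPart p := h2
    have h3 : ∀ y, (hW.fromSpec ≫ p ≫ P1.toBase A) y ≠ IsLocalRing.closedPoint A := by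
      intro y
      rw [Scheme.Hom.comp_apply]
      exact mem_genericPart.mp (h2 (hW.range_fromSpec.le ⟨y, rfl⟩))
    obtain ⟨g, hg⟩ := hσu hW.fromSpec h3
    have h4 : z ∈ Set.range hW.fromSpec := hW.range_fromSpec.ge h1
    have h5 : (Spec.map (CommRingCat.ofHom (algebraMap Γ(V, W) (Localization.Away (1 : Γ(V, W))))) ≫
        g) ≫ σ = Spec.map (CommRingCat.ofHom (algebraMap Γ(V, W) (Localization.Away 1))) ≫
          hW.fromSpec := by
      rw [Category.assoc, hg]
    exact ⟨Γ(V, W), inferInstance, hW.fromSpec, inferInstance, 1, _, one_mem _, h4, h5⟩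

end RayScheme

/-! ### The projective line is compatible with base change -/

section Local

theorem hom_ext_of_locally {T X : Scheme.{u}} {f g : T ⟶ X}
    (h : ∀ z : T, ∃ U : T.Opens, z ∈ U ∧ U.ι ≫ f = U.ι ≫ g) : f = g := by
  choose U hU h using h
  have hs : iSup U = ⊤ := by
    ext z
    simp only [Opens.coe_iSup, Set.mem_iUnion, Opens.coe_top, Set.mem_univ, iff_true]
    exact ⟨z, hU z⟩
  exact Scheme.Cover.hom_ext (T.openCoverOfIsOpenCover U hs) _ _ h

theorem hom_ext_of_cover {T X : Scheme.{u}} {f g : T ⟶ X}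
    (h : ∀ z : T, ∃ (O : Scheme.{u}) (i : O ⟶ T) (_ : IsOpenImmersion i), z ∈ Set.range i ∧
      i ≫ f = i ≫ g) : f = g := by
  refine hom_ext_of_locally fun z ↦ ?_
  obtain ⟨O, i, _, hz, hi⟩ := h z
  have h1 : i.opensRange.ι = (Scheme.Hom.isoOpensRange i).inv ≫ i := by simp
  refine ⟨i.opensRange, hz, ?_⟩
  rw [h1, Category.assoc, Category.assoc, hi]

variable {A : Type u} [CommRing A]

theorem exists_open_homogP1 {T : Scheme.{u}} (n : T ⟶ P1 A) (z : T) :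
    ∃ U : T.Opens, z ∈ U ∧ ∃ i, ∀ {O : Scheme.{u}} (k : O ⟶ T), Set.range k ⊆ U →
      ∃ (c : Fin 2 → Γ(O, ⊤)) (hi : c i = 1), k ≫ n = homogP1 (k ≫ n ≫ P1.toBase A) c i hi := by
  obtain ⟨i, hi⟩ := exists_mem_chartOpen (n z)
  refine ⟨n ⁻¹ᵁ chartOpen A i, hi, i, fun {O} k hk ↦ ?_⟩
  obtain ⟨c, hc, h⟩ := eq_homogP1 (k ≫ n) i fun o _ ↦ hk ⟨o, rfl⟩
  refine ⟨c, hc, h.trans (homogP1_congr hc (Category.assoc _ _ _) rfl)⟩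

/-- `baseChange φ` does not alter homogeneous coordinates, so the cross relation that expresses
equality is the same before and after it. Together with `exists_lift_baseChange` this says that the
square over `Spec φ` is cartesian. -/
theorem hom_ext_baseChange (φ : A →+* A) {T : Scheme.{u}} {n n' : T ⟶ P1 A}
    (h : n ≫ baseChange φ = n' ≫ baseChange φ) (h' : n ≫ P1.toBase A = n' ≫ P1.toBase A) :
    n = n' := by
  refine hom_ext_of_locally fun z ↦ ?_
  obtain ⟨U, hzU, i, hU⟩ := exists_open_homogP1 n z
  obtain ⟨U', hzU', i', hU'⟩ := exists_open_homogP1 n' z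
  obtain ⟨c, hc, h1⟩ := hU (U ⊓ U').ι (by rw [Scheme.Opens.range_ι]; exact Set.inter_subset_left)
  obtain ⟨c', hc', h2⟩ := hU' (U ⊓ U').ι (by
    rw [Scheme.Opens.range_ι]; exact Set.inter_subset_right)
  rw [← h'] at h2
  refine ⟨U ⊓ U', ⟨hzU, hzU'⟩, ?_⟩
  have h3 : ((U ⊓ U').ι ≫ n) ≫ baseChange φ = ((U ⊓ U').ι ≫ n') ≫ baseChange φ := by
    rw [Category.assoc, Category.assoc, h]
  rw [h1, h2, homogP1_baseChange, homogP1_baseChange, homogP1_eq_iff] at h3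
  rw [h1, h2, homogP1_eq_iff]
  exact h3

/-- The projective line is compatible with base change. -/
theorem exists_lift_baseChange (φ : A →+* A) {T : Scheme.{u}} (m : T ⟶ P1 A)
    (t : T ⟶ Spec (.of A)) (h : m ≫ P1.toBase A = t ≫ Spec.map (CommRingCat.ofHom φ)) :
    ∃ n : T ⟶ P1 A, n ≫ baseChange φ = m ∧ n ≫ P1.toBase A = t := by
  let Q : ∀ {O : Scheme.{u}}, (O ⟶ T) → (O ⟶ P1 A) → Prop := fun i f ↦
    f ≫ baseChange φ = i ≫ m ∧ f ≫ P1.toBase A = i ≫ t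
  have ex : ∀ z : T, ∃ (O : Scheme.{u}) (i : O ⟶ T) (_ : IsOpenImmersion i) (f : O ⟶ P1 A),
      z ∈ Set.range i ∧ Q i f := by
    intro z
    obtain ⟨U, hzU, i, hU⟩ := exists_open_homogP1 m z
    obtain ⟨c, hc, h1⟩ := hU U.ι (by rw [Scheme.Opens.range_ι])
    refine ⟨U, U.ι, inferInstance, homogP1 (U.ι ≫ t) c i hc, ⟨⟨z, hzU⟩, rfl⟩, ?_, ?_⟩
    · rw [homogP1_baseChange, h1]
      exact homogP1_congr hc (by rw [h, Category.assoc]) rfl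
    · rw [homogP1_toBase]
  obtain ⟨n, hn⟩ := exists_glue Q
    (fun k _ i f hf ↦ ⟨by rw [Category.assoc, hf.1, Category.assoc],
      by rw [Category.assoc, hf.2, Category.assoc]⟩)
    (fun i _ f f' hf hf' ↦ hom_ext_baseChange φ (hf.1.trans hf'.1.symm) (hf.2.trans hf'.2.symm))
    ex
  refine ⟨n, hom_ext_of_cover fun z ↦ ?_, hom_ext_of_cover fun z ↦ ?_⟩
  all_goals
    obtain ⟨O, i, hi, f, hz, hf⟩ := ex z
    refine ⟨O, i, hi, hz, ?_⟩
    rw [← Category.assoc, hn i f hf]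
  · exact hf.1
  · exact hf.2

end Local

/-! ### The function `x ^ a / f` in homogeneous coordinates -/

section CrossRelation

variable {A : Type u} [CommRing A]

/-- `g` is the rational function `x ^ a / f` wherever it is determined by `f`. -/
def CrossRel (x : A) (a : ℕ) {O : Scheme.{u}} (f g : O ⟶ P1 A) : Prop :=
  f ≫ P1.toBase A = g ≫ P1.toBase A ∧
    ∀ {T : Scheme.{u}} (k : T ⟶ O) (st : T ⟶ Spec (.of A)) (c c' : Fin 2 → Γ(T, ⊤)) (i i' : Fin 2)
      (hi : c i = 1) (hi' : c' i' = 1), k ≫ f = homogP1 st c i hi → k ≫ g = homogP1 st c' i' hi' →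
        c' 0 * c 0 = sectionsMap st x ^ a * (c 1 * c' 1)

variable {x : A} {a : ℕ} {O : Scheme.{u}} {f g : O ⟶ P1 A}

theorem CrossRel.comp (h : CrossRel x a f g) {T : Scheme.{u}} (k : T ⟶ O) :
    CrossRel x a (k ≫ f) (k ≫ g) :=
  ⟨by rw [Category.assoc, h.1, Category.assoc], fun l st c c' i i' hi hi' h1 h2 ↦
    h.2 (l ≫ k) st c c' i i' hi hi' (by rw [Category.assoc, h1]) (by rw [Category.assoc, h2])⟩

theorem exists_eq_mul_of_cross {R : Type*} [CommRing R] {c d : Fin 2 → R} {i : Fin 2}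
    (hi : c i = 1) (h : c 0 * d 1 = c 1 * d 0) : d 0 = d i * c 0 ∧ d 1 = d i * c 1 := by
  have : i = 0 ∨ i = 1 := by omega
  obtain rfl | rfl := this
  · exact ⟨by simp [hi], by linear_combination h - d 1 * hi⟩
  · exact ⟨by linear_combination -h - d 0 * hi, by simp [hi]⟩

/-- The relation is homogeneous in either vector, and any other coordinates of the same morphisms
are multiples of the given ones, so one choice of coordinates is enough. -/
theorem crossRel_homogP1 {st : O ⟶ Spec (.of A)} {c c' : Fin 2 → Γ(O, ⊤)} {i i' : Fin 2}
    {hi : c i = 1} {hi' : c' i' = 1} (h : c' 0 * c 0 = sectionsMap st x ^ a * (c 1 * c' 1)) :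
    CrossRel x a (homogP1 st c i hi) (homogP1 st c' i' hi') := by
  refine ⟨by rw [homogP1_toBase, homogP1_toBase], fun {T} k st' d d' l l' hl hl' h1 h2 ↦ ?_⟩
  have hst : k ≫ st = st' := by
    have h3 := congrArg (fun m ↦ m ≫ P1.toBase A) h1
    rwa [Category.assoc, homogP1_toBase, homogP1_toBase] at h3
  subst hst
  rw [comp_homogP1, homogP1_eq_iff] at h1 h2
  have hci : k.appTop.hom (c i) = 1 := by rw [hi, map_one]
  have hci' : k.appTop.hom (c' i') = 1 := by rw [hi', map_one]
  obtain ⟨h3, h4⟩ := exists_eq_mul_of_cross (c := fun l ↦ k.appTop.hom (c l)) hci h1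
  obtain ⟨h5, h6⟩ := exists_eq_mul_of_cross (c := fun l ↦ k.appTop.hom (c' l)) hci' h2
  have h7 := congrArg k.appTop.hom h
  simp only [map_mul, map_pow] at h7
  rw [h3, h4, h5, h6, sectionsMap_comp, RingHom.comp_apply]
  linear_combination d i * d' i' * h7

theorem crossRel_of_eq {st : O ⟶ Spec (.of A)} {c c' : Fin 2 → Γ(O, ⊤)} {i i' : Fin 2}
    {hi : c i = 1} {hi' : c' i' = 1} (hf : f = homogP1 st c i hi) (hg : g = homogP1 st c' i' hi')
    (h : c' 0 * c 0 = sectionsMap st x ^ a * (c 1 * c' 1)) : CrossRel x a f g := by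
  subst hf hg
  exact crossRel_homogP1 h

theorem crossRel_pt {R : Type u} [CommRing R] {α : A →+* R} {c c' : Fin 2 → R} {i i' : Fin 2}
    {hi : c i = 1} {hi' : c' i' = 1} (h : c' 0 * c 0 = α x ^ a * (c 1 * c' 1)) :
    CrossRel x a (pt α c i hi) (pt α c' i' hi') := by
  refine crossRel_homogP1 ?_
  have h1 := congrArg (Scheme.ΓSpecIso (CommRingCat.of R)).inv.hom h
  rw [sectionsMap_SpecMap]
  simpa only [map_mul, map_pow, RingHom.comp_apply] using h1

theorem eq_of_locally_eq_appTop {T : Scheme.{u}} {s t : Γ(T, ⊤)}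
    (h : ∀ z : T, ∃ (O : Scheme.{u}) (i : O ⟶ T) (_ : IsOpenImmersion i), z ∈ Set.range i ∧
      i.appTop.hom s = i.appTop.hom t) : s = t := by
  refine TopCat.Presheaf.section_ext T.sheaf ⊤ s t fun z hz ↦ ?_
  obtain ⟨O, i, _, ⟨y, rfl⟩, hi⟩ := h z
  have h3 : Function.Injective (i.stalkMap y).hom :=
    (ConcreteCategory.bijective_of_isIso (i.stalkMap y)).1
  refine h3 ((Scheme.Hom.germ_stalkMap_apply i ⊤ y hz s).trans
    (Eq.trans ?_ (Scheme.Hom.germ_stalkMap_apply i ⊤ y hz t).symm))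
  exact congrArg _ hi

theorem crossRel_of_locally (h : ∀ z : O, ∃ (W : Scheme.{u}) (i : W ⟶ O) (_ : IsOpenImmersion i),
    z ∈ Set.range i ∧ CrossRel x a (i ≫ f) (i ≫ g)) : CrossRel x a f g := by
  refine ⟨hom_ext_of_cover fun z ↦ ?_, fun {T} k st c c' l l' hl hl' h1 h2 ↦ ?_⟩
  · obtain ⟨W, i, hi, hz, h⟩ := h z
    exact ⟨W, i, hi, hz, by simpa using h.1⟩
  · refine eq_of_locally_eq_appTop fun t ↦ ?_
    obtain ⟨W, i, hi, hz, h⟩ := h (k t)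
    refine ⟨pullback k i, pullback.fst k i, inferInstance, ?_, ?_⟩
    · rw [IsOpenImmersion.range_pullbackFst]
      exact hz
    · have hc : (pullback.fst k i).appTop.hom (c l) = 1 := by rw [hl, map_one]
      have hc' : (pullback.fst k i).appTop.hom (c' l') = 1 := by rw [hl', map_one]
      have h3 := h.2 (pullback.snd k i) (pullback.fst k i ≫ st) _ _ l l' hc hc'
        (by rw [← Category.assoc, ← pullback.condition, Category.assoc, h1, comp_homogP1])
        (by rw [← Category.assoc, ← pullback.condition, Category.assoc, h2, comp_homogP1])
      simp only [map_mul, map_pow]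
      rw [h3, sectionsMap_comp]
      rfl

variable [IsDomain A] [IsDiscreteValuationRing A]

theorem isUnit_sectionsMap (hx : Irreducible x) (st : O ⟶ Spec (.of A))
    (h : ∀ o : O, st o ≠ IsLocalRing.closedPoint A) : IsUnit (sectionsMap st x) := by
  refine RingedSpace.isUnit_of_isUnit_germ O.toRingedSpace ⊤ _ fun o ho ↦ ?_
  have h1 := (mem_basicOpen_sectionsMap_iff hx st o).mpr (h o)
  exact (Scheme.mem_basicOpen O _ o ho).mp h1

/-- Off the special fibre `x ^ a` is invertible, so the relation determines the ratio of the
coordinates of `g`, whichever coordinate of `f` is `1`. -/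
theorem CrossRel.unique (hx : Irreducible x) {g' : O ⟶ P1 A} (h : CrossRel x a f g)
    (h' : CrossRel x a f g')
    (hf : ∀ o : O, (f ≫ P1.toBase A) o ≠ IsLocalRing.closedPoint A) : g = g' := by
  refine hom_ext_of_locally fun z ↦ ?_
  obtain ⟨U, hzU, i, hU⟩ := exists_open_homogP1 f z
  obtain ⟨U', hzU', i', hU'⟩ := exists_open_homogP1 g z
  obtain ⟨U'', hzU'', i'', hU''⟩ := exists_open_homogP1 g' z
  let k := (U ⊓ U' ⊓ U'').ι
  have hk : Set.range k = (U ∩ U' ∩ U'' : Set O) := Scheme.Opens.range_ι _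
  obtain ⟨c, hc, h1⟩ := hU k (by rw [hk]; exact fun _ h ↦ h.1.1)
  obtain ⟨c', hc', h2⟩ := hU' k (by rw [hk]; exact fun _ h ↦ h.1.2)
  obtain ⟨c'', hc'', h3⟩ := hU'' k (by rw [hk]; exact fun _ h ↦ h.2)
  rw [← h.1] at h2
  rw [← h'.1] at h3
  have h4 := h.2 k _ _ _ _ _ _ _ h1 h2
  have h5 := h'.2 k _ _ _ _ _ _ _ h1 h3
  have hu : IsUnit (sectionsMap (k ≫ f ≫ P1.toBase A) x ^ a) :=
    (isUnit_sectionsMap hx _ fun o ↦ by rw [Scheme.Hom.comp_apply]; exact hf _).pow a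
  refine ⟨U ⊓ U' ⊓ U'', ⟨⟨hzU, hzU'⟩, hzU''⟩, ?_⟩
  change k ≫ g = k ≫ g'
  rw [h2, h3, homogP1_eq_iff]
  have : i = 0 ∨ i = 1 := by omega
  obtain rfl | rfl := this
  · rw [hc, mul_one] at h4 h5
    rw [h4, h5]
    ring
  · rw [hc, one_mul] at h4 h5
    refine hu.mul_left_cancel ?_
    linear_combination c'' 0 * h4 - c' 0 * h5

theorem ext_of_generic {O P : Scheme.{u}} [IsIntegral O] [P.IsSeparated] {g g' : O ⟶ P} (U : O.Opens) (hU : (U : Set O).Nonempty)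
    (h : U.ι ≫ g = U.ι ≫ g') : g = g' := by
  have hd : Dense (U : Set O) := U.2.dense hU
  have := Opens.isDominant_ι hd
  exact ext_of_isDominant U.ι h

theorem CrossRel.unique_of_isIntegral [IsIntegral O] (hx : Irreducible x) {g' : O ⟶ P1 A}
    (h : CrossRel x a f g) (h' : CrossRel x a f g') (o : O)
    (ho : (f ≫ P1.toBase A) o ≠ IsLocalRing.closedPoint A) : g = g' :=
  ext_of_generic (genericPart f) ⟨o, mem_genericPart.mpr ho⟩
    ((h.comp _).unique hx (h'.comp _) fun o ↦ by
      rw [Category.assoc]; exact ι_ne_closedPoint f o)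

end CrossRelation

section RayScheme

variable {A : Type u} [CommRing A] [IsDomain A] [IsDiscreteValuationRing A]
  {V V' : Scheme.{u}} {p : V ⟶ P1 A} {p' : V' ⟶ P1 A} {x : A} {R R' : Type u} [CommRing R]
  [CommRing R'] {j : Spec (CommRingCat.of R) ⟶ V} {α : A →+* R} {s v : R} {a b q q' : ℕ}
  {j' : Spec (CommRingCat.of R') ⟶ V'} {α' : A →+* R'} {s' ω : R'}

theorem IsRayScheme.exists_ne_closedPoint (h : IsRayScheme p x j α s v a b q q')
    (hx : Irreducible x) {O : Scheme.{u}} [Nonempty O] (i : O ⟶ V) [IsOpenImmersion i] :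
    ∃ o : O, (i ≫ p ≫ P1.toBase A) o ≠ IsLocalRing.closedPoint A := by
  have := h.isIntegral hx
  obtain ⟨σ, -, hσ, -⟩ := h.exists_genericP1_hom
  obtain ⟨y⟩ := genericP1_nonempty (A := A) hx
  have h1 : σ y ∈ genericPart p := by
    have h2 := genericP1_ne_closedPoint y
    rw [← hσ, Category.assoc, Scheme.Hom.comp_apply] at h2
    exact mem_genericPart.mpr h2
  obtain ⟨z, hz, hz'⟩ := nonempty_preirreducible_inter (genericPart p).2 i.opensRange.2 ⟨_, h1⟩
    (Set.range_nonempty i)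
  obtain ⟨o, rfl⟩ := hz'
  refine ⟨o, ?_⟩
  rw [Scheme.Hom.comp_apply]
  exact mem_genericPart.mp hz

theorem isIntegral_or_isEmpty [IsIntegral V] {O : Scheme.{u}} (i : O ⟶ V) [IsOpenImmersion i] :
    IsEmpty O ∨ (Nonempty O ∧ IsIntegral O) := by
  rcases isEmpty_or_nonempty O with h | h
  · exact .inl h
  · exact .inr ⟨h, isIntegral_of_isOpenImmersion i⟩

/-- The rational function `x ^ a / y` extends to a morphism on `U_a`. -/
theorem IsRayScheme.exists_crossRel (h : IsRayScheme p' x j' α' s' ω a 1 0 1)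
    (hx : Irreducible x) : ∃ g : V' ⟶ P1 A, CrossRel x a p' g ∧ j' ≫ g = ptY α' ω := by
  have := h.isIntegral hx
  have hj := h.chart.isOpenImmersion
  let Q : ∀ {O : Scheme.{u}}, (O ⟶ V') → (O ⟶ P1 A) → Prop := fun i f ↦ CrossRel x a (i ≫ p') f
  have hs : α' x = s' := by simpa using h.chart.isRay.rel
  have hQj : Q j' (ptY α' ω) := by
    -- On the ray chart `y = x ^ a ω`, so `x ^ a / y` is `[1 : ω]`.
    have h1 : CrossRel x a (ptZ α' (s' ^ a * ω ^ 1)) (ptY α' ω) := crossRel_pt (by simp [hs])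
    rwa [← h.chart.comp] at h1
  have ex : ∀ z : V', ∃ (O : Scheme.{u}) (i : O ⟶ V') (_ : IsOpenImmersion i) (f : O ⟶ P1 A),
      z ∈ Set.range i ∧ Q i f := by
    intro z
    by_cases hz : (p' ≫ P1.toBase A) z = IsLocalRing.closedPoint A
    · exact ⟨_, j', hj, _, h.mem_range z hz, hQj⟩
    · obtain ⟨U, hzU, i, hU⟩ := exists_open_homogP1 p' z
      let k := (U ⊓ genericPart p').ι
      have hk : Set.range k = (U ∩ genericPart p' : Set V') := Scheme.Opens.range_ι _
      obtain ⟨c, hc, h1⟩ := hU k (by rw [hk]; exact fun _ h ↦ h.1)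
      have hu : IsUnit (sectionsMap (k ≫ p' ≫ P1.toBase A) x ^ a) :=
        (isUnit_sectionsMap hx _ fun o ↦ by
          rw [Scheme.Hom.comp_apply]; exact mem_genericPart.mp o.2.2).pow a
      obtain ⟨u, hu⟩ := hu.exists_right_inv
      have hz' : z ∈ Set.range k := by rw [hk]; exact ⟨hzU, mem_genericPart.mpr hz⟩
      have : i = 0 ∨ i = 1 := by omega
      obtain rfl | rfl := this
      -- Off the special fibre `x ^ a / y` is `[x ^ a c₁ : 1]` where `c₀ = 1`, and `[1 : c₀ x⁻ᵃ]`
      -- where `c₁ = 1`.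
      · refine ⟨_, k, inferInstance, homogP1 (k ≫ p' ≫ P1.toBase A)
          ![sectionsMap (k ≫ p' ≫ P1.toBase A) x ^ a * c 1, 1] 1 rfl, hz', ?_⟩
        refine crossRel_of_eq h1 rfl ?_
        simp [hc]
      · refine ⟨_, k, inferInstance, homogP1 (k ≫ p' ≫ P1.toBase A)
          ![1, c 0 * u] 0 rfl, hz', ?_⟩
        refine crossRel_of_eq h1 rfl ?_
        simp only [hc, Matrix.cons_val_zero, Matrix.cons_val_one]
        linear_combination - c 0 * hu
  obtain ⟨g, hg⟩ := exists_glue Q (fun k _ i f hf ↦ by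
      have := hf.comp k
      rwa [← Category.assoc] at this) (fun {O} i _ f f' hf hf' ↦ by
      rcases isIntegral_or_isEmpty i with h1 | ⟨h1, h2⟩
      · exact hom_ext_of_locally fun z ↦ (h1.false z).elim
      · obtain ⟨o, ho⟩ := h.exists_ne_closedPoint hx i
        exact hf.unique_of_isIntegral hx hf' o (by rwa [Category.assoc])) ex
  refine ⟨g, crossRel_of_locally fun z ↦ ?_, hg j' _ hQj⟩
  obtain ⟨O, i, hi, f, hz, hf⟩ := ex z
  refine ⟨O, i, hi, hz, ?_⟩
  rw [hg i f hf]
  exact hf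

end RayScheme

/-! ### The covering `U_a → U_r` -/

section RayCover

variable {A : Type u} [CommRing A] [IsDomain A] [IsDiscreteValuationRing A]
  {V V' : Scheme.{u}} {p : V ⟶ P1 A} {p' : V' ⟶ P1 A} {x : A} {R R' : Type u} [CommRing R]
  [CommRing R'] {j : Spec (CommRingCat.of R) ⟶ V} {α : A →+* R} {s v : R} {a b q q' : ℕ}
  {j' : Spec (CommRingCat.of R') ⟶ V'} {α' : A →+* R'} {s' ω : R'}
  {φ : A →+* A} {f : R →+* R'} {H : V' ⟶ V} {g : V' ⟶ P1 A}

/-- `H : V' ⟶ V` is the normalization of the base change of the ray scheme `V` along the Kummer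
covering `φ`, and `g` is the function `x ^ a / y` on `V'`. -/
structure IsRayCover (p : V ⟶ P1 A) (p' : V' ⟶ P1 A) (x : A) (j : Spec (CommRingCat.of R) ⟶ V)
    (α : A →+* R) (s v : R) (a b q q' : ℕ) (j' : Spec (CommRingCat.of R') ⟶ V') (α' : A →+* R')
    (s' ω : R') (φ : A →+* A) (f : R →+* R') (H : V' ⟶ V) (g : V' ⟶ P1 A) : Prop where
  irreducible : Irreducible x
  pos : 0 < b
  base : IsKummer φ x x b
  target : IsRayScheme p x j α s v a b q q'
  source : IsRayScheme p' x j' α' s' ω a 1 0 1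
  comm : H ≫ p = p' ≫ baseChange φ
  chart : j' ≫ H = Spec.map (CommRingCat.ofHom f) ≫ j
  comp : f.comp α = α'.comp φ
  rel : f s * ω ^ q = α' x
  kummer : IsKummer f v ω b
  crossRel : CrossRel x a p' g
  chart_function : j' ≫ g = ptY α' ω

theorem SpecMap_kummer_eq_closedPoint_iff (hx : Irreducible x) (hφ : IsKummer φ x x b) (hb : 0 < b)
    (c : Spec (CommRingCat.of A)) :
    (Spec.map (CommRingCat.ofHom φ)) c = IsLocalRing.closedPoint A ↔
      c = IsLocalRing.closedPoint A := by
  refine (SpecMap_eq_closedPoint_iff hx φ c).trans (Iff.trans ?_ (eq_closedPoint_iff hx c).symm)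
  rw [← hφ.rel]
  exact c.2.pow_mem_iff_mem b hb

theorem IsRayScheme.hom_ext_of_ne (h : IsRayScheme p x j α s v a b q q') {T : Scheme.{u}}
    {e e' : T ⟶ V} (he : e ≫ p = e' ≫ p)
    (hT : ∀ y : T, (e ≫ p ≫ P1.toBase A) y ≠ IsLocalRing.closedPoint A) : e = e' :=
  (h.existsUnique_lift (e ≫ p) (by simpa using hT)).unique rfl he.symm

/-- `H` is glued from the Kummer homomorphism on the ray chart and from the base change of the
projective line elsewhere. The pieces agree because both lie over `baseChange φ`, and morphisms from
integral schemes that meet the generic fibre are determined on the projective line. -/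
theorem IsRayScheme.exists_isRayCover (h : IsRayScheme p x j α s v a b q q')
    (h' : IsRayScheme p' x j' α' s' ω a 1 0 1) (hx : Irreducible x) (hφ : IsKummer φ x x b)
    (hb : 0 < b) (hq : b * q' = a * q + 1) :
    ∃ f H g, IsRayCover p p' x j α s v a b q q' j' α' s' ω φ f H g := by
  obtain ⟨g, hg, hgj⟩ := h'.exists_crossRel hx
  obtain ⟨f, hf, hfs, hfv, hfk⟩ := h.chart.isRay.exists_isKummer h'.chart.isRay hφ hb
  have := h'.isIntegral hx
  have hj' := h'.chart.isOpenImmersion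
  let Q : ∀ {O : Scheme.{u}}, (O ⟶ V') → (O ⟶ V) → Prop := fun i f ↦
    f ≫ p = i ≫ p' ≫ baseChange φ
  have hs' : α' x = s' := by simpa using h'.chart.isRay.rel
  have hne : ∀ {O : Scheme.{u}} (i : O ⟶ V') (f : O ⟶ V) (o : O), f ≫ p = i ≫ p' ≫ baseChange φ →
      (i ≫ p' ≫ P1.toBase A) o ≠ IsLocalRing.closedPoint A →
      (f ≫ p ≫ P1.toBase A) o ≠ IsLocalRing.closedPoint A := by
    intro O i f o hf ho
    have h1 : f ≫ p ≫ P1.toBase A = (i ≫ p' ≫ P1.toBase A) ≫ Spec.map (CommRingCat.ofHom φ) := by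
      rw [← Category.assoc, hf]
      simp only [Category.assoc, baseChange_toBase]
    rw [h1, Scheme.Hom.comp_apply]
    exact fun h2 ↦ ho ((SpecMap_kummer_eq_closedPoint_iff hx hφ hb _).mp h2)
  have hQj : Q j' (Spec.map (CommRingCat.ofHom f) ≫ j) := by
    change _ = _
    rw [Category.assoc, h.chart.comp, ← Category.assoc, h'.chart.comp]
    refine (SpecMap_ptZ _ _ _).trans (Eq.trans ?_ (pt_baseChange _ _ _ _ _).symm)
    -- The two expressions for `y` agree: `s ^ a v ^ q'` is sent to `s ^ a ω ^ (b q') = (s ω ^ q) ^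
    -- a ω = x ^ a ω`, by `b q' = a q + 1`.
    refine ptZ_eq_ptZ_iff.mpr ⟨hf, ?_⟩
    rw [map_mul, map_pow, map_pow, hfv, ← hs', ← hfs, ← pow_mul, hq]
    ring
  have ex : ∀ z : V', ∃ (O : Scheme.{u}) (i : O ⟶ V') (_ : IsOpenImmersion i) (f : O ⟶ V),
      z ∈ Set.range i ∧ Q i f := by
    intro z
    by_cases hz : (p' ≫ P1.toBase A) z = IsLocalRing.closedPoint A
    · exact ⟨_, j', hj', _, h'.mem_range z hz, hQj⟩
    · let k := (genericPart p').ι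
      obtain ⟨l, hl, -⟩ := h.existsUnique_lift (k ≫ p' ≫ baseChange φ) (by
        intro y
        have h1 : (k ≫ p' ≫ baseChange φ) ≫ P1.toBase A =
            (k ≫ p' ≫ P1.toBase A) ≫ Spec.map (CommRingCat.ofHom φ) := by
          simp only [Category.assoc, baseChange_toBase]
        rw [h1, Scheme.Hom.comp_apply]
        exact fun h2 ↦ ι_ne_closedPoint p' y ((SpecMap_kummer_eq_closedPoint_iff hx hφ hb _).mp h2))
      exact ⟨_, k, inferInstance, l, ⟨⟨z, mem_genericPart.mpr hz⟩, rfl⟩, hl⟩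
  obtain ⟨H, hH⟩ := exists_glue Q (fun k _ i f hf ↦ by
      change _ = _
      rw [Category.assoc, hf, Category.assoc]) (fun {O} i _ f f' hf hf' ↦ by
      rcases isIntegral_or_isEmpty i with h1 | ⟨h1, h2⟩
      · exact hom_ext_of_locally fun z ↦ (h1.false z).elim
      · obtain ⟨o, ho⟩ := h'.exists_ne_closedPoint hx i
        exact h.hom_ext (hf.trans hf'.symm) o (hne i f o hf ho)) ex
  refine ⟨f, H, g, hx, hb, hφ, h, h', hom_ext_of_cover fun z ↦ ?_, hH _ _ hQj, hf, hfs, hfk, hg,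
    hgj⟩
  obtain ⟨O, i, hi, f, hz, hf⟩ := ex z
  refine ⟨O, i, hi, hz, ?_⟩
  rw [← Category.assoc, hH i f hf]
  exact hf

variable (D : IsRayCover p p' x j α s v a b q q' j' α' s' ω φ f H g)
include D

/-- A morphism to `V'` is determined by its compositions with `p'` and `x ^ a / y`. -/
theorem IsRayCover.hom_ext {T : Scheme.{u}} {e e' : T ⟶ V'} (hp : e ≫ p' = e' ≫ p')
    (hg : e ≫ g = e' ≫ g) : e = e' := by
  have := D.source.chart.isOpenImmersion
  have hb : e ≫ p' ≫ P1.toBase A = e' ≫ p' ≫ P1.toBase A := by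
    rw [← Category.assoc, hp, Category.assoc]
  refine hom_ext_of_locally fun z ↦ ?_
  by_cases hz : (e ≫ p' ≫ P1.toBase A) z = IsLocalRing.closedPoint A
  · have hz' := hz
    rw [hb] at hz'
    rw [Scheme.Hom.comp_apply] at hz hz'
    let U := e ⁻¹ᵁ j'.opensRange ⊓ e' ⁻¹ᵁ j'.opensRange
    have h1 : Set.range (U.ι ≫ e) ⊆ Set.range j' := by
      rintro _ ⟨y, rfl⟩
      exact y.2.1
    have h2 : Set.range (U.ι ≫ e') ⊆ Set.range j' := by
      rintro _ ⟨y, rfl⟩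
      exact y.2.2
    refine ⟨U, ⟨D.source.mem_range _ hz, D.source.mem_range _ hz'⟩, ?_⟩
    obtain ⟨l, hl⟩ : ∃ l, l ≫ j' = U.ι ≫ e := ⟨_, IsOpenImmersion.lift_fac j' _ h1⟩
    obtain ⟨l', hl'⟩ : ∃ l, l ≫ j' = U.ι ≫ e' := ⟨_, IsOpenImmersion.lift_fac j' _ h2⟩
    rw [← hl, ← hl']
    congr 1
    -- On the ray chart `p'` alone does not see `ω` where `x` vanishes; the function `g = [1 : ω]`
    -- recovers it.
    have h3 : l ≫ ptY α' ω = l' ≫ ptY α' ω := by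
      rw [← D.chart_function, ← Category.assoc, ← Category.assoc, hl, hl', Category.assoc, hg,
        Category.assoc]
    obtain ⟨h4, h5⟩ := comp_pt_cross h3
    refine hom_ext_Spec (D.source.chart.isRay.hom_ext h4 ?_ (h5 1))
    have hs' : α' x = s' := by simpa using D.source.chart.isRay.rel
    rw [← hs']
    exact congrArg (fun m ↦ m x) h4
  · refine ⟨genericPart (e ≫ p'), mem_genericPart.mpr (by simpa using hz), ?_⟩
    refine D.source.hom_ext_of_ne (by rw [Category.assoc, Category.assoc, hp]) fun y ↦ ?_
    have h1 := ι_ne_closedPoint (e ≫ p') y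
    simpa only [Category.assoc] using h1

/-- By `hom_ext`, the pair `(p', g)` is a monomorphism into the fibre product of two projective
lines, which is separated over the base. -/
theorem IsRayCover.isSeparated : IsSeparated (p' ≫ P1.toBase A) := by
  obtain ⟨m, hm1, hm2⟩ : ∃ m : V' ⟶ pullback (P1.toBase A) (P1.toBase A),
      m ≫ pullback.fst _ _ = p' ∧ m ≫ pullback.snd _ _ = g :=
    ⟨pullback.lift p' g D.crossRel.1, pullback.lift_fst _ _ _, pullback.lift_snd _ _ _⟩
  have hm : Mono m := by
    refine ⟨fun e e' he ↦ D.hom_ext ?_ ?_⟩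
    · rw [← hm1, ← Category.assoc, he, Category.assoc]
    · rw [← hm2, ← Category.assoc, he, Category.assoc]
  rw [← hm1, Category.assoc]
  infer_instance

end RayCover

/-! ### Comparison of `U_a` with the base change of `U_r` -/

section Pullback

variable {A : Type u} [CommRing A] [IsDomain A] [IsDiscreteValuationRing A]
  {V V' : Scheme.{u}} {p : V ⟶ P1 A} {p' : V' ⟶ P1 A} {x : A} {R R' : Type u} [CommRing R]
  [CommRing R'] {j : Spec (CommRingCat.of R) ⟶ V} {α : A →+* R} {s v : R} {a b q q' : ℕ}
  {j' : Spec (CommRingCat.of R') ⟶ V'} {α' : A →+* R'} {s' ω : R'}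
  {φ : A →+* A} {f : R →+* R'} {H : V' ⟶ V} {g : V' ⟶ P1 A}
  {M : Scheme.{u}} {p₁ : M ⟶ V} {p₂ : M ⟶ Spec (CommRingCat.of A)} {ρ : V' ⟶ M}

/-- The preimage of the ray chart of `V` is the ray chart of `V'`. -/
theorem IsRayCover.mem_range_of_mem_range
    (D : IsRayCover p p' x j α s v a b q q' j' α' s' ω φ f H g) (z : V')
    (hz : H z ∈ Set.range j) : z ∈ Set.range j' := by
  by_cases hz' : (p' ≫ P1.toBase A) z = IsLocalRing.closedPoint A
  · exact D.source.mem_range z hz'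
  have := D.target.chart.isOpenImmersion
  -- The claim is tested on the residue field of a point off the special fibre. There `x ≠ 0`, and
  -- `s ^ b v ^ q = x ^ b` gives `s ≠ 0`, so `y / x ^ a` is a nonzero value for `ω`. The resulting
  -- point of the ray chart has the same image on the projective line as `z`, hence equals it.
  let κ := V'.residueField z
  let i : Spec (.of κ) ⟶ V' := V'.fromSpecResidueField z
  have hi : ∀ y, i y = z := fun y ↦ Scheme.fromSpecResidueField_apply z y
  have h1 : Set.range (i ≫ H) ⊆ Set.range j := by
    rintro _ ⟨y, rfl⟩
    rw [Scheme.Hom.comp_apply, hi]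
    exact hz
  obtain ⟨l, hl⟩ : ∃ l, l ≫ j = i ≫ H := ⟨_, IsOpenImmersion.lift_fac j _ h1⟩
  obtain ⟨θ, rfl⟩ := exists_ringHom (g := l)
  obtain ⟨τ, hτ⟩ := exists_ringHom (g := i ≫ p' ≫ P1.toBase A)
  obtain ⟨y₀⟩ : Nonempty (Spec (.of κ)) := inferInstance
  have hτx : τ x ≠ 0 := by
    intro h0
    refine hz' ?_
    have h2 : (i ≫ p' ≫ P1.toBase A) (y₀) = IsLocalRing.closedPoint A := by
      rw [hτ]
      refine (SpecMap_eq_closedPoint_iff D.irreducible τ _).mpr ?_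
      rw [h0]
      exact Ideal.zero_mem _
    rwa [Scheme.Hom.comp_apply, hi] at h2
  have h2 : (i ≫ p') ≫ baseChange φ = ptZ (θ.comp α) (θ s ^ a * θ v ^ q') := by
    rw [Category.assoc, ← D.comm, ← Category.assoc, ← hl, Category.assoc, D.target.chart.comp]
    refine (SpecMap_ptZ _ _ _).trans ?_
    rw [map_mul, map_pow, map_pow]
  have hτ' : ∀ (β : A →+* κ) c l (hl : c l = 1), i ≫ p' = pt β c l hl → β = τ := by
    intro β c l hl hβ
    refine SpecMap_ofHom_injective ?_
    rw [← hτ, ← Category.assoc, hβ, pt_toBase]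
  have h3 : i ≫ p' = ptZ τ (θ s ^ a * θ v ^ q') ∧ θ.comp α = τ.comp φ := by
    rcases eq_ptZ_or_ptY (i ≫ p') with ⟨β, y, hβ⟩ | ⟨β, y, hβ⟩
    · obtain rfl := hτ' _ _ _ _ hβ
      have h4 := (congrArg (fun m ↦ m ≫ baseChange φ) hβ).symm.trans h2
      have h5 := ptZ_eq_ptZ_iff.mp ((pt_baseChange _ _ _ _ _).symm.trans h4)
      exact ⟨hβ.trans (ptZ_eq_ptZ_iff.mpr ⟨rfl, h5.2⟩), h5.1.symm⟩
    · obtain rfl := hτ' _ _ _ _ hβ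
      have h4 := (congrArg (fun m ↦ m ≫ baseChange φ) hβ).symm.trans h2
      have h5 := ptZ_eq_ptY_iff.mp (h4.symm.trans (pt_baseChange _ _ _ _ _))
      exact ⟨hβ.trans (ptZ_eq_ptY_iff.mpr ⟨rfl, h5.2⟩).symm, h5.1⟩
  have h4 : θ s ^ b * θ v ^ q = τ x ^ b := by
    rw [← map_pow, ← map_pow, ← map_mul, ← D.target.chart.isRay.rel, ← map_pow, D.base.rel]
    exact congrArg (fun m ↦ m x) h3.2
  have hs0 : θ s ≠ 0 := by
    intro h0
    rw [h0, zero_pow D.pos.ne', zero_mul] at h4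
    exact hτx (eq_zero_of_pow_eq_zero h4.symm)
  have hv0 : θ v ≠ 0 := (D.target.chart.isRay.isUnit.map θ).ne_zero
  have hy0 : θ s ^ a * θ v ^ q' ≠ 0 := mul_ne_zero (pow_ne_zero _ hs0) (pow_ne_zero _ hv0)
  obtain ⟨k, hk, hks, hkω⟩ := D.source.chart.isRay.exists_lift τ (τ x)
    (θ s ^ a * θ v ^ q' / τ x ^ a) (IsUnit.mk0 _ (div_ne_zero hy0 (pow_ne_zero _ hτx))) (by simp)
  have h5 : Spec.map (CommRingCat.ofHom k) ≫ j' = i := by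
    refine (D.source.hom_ext_of_ne ?_ ?_).symm
    · rw [Category.assoc, D.source.chart.comp, h3.1]
      refine Eq.trans ?_ (SpecMap_ptZ _ _ _).symm
      refine ptZ_eq_ptZ_iff.mpr ⟨hk.symm, ?_⟩
      rw [map_mul, map_pow, map_pow, hks, hkω, pow_one, mul_div_cancel₀ _ (pow_ne_zero _ hτx)]
    · intro y
      rw [Scheme.Hom.comp_apply, hi]
      exact hz'
  refine ⟨Spec.map (CommRingCat.ofHom k) (y₀), ?_⟩
  rw [← Scheme.Hom.comp_apply, h5, hi]

/-- The comparison morphism `ρ` from `V'` to the base change `M` of `V` along `φ`. -/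
structure IsRayComparison (p : V ⟶ P1 A) (p' : V' ⟶ P1 A) (x : A)
    (j : Spec (CommRingCat.of R) ⟶ V)
    (α : A →+* R) (s v : R) (a b q q' : ℕ) (j' : Spec (CommRingCat.of R') ⟶ V') (α' : A →+* R')
    (s' ω : R') (φ : A →+* A) (f : R →+* R') (H : V' ⟶ V) (g : V' ⟶ P1 A)
    (p₁ : M ⟶ V) (p₂ : M ⟶ Spec (CommRingCat.of A)) (ρ : V' ⟶ M) : Prop
    extends IsRayCover p p' x j α s v a b q q' j' α' s' ω φ f H g where
  isPullback : IsPullback p₁ p₂ (p ≫ P1.toBase A) (Spec.map (CommRingCat.ofHom φ))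
  comp_p₁ : ρ ≫ p₁ = H
  comp_p₂ : ρ ≫ p₂ = p' ≫ P1.toBase A

variable (D : IsRayComparison p p' x j α s v a b q q' j' α' s' ω φ f H g p₁ p₂ ρ)
include D

theorem IsRayComparison.ne_closedPoint {T : Scheme.{u}} (t : T ⟶ M) (y : T)
    (h : (t ≫ p₂) y ≠ IsLocalRing.closedPoint A) :
    (t ≫ p₁ ≫ p ≫ P1.toBase A) y ≠ IsLocalRing.closedPoint A := by
  have h1 : t ≫ p₁ ≫ p ≫ P1.toBase A = (t ≫ p₂) ≫ Spec.map (CommRingCat.ofHom φ) := by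
    rw [D.isPullback.w, Category.assoc]
  rw [h1, Scheme.Hom.comp_apply]
  exact fun h2 ↦ h ((SpecMap_kummer_eq_closedPoint_iff D.irreducible D.base D.pos _).mp h2)

/-- Since the projective line is compatible with base change, `M` maps to the projective line over
its second projection; this is the function `y` on `M`. -/
theorem IsRayComparison.exists_hom_P1 :
    ∃ n : M ⟶ P1 A, n ≫ baseChange φ = p₁ ≫ p ∧ n ≫ P1.toBase A = p₂ ∧ ρ ≫ n = p' := by
  obtain ⟨n, hn, hn2⟩ := exists_lift_baseChange φ (p₁ ≫ p) p₂ (by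
    rw [Category.assoc, D.isPullback.w])
  refine ⟨n, hn, hn2, hom_ext_baseChange φ ?_ ?_⟩
  · rw [Category.assoc, hn, ← Category.assoc, D.comp_p₁, D.comm]
  · rw [Category.assoc, hn2, D.comp_p₂]

/-- Off the special fibre `V'` is the projective line. So the coordinate `y` on `M` gives a morphism
to `V'`; it lies over the given one because `V` is the projective line there too. -/
theorem IsRayComparison.exists_lift {T : Scheme.{u}} (t : T ⟶ M)
    (h : ∀ y, (t ≫ p₂) y ≠ IsLocalRing.closedPoint A) : ∃ l : T ⟶ V', l ≫ ρ = t := by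
  obtain ⟨n, hn, hn2, -⟩ := D.exists_hom_P1
  obtain ⟨l, hl, -⟩ := D.source.existsUnique_lift (t ≫ n) (by
    rw [Category.assoc, hn2]
    exact h)
  refine ⟨l, D.isPullback.hom_ext ?_ ?_⟩
  · rw [Category.assoc, D.comp_p₁]
    have h1 : (l ≫ H) ≫ p = (t ≫ p₁) ≫ p := by
      rw [Category.assoc, D.comm, ← Category.assoc, hl, Category.assoc, hn, Category.assoc]
    exact (D.target.hom_ext_of_ne h1.symm fun y ↦ by
      rw [Category.assoc]; exact D.ne_closedPoint t y (h y)).symm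
  · rw [Category.assoc, D.comp_p₂, ← Category.assoc, hl, Category.assoc, hn2]

theorem IsRayComparison.comp_p'_eq {T : Scheme.{u}} {e e' : T ⟶ V'} (h : e ≫ ρ = e' ≫ ρ) :
    e ≫ p' = e' ≫ p' := by
  obtain ⟨n, -, -, hn⟩ := D.exists_hom_P1
  rw [← hn, ← Category.assoc, h, Category.assoc]

theorem IsRayComparison.hom_ext {T : Scheme.{u}} {e e' : T ⟶ V'} (h : e ≫ ρ = e' ≫ ρ)
    (hg : e ≫ g = e' ≫ g) : e = e' :=
  D.toIsRayCover.hom_ext (D.comp_p'_eq h) hg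

theorem IsRayComparison.hom_ext_of_ne {T : Scheme.{u}} {e e' : T ⟶ V'} (h : e ≫ ρ = e' ≫ ρ)
    (hT : ∀ y, (e ≫ p' ≫ P1.toBase A) y ≠ IsLocalRing.closedPoint A) : e = e' :=
  D.source.hom_ext_of_ne (D.comp_p'_eq h) hT

end Pullback

/-! ### Base change of Kummer extensions, and integrality of the base change of `U_r` -/

section Kummer

variable {R S : Type u} [CommRing R] [CommRing S] {f : R →+* S} {w : R} {τ : S} {b : ℕ}

/-- `S` is free over the domain `R`, so multiplication by the nonzero element `w = τ ^ b` is
injective. -/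
theorem IsKummer.mem_nonZeroDivisors [IsDomain R] (h : IsKummer f w τ b) (hb : 0 < b)
    (hw : w ≠ 0) : τ ∈ nonZeroDivisors S := by
  obtain ⟨e, he, heτ⟩ := h.exists_ringEquiv (isKummer_adjoinRoot w b)
  have hmonic : (Polynomial.X ^ b - Polynomial.C w).Monic := Polynomial.monic_X_pow_sub_C w hb.ne'
  have hfree : Module.Free R (AdjoinRoot (Polynomial.X ^ b - Polynomial.C w)) :=
    .of_basis (AdjoinRoot.powerBasis' hmonic).basis
  rw [mem_nonZeroDivisors_iff_right]
  intro z hz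
  have h1 : w • e z = 0 := by
    rw [Algebra.smul_def]
    have h2 : (algebraMap R (AdjoinRoot (Polynomial.X ^ b - Polynomial.C w))) w = e (τ ^ b) := by
      rw [h.rel]
      exact (congrArg (fun m ↦ m w) he).symm
    have h3 : τ ^ b * z = 0 := by
      rw [← Nat.sub_add_cancel hb, pow_succ, mul_assoc, mul_comm τ z, hz, mul_zero]
    rw [h2, ← map_mul, h3, map_zero]
  have h2 := (smul_eq_zero_iff_right hw).mp h1
  exact (map_eq_zero_iff e e.injective).mp h2

/-- Adjoining a `b`-th root of `x` commutes with extension of scalars: `S` is the tensor product of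
`R` with `A` along `φ`, and `τ` is the image of the second copy of `x`. -/
theorem IsKummer.exists_isPushout {A : Type u} [CommRing A] {φ : A →+* A} {x : A}
    (hφ : IsKummer φ x x b) {β : A →+* R} (h : IsKummer f (β x) τ b) :
    ∃ ψ : A →+* S, ψ x = τ ∧ IsPushout (CommRingCat.ofHom β) (CommRingCat.ofHom φ)
      (CommRingCat.ofHom f) (CommRingCat.ofHom ψ) := by
  obtain ⟨ψ, hψ, hψx⟩ := hφ.exists_lift (f.comp β) τ h.rel
  have hw : CommRingCat.ofHom β ≫ CommRingCat.ofHom f =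
      CommRingCat.ofHom φ ≫ CommRingCat.ofHom ψ := by
    rw [← CommRingCat.ofHom_comp, ← CommRingCat.ofHom_comp, hψ]
  have key : ∀ s : PushoutCocone (CommRingCat.ofHom β) (CommRingCat.ofHom φ),
      ∃! l : CommRingCat.of S ⟶ s.pt, CommRingCat.ofHom f ≫ l = s.inl ∧
        CommRingCat.ofHom ψ ≫ l = s.inr := by
    intro s
    have hs : s.inl.hom.comp β = s.inr.hom.comp φ := congrArg CommRingCat.Hom.hom s.condition
    obtain ⟨l, ⟨hl, hlτ⟩, hu⟩ := h.existsUnique_lift s.inl.hom (s.inr.hom x) (by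
      rw [← map_pow, hφ.rel]
      exact (congrArg (fun m ↦ m x) hs).symm)
    refine ⟨CommRingCat.ofHom l, ⟨CommRingCat.hom_ext hl, CommRingCat.hom_ext ?_⟩,
      fun m ⟨hm, hm'⟩ ↦ CommRingCat.hom_ext (hu _ ⟨congrArg CommRingCat.Hom.hom hm, ?_⟩)⟩
    · refine hφ.hom_ext ?_ ?_
      · rw [← hs, ← hl]
        change (l.comp ψ).comp φ = _
        rw [RingHom.comp_assoc, hψ]
        rfl
      · exact (congrArg l hψx).trans hlτ
    · rw [← hψx]
      exact congrArg (fun n ↦ n.hom x) hm'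
  choose l hl hu using key
  exact ⟨ψ, hψx, ⟨⟨hw⟩, ⟨PushoutCocone.IsColimit.mk hw l (fun s ↦ (hl s).1) (fun s ↦ (hl s).2)
    fun s m h1 h2 ↦ hu s m ⟨h1, h2⟩⟩⟩⟩

end Kummer

section Pullback

variable {A : Type u} [CommRing A] [IsDomain A] [IsDiscreteValuationRing A]
  {V V' : Scheme.{u}} {p : V ⟶ P1 A} {p' : V' ⟶ P1 A} {x : A} {R R' : Type u} [CommRing R]
  [CommRing R'] {j : Spec (CommRingCat.of R) ⟶ V} {α : A →+* R} {s v : R} {a b q q' : ℕ}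
  {j' : Spec (CommRingCat.of R') ⟶ V'} {α' : A →+* R'} {s' ω : R'}
  {φ : A →+* A} {f : R →+* R'} {H : V' ⟶ V} {g : V' ⟶ P1 A}
  {M : Scheme.{u}} {p₁ : M ⟶ V} {p₂ : M ⟶ Spec (CommRingCat.of A)} {ρ : V' ⟶ M}

variable (D : IsRayComparison p p' x j α s v a b q q' j' α' s' ω φ f H g p₁ p₂ ρ)
include D

/-- Over `Spec S` the fibre product along `φ` is the spectrum of `S[τ] / (τ ^ b = x)`, by pasting
the pushout square to the cartesian square of `M`. -/
theorem IsRayComparison.exists_kummer_chart {S : Type u} [CommRing S] (i : Spec (.of S) ⟶ V)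
    (β : A →+* S) (hβ : i ≫ p ≫ P1.toBase A = Spec.map (CommRingCat.ofHom β)) :
    ∃ (B : Type u) (_ : CommRing B) (e : S →+* B) (τ : B) (ψ : A →+* B) (k : Spec (.of B) ⟶ M),
      IsKummer e (β x) τ b ∧ ψ x = τ ∧ k ≫ p₂ = Spec.map (CommRingCat.ofHom ψ) ∧
      IsPullback k (Spec.map (CommRingCat.ofHom e)) p₁ i := by
  have h := isKummer_adjoinRoot (β x) b
  obtain ⟨ψ, hψ, hP⟩ := D.base.exists_isPushout h
  have h1 := isPullback_SpecMap_of_isPushout _ _ _ _ hP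
  rw [← hβ] at h1
  obtain ⟨k, hk1, hk2⟩ : ∃ k, k ≫ p₁ = Spec.map (CommRingCat.ofHom (AdjoinRoot.of _)) ≫ i ∧
      k ≫ p₂ = Spec.map (CommRingCat.ofHom ψ) :=
    ⟨D.isPullback.lift _ _ ((Category.assoc _ _ _).trans h1.w), D.isPullback.lift_fst _ _ _,
      D.isPullback.lift_snd _ _ _⟩
  refine ⟨_, _, _, _, ψ, k, h, hψ, hk2, ?_⟩
  rw [← hk2] at h1
  exact (IsPullback.of_bot h1 hk1.symm D.isPullback).flip

/-- Each Kummer chart of `M` maps to the integral scheme `V'` after inverting the nonzerodivisor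
`τ`, because `τ` is the coordinate `x` of the base and inverting it removes the special fibre. -/
theorem IsRayComparison.isIntegral : IsIntegral M := by
  have := D.source.isIntegral D.irreducible
  have := D.target.isIntegral D.irreducible
  refine isIntegral_of_charts ρ fun z ↦ ?_
  obtain ⟨_, ⟨W, (hW : IsAffineOpen W), rfl⟩, h1, -⟩ :=
    V.isBasis_affineOpens.exists_subset_of_mem_open (Set.mem_univ (p₁ z)) isOpen_univ
  have h1' : p₁ z ∈ Set.range hW.fromSpec := hW.range_fromSpec.ge h1
  have hne : Nonempty (Spec Γ(V, W)) := ⟨h1'.choose⟩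
  have hWne : Nonempty W := ⟨⟨_, h1⟩⟩
  have hdom : IsDomain Γ(V, W) := inferInstance
  obtain ⟨β, hβ⟩ := exists_ringHom (g := hW.fromSpec ≫ p ≫ P1.toBase A)
  obtain ⟨o, ho⟩ := D.target.exists_ne_closedPoint D.irreducible hW.fromSpec
  have hβx : β x ≠ 0 := by
    intro h0
    refine ho ?_
    rw [hβ]
    refine (SpecMap_eq_closedPoint_iff D.irreducible β _).mpr ?_
    rw [h0]
    exact Ideal.zero_mem _
  obtain ⟨B, _, e, τ, ψ, k, hK, hψ, hk, hP⟩ := D.exists_kummer_chart (S := Γ(V, W)) hW.fromSpec β hβ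
  have hk' : IsOpenImmersion k := MorphismProperty.of_isPullback hP.flip inferInstance
  have hψτ : IsUnit ((algebraMap B (Localization.Away τ)).comp ψ x) := by
    rw [RingHom.comp_apply, hψ]
    exact IsLocalization.Away.algebraMap_isUnit _
  obtain ⟨l, hl⟩ := D.exists_lift (Spec.map (CommRingCat.ofHom (algebraMap B (Localization.Away τ)))
    ≫ k) (by
    rw [Category.assoc, hk, ← Spec.map_comp, ← CommRingCat.ofHom_comp]
    exact apply_ne_closedPoint_of_isUnit D.irreducible _ hψτ)
  refine ⟨B, _, k, hk', τ, l, hK.mem_nonZeroDivisors D.pos hβx, ?_, hl⟩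
  obtain ⟨w, hw⟩ := h1'
  obtain ⟨y, hy, -⟩ := Scheme.exists_preimage_of_isPullback hP z w hw.symm
  exact ⟨y, hy⟩

end Pullback

/-! ### Lifting to `U_a` where `x ^ a / y` extends -/

section Extension

variable {A : Type u} [CommRing A] [IsDomain A] [IsDiscreteValuationRing A]
  {V V' : Scheme.{u}} {p : V ⟶ P1 A} {p' : V' ⟶ P1 A} {x : A} {R R' : Type u} [CommRing R]
  [CommRing R'] {j : Spec (CommRingCat.of R) ⟶ V} {α : A →+* R} {s v : R} {a b q q' : ℕ}
  {j' : Spec (CommRingCat.of R') ⟶ V'} {α' : A →+* R'} {s' ω : R'}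
  {φ : A →+* A} {f : R →+* R'} {H : V' ⟶ V} {g : V' ⟶ P1 A}
  {M : Scheme.{u}} {p₁ : M ⟶ V} {p₂ : M ⟶ Spec (CommRingCat.of A)} {ρ : V' ⟶ M}

variable (D : IsRayComparison p p' x j α s v a b q q' j' α' s' ω φ f H g p₁ p₂ ρ)
include D

/-- This is the core of the universal property. With `γ = [c₀ : c₁]` extending `1 / ω`, the
relations `ω ^ b = v` and `s ω ^ q = x` become homogeneous relations between `c₀` and `c₁`. They
make `w = c₁ / c₀` a function on `Spec S`, and `ω ↦ w` defines the homomorphism `R' → S`. The second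
relation ensures that it is compatible with the structure of `A`-algebra. -/
theorem IsRayComparison.exists_lift_of_injective {S K : Type u} [CommRing S] [Field K]
    (ι : S →+* K) (hι : Function.Injective ι) (t : Spec (.of S) ⟶ M) (γ : Spec (.of S) ⟶ P1 A)
    (hγ : γ ≫ P1.toBase A = t ≫ p₂) (i : Fin 2) (hi : ⊤ ≤ γ ⁻¹ᵁ chartOpen A i)
    (ht : Set.range (t ≫ p₁) ⊆ Set.range j) (e : Spec (.of K) ⟶ V')
    (he : e ≫ ρ = Spec.map (CommRingCat.ofHom ι) ≫ t)
    (heg : e ≫ g = Spec.map (CommRingCat.ofHom ι) ≫ γ) :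
    ∃ l : Spec (.of S) ⟶ V', l ≫ ρ = t ∧ l ≫ g = γ := by
  have := D.target.chart.isOpenImmersion
  have := D.source.chart.isOpenImmersion
  obtain ⟨τ, c, hc, rfl⟩ := eq_pt γ i hi
  rw [pt_toBase] at hγ
  obtain ⟨θ', hθ'⟩ : ∃ l, l ≫ j = t ≫ p₁ := ⟨_, IsOpenImmersion.lift_fac j _ ht⟩
  obtain ⟨θ, rfl⟩ := exists_ringHom (g := θ')
  have hθτ : θ.comp α = τ.comp φ := by
    refine SpecMap_ofHom_injective ?_
    rw [CommRingCat.ofHom_comp, CommRingCat.ofHom_comp, Spec.map_comp, Spec.map_comp, hγ,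
      Category.assoc, ← D.isPullback.w, ← Category.assoc, ← hθ', Category.assoc,
      D.target.chart.comp_toBase]
  have he₁ : e ≫ H = Spec.map (CommRingCat.ofHom (ι.comp θ)) ≫ j := by
    rw [← D.comp_p₁, ← Category.assoc, he, Category.assoc, ← hθ', CommRingCat.ofHom_comp,
      Spec.map_comp, Category.assoc]
  obtain ⟨e', he'⟩ : ∃ l, l ≫ j' = e := by
    refine ⟨_, IsOpenImmersion.lift_fac j' e ?_⟩
    rintro _ ⟨y, rfl⟩
    refine D.mem_range_of_mem_range _ ?_
    rw [← Scheme.Hom.comp_apply, he₁]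
    exact ⟨_, (Scheme.Hom.comp_apply _ _ _).symm⟩
  obtain ⟨μ, rfl⟩ := exists_ringHom (g := e')
  have hμf : μ.comp f = ι.comp θ := by
    refine SpecMap_ofHom_injective ?_
    rw [← cancel_mono j, ← he₁, ← he', Category.assoc, D.chart, CommRingCat.ofHom_comp,
      Spec.map_comp, Category.assoc]
  have hμα : μ.comp α' = ι.comp τ := by
    refine SpecMap_ofHom_injective ?_
    rw [CommRingCat.ofHom_comp, CommRingCat.ofHom_comp, Spec.map_comp, Spec.map_comp,
      ← D.source.chart.comp_toBase, hγ, ← Category.assoc, he', ← D.comp_p₂, ← Category.assoc, he,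
      Category.assoc]
  have hμω : ι (c 1) = μ ω * ι (c 0) := by
    rw [← he', Category.assoc, D.chart_function] at heg
    have h1 := (pt_eq_pt_iff.mp (((SpecMap_ptY μ α' ω).symm.trans heg).trans
      (SpecMap_pt ι τ c i hc))).2
    simpa using h1
  have e1 : ∀ r, μ (f r) = ι (θ r) := fun r ↦ congrArg (fun m ↦ m r) hμf
  have e2 : ∀ r, μ (α' r) = ι (τ r) := fun r ↦ congrArg (fun m ↦ m r) hμα
  -- Both relations hold in `K`, where a point of `V'` is given, and descend to `S` because `ι` is
  -- injective.
  have r1 : c 1 ^ b = θ v * c 0 ^ b := by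
    apply hι
    rw [map_pow, map_mul, hμω, map_pow, mul_pow, ← e1 v, ← D.kummer.rel, map_pow]
  have r2 : θ s * c 1 ^ q = τ x * c 0 ^ q := by
    apply hι
    rw [map_mul, map_pow, map_mul, hμω, map_pow, ← e1 s, ← e2 x, ← D.rel, map_mul, map_pow]
    ring
  have hw : ∃ w, c 1 = w * c 0 ∧ w ^ b = θ v ∧ θ s * w ^ q = τ x := by
    have : i = 0 ∨ i = 1 := by omega
    obtain rfl | rfl := this
    · rw [hc, one_pow, mul_one] at r1 r2
      exact ⟨c 1, by rw [hc, mul_one], r1, r2⟩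
    -- If `c₁ = 1`, the first relation reads `1 = v c₀ ^ b`, so `c₀` is invertible. This excludes a
    -- pole of `ω`.
    · rw [hc, one_pow] at r1 r2
      have hu : IsUnit (c 0) := isUnit_of_dvd_one
        ((dvd_pow_self _ D.pos.ne').trans ⟨θ v, by rw [mul_comm, ← r1]⟩)
      obtain ⟨w, hw⟩ := hu.exists_right_inv
      have h1 : ∀ n, c 0 ^ n * w ^ n = 1 := fun n ↦ by rw [← mul_pow, hw, one_pow]
      refine ⟨w, by rw [hc, mul_comm, hw], ?_, ?_⟩
      · linear_combination w ^ b * r1 + θ v * h1 b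
      · linear_combination w ^ q * r2 + τ x * h1 q
  obtain ⟨w, hw, hwb, hwq⟩ := hw
  obtain ⟨k, hk, hkω⟩ := D.kummer.exists_lift θ w hwb
  have hkα : k.comp α' = τ := by
    refine D.base.hom_ext ?_ ?_
    · rw [RingHom.comp_assoc, ← D.comp, ← RingHom.comp_assoc, hk, hθτ]
    · rw [RingHom.comp_apply, ← D.rel, map_mul, map_pow, hkω, ← hwq]
      exact congrArg (fun z ↦ z * w ^ q) (congrArg (fun m ↦ m s) hk)
  refine ⟨Spec.map (CommRingCat.ofHom k) ≫ j', D.isPullback.hom_ext ?_ ?_, ?_⟩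
  · rw [Category.assoc, D.comp_p₁, Category.assoc, D.chart, ← Category.assoc, ← Spec.map_comp,
      ← CommRingCat.ofHom_comp, hk, hθ']
  · rw [Category.assoc, D.comp_p₂, Category.assoc, D.source.chart.comp_toBase, ← Spec.map_comp,
      ← CommRingCat.ofHom_comp, hkα, hγ]
  · rw [Category.assoc, D.chart_function]
    refine (SpecMap_ptY _ _ _).trans (pt_eq_pt_iff.mpr ⟨hkα, ?_⟩)
    simp [hkω, hw]

/-- A lift to `V'` on a dense open subset extends as soon as `x ^ a / y` extends. -/
theorem IsRayComparison.exists_extension {T : Scheme.{u}} [IsIntegral T] (t : T ⟶ M)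
    (γ : T ⟶ P1 A) (O : T.Opens) (hO : (O : Set T).Nonempty) (m : O.toScheme ⟶ V')
    (hm : m ≫ ρ = O.ι ≫ t) (hmg : m ≫ g = O.ι ≫ γ) : ∃ l : T ⟶ V', l ≫ ρ = t ∧ l ≫ g = γ := by
  have := D.target.chart.isOpenImmersion
  have hγ : γ ≫ P1.toBase A = t ≫ p₂ := by
    refine ext_of_generic O hO ?_
    rw [← Category.assoc, ← hmg, Category.assoc, ← D.crossRel.1, ← D.comp_p₂, ← Category.assoc, hm,
      Category.assoc]
  -- The generic point of `Spec S` lands in `O`, so `m` supplies the point over the fraction field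
  -- that `exists_lift_of_injective` needs.
  have exists_lift_affine : ∀ {S : Type u} [CommRing S] [IsDomain S] (w : Spec (.of S) ⟶ T)
      [IsOpenImmersion w] (i : Fin 2), (∀ y, w y ∈ (t ≫ p₁) ⁻¹ᵁ j.opensRange) →
      (∀ y, w y ∈ γ ⁻¹ᵁ chartOpen A i) →
      ∃ l : Spec (.of S) ⟶ V', l ≫ ρ = w ≫ t ∧ l ≫ g = w ≫ γ := by
    intro S _ _ w _ i hw hw'
    let K := FractionRing S
    let ι := algebraMap S K
    have hι : Function.Injective ι := IsFractionRing.injective S K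
    have hO' : ∀ y, (Spec.map (CommRingCat.ofHom ι) ≫ w) y ∈ O := by
      intro y
      obtain ⟨y₀⟩ : Nonempty (Spec (.of S)) := inferInstance
      obtain ⟨_, ⟨y₁, rfl⟩, hy₁⟩ := nonempty_preirreducible_inter w.opensRange.2 O.2 ⟨_, y₀, rfl⟩ hO
      have h1 : Spec.map (CommRingCat.ofHom ι) y ⤳ y₁ := by
        refine (PrimeSpectrum.le_iff_specializes (Spec.map (CommRingCat.ofHom ι) y) y₁).mp ?_
        intro r hr
        have h2 : ι r = 0 := by
          by_contra h0
          exact y.2.ne_top (Ideal.eq_top_of_isUnit_mem _ hr (IsUnit.mk0 _ h0))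
        rw [hι (h2.trans (map_zero ι).symm)]
        exact Ideal.zero_mem _
      rw [Scheme.Hom.comp_apply]
      exact (h1.map w.continuous).mem_open O.2 hy₁
    obtain ⟨e', he'⟩ : ∃ l, l ≫ O.ι = Spec.map (CommRingCat.ofHom ι) ≫ w := by
      refine ⟨_, IsOpenImmersion.lift_fac O.ι _ ?_⟩
      rw [Scheme.Opens.range_ι]
      rintro _ ⟨y, rfl⟩
      exact hO' y
    refine D.exists_lift_of_injective ι hι (w ≫ t) (w ≫ γ) (by simp [hγ]) i (fun y _ ↦ ?_) ?_
      (e' ≫ m) ?_ ?_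
    · exact hw' y
    · rintro _ ⟨y, rfl⟩
      rw [Category.assoc, Scheme.Hom.comp_apply]
      exact hw y
    · rw [Category.assoc, hm, ← Category.assoc, he', Category.assoc]
    · rw [Category.assoc, hmg, ← Category.assoc, he', Category.assoc]
  let Q : ∀ {O : Scheme.{u}}, (O ⟶ T) → (O ⟶ V') → Prop := fun i f ↦
    f ≫ ρ = i ≫ t ∧ f ≫ g = i ≫ γ
  have ex : ∀ z : T, ∃ (O : Scheme.{u}) (i : O ⟶ T) (_ : IsOpenImmersion i) (f : O ⟶ V'),
      z ∈ Set.range i ∧ Q i f := by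
    intro z
    by_cases hz : (t ≫ p₂) z = IsLocalRing.closedPoint A
    · obtain ⟨i, hi⟩ := exists_mem_chartOpen (γ z)
      have hzj : p₁ (t z) ∈ Set.range j := by
        refine D.target.mem_range _ ?_
        have h1 : (t ≫ p₁ ≫ p ≫ P1.toBase A) z = IsLocalRing.closedPoint A := by
          rw [D.isPullback.w, ← Category.assoc, Scheme.Hom.comp_apply, hz]
          exact (SpecMap_kummer_eq_closedPoint_iff D.irreducible D.base D.pos _).mpr rfl
        rwa [Scheme.Hom.comp_apply, Scheme.Hom.comp_apply] at h1
      have := D.target.chart.isOpenImmersion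
      let N : T.Opens := (t ≫ p₁) ⁻¹ᵁ j.opensRange ⊓ γ ⁻¹ᵁ chartOpen A i
      have hzN : z ∈ N := ⟨by
        change (t ≫ p₁) z ∈ j.opensRange
        rw [Scheme.Hom.comp_apply]; exact hzj, hi⟩
      obtain ⟨_, ⟨W, (hW : IsAffineOpen W), rfl⟩, h1, h2⟩ :=
        T.isBasis_affineOpens.exists_subset_of_mem_open hzN N.2
      have h2 : W ≤ N := h2
      have h1' : z ∈ Set.range hW.fromSpec := hW.range_fromSpec.ge h1
      have hWN : ∀ y, hW.fromSpec y ∈ N := fun y ↦ h2 (hW.range_fromSpec.le ⟨y, rfl⟩)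
      have hWne : Nonempty W := ⟨⟨_, h1⟩⟩
      obtain ⟨l, hl, hlg⟩ := exists_lift_affine hW.fromSpec i (fun y ↦ (hWN y).1) fun y ↦ (hWN y).2
      exact ⟨_, hW.fromSpec, inferInstance, l, h1', hl, hlg⟩
    -- Off the special fibre the lift exists without any condition. Its composition with `g` agrees
    -- with `γ` on `O`, hence everywhere by separatedness of the projective line.
    · have hopen : IsOpen {y : T | (t ≫ p₂) y ≠ IsLocalRing.closedPoint A} :=
        (IsLocalRing.isClosed_singleton_closedPoint A).isOpen_compl.preimage (t ≫ p₂).continuous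
      let U : T.Opens := ⟨_, hopen⟩
      have hU : ∀ y : U.toScheme, ((U.ι ≫ t) ≫ p₂) y ≠ IsLocalRing.closedPoint A := by
        intro y
        rw [Category.assoc, Scheme.Hom.comp_apply]
        exact y.2
      obtain ⟨l, hl⟩ := D.exists_lift (U.ι ≫ t) hU
      have hUne : Nonempty U := ⟨⟨z, hz⟩⟩
      refine ⟨U, U.ι, inferInstance, l, ⟨⟨z, hz⟩, rfl⟩, hl, ?_⟩
      obtain ⟨y, hyU, hyO⟩ := nonempty_preirreducible_inter U.2 O.2 ⟨z, hz⟩ hO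
      refine ext_of_generic (U.ι ⁻¹ᵁ O) ⟨⟨y, hyU⟩, hyO⟩ ?_
      have h1 : (U.ι ⁻¹ᵁ O).ι ≫ l = U.ι ∣_ O ≫ m := by
        refine D.hom_ext_of_ne ?_ fun w ↦ ?_
        · rw [Category.assoc, hl, Category.assoc, hm, ← Category.assoc, ← Category.assoc,
            morphismRestrict_ι]
        · rw [← D.comp_p₂, Category.assoc, ← Category.assoc l, hl, Scheme.Hom.comp_apply]
          exact hU _
      rw [← Category.assoc, h1, Category.assoc, hmg, ← Category.assoc, morphismRestrict_ι,
        Category.assoc]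
  obtain ⟨l, hl⟩ := exists_glue Q
    (fun k _ i f hf ↦ ⟨by rw [Category.assoc, hf.1, Category.assoc],
      by rw [Category.assoc, hf.2, Category.assoc]⟩)
    (fun i _ f f' hf hf' ↦ D.hom_ext (hf.1.trans hf'.1.symm) (hf.2.trans hf'.2.symm)) ex
  refine ⟨l, hom_ext_of_cover fun z ↦ ?_, hom_ext_of_cover fun z ↦ ?_⟩
  all_goals
    obtain ⟨O, i, hi, f, hz, hf⟩ := ex z
    refine ⟨O, i, hi, hz, ?_⟩
    rw [← Category.assoc, hl i f hf]
  · exact hf.1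
  · exact hf.2

end Extension

/-! ### Finiteness conditions -/

section FiniteType

theorem locallyOfFiniteType_of_cover {T S : Scheme.{u}} (f : T ⟶ S)
    (h : ∀ z : T, ∃ (O : Scheme.{u}) (i : O ⟶ T) (_ : IsOpenImmersion i), z ∈ Set.range i ∧
      LocallyOfFiniteType (i ≫ f)) : LocallyOfFiniteType f := by
  choose O i hi hz h using h
  have hs : iSup (fun z ↦ (i z).opensRange) = ⊤ := by
    ext z
    simp only [Opens.coe_iSup, Set.mem_iUnion, Opens.coe_top, Set.mem_univ, iff_true]
    exact ⟨z, hz z⟩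
  have : IsZariskiLocalAtSource (@LocallyOfFiniteType : MorphismProperty Scheme.{u}) :=
    HasRingHomProperty.instIsZariskiLocalAtSource (Q := RingHom.FiniteType)
  rw [IsZariskiLocalAtSource.iff_of_iSup_eq_top (P := @LocallyOfFiniteType) _ hs]
  intro z
  have h1 : (i z).opensRange.ι = (Scheme.Hom.isoOpensRange (i z)).inv ≫ i z := by simp
  rw [h1, Category.assoc]
  have := h z
  infer_instance

theorem locallyOfFiniteType_SpecMap {A R : Type u} [CommRing A] [CommRing R] {α : A →+* R}
    (h : α.FiniteType) : LocallyOfFiniteType (Spec.map (CommRingCat.ofHom α)) :=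
  (HasRingHomProperty.Spec_iff (P := @LocallyOfFiniteType)).mpr h

variable {A : Type u} [CommRing A]

theorem exists_polynomial_chart (z : P1 A) :
    ∃ i : Spec (.of (Polynomial A)) ⟶ P1 A, IsOpenImmersion i ∧ z ∈ Set.range i ∧
      (i = ptZ Polynomial.C Polynomial.X ∨ i = ptY Polynomial.C Polynomial.X) ∧
      i ≫ P1.toBase A = Spec.map (CommRingCat.ofHom Polynomial.C) := by
  obtain ⟨i, hi⟩ := exists_mem_chartOpen z
  have h0 : IsOpenImmersion (ptY (Polynomial.C : A →+* _) Polynomial.X) ∧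
    ∀ t, t ∈ Set.range (ptY (Polynomial.C : A →+* _) Polynomial.X) ↔ t ∈ chartOpen A 0 :=
      isOpenImmersion_pt (A := A) 0 1 (by decide) ![1, Polynomial.X] rfl rfl
  have h1 : IsOpenImmersion (ptZ (Polynomial.C : A →+* _) Polynomial.X) ∧
    ∀ t, t ∈ Set.range (ptZ (Polynomial.C : A →+* _) Polynomial.X) ↔ t ∈ chartOpen A 1 :=
      isOpenImmersion_pt (A := A) 1 0 (by decide) ![Polynomial.X, 1] rfl rfl
  fin_cases i
  · exact ⟨_, h0.1, (h0.2 z).mpr hi, .inr rfl, pt_toBase _ _ _ _⟩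
  · exact ⟨_, h1.1, (h1.2 z).mpr hi, .inl rfl, pt_toBase _ _ _ _⟩

instance : LocallyOfFiniteType (P1.toBase A) := by
  refine locallyOfFiniteType_of_cover _ fun z ↦ ?_
  obtain ⟨i, hi, hz, -, h⟩ := exists_polynomial_chart z
  refine ⟨_, i, hi, hz, ?_⟩
  rw [h]
  refine locallyOfFiniteType_SpecMap ?_
  exact (RingHom.finiteType_algebraMap (A := A) (B := Polynomial A)).mpr inferInstance

instance : CompactSpace (P1 A) := by
  refine ⟨?_⟩
  have h : (Set.univ : Set (P1 A)) = Set.range (ptZ (Polynomial.C : A →+* _) Polynomial.X) ∪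
      Set.range (ptY (Polynomial.C : A →+* _) Polynomial.X) := by
    refine (Set.eq_univ_of_forall fun z ↦ ?_).symm
    obtain ⟨i, -, hz, rfl | rfl, -⟩ := exists_polynomial_chart z
    · exact .inl hz
    · exact .inr hz
  rw [h]
  exact (isCompact_range (Scheme.Hom.continuous _)).union (isCompact_range (Scheme.Hom.continuous _))

theorem IsRay.finiteType {R : Type u} [CommRing R] {α : A →+* R} {x : A} {s v : R} {b q : ℕ}
    (h : IsRay α x s v b q) : α.FiniteType := by
  let := α.toAlgebra
  obtain ⟨v', hv⟩ := h.isUnit.exists_right_inv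
  let B := Algebra.adjoin A ({s, v, v'} : Set R)
  let s₀ : B := ⟨s, Algebra.subset_adjoin (by simp)⟩
  let v₀ : B := ⟨v, Algebra.subset_adjoin (by simp)⟩
  let v₀' : B := ⟨v', Algebra.subset_adjoin (by simp)⟩
  have hv₀ : v₀ * v₀' = 1 := Subtype.ext hv
  obtain ⟨k, hk, hks, hkv⟩ := h.exists_lift (algebraMap A B) s₀ v₀ (.of_mul_eq_one _ hv₀)
    (Subtype.ext h.rel)
  have h1 : (B.val : B →+* R).comp k = RingHom.id R := by
    refine h.hom_ext ?_ ?_ ?_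
    · rw [RingHom.comp_assoc, hk]
      rfl
    · rw [RingHom.comp_apply, hks]
      rfl
    · rw [RingHom.comp_apply, hkv]
      rfl
  have h2 : B = ⊤ := by
    refine eq_top_iff.mpr fun r _ ↦ ?_
    have h3 := congrArg (fun m ↦ m r) h1
    have h4 : (k r : R) = r := h3
    rw [← h4]
    exact (k r).2
  have : Algebra.FiniteType A R := ⟨Subalgebra.fg_def.mpr ⟨{s, v, v'}, Set.toFinite _, h2⟩⟩
  exact RingHom.finiteType_algebraMap.mpr this

end FiniteType

section RayScheme

variable {A : Type u} [CommRing A] [IsDomain A] [IsDiscreteValuationRing A]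
  {V : Scheme.{u}} {p : V ⟶ P1 A} {x : A} {R : Type u} [CommRing R]
  {j : Spec (CommRingCat.of R) ⟶ V} {α : A →+* R} {s v : R} {a b q q' : ℕ}

theorem IsRayScheme.mem_range_or (h : IsRayScheme p x j α s v a b q q') :
    ∃ σ : genericP1 A ⟶ V, IsOpenImmersion σ ∧ σ ≫ p = (genericPart (𝟙 (P1 A))).ι ∧
      ∀ z, z ∈ Set.range j ∨ z ∈ Set.range σ := by
  obtain ⟨σ, hσ, hσp, hσu⟩ := h.exists_genericP1_hom
  refine ⟨σ, hσ, hσp, fun z ↦ ?_⟩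
  by_cases hz : (p ≫ P1.toBase A) z = IsLocalRing.closedPoint A
  · exact .inl (h.mem_range z hz)
  · obtain ⟨g, hg⟩ := hσu (genericPart p).ι (ι_ne_closedPoint p)
    let z' : (genericPart p).toScheme := ⟨z, mem_genericPart.mpr hz⟩
    exact .inr ⟨g z', congrArg (fun m : _ ⟶ V ↦ m z') hg⟩

theorem IsRayScheme.locallyOfFiniteType (h : IsRayScheme p x j α s v a b q q') :
    LocallyOfFiniteType (p ≫ P1.toBase A) := by
  obtain ⟨σ, hσ, hσp, hσu⟩ := h.mem_range_or
  refine locallyOfFiniteType_of_cover _ fun z ↦ (hσu z).elim (fun hz ↦ ?_) fun hz ↦ ?_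
  · refine ⟨_, j, h.chart.isOpenImmersion, hz, ?_⟩
    rw [h.chart.comp_toBase]
    exact locallyOfFiniteType_SpecMap h.chart.isRay.finiteType
  · refine ⟨_, σ, hσ, hz, ?_⟩
    rw [← Category.assoc, hσp]
    infer_instance

/-- A ray scheme is covered by an affine chart and the generic fibre. The latter is compact, being
open in the projective line over the noetherian ring `A`. -/
theorem IsRayScheme.quasiCompact (h : IsRayScheme p x j α s v a b q q') :
    QuasiCompact (p ≫ P1.toBase A) := by
  obtain ⟨σ, hσ, hσp, hσu⟩ := h.mem_range_or
  have h1 : IsLocallyNoetherian (P1 A) := LocallyOfFiniteType.isLocallyNoetherian (P1.toBase A)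
  have h2 : CompactSpace (genericP1 A) :=
    QuasiCompact.compactSpace_of_compactSpace (genericPart (𝟙 (P1 A))).ι
  have h3 : CompactSpace V := by
    refine ⟨?_⟩
    have h : (Set.univ : Set V) = Set.range j ∪ Set.range σ :=
      (Set.eq_univ_of_forall hσu).symm
    rw [h]
    exact (isCompact_range j.continuous).union (isCompact_range σ.continuous)
  exact (quasiCompact_iff_compactSpace _).mpr h3

end RayScheme

section Variety

variable {A : Type u} [CommRing A] [IsDomain A] [IsDiscreteValuationRing A]
  {V V' : Scheme.{u}} {p : V ⟶ P1 A} {p' : V' ⟶ P1 A} {x : A} {R R' : Type u} [CommRing R]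
  [CommRing R'] {j : Spec (CommRingCat.of R) ⟶ V} {α : A →+* R} {s v : R} {a b q q' : ℕ}
  {j' : Spec (CommRingCat.of R') ⟶ V'} {α' : A →+* R'} {s' ω : R'}
  {φ : A →+* A} {f : R →+* R'} {H : V' ⟶ V} {g : V' ⟶ P1 A}
  {M : Scheme.{u}} {p₁ : M ⟶ V} {p₂ : M ⟶ Spec (CommRingCat.of A)} {ρ : V' ⟶ M}

variable (D : IsRayComparison p p' x j α s v a b q q' j' α' s' ω φ f H g p₁ p₂ ρ)
include D

theorem IsRayComparison.isVarietyOver : IsVarietyOver (ρ ≫ p₂) := by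
  rw [D.comp_p₂]
  exact ⟨D.source.isIntegral D.irreducible, D.isSeparated, D.source.locallyOfFiniteType,
    D.source.quasiCompact⟩

end Variety

/-! ### The covering is finite étale -/

section FiniteEtale

instance isZariskiLocalAtTarget_isFinite : IsZariskiLocalAtTarget (@IsFinite.{u}) :=
  @HasAffineProperty.instIsZariskiLocalAtTarget _ _
    IsFinite.instHasAffinePropertyAndIsAffineFiniteCarrierObjOppositeOpensCarrierCarrierCommRingCatPresheafOpOpensTopHomAppTop

instance isZariskiLocalAtTarget_etale : IsZariskiLocalAtTarget (@Etale.{u}) :=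
  HasRingHomProperty.instIsZariskiLocalAtTarget (P := @Etale.{u}) (Q := RingHom.Etale)

theorem of_isPullback_of_cover (P : MorphismProperty Scheme.{u}) [IsZariskiLocalAtTarget P]
    [P.IsStableUnderBaseChange] {V V' : Scheme.{u}} {H : V' ⟶ V}
    (h : ∀ z : V, ∃ (S T : Scheme.{u}) (k : T ⟶ V') (h : T ⟶ S) (i : S ⟶ V)
      (_ : IsOpenImmersion i), z ∈ Set.range i ∧ IsPullback k h H i ∧ P h) : P H := by
  choose S T k h i hi hz hP hh using h
  refine IsZariskiLocalAtTarget.of_iSup_eq_top (fun z ↦ (i z).opensRange)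
    (top_le_iff.mp fun z _ ↦ Opens.mem_iSup.mpr ⟨z, hz z⟩) fun z ↦ ?_
  have h1 := (isPullback_morphismRestrict H (i z).opensRange)
  have h3 : (i z).isoOpensRange.inv ≫ i z = (i z).opensRange.ι := by simp
  obtain ⟨m, hm1, hm2⟩ : ∃ m, m ≫ k z = (H ⁻¹ᵁ (i z).opensRange).ι ∧
      m ≫ h z = H ∣_ (i z).opensRange ≫ (i z).isoOpensRange.inv := by
    have h2 : (H ⁻¹ᵁ (i z).opensRange).ι ≫ H =
        (H ∣_ (i z).opensRange ≫ (i z).isoOpensRange.inv) ≫ i z := by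
      rw [Category.assoc, h3, morphismRestrict_ι]
    exact ⟨(hP z).lift _ _ h2, (hP z).lift_fst _ _ h2, (hP z).lift_snd _ _ h2⟩
  have h4 : IsPullback (m ≫ k z) (H ∣_ (i z).opensRange) H ((i z).isoOpensRange.inv ≫ i z) := by
    rw [hm1, h3]
    first | exact h1 | exact h1.flip
  exact P.of_isPullback (IsPullback.of_right h4 hm2 (hP z)) (hh z)

variable {A : Type u} [CommRing A] [IsDomain A] [IsDiscreteValuationRing A]
  {V V' : Scheme.{u}} {p : V ⟶ P1 A} {p' : V' ⟶ P1 A} {x : A} {R R' : Type u} [CommRing R]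
  [CommRing R'] {j : Spec (CommRingCat.of R) ⟶ V} {α : A →+* R} {s v : R} {a b q q' : ℕ}
  {j' : Spec (CommRingCat.of R') ⟶ V'} {α' : A →+* R'} {s' ω : R'}
  {φ : A →+* A} {f : R →+* R'} {H : V' ⟶ V} {g : V' ⟶ P1 A}
  {M : Scheme.{u}} {p₁ : M ⟶ V} {p₂ : M ⟶ Spec (CommRingCat.of A)} {ρ : V' ⟶ M}

variable (D : IsRayComparison p p' x j α s v a b q q' j' α' s' ω φ f H g p₁ p₂ ρ)
include D

/-- There are two kinds of charts: on the ray chart a root of the unit `v` is adjoined, and off the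
special fibre a root of `x`, which is a unit there. -/
theorem IsRayComparison.exists_kummer_chart_of_isUnit (z : V) :
    ∃ (S B : Type u) (_ : CommRing S) (_ : CommRing B) (_ : A →+* S) (e : S →+* B) (w : S) (τ : B)
      (k : Spec (.of B) ⟶ V') (i : Spec (.of S) ⟶ V),
      IsOpenImmersion i ∧ z ∈ Set.range i ∧ IsKummer e w τ b ∧ IsUnit w ∧
      IsPullback k (Spec.map (CommRingCat.ofHom e)) H i := by
  have := D.target.chart.isOpenImmersion
  have := D.source.chart.isOpenImmersion
  by_cases hz : (p ≫ P1.toBase A) z = IsLocalRing.closedPoint A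
  -- The square over the ray chart is cartesian because its preimage under `H` is exactly the ray
  -- chart of `V'`.
  · have hs : ∀ s : PullbackCone H j, ∃ l, l ≫ j' = s.fst := by
      intro s
      refine ⟨_, IsOpenImmersion.lift_fac j' s.fst ?_⟩
      rintro _ ⟨y, rfl⟩
      refine D.mem_range_of_mem_range _ ?_
      rw [← Scheme.Hom.comp_apply, s.condition]
      exact ⟨_, (Scheme.Hom.comp_apply _ _ _).symm⟩
    choose l hl using hs
    refine ⟨R, R', _, _, α, f, v, ω, j', j, inferInstance, D.target.mem_range z hz, D.kummer,
      D.target.chart.isRay.isUnit, ⟨⟨D.chart⟩, ⟨PullbackCone.IsLimit.mk _ l hl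
        (fun s ↦ ?_) (fun s m hm _ ↦ ?_)⟩⟩⟩
    · rw [← cancel_mono j, Category.assoc, ← D.chart, ← Category.assoc, hl]
      exact s.condition
    · rw [← cancel_mono j', hm, hl]
  · obtain ⟨_, ⟨W, (hW : IsAffineOpen W), rfl⟩, h1, h2⟩ :=
      V.isBasis_affineOpens.exists_subset_of_mem_open (mem_genericPart.mpr hz) (genericPart p).2
    have h2 : W ≤ genericPart p := h2
    have h1' : z ∈ Set.range hW.fromSpec := hW.range_fromSpec.ge h1
    obtain ⟨β, hβ⟩ := exists_ringHom (R := Γ(V, W)) (g := hW.fromSpec ≫ p ≫ P1.toBase A)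
    have hne : ∀ y, (hW.fromSpec ≫ p ≫ P1.toBase A) y ≠ IsLocalRing.closedPoint A := by
      intro y
      rw [Scheme.Hom.comp_apply]
      exact mem_genericPart.mp (h2 (hW.range_fromSpec.le ⟨y, rfl⟩))
    have hu : IsUnit (β x) := by
      by_contra h0
      obtain ⟨m, hm, hxm⟩ := exists_max_ideal_of_mem_nonunits h0
      refine hne ⟨m, hm.isPrime⟩ ?_
      rw [hβ]
      exact (SpecMap_eq_closedPoint_iff D.irreducible β _).mpr hxm
    obtain ⟨B, _, e, τ, ψ, k, hK, hψ, hk, hP⟩ :=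
      D.exists_kummer_chart (S := Γ(V, W)) hW.fromSpec β hβ
    have hψu : IsUnit (ψ x) := by
      rw [hψ]
      have h3 := hu.map e
      rw [← hK.rel] at h3
      exact (isUnit_pow_iff D.pos.ne').mp h3
    have hkne : ∀ y, (k ≫ p₂) y ≠ IsLocalRing.closedPoint A := by
      rw [hk]
      exact apply_ne_closedPoint_of_isUnit D.irreducible _ hψu
    -- Off the special fibre `V'` and `M` coincide, so the cartesian square for `M` is also one for
    -- `V'`.
    obtain ⟨l, hl⟩ := D.exists_lift k hkne
    refine ⟨Γ(V, W), B, _, _, β, e, β x, τ, l, hW.fromSpec, inferInstance, h1', hK, hu, ⟨⟨?_⟩,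
      ⟨PullbackCone.IsLimit.mk _ (fun s ↦ hP.lift (s.fst ≫ ρ) s.snd ?_) (fun s ↦ ?_)
        (fun s ↦ hP.lift_snd _ _ _) (fun s m hm hm' ↦ hP.hom_ext ?_ ?_)⟩⟩⟩
    · rw [← D.comp_p₁, ← Category.assoc, hl, hP.w]
    · rw [Category.assoc, D.comp_p₁]
      exact s.condition
    · have h5 : (hP.lift (s.fst ≫ ρ) s.snd (by rw [Category.assoc, D.comp_p₁]; exact s.condition) ≫
          l) ≫ ρ = s.fst ≫ ρ := by
        rw [Category.assoc, hl, hP.lift_fst]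
      refine D.hom_ext_of_ne h5 fun y ↦ ?_
      rw [← D.comp_p₂, Category.assoc, ← Category.assoc l, hl, Scheme.Hom.comp_apply]
      exact hkne _
    · rw [hP.lift_fst, ← hm, Category.assoc, hl]
    · rw [hP.lift_snd, hm']

theorem IsRayComparison.finite_etale (hb : IsUnit (b : A)) :
    IsFinite H ∧ Etale H ∧ ∀ z, H.finrank z = b := by
  have h : ∀ z : V, ∃ (S T : Scheme.{u}) (k : T ⟶ V') (h : T ⟶ S) (i : S ⟶ V)
      (_ : IsOpenImmersion i), z ∈ Set.range i ∧ IsPullback k h H i ∧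
      (IsFinite h ∧ Etale h ∧ ∀ y, h.finrank y = b) := by
    intro z
    obtain ⟨S, B, _, _, θ, e, w, τ, k, i, hi, hz, hK, hw, hP⟩ := D.exists_kummer_chart_of_isUnit z
    have : Nontrivial S := by
      obtain ⟨y, -⟩ := hz
      exact PrimeSpectrum.nonempty_iff_nontrivial.mp ⟨y⟩
    refine ⟨_, _, k, _, i, hi, hz, hP, hK.finite_etale ?_ hw⟩
    simpa using hb.map θ
  have h1 : IsFinite H := of_isPullback_of_cover @IsFinite fun z ↦ by
    obtain ⟨S, T, k, h, i, hi, hz, hP, h1, -⟩ := h z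
    exact ⟨S, T, k, h, i, hi, hz, hP, h1⟩
  have h2 : Etale H := of_isPullback_of_cover @Etale fun z ↦ by
    obtain ⟨S, T, k, h, i, hi, hz, hP, -, h1, -⟩ := h z
    exact ⟨S, T, k, h, i, hi, hz, hP, h1⟩
  refine ⟨h1, h2, fun z ↦ ?_⟩
  obtain ⟨S, T, k, h, i, hi, ⟨y, rfl⟩, hP, -, -, hr⟩ := h z
  rw [← Scheme.Hom.finrank_of_isPullback k h H i hP y, hr]

end FiniteEtale

/-! ### The rational function `x ^ a / y` on the base change -/

section Function

variable {A : Type u} [CommRing A]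

theorem appTop_topIso_inv_app {M : Scheme.{u}} (t : M ⟶ P1 A) {O : Scheme.{u}}
    (k : O ⟶ (t ⁻¹ᵁ opY A).toScheme) (e : ⊤ ≤ (k ≫ (t ⁻¹ᵁ opY A).ι ≫ t) ⁻¹ᵁ opY A)
    (r : Γ(P1 A, opY A)) :
    k.appTop.hom ((t ⁻¹ᵁ opY A).topIso.inv.hom ((t.app (opY A)).hom r)) =
      ((k ≫ (t ⁻¹ᵁ opY A).ι ≫ t).appLE (opY A) ⊤ e).hom r := by
  have e0 : ⊤ ≤ (t ⁻¹ᵁ opY A).ι ⁻¹ᵁ (t ⁻¹ᵁ opY A) := (Scheme.Opens.ι_preimage_self _).ge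
  have h1 : (t ⁻¹ᵁ opY A).topIso.inv = (t ⁻¹ᵁ opY A).ι.appLE (t ⁻¹ᵁ opY A) ⊤ e0 :=
    (congrArg M.presheaf.map (Subsingleton.elim _ _)).trans (M.presheaf.map_comp _ _)
  have e1 : ⊤ ≤ ((k ≫ (t ⁻¹ᵁ opY A).ι) ≫ t) ⁻¹ᵁ opY A := by rwa [Category.assoc]
  have h3 : k.appTop = k.appLE ⊤ ⊤ le_rfl := Scheme.Hom.app_eq_appLE k
  have h2 : t.app (opY A) ≫ (t ⁻¹ᵁ opY A).topIso.inv ≫ k.appTop =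
      (k ≫ (t ⁻¹ᵁ opY A).ι ≫ t).appLE (opY A) ⊤ e := by
    have h4 : ((k ≫ (t ⁻¹ᵁ opY A).ι) ≫ t).appLE (opY A) ⊤ e1 =
        (k ≫ (t ⁻¹ᵁ opY A).ι ≫ t).appLE (opY A) ⊤ e := by
      congr 1
    rw [← h4, Scheme.Hom.comp_appLE, h1, h3]
    exact congrArg (t.app (opY A) ≫ ·) (Scheme.Hom.appLE_comp_appLE _ _ _ _ _ _ _)
  exact congrArg (fun g ↦ (CommRingCat.Hom.hom g) r) h2

/-- The function `x ^ a / y` on the open subscheme `Y ≠ 0` of a base change. -/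
theorem crossRel_function {M : Scheme.{u}} {t n : M ⟶ P1 A} {st : M ⟶ Spec (.of A)} {φ : A →+* A}
    (hn : n ≫ baseChange φ = t) (hst : n ≫ P1.toBase A = st) (x : A) (a : ℕ) :
    CrossRel x a ((t ⁻¹ᵁ opY A).ι ≫ n) (toP1 ((t ⁻¹ᵁ opY A).ι ≫ st)
      (sectionsMap ((t ⁻¹ᵁ opY A).ι ≫ st) x ^ a *
        (t ⁻¹ᵁ opY A).topIso.inv (t.app (opY A) (monomialSection x 0 1)))) := by
  refine crossRel_of_locally fun z ↦ ?_
  obtain ⟨U, hzU, i, hU⟩ := exists_open_homogP1 ((t ⁻¹ᵁ opY A).ι ≫ n) z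
  obtain ⟨c, hc, h1⟩ := hU U.ι (by rw [Scheme.Opens.range_ι])
  refine ⟨U, U.ι, inferInstance, ⟨⟨z, hzU⟩, rfl⟩, ?_⟩
  have h2 : U.ι ≫ (t ⁻¹ᵁ opY A).ι ≫ n = homogP1 (U.ι ≫ (t ⁻¹ᵁ opY A).ι ≫ st) c i hc :=
    h1.trans (homogP1_congr hc (by rw [← hst, Category.assoc]) rfl)
  have h3 : U.ι ≫ (t ⁻¹ᵁ opY A).ι ≫ t =
      homogP1 ((U.ι ≫ (t ⁻¹ᵁ opY A).ι ≫ st) ≫ Spec.map (CommRingCat.ofHom φ)) c i hc := by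
    rw [← homogP1_baseChange, ← h2]
    simp only [Category.assoc, hn]
  have e : ⊤ ≤ (U.ι ≫ (t ⁻¹ᵁ opY A).ι ≫ t) ⁻¹ᵁ opY A := fun o _ ↦ (U.ι o).2
  have e' := e
  rw [h3] at e'
  -- With exponents `0` and `1` the section is `1 / y`, and the formula reads `(1 / y) c₀ = c₁`.
  have h4 := homogP1_monomialSection _ c i hc x 0 1 ⊤ e'
  have h5 := (appTop_topIso_inv_app t U.ι e (monomialSection x 0 1)).trans
    (appLE_congr_hom h3 e e' _)
  rw [← h5] at h4
  refine crossRel_of_eq h2 ((congrArg (U.ι ≫ ·) (toP1_eq _ _)).trans (comp_homogP1 _ _ _ _ _)) ?_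
  have h6 : ∀ r : Γ(U.toScheme, ⊤),
      U.toScheme.presheaf.map (homOfLE (le_top : (⊤ : U.toScheme.Opens) ≤ ⊤)).op r = r :=
    fun r ↦ congrArg (fun g ↦ (CommRingCat.Hom.hom g) r) (U.toScheme.presheaf.map_id (.op ⊤))
  rw [pow_one, pow_one, pow_zero, one_mul] at h4
  have h7 := ((congrArg (_ * ·) (h6 (c 0))).symm.trans h4).trans (h6 (c 1))
  rw [sectionsMap_comp U.ι, RingHom.comp_apply]
  change U.ι.appTop.hom (_ * _) * c 0 = _ * (c 1 * U.ι.appTop.hom 1)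
  rw [map_mul, map_pow, map_one, mul_one, mul_assoc]
  exact congrArg (_ * ·) h7

end Function

/-! ### The universal property of `U_a`, and the theorem -/

section Universal

variable {A : Type u} [CommRing A] [IsDomain A] [IsDiscreteValuationRing A]
  {V V' : Scheme.{u}} {p : V ⟶ P1 A} {p' : V' ⟶ P1 A} {x : A} {R R' : Type u} [CommRing R]
  [CommRing R'] {j : Spec (CommRingCat.of R) ⟶ V} {α : A →+* R} {s v : R} {a b q q' : ℕ}
  {j' : Spec (CommRingCat.of R') ⟶ V'} {α' : A →+* R'} {s' ω : R'}
  {φ : A →+* A} {f : R →+* R'} {H : V' ⟶ V} {g : V' ⟶ P1 A}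
  {M : Scheme.{u}} {p₁ : M ⟶ V} {p₂ : M ⟶ Spec (CommRingCat.of A)} {ρ : V' ⟶ M}

variable (D : IsRayComparison p p' x j α s v a b q q' j' α' s' ω φ f H g p₁ p₂ ρ)
include D

variable {n : M ⟶ P1 A} (hρ : ρ ≫ n = p')
  {h₀ : M.PartialMap (P1 A)} (h₀n : CrossRel x a (h₀.domain.ι ≫ n) h₀.hom)
include hρ h₀n

/-- `g` extends every representative of the rational map. Off the special fibre, and where `h` and
`h₀` agree, both are `x ^ a / y`; this open subset of the integral scheme `V'` is nonempty, so they
agree wherever `h` is defined. -/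
theorem IsRayComparison.comp_g_eq {h : M.PartialMap (P1 A)}
    (hh : h.toRationalMap = h₀.toRationalMap) {T : Scheme.{u}} (k : T ⟶ V')
    (l : T ⟶ h.domain.toScheme) (hkl : k ≫ ρ = l ≫ h.domain.ι) : k ≫ g = l ≫ h.hom := by
  have := D.isIntegral
  have := D.source.isIntegral D.irreducible
  obtain ⟨W, hW, hWl, hWr, hWe⟩ := Scheme.PartialMap.toRationalMap_eq_iff.mp hh
  rw [Scheme.PartialMap.restrict_hom, Scheme.PartialMap.restrict_hom] at hWe
  let G : M.Opens := ⟨{z | p₂ z ≠ IsLocalRing.closedPoint A},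
    (IsLocalRing.isClosed_singleton_closedPoint A).isOpen_compl.preimage p₂.continuous⟩
  have hGne : (G : Set M).Nonempty := by
    obtain ⟨o, ho⟩ := D.source.exists_ne_closedPoint D.irreducible (𝟙 V')
    rw [Category.id_comp, ← D.comp_p₂, Scheme.Hom.comp_apply] at ho
    exact ⟨_, ho⟩
  have hW₀ : ((W ⊓ G : M.Opens) : Set M).Nonempty := by
    obtain ⟨y, hy1, hy2⟩ := hW.inter_open_nonempty _ G.2 hGne
    exact ⟨y, hy2, hy1⟩
  have hρW : ((ρ ⁻¹ᵁ (W ⊓ G) : V'.Opens) : Set V').Nonempty := by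
    obtain ⟨y, hy⟩ := hW₀
    obtain ⟨m, hm⟩ := D.exists_lift (W ⊓ G).ι (by
      intro z
      rw [Scheme.Hom.comp_apply]
      exact z.2.2)
    let y' : (W ⊓ G).toScheme := ⟨y, hy⟩
    refine ⟨m y', ?_⟩
    change ρ (m y') ∈ W ⊓ G
    rw [← Scheme.Hom.comp_apply, hm]
    exact hy
  let N := ρ ⁻¹ᵁ (W ⊓ G)
  obtain ⟨r, hr⟩ : ∃ r : N.toScheme ⟶ W.toScheme, r ≫ W.ι = N.ι ≫ ρ :=
    ⟨ρ ∣_ (W ⊓ G) ≫ M.homOfLE inf_le_left, by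
      rw [Category.assoc, Scheme.homOfLE_ι, morphismRestrict_ι]⟩
  have h1 : N.ι ≫ g = r ≫ M.homOfLE hWr ≫ h₀.hom := by
    refine (D.crossRel.comp N.ι).unique D.irreducible (g' := r ≫ M.homOfLE hWr ≫ h₀.hom) ?_ ?_
    · have h2 : N.ι ≫ p' = r ≫ M.homOfLE hWr ≫ h₀.domain.ι ≫ n := by
        rw [Scheme.homOfLE_ι_assoc, ← Category.assoc, hr, Category.assoc, hρ]
      rw [h2, ← Category.assoc, ← Category.assoc r]
      exact h₀n.comp _
    · intro o
      rw [Category.assoc, ← D.comp_p₂, Scheme.Hom.comp_apply, Scheme.Hom.comp_apply]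
      exact o.2.2
  rw [← hWe] at h1
  let P := ρ ⁻¹ᵁ h.domain
  have hNP : N ≤ P := fun y hy ↦ hWl hy.1
  obtain ⟨y₀, hy₀⟩ := hρW
  have hPne : Nonempty P := ⟨⟨y₀, hNP hy₀⟩⟩
  have h3 : P.ι ≫ g = ρ ∣_ h.domain ≫ h.hom := by
    refine ext_of_generic (P.ι ⁻¹ᵁ N) ⟨⟨y₀, hNP hy₀⟩, hy₀⟩ ?_
    have h4 : (P.ι ⁻¹ᵁ N).ι ≫ P.ι = P.ι ∣_ N ≫ N.ι := (morphismRestrict_ι _ _).symm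
    rw [← Category.assoc, h4, Category.assoc, h1, ← Category.assoc, ← Category.assoc,
      ← Category.assoc (Y := h.domain.toScheme)]
    refine congrArg (· ≫ h.hom) ?_
    rw [← cancel_mono h.domain.ι, Category.assoc, Category.assoc, Scheme.homOfLE_ι, Category.assoc,
      hr, morphismRestrict_ι, ← Category.assoc, ← Category.assoc, h4]
  obtain ⟨k', hk'⟩ : ∃ k', k' ≫ P.ι = k := by
    refine ⟨_, IsOpenImmersion.lift_fac P.ι k ?_⟩
    rw [Scheme.Opens.range_ι]
    rintro _ ⟨y, rfl⟩
    change ρ (k y) ∈ h.domain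
    rw [← Scheme.Hom.comp_apply, hkl, Scheme.Hom.comp_apply]
    exact (l y).2
  rw [← hk', Category.assoc, h3, ← Category.assoc]
  congr 1
  rw [← cancel_mono h.domain.ι, ← hkl, Category.assoc, morphismRestrict_ι, ← Category.assoc, hk']

/-- A lift on a dense open subset extends by `exists_extension`. Uniqueness holds because a morphism
to `V'` is determined by its compositions with `ρ` and `g`, and the latter is fixed on a dense open
subset. -/
theorem IsRayComparison.isUniversalExtension :
    IsUniversalExtension p₂ h₀.toRationalMap ρ := by
  have := D.isIntegral
  have := D.source.isIntegral D.irreducible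
  have hG : IsOpen {z | p₂ z ≠ IsLocalRing.closedPoint A} :=
    (IsLocalRing.isClosed_singleton_closedPoint A).isOpen_compl.preimage p₂.continuous
  have hGne : {z | p₂ z ≠ IsLocalRing.closedPoint A}.Nonempty := by
    obtain ⟨o, ho⟩ := D.source.exists_ne_closedPoint D.irreducible (𝟙 V')
    rw [Category.id_comp, ← D.comp_p₂, Scheme.Hom.comp_apply] at ho
    exact ⟨_, ho⟩
  let G : M.Opens := ⟨_, hG⟩
  -- A test scheme may lie entirely in the special fibre, where no lift is available from the
  -- generic fibre. Therefore the domain of definition of each representative, which does meet the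
  -- generic fibre, is lifted to `V'` beforehand.
  have key : ∀ h : M.PartialMap (P1 A), h.toRationalMap = h₀.toRationalMap →
      ∃ m : h.domain.toScheme ⟶ V', m ≫ ρ = h.domain.ι ∧ m ≫ g = h.hom := by
    intro h hh
    obtain ⟨y, hy1, hy2⟩ := h.dense_domain.inter_open_nonempty _ hG hGne
    have hne : Nonempty h.domain := ⟨⟨y, hy2⟩⟩
    obtain ⟨m, hm⟩ := D.exists_lift ((h.domain.ι ⁻¹ᵁ G).ι ≫ h.domain.ι) (by
      intro z
      rw [Scheme.Hom.comp_apply, Scheme.Hom.comp_apply]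
      exact z.2)
    exact D.exists_extension h.domain.ι h.hom (h.domain.ι ⁻¹ᵁ G) ⟨⟨y, hy2⟩, hy1⟩ m hm
      (D.comp_g_eq hρ h₀n hh m _ hm)
  refine ⟨D.isVarietyOver, ⟨h₀, g, rfl, ?_, ?_⟩, fun {Y} t hY ⟨h, γ, hh, hd, hγ⟩ ↦ ?_⟩
  · obtain ⟨y, hy⟩ := h₀.dense_domain.nonempty
    obtain ⟨m, hm, -⟩ := key h₀ rfl
    let y' : h₀.domain.toScheme := ⟨y, hy⟩
    refine (ρ ⁻¹ᵁ h₀.domain).2.dense ⟨m y', ?_⟩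
    change ρ (m y') ∈ h₀.domain
    rw [← Scheme.Hom.comp_apply, hm]
    exact hy
  · exact D.comp_g_eq hρ h₀n rfl _ _ (morphismRestrict_ι _ _).symm
  · have := hY.isIntegral
    obtain ⟨m, hm, hmg⟩ := key h hh
    obtain ⟨l, hl, -⟩ := D.exists_extension t γ (t ⁻¹ᵁ h.domain) hd.nonempty (t ∣_ h.domain ≫ m)
      (by rw [Category.assoc, hm, morphismRestrict_ι]) (by rw [Category.assoc, hmg, hγ])
    refine ⟨l, hl, fun l' hl' ↦ D.hom_ext (hl'.trans hl.symm)
      (ext_of_generic (t ⁻¹ᵁ h.domain) hd.nonempty ?_)⟩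
    have h1 : ∀ e : Y ⟶ V', e ≫ ρ = t →
        (t ⁻¹ᵁ h.domain).ι ≫ e ≫ g = t ∣_ h.domain ≫ h.hom := by
      intro e he
      rw [← Category.assoc]
      exact D.comp_g_eq hρ h₀n hh _ _ (by rw [Category.assoc, he, morphismRestrict_ι])
    rw [h1 l hl, h1 l' hl']

end Universal

/-- `q` is the residue modulo `b` of the negative of the Bézout coefficient of `a`; reducing it
makes both exponents natural numbers. -/
theorem _root_.Nat.Coprime.exists_mul_eq_mul_add_one {a b : ℕ} (h : a.Coprime b) (hb : 0 < b) :
    ∃ q q' : ℕ, b * q' = a * q + 1 := by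
  have h1 : (a : ℤ) * a.gcdA b + b * a.gcdB b = 1 := by
    rw [← Nat.gcd_eq_gcd_ab, h.gcd_eq_one, Nat.cast_one]
  have hb' : (b : ℤ) ≠ 0 := by exact_mod_cast hb.ne'
  obtain ⟨q, hq⟩ := Int.eq_ofNat_of_zero_le (Int.emod_nonneg (-a.gcdA b) hb')
  have h2 : b ∣ a * q + 1 := by
    have h3 : (b : ℤ) ∣ a * q + 1 := by
      rw [← hq]
      refine ⟨a.gcdB b - a * ((-a.gcdA b) / b), ?_⟩
      have h4 := Int.emod_add_mul_ediv (-a.gcdA b) b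
      linear_combination a * h4 - h1
    exact_mod_cast h3
  obtain ⟨q', hq'⟩ := h2
  exact ⟨q, q', hq'.symm⟩

theorem IsUniversalExtension.exists_iso {M P C : Scheme.{u}} {s : M ⟶ C} {f : M ⤏ P}
    {Z Z' : Scheme.{u}} {ρ : Z ⟶ M} {ρ' : Z' ⟶ M} (h : IsUniversalExtension s f ρ)
    (h' : IsUniversalExtension s f ρ') : ∃ e : Z ≅ Z', e.hom ≫ ρ' = ρ := by
  obtain ⟨e, he, -⟩ := h'.existsUnique_lift ρ h.isVariety h.pullbackExtends
  obtain ⟨e', he', -⟩ := h.existsUnique_lift ρ' h'.isVariety h'.pullbackExtends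
  refine ⟨⟨e, e', ?_, ?_⟩, he⟩
  · refine (h.existsUnique_lift ρ h.isVariety h.pullbackExtends).unique ?_ (Category.id_comp ρ)
    rw [Category.assoc, he', he]
  · refine (h'.existsUnique_lift ρ' h'.isVariety h'.pullbackExtends).unique ?_
      (Category.id_comp ρ')
    rw [Category.assoc, he, he']

section Nonempty

variable {A : Type u} [CommRing A] [IsDomain A] [IsDiscreteValuationRing A]
  {V V' : Scheme.{u}} {p : V ⟶ P1 A} {p' : V' ⟶ P1 A} {x : A} {R R' : Type u} [CommRing R]
  [CommRing R'] {j : Spec (CommRingCat.of R) ⟶ V} {α : A →+* R} {s v : R} {a b q q' : ℕ}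
  {j' : Spec (CommRingCat.of R') ⟶ V'} {α' : A →+* R'} {s' ω : R'}
  {φ : A →+* A} {f : R →+* R'} {H : V' ⟶ V} {g : V' ⟶ P1 A}
  {M : Scheme.{u}} {p₁ : M ⟶ V} {p₂ : M ⟶ Spec (CommRingCat.of A)} {ρ : V' ⟶ M}

variable (D : IsRayComparison p p' x j α s v a b q q' j' α' s' ω φ f H g p₁ p₂ ρ)
include D

theorem IsRayComparison.nonempty_preimage_opY :
    (((p₁ ≫ p) ⁻¹ᵁ opY A : M.Opens) : Set M).Nonempty := by
  -- The point `y = 1` over the fraction field of `A` is a point of `V'` at which `Y` does not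
  -- vanish.
  let K := FractionRing A
  obtain ⟨e, he, -⟩ := D.source.existsUnique_lift (ptZ (algebraMap A K) 1) (by
    rw [pt_toBase]
    refine apply_ne_closedPoint_of_isUnit D.irreducible _
      (IsUnit.mk0 _ fun h0 ↦ D.irreducible.ne_zero ?_)
    exact (FaithfulSMul.algebraMap_eq_zero_iff A K).mp h0)
  obtain ⟨y⟩ : Nonempty (Spec (.of K)) := inferInstance
  refine ⟨ρ (e y), ?_⟩
  change (p₁ ≫ p) (ρ (e y)) ∈ chartOpen A 0
  have h1 : e ≫ ρ ≫ p₁ ≫ p = ptZ ((algebraMap A K).comp φ) 1 := by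
    rw [← Category.assoc ρ, D.comp_p₁, D.comm, ← Category.assoc, he]
    exact pt_baseChange _ _ _ _ _
  rw [← Scheme.Hom.comp_apply, ← Scheme.Hom.comp_apply, h1]
  refine (pt_mem_chartOpen _ _ _ _ _ _).mpr fun h0 ↦ ?_
  exact y.2.ne_top ((Ideal.eq_top_iff_one _).mpr h0)

end Nonempty

end NodalBlowup

end

theorem mainTheorem6 {k : Type u} [Field k] [IsAlgClosed k] [CharZero k]
    {A : Type u} [CommRing A] [IsLocalRing A] [Algebra (Polynomial k) A] [Algebra k A]
    [IsScalarTower k (Polynomial k) A]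
    (hA : IsHenselizationAt (Polynomial k) (Ideal.span {Polynomial.X}) A)
    (x : A) (hx : x = algebraMap (Polynomial k) A Polynomial.X)
    (a b : ℕ) (hb : 0 < b) (hab : a.Coprime b)
    (φ : A →ₐ[k] A) (hφ : φ x = x ^ b)
    {X : Scheme.{u}} (π : X ⟶ P1 A) (hX : IsNodalBlowup π) (hL : HasLine π x a b)
    {X' : Scheme.{u}} (π' : X' ⟶ P1 A) (hX' : IsNodalBlowup π') (hL' : HasLine π' x a 1) :
    ∃ hD : Dense (UBase.dom π x a b φ.toRingHom : Set (UBase π x a b φ.toRingHom)),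
      (∃ (Z : Scheme.{u}) (ρ : Z ⟶ UBase π x a b φ.toRingHom),
        IsUniversalExtension (UBase.p₂ π x a b φ.toRingHom)
          (UBase.ratMap π x a b φ.toRingHom hD) ρ) ∧
      ∀ (Z : Scheme.{u}) (ρ : Z ⟶ UBase π x a b φ.toRingHom),
        IsUniversalExtension (UBase.p₂ π x a b φ.toRingHom)
          (UBase.ratMap π x a b φ.toRingHom hD) ρ →
        (∃ e : (Uopen π' x a 1).toScheme ≅ Z,
          e.hom ≫ ρ ≫ UBase.p₂ π x a b φ.toRingHom = Uopen.toBase π' x a 1) ∧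
        IsFinite (ρ ≫ UBase.p₁ π x a b φ.toRingHom) ∧
        Etale (ρ ≫ UBase.p₁ π x a b φ.toRingHom) ∧
        ∀ p : (Uopen π x a b).toScheme, (ρ ≫ UBase.p₁ π x a b φ.toRingHom).finrank p = b := by
  obtain ⟨_, _, hirr⟩ := hA.isDiscreteValuationRing
  rw [← hx] at hirr
  have hφ' : IsKummer φ.toRingHom x x b := isKummer_of_exists_sum hb hφ (by
    rw [hx] at hφ ⊢
    exact hA.exists_sum_eq_and_unique b hb φ hφ)
  have hbA : IsUnit (b : A) := by
    have h : IsUnit ((b : k)) := IsUnit.mk0 _ (Nat.cast_ne_zero.mpr hb.ne')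
    simpa using h.map (algebraMap k A)
  obtain ⟨q, q', hq⟩ := hab.exists_mul_eq_mul_add_one hb
  obtain ⟨R, _, j, α, s, v, h⟩ := hX.exists_isRayScheme hirr hL hb hab hq
  -- For the slope `a / 1` the exponents can be taken as `q = 0` and `q' = 1`, which makes `s' = x`
  -- and `y = x ^ a ω`.
  obtain ⟨R', _, j', α', s', ω, h'⟩ :=
    hX'.exists_isRayScheme (q := 0) (q' := 1) hirr hL' one_pos (Nat.coprime_one_right a) (by simp)
  obtain ⟨f, H, g, D₀⟩ := h.exists_isRayCover h' hirr hφ' hb hq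
  have hP : IsPullback (UBase.p₁ π x a b φ.toRingHom) (UBase.p₂ π x a b φ.toRingHom)
      (((Uopen π x a b).ι ≫ π) ≫ P1.toBase A) (Spec.map (CommRingCat.ofHom φ.toRingHom)) := by
    rw [Category.assoc]
    exact IsPullback.of_hasPullback _ _
  have hw : H ≫ ((Uopen π x a b).ι ≫ π) ≫ P1.toBase A =
      (((Uopen π' x a 1).ι ≫ π') ≫ P1.toBase A) ≫ Spec.map (CommRingCat.ofHom φ.toRingHom) := by
    rw [← Category.assoc H, D₀.comm, Category.assoc, baseChange_toBase, Category.assoc,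
      Category.assoc, Category.assoc]
  have D : IsRayComparison ((Uopen π x a b).ι ≫ π) ((Uopen π' x a 1).ι ≫ π') x j α s v a b q q' j'
      α' s' ω φ.toRingHom f H g (UBase.p₁ π x a b φ.toRingHom) (UBase.p₂ π x a b φ.toRingHom)
      (hP.lift _ _ hw) := ⟨D₀, hP, hP.lift_fst _ _ _, hP.lift_snd _ _ _⟩
  obtain ⟨n, hn, hn2, hn3⟩ := D.exists_hom_P1
  have := D.isIntegral
  have hD : Dense (UBase.dom π x a b φ.toRingHom : Set (UBase π x a b φ.toRingHom)) :=
    (UBase.dom π x a b φ.toRingHom).2.dense D.nonempty_preimage_opY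
  have hU : IsUniversalExtension (UBase.p₂ π x a b φ.toRingHom)
      (UBase.ratMap π x a b φ.toRingHom hD) (hP.lift _ _ hw) :=
    D.isUniversalExtension hn3 (crossRel_function hn hn2 x a)
  refine ⟨hD, ⟨_, _, hU⟩, fun Z ρ hρ ↦ ?_⟩
  -- Universal extensions are unique up to isomorphism over the base change, so it suffices to treat
  -- the model given by `U_a`.
  obtain ⟨e, he⟩ := hU.exists_iso hρ
  have he' : ρ ≫ UBase.p₁ π x a b φ.toRingHom = e.inv ≫ H := by
    rw [← D.comp_p₁, ← he, Category.assoc, Iso.inv_hom_id_assoc]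
  obtain ⟨h1, h2, h3⟩ := D.finite_etale hbA
  refine ⟨⟨e, ?_⟩, ?_⟩
  · rw [← Category.assoc, he, D.comp_p₂, Category.assoc]
    rfl
  · rw [he', Scheme.Hom.finrank_comp_left_of_isIso]
    exact ⟨inferInstance, inferInstance, h3⟩
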